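/- Let $d\ge1$, let $\sigma\ge2$ and $0\le\rho\le\sigma$ be integers, let $1\le p,q\le\infty$ and $s<0$, and consider on $\mathcal M=\mathbb R^d$ or $\mathcal M=\mathbb T^d$ the nonlinear wave equation $$\partial_t^2u-\Delta u=\pm u^{\rho}\,\overline u^{\,\sigma-\rho},\qquad (u,\partial_tu)|_{t=0}=(u_0,u_1).\tag{NLW}$$ Here $\mathbb T^d=\mathbb R^d/\mathbb Z^d$ and $\mathcal F$ is the Fourier transform with characters $e^{2\pi i x\cdot\xi}$. Let $\langle n\rangle=(1+|n|^2)^{1/2}$ and $Q_1=(-\frac12,\frac12]^d$. For $r\in\mathbb R$ let $X_r$ be one of the following spaces of (tempered) distributions $f$ on $\mathcal M$, the same one for all $r$: - the Fourier amalgam space $\widehat w^{p,q}_r(\mathbb R^d)$, with norm $\big\|\,\|\chi_{n+Q_1}\mathcal Ff\|_{L^p(\mathbb R^d)}\langle n\rangle^r\big\|_{\ell^q_n(\mathbb Z^d)}$; - the Wiener amalgam space $W^{2,q}_r(\mathbb R^d)$, with norm $\big\|\,\|\square_nf\cdot\langle n\rangle^r\|_{\ell^q_n(\mathbb Z^d)}\big\|_{L^2_x(\mathbb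 R^d)}$, where $\square_n=\mathcal F^{-1}\sigma_n\mathcal F$, $\sigma_n=\chi(\cdot-n)/\sum_{\ell\in\mathbb Z^d}\chi(\cdot-\ell)$, and $\chi:\mathbb R^d\to[0,1]$ is any smooth function with $\chi(\xi)=1$ for $|\xi|_\infty\le\frac12$ and $\chi(\xi)=0$ for $|\xi|_\infty\ge1$; - the Fourier–Lebesgue space $\mathcal FL^q_r(\mathbb T^d)$, with norm $\|\widehat f(n)\langle n\rangle^r\|_{\ell^q_n(\mathbb Z^d)}$. Put $\mathcal X_s=X_s\times X_{s-1}$ with $\|(f_0,f_1)\|_{\mathcal X_s}=\|f_0\|_{X_s}+\sqrt2\,\|f_1\|_{X_{s-1}}$. Let $\vec u_0\in\mathcal X_s$; if $q=\infty$, assume in addition that $\vec u_0$ lies in the closure in $\mathcal X_s$ of the pairs in $\mathcal X_s$ whose Fourier transforms have compact support (for $q<\infty$ nothing more is assumed). A smooth solution on $[0,T]$ is a function $u\in C^\infty([0,T]\times\mathcal M)\cap C([0,T],\mathcal FL^1(\mathcal M))$ that satisfies (NLW) pointwise. (1) *Norm inflation with infinite loss of regularity at $\vec u_0$.* For every $\theta\in\mathbb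 R$ and $\varepsilon>0$ there are $\vec u_{0,\varepsilon}\in\mathcal X_s$ and $T$ with $$\|\vec u_0-\vec u_{0,\varepsilon}\|_{\mathcal X_s}<\varepsilon,\qquad 0<T<\varepsilon,$$ such that (NLW) with data $\vec u_{0,\varepsilon}$ has a smooth solution $u_\varepsilon$ on $[0,T]$, it is the only one, it belongs to $C([0,T],X_\theta)$, and $$\|u_\varepsilon(T)\|_{X_\theta}>\frac1\varepsilon.$$ (2) *Discontinuity of the solution map at $\vec u_0$.* Let $T>0$ and $\theta\in\mathbb R$. There is no $g\in C([0,T],X_\theta)$ to which the smooth solutions converge in $X_\theta$, uniformly on the parts of $[0,T]$ on which they exist, as their data tend to $\vec u_0$ in $\mathcal X_s$. In particular, let $\Phi$ be any map from a neighbourhood of $\vec u_0$ in $\mathcal X_s$ to $C([0,T],X_\theta)$ such that $\Phi(\vec v)=u$ on $[0,T']$ whenever $0<T'\le T$ and $u$ is a smooth solution on $[0,T']$ with data $\vec v$. Then $\Phi$ is not continuous at $\vec u_0$. -/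

import Mathlib

open MeasureTheory Set Filter Topology
open scoped ENNReal SchwartzMap FourierTransform ContDiff Laplacian

noncomputable section

namespace NLW

/-! Conventions: `ℝᵈ` is `EuclideanSpace ℝ (Fin d)`, the torus is `ℝᵈ / ℤᵈ`, functions on the torus
are `ℤᵈ`-periodic functions on `ℝᵈ`, and all Fourier transforms use the characters
`exp (2 π i ⟨x, ξ⟩)`. Norms take values in `[0, ∞]`; a space is the set of finite norm. -/

abbrev Space (d : ℕ) : Type := EuclideanSpace ℝ (Fin d)

abbrev Lattice (d : ℕ) : Type := Fin d → ℤ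

/-- The lattice point `n`, seen in `ℝᵈ`. -/
def latticePt {d : ℕ} (n : Lattice d) : Space d := WithLp.toLp 2 (fun i => (n i : ℝ))

/-- The weight `⟨n⟩ ^ s = (1 + |n| ^ 2) ^ (s / 2)`. -/
def weight {d : ℕ} (s : ℝ) (n : Lattice d) : ℝ≥0∞ :=
  ENNReal.ofReal ((1 + ∑ i, (n i : ℝ) ^ 2) ^ (s / 2))

/-- The half-open unit cube `n + (-1/2, 1/2]ᵈ`. -/
def unitCube {d : ℕ} (n : Lattice d) : Set (Space d) :=
  {ξ | ∀ i, ξ i - (n i : ℝ) ∈ Ioc (-(1 / 2) : ℝ) (1 / 2)}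

/-- The `ℓ^q` norm of a family of elements of `[0, ∞]` indexed by `ℤᵈ`. -/
def ellNorm {d : ℕ} (q : ℝ≥0∞) (a : Lattice d → ℝ≥0∞) : ℝ≥0∞ := eLpNorm a q Measure.count

/-! ### Function spaces on `ℝᵈ` -/

/-- The tempered distribution `f` is (integration against) the function `g`. -/
def Represents {d : ℕ} (g : Space d → ℂ) (f : 𝓢'(Space d, ℂ)) : Prop :=
  AEStronglyMeasurable g volume ∧
    ∀ φ : 𝓢(Space d, ℂ), Integrable (fun x => φ x * g x) volume ∧ f φ = ∫ x, φ x * g x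

/-- The norm of the Fourier amalgam space `ŵ^{p,q}_s(ℝᵈ)`; it is infinite unless the Fourier
transform of `f` is a function `g` (which is then unique almost everywhere, so that the infimum is
the value at this `g`). -/
def fourierAmalgamNorm {d : ℕ} (p q : ℝ≥0∞) (s : ℝ) (f : 𝓢'(Space d, ℂ)) : ℝ≥0∞ :=
  ⨅ (g : Space d → ℂ) (_ : Represents g (𝓕 f)),
    ellNorm q (fun n : Lattice d => eLpNorm g p (volume.restrict (unitCube n)) * weight s n)

/-- The cut-off functions from which the uniform decomposition is built: smooth, with values in
`[0, 1]`, equal to `1` for `|ξ|_∞ ≤ 1/2` and to `0` for `|ξ|_∞ ≥ 1`. -/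
structure IsCutoff {d : ℕ} (χ : Space d → ℝ) : Prop where
  smooth : ContDiff ℝ ∞ χ
  mem_unit : ∀ ξ, χ ξ ∈ Icc (0 : ℝ) 1
  eq_one : ∀ ξ : Space d, (∀ i, |ξ i| ≤ 1 / 2) → χ ξ = 1
  eq_zero : ∀ ξ : Space d, (∃ i, 1 ≤ |ξ i|) → χ ξ = 0

/-- The partition of unity `χ (ξ - n) / ∑_ℓ χ (ξ - ℓ)`. -/
def boxSymbol {d : ℕ} (χ : Space d → ℝ) (n : Lattice d) (ξ : Space d) : ℂ :=
  ((χ (ξ - latticePt n) / ∑' l : Lattice d, χ (ξ - latticePt l) : ℝ) : ℂ)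

/-- The frequency-uniform decomposition operator, the Fourier multiplier with symbol
`boxSymbol χ n`. -/
def box {d : ℕ} (χ : Space d → ℝ) (n : Lattice d) (f : 𝓢'(Space d, ℂ)) : 𝓢'(Space d, ℂ) :=
  TemperedDistribution.fourierMultiplierCLM ℂ (boxSymbol χ n) f

/-- The norm of the Wiener amalgam space `W^{p,q}_s(ℝᵈ)`. The functions `h n` representing the
distributions `box χ n f` are unique almost everywhere. -/
def wienerAmalgamNorm {d : ℕ} (χ : Space d → ℝ) (p q : ℝ≥0∞) (s : ℝ) (f : 𝓢'(Space d, ℂ)) :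
    ℝ≥0∞ :=
  ⨅ (h : Lattice d → Space d → ℂ) (_ : ∀ n, Represents (h n) (box χ n f)),
    eLpNorm (fun x => ellNorm q (fun n : Lattice d => ‖h n x‖ₑ * weight s n)) p volume

/-- The Fourier transform of `f` has compact support. -/
def BandLimited {d : ℕ} (f : 𝓢'(Space d, ℂ)) : Prop :=
  ∃ R : ℝ, Distribution.IsVanishingOn (𝓕 f : 𝓢'(Space d, ℂ)) (Metric.closedBall (0 : Space d) R)ᶜ

/-! ### Distributions on the torus -/

def IsPeriodic {d : ℕ} (f : Space d → ℂ) : Prop :=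
  ∀ (k : Lattice d) (x : Space d), f (x + latticePt k) = f x

/-- The test functions `C^∞(𝕋ᵈ)`. -/
def torusTest (d : ℕ) : Submodule ℂ (Space d → ℂ) where
  carrier := {φ | ContDiff ℝ ∞ φ ∧ IsPeriodic φ}
  add_mem' := fun {a b} ha hb =>
    ⟨ha.1.add hb.1, fun k x => by simp [ha.2 k x, hb.2 k x]⟩
  zero_mem' := ⟨contDiff_const, fun _ _ => rfl⟩
  smul_mem' := fun c a ha =>
    ⟨contDiff_const.smul ha.1, fun k x => by simp [ha.2 k x]⟩

/-- The distributions on `𝕋ᵈ`: the linear functionals on `C^∞(𝕋ᵈ)` that are continuous, that is,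
bounded by the suprema of finitely many derivatives. -/
def torusDistribution (d : ℕ) : Submodule ℂ (Module.Dual ℂ (torusTest d)) where
  carrier := {f | ∃ (C : ℝ) (m : ℕ), ∀ (φ : torusTest d) (B : ℝ),
    (∀ k ≤ m, ∀ x, ‖iteratedFDeriv ℝ k (φ : Space d → ℂ) x‖ ≤ B) → ‖f φ‖ ≤ C * B}
  add_mem' := by
    rintro f g ⟨C, m, hf⟩ ⟨C', m', hg⟩
    refine ⟨C + C', max m m', fun φ B hB => ?_⟩
    have h1 := hf φ B fun k hk => hB k (hk.trans (le_max_left _ _))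
    have h2 := hg φ B fun k hk => hB k (hk.trans (le_max_right _ _))
    calc ‖(f + g) φ‖ ≤ ‖f φ‖ + ‖g φ‖ := norm_add_le _ _
      _ ≤ (C + C') * B := by linarith
  zero_mem' := ⟨0, 0, fun φ B _ => by simp⟩
  smul_mem' := by
    rintro c f ⟨C, m, hf⟩
    refine ⟨‖c‖ * C, m, fun φ B hB => ?_⟩
    have h := mul_le_mul_of_nonneg_left (hf φ B hB) (norm_nonneg c)
    calc ‖(c • f) φ‖ = ‖c‖ * ‖f φ‖ := norm_smul c (f φ)
      _ ≤ ‖c‖ * C * B := by linarith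

/-- The character `exp (2 π i ⟨n, x⟩)`. -/
def characterFun {d : ℕ} (n : Lattice d) (x : Space d) : ℂ :=
  Complex.exp (2 * Real.pi * Complex.I * ((∑ i, (n i : ℝ) * x i : ℝ) : ℂ))

theorem characterFun_mem {d : ℕ} (n : Lattice d) : characterFun n ∈ torusTest d := by
  refine ⟨?_, fun k x => ?_⟩
  · unfold characterFun
    have h : ContDiff ℝ ∞ (fun x : Space d => ∑ i, (n i : ℝ) * x i) := by fun_prop
    have h' : ContDiff ℝ ∞ (fun x : Space d => ((∑ i, (n i : ℝ) * x i : ℝ) : ℂ)) :=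
      Complex.ofRealCLM.contDiff.comp h
    exact (contDiff_const.mul h').cexp
  · unfold characterFun
    rw [Complex.exp_eq_exp_iff_exists_int]
    refine ⟨∑ i, n i * k i, ?_⟩
    simp only [latticePt, PiLp.add_apply, mul_add, Finset.sum_add_distrib]
    push_cast
    ring

/-- The Fourier coefficient of a distribution on the torus. -/
def torusCoeff {d : ℕ} (f : torusDistribution d) (n : Lattice d) : ℂ :=
  f.1 ⟨characterFun (-n), characterFun_mem (-n)⟩

/-- The norm of the Fourier-Lebesgue space `𝓕L^q_s(𝕋ᵈ)`. -/
def torusFourierLebesgueNorm {d : ℕ} (q : ℝ≥0∞) (s : ℝ) (f : torusDistribution d) : ℝ≥0∞ :=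
  ellNorm q (fun n : Lattice d => ‖torusCoeff f n‖ₑ * weight s n)

/-- The distribution `f` on the torus is (integration against) the periodic function `g`. -/
def TorusRepresents {d : ℕ} (g : Space d → ℂ) (f : torusDistribution d) : Prop :=
  IsPeriodic g ∧ IntegrableOn g (unitCube 0) volume ∧
    ∀ φ : torusTest d, f.1 φ = ∫ x in unitCube 0, (φ : Space d → ℂ) x * g x

/-- The distribution on the torus has finitely many nonzero Fourier coefficients. -/
def TorusBandLimited {d : ℕ} (f : torusDistribution d) : Prop :=
  {n : Lattice d | torusCoeff f n ≠ 0}.Finite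

/-! ### Solutions -/

/-- `u ∈ C([0, T], X)`, where `X` is the space given by the norm `N`. -/
def ContinuousInto {D : Type} [AddCommGroup D] (N : D → ℝ≥0∞) (T : ℝ) (u : ℝ → D) : Prop :=
  (∀ t ∈ Icc 0 T, N (u t) < ⊤) ∧
    ∀ t₀ ∈ Icc 0 T, Tendsto (fun t => N (u t - u t₀)) (𝓝[Icc 0 T] t₀) (𝓝 0)

/-- `u` is `C^∞` on `[0, T] × ℝᵈ` and solves `∂ₜ² u - Δ u = μ u^ρ ū^(σ - ρ)` there (by continuity it
is enough to ask for the equation in the open time interval). -/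
def IsClassicalSolution {d : ℕ} (μ : ℂ) (ρ σ : ℕ) (T : ℝ) (u : ℝ → Space d → ℂ) : Prop :=
  ContDiffOn ℝ ∞ (fun z : ℝ × Space d => u z.1 z.2) (Icc 0 T ×ˢ univ) ∧
    ∀ t ∈ Ioo 0 T, ∀ x, iteratedDeriv 2 (fun τ => u τ x) t - (Δ (u t)) x =
      μ * u t x ^ ρ * (starRingEnd ℂ (u t x)) ^ (σ - ρ)

/-- `U` is the smooth solution on `[0, T]` with data `v = (v₀, v₁)`: a curve in `C([0, T], 𝓕L¹)`
(`N` is the norm of `𝓕L¹`) that is given by a function which is smooth up to the boundary and solves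
the equation pointwise. The relation `Rep g f` says that the distribution `f` is the function `g`. -/
def IsSmoothSolution {d : ℕ} {D : Type} [AddCommGroup D] (Rep : (Space d → ℂ) → D → Prop)
    (N : D → ℝ≥0∞) (μ : ℂ) (ρ σ : ℕ) (T : ℝ) (v : D × D) (U : ℝ → D) : Prop :=
  ContinuousInto N T U ∧ ∃ u : ℝ → Space d → ℂ,
    IsClassicalSolution μ ρ σ T u ∧ (∀ t ∈ Icc 0 T, Rep (u t) (U t)) ∧ Rep (u 0) v.1 ∧
      Rep (fun x => derivWithin (fun τ => u τ x) (Icc 0 T) 0) v.2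

/-- The smooth solutions on `ℝᵈ`; `𝓕L¹(ℝᵈ)` is `ŵ^{1,1}_0(ℝᵈ)`. -/
def SolRd {d : ℕ} (μ : ℂ) (ρ σ : ℕ) :
    ℝ → 𝓢'(Space d, ℂ) × 𝓢'(Space d, ℂ) → (ℝ → 𝓢'(Space d, ℂ)) → Prop :=
  IsSmoothSolution Represents (fourierAmalgamNorm 1 1 0) μ ρ σ

/-- The smooth solutions on `𝕋ᵈ`. -/
def SolTorus {d : ℕ} (μ : ℂ) (ρ σ : ℕ) :
    ℝ → torusDistribution d × torusDistribution d → (ℝ → torusDistribution d) → Prop :=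
  IsSmoothSolution TorusRepresents (torusFourierLebesgueNorm 1 0) μ ρ σ

/-! ### Norm inflation and discontinuity

Below, `X s` is the norm of the space `X_s` and `Sol T v u` says that `u` is the smooth solution
on `[0, T]` with data `v`. -/

section Inflation

variable {D : Type} [AddCommGroup D]

/-- The norm of `X_s × X_{s-1}`. -/
def pairNorm (X : ℝ → D → ℝ≥0∞) (s : ℝ) (v : D × D) : ℝ≥0∞ :=
  X s v.1 + ENNReal.ofReal (Real.sqrt 2) * X (s - 1) v.2

/-- `v` lies in the closure in `X_s × X_{s-1}` of the pairs whose components satisfy `BL`. -/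
def InClosure (X : ℝ → D → ℝ≥0∞) (BL : D → Prop) (s : ℝ) (v : D × D) : Prop :=
  ∀ δ : ℝ, 0 < δ → ∃ w : D × D, BL w.1 ∧ BL w.2 ∧ pairNorm X s w < ⊤ ∧
    pairNorm X s (v - w) < ENNReal.ofReal δ

/-- Norm inflation with infinite loss of regularity at `v`. -/
def NormInflationAt (X : ℝ → D → ℝ≥0∞) (Sol : ℝ → D × D → (ℝ → D) → Prop) (s : ℝ)
    (v : D × D) : Prop :=
  ∀ θ ε : ℝ, 0 < ε → ∃ w : D × D, pairNorm X s w < ⊤ ∧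
    pairNorm X s (v - w) < ENNReal.ofReal ε ∧
    ∃ T : ℝ, 0 < T ∧ T < ε ∧ ∃ u : ℝ → D, Sol T w u ∧
      (∀ u' : ℝ → D, Sol T w u' → ∀ t ∈ Icc 0 T, u' t = u t) ∧
      ContinuousInto (X θ) T u ∧ ENNReal.ofReal (1 / ε) < X θ (u T)

/-- `Φ` is a solution map with values in `C([0, T], X_θ)`, defined on the set of data `A`: on the
interval of existence of a smooth solution it agrees with this solution. Nothing is said about
the values at data without a smooth solution. -/
def IsSolutionMapOn (X : ℝ → D → ℝ≥0∞) (Sol : ℝ → D × D → (ℝ → D) → Prop) (θ T : ℝ)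
    (A : Set (D × D)) (Φ : D × D → ℝ → D) : Prop :=
  ∀ w ∈ A, ContinuousInto (X θ) T (Φ w) ∧
    ∀ T' : ℝ, 0 < T' → T' ≤ T → ∀ u : ℝ → D, Sol T' w u → ∀ t ∈ Icc 0 T', Φ w t = u t

/-- `Φ`, defined on the set of data `A`, is continuous at `v` from `X_s × X_{s-1}` to
`C([0, T], X_θ)`. -/
def MapContinuousAt (X : ℝ → D → ℝ≥0∞) (s θ T : ℝ) (A : Set (D × D)) (Φ : D × D → ℝ → D)
    (v : D × D) : Prop :=
  ∀ η : ℝ, 0 < η → ∃ δ : ℝ, 0 < δ ∧ ∀ w ∈ A, pairNorm X s (v - w) < ENNReal.ofReal δ →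
    ∀ t ∈ Icc 0 T, X θ (Φ w t - Φ v t) ≤ ENNReal.ofReal η

/-- As the data tend to `v` in `X_s × X_{s-1}`, their smooth solutions tend to `g` in `X_θ`,
uniformly on the part of `[0, T]` on which they exist. -/
def SolutionsConvergeTo (X : ℝ → D → ℝ≥0∞) (Sol : ℝ → D × D → (ℝ → D) → Prop) (s θ T : ℝ)
    (v : D × D) (g : ℝ → D) : Prop :=
  ∀ η : ℝ, 0 < η → ∃ δ : ℝ, 0 < δ ∧ ∀ w : D × D, pairNorm X s w < ⊤ →
    pairNorm X s (v - w) < ENNReal.ofReal δ →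
    ∀ T' : ℝ, 0 < T' → T' ≤ T → ∀ u : ℝ → D, Sol T' w u →
      ∀ t ∈ Icc 0 T', X θ (u t - g t) ≤ ENNReal.ofReal η

/-- The solution map into `C([0, T], X_θ)` is discontinuous at `v` for all `T` and `θ`: smooth
solutions have no limit in `C([0, T], X_θ)` as the data tend to `v`, and no solution map defined
on a neighbourhood of `v` in `X_s × X_{s-1}` is continuous at `v`. -/
def SolutionMapDiscontinuousAt (X : ℝ → D → ℝ≥0∞) (Sol : ℝ → D × D → (ℝ → D) → Prop) (s : ℝ)
    (v : D × D) : Prop :=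
  ∀ T θ : ℝ, 0 < T →
    (¬ ∃ g : ℝ → D, ContinuousInto (X θ) T g ∧ SolutionsConvergeTo X Sol s θ T v g) ∧
    ∀ (A : Set (D × D)) (Φ : D × D → ℝ → D),
      (∃ r : ℝ, 0 < r ∧ ∀ w : D × D, pairNorm X s w < ⊤ →
        pairNorm X s (v - w) < ENNReal.ofReal r → w ∈ A) →
      IsSolutionMapOn X Sol θ T A Φ → ¬ MapContinuousAt X s θ T A Φ v

/-- Norm inflation with infinite loss of regularity, and discontinuity of the solution map, at every
datum in `X_s × X_{s-1}`; if `q = ∞`, at every datum in the closure of the band-limited ones. -/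
def StronglyIllPosed (X : ℝ → D → ℝ≥0∞) (Sol : ℝ → D × D → (ℝ → D) → Prop) (BL : D → Prop)
    (q : ℝ≥0∞) (s : ℝ) : Prop :=
  ∀ v : D × D, pairNorm X s v < ⊤ → (q = ⊤ → InClosure X BL s v) →
    NormInflationAt X Sol s v ∧ SolutionMapDiscontinuousAt X Sol s v

end Inflation

end NLW

end

noncomputable section

namespace NLW

set_option linter.unusedSectionVars false

/-! ### From norm inflation to discontinuity of the solution map -/

section

section Discontinuity

variable {D : Type} [AddCommGroup D]

/-- Curves in `C([0, T], X_θ)` are bounded in `X_θ` near the initial time. -/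
theorem ContinuousInto.exists_bound {N : D → ℝ≥0∞} (hadd : ∀ f g, N (f + g) ≤ N f + N g) {T : ℝ}
    (hT : 0 < T) {g : ℝ → D} (hg : ContinuousInto N T g) :
    ∃ t₁ : ℝ, 0 < t₁ ∧ t₁ ≤ T ∧ ∀ t ∈ Icc 0 t₁, N (g t) ≤ 1 + N (g 0) := by
  have h0 : (0 : ℝ) ∈ Icc 0 T := ⟨le_rfl, hT.le⟩
  have h := (hg.2 0 h0).eventually_lt_const (u := 1) (by simp)
  obtain ⟨r, hr, hr'⟩ := Metric.mem_nhdsWithin_iff.1 h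
  refine ⟨min (r / 2) T, by positivity, min_le_right _ _, fun t ht => ?_⟩
  have hlt : N (g t - g 0) < 1 := by
    refine hr' ⟨?_, ?_⟩
    · rw [Metric.mem_ball, Real.dist_eq, sub_zero, abs_of_nonneg ht.1]
      linarith [ht.2.trans (min_le_left _ _)]
    · exact ⟨ht.1, ht.2.trans (min_le_right _ _)⟩
  calc N (g t) = N ((g t - g 0) + g 0) := by rw [sub_add_cancel]
    _ ≤ N (g t - g 0) + N (g 0) := hadd _ _
    _ ≤ 1 + N (g 0) := by gcongr

/-- Norm inflation contradicts any uniform control of the solutions near the datum by a fixed curve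
in `C([0, T], X_θ)`. -/
theorem NormInflationAt.false_of_close {X : ℝ → D → ℝ≥0∞} {Sol : ℝ → D × D → (ℝ → D) → Prop}
    {s : ℝ} {v : D × D} (h : NormInflationAt X Sol s v) {θ T δ : ℝ}
    (hadd : ∀ f g, X θ (f + g) ≤ X θ f + X θ g) (hT : 0 < T) (hδ : 0 < δ) {g : ℝ → D}
    (hg : ContinuousInto (X θ) T g)
    (hclose : ∀ w : D × D, pairNorm X s w < ⊤ → pairNorm X s (v - w) < ENNReal.ofReal δ →
      ∀ T' : ℝ, 0 < T' → T' ≤ T → ∀ u : ℝ → D, Sol T' w u →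
        ∀ t ∈ Icc 0 T', X θ (u t - g t) ≤ 1) : False := by
  obtain ⟨t₁, ht₁, ht₁T, hb⟩ := hg.exists_bound hadd hT
  have hB : (1 : ℝ≥0∞) + (1 + X θ (g 0)) < ⊤ := by
    simpa using hg.1 0 ⟨le_rfl, hT.le⟩
  obtain ⟨B, hB'⟩ := ENNReal.lt_iff_exists_nnreal_btwn.1 hB
  have hBpos : (0 : ℝ) < B := by
    have : (0 : ℝ≥0∞) < B := lt_of_le_of_lt (by simp) hB'.1
    exact_mod_cast this
  -- Being below t₁ puts the inflation time where g is bounded, being below δ puts the datum where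
  -- solutions follow g, and 1/ε ≥ B exceeds the bound that these two facts imply.
  set ε := min (min t₁ δ) (1 / B) with hε
  have hεpos : 0 < ε := by positivity
  obtain ⟨w, hw, hvw, T', hT', hT'ε, u, hu, -, -, hbig⟩ := h θ ε hεpos
  have hT't₁ : T' ≤ t₁ := hT'ε.le.trans ((min_le_left _ _).trans (min_le_left _ _))
  have hmem : T' ∈ Icc 0 T' := ⟨hT'.le, le_rfl⟩
  have h1 := hclose w hw (hvw.trans_le (ENNReal.ofReal_le_ofReal
    ((min_le_left _ _).trans (min_le_right _ _)))) T' hT' (hT't₁.trans ht₁T) u hu T' hmem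
  have h2 := hb T' ⟨hT'.le, hT't₁⟩
  have h3 : X θ (u T') ≤ 1 + (1 + X θ (g 0)) := by
    calc X θ (u T') = X θ ((u T' - g T') + g T') := by rw [sub_add_cancel]
      _ ≤ X θ (u T' - g T') + X θ (g T') := hadd _ _
      _ ≤ _ := add_le_add h1 h2
  have h4 : (B : ℝ≥0∞) ≤ ENNReal.ofReal (1 / ε) := by
    rw [← ENNReal.ofReal_coe_nnreal]
    apply ENNReal.ofReal_le_ofReal
    rw [le_div_iff₀ hεpos, ← le_div_iff₀' hBpos]
    exact min_le_right _ _
  exact absurd (hbig.trans_le h3) (not_lt.2 (hB'.1.le.trans h4))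

/-- Either form of continuity supplies one fixed curve that the smooth solutions with nearby data
must follow within distance 1: the limit g in the first case, Φ v in the second. Inflation excludes
such a curve. -/
theorem NormInflationAt.solutionMapDiscontinuousAt {X : ℝ → D → ℝ≥0∞}
    {Sol : ℝ → D × D → (ℝ → D) → Prop} {s : ℝ} {v : D × D} (h : NormInflationAt X Sol s v)
    (hadd : ∀ θ f g, X θ (f + g) ≤ X θ f + X θ g) (hzero : ∀ θ, X θ 0 = 0)
    (hv : pairNorm X s v < ⊤) : SolutionMapDiscontinuousAt X Sol s v := by
  refine fun T θ hT => ⟨?_, ?_⟩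
  · rintro ⟨g, hg, hconv⟩
    obtain ⟨δ, hδ, hclose⟩ := hconv 1 one_pos
    refine h.false_of_close (hadd θ) hT hδ hg ?_
    simpa using hclose
  · rintro A Φ ⟨r, hr, hA⟩ hΦ hcont
    obtain ⟨δ, hδ, hclose⟩ := hcont 1 one_pos
    have hvA : v ∈ A := hA v hv (by simp [pairNorm, hzero, hr])
    refine h.false_of_close (hadd θ) hT (lt_min hδ hr) (hΦ v hvA).1
      fun w hw hvw T' hT' hT'T u hu t ht => ?_
    have hwA : w ∈ A := hA w hw (hvw.trans_le (ENNReal.ofReal_le_ofReal (min_le_right _ _)))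
    rw [← (hΦ w hwA).2 T' hT' hT'T u hu t ht]
    simpa using hclose w hwA (hvw.trans_le (ENNReal.ofReal_le_ofReal (min_le_left _ _))) t
      ⟨ht.1, ht.2.trans hT'T⟩

end Discontinuity

end

section

/-! ### Convolution of profiles on the frequency side -/

/-- A frequency space: a measured group `G` together with a homomorphism `ι` to `ℝᵈ`. The two
examples are `ℝᵈ` itself and the lattice `ℤᵈ`. -/
class IsFrequencySpace {d : ℕ} {G : Type} [AddCommGroup G] [MeasurableSpace G] (m : Measure G)
    (ι : G →+ Space d) : Prop where
  measurable : Measurable ι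
  integrable_exp : ∀ a : ℝ, 0 < a → Integrable (fun ξ => Real.exp (-(a * ‖ι ξ‖))) m
  ball_pos : ∀ r : ℝ, 0 < r → 0 < m {ξ | ‖ι ξ‖ ≤ r}

variable {d : ℕ} {G : Type} [AddCommGroup G] [MeasurableSpace G]

def conv (m : Measure G) (f g : G → ℂ) (ξ : G) : ℂ := ∫ η, f η * g (ξ - η) ∂m

/-- The profile of the complex conjugate. -/
def sharp (f : G → ℂ) (ξ : G) : ℂ := starRingEnd ℂ (f (-ξ))

/-- The exponential weight `exp (a |ξ|)`. -/
def expWeight (ι : G →+ Space d) (a : ℝ) (ξ : G) : ℝ := Real.exp (a * ‖ι ξ‖)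

/-- The profile `f` is bounded by `M` in the exponentially weighted spaces `L¹` and `L^∞`. -/
structure Bd (m : Measure G) (ι : G →+ Space d) (a M : ℝ) (f : G → ℂ) : Prop where
  meas : Measurable f
  lint : ∫⁻ ξ, ENNReal.ofReal (expWeight ι a ξ) * ‖f ξ‖ₑ ∂m ≤ ENNReal.ofReal M
  sup : ∀ ξ, expWeight ι a ξ * ‖f ξ‖ ≤ M

section

variable {m : Measure G} {ι : G →+ Space d} {a M M' : ℝ} {f g : G → ℂ}

theorem expWeight_pos (ξ : G) : 0 < expWeight ι a ξ := Real.exp_pos _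

theorem one_le_expWeight (ha : 0 ≤ a) (ξ : G) : 1 ≤ expWeight ι a ξ :=
  Real.one_le_exp (by positivity)

/-- Submultiplicativity of the weight is the triangle inequality. It makes the weighted spaces
algebras under convolution. -/
theorem expWeight_le_mul (ha : 0 ≤ a) (ξ η : G) :
    expWeight ι a ξ ≤ expWeight ι a η * expWeight ι a (ξ - η) := by
  unfold expWeight
  rw [← Real.exp_add, ← mul_add]
  gcongr
  calc ‖ι ξ‖ = ‖ι η + ι (ξ - η)‖ := by rw [← map_add]; simp
    _ ≤ _ := norm_add_le _ _

theorem expWeight_neg (ξ : G) : expWeight ι a (-ξ) = expWeight ι a ξ := by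
  simp [expWeight]

theorem Bd.nonneg (h : Bd m ι a M f) : 0 ≤ M :=
  (mul_nonneg (expWeight_pos (0 : G)).le (norm_nonneg _)).trans (h.sup 0)

theorem Bd.mono (h : Bd m ι a M f) (hM : M ≤ M') : Bd m ι a M' f :=
  ⟨h.meas, h.lint.trans (ENNReal.ofReal_le_ofReal hM), fun ξ => (h.sup ξ).trans hM⟩

theorem Bd.norm_le (h : Bd m ι a M f) (ξ : G) : ‖f ξ‖ ≤ M * Real.exp (-(a * ‖ι ξ‖)) := by
  have h1 := h.sup ξ
  rw [Real.exp_neg, ← div_eq_mul_inv, le_div_iff₀ (Real.exp_pos _), mul_comm]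
  exact h1

theorem Bd.lintegral_le (ha : 0 ≤ a) (h : Bd m ι a M f) :
    ∫⁻ ξ, ‖f ξ‖ₑ ∂m ≤ ENNReal.ofReal M := by
  refine le_trans (lintegral_mono fun ξ => ?_) h.lint
  calc ‖f ξ‖ₑ = 1 * ‖f ξ‖ₑ := (one_mul _).symm
    _ ≤ _ := by
      gcongr
      exact ENNReal.one_le_ofReal.2 (one_le_expWeight ha ξ)

theorem Bd.integrable (ha : 0 ≤ a) (h : Bd m ι a M f) : Integrable f m :=
  ⟨h.meas.aestronglyMeasurable, (h.lintegral_le ha).trans_lt ENNReal.ofReal_lt_top⟩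

theorem Bd.integral_norm_le (ha : 0 ≤ a) (h : Bd m ι a M f) : ∫ ξ, ‖f ξ‖ ∂m ≤ M := by
  rw [integral_norm_eq_lintegral_enorm h.meas.aestronglyMeasurable]
  exact ENNReal.toReal_le_of_le_ofReal h.nonneg (h.lintegral_le ha)

theorem Bd.zero : Bd m ι a 0 (0 : G → ℂ) :=
  ⟨measurable_const, by simp, by simp⟩

theorem Bd.congr (h : Bd m ι a M f) (hfg : ∀ ξ, ‖g ξ‖ = ‖f ξ‖) (hg : Measurable g) :
    Bd m ι a M g := by
  refine ⟨hg, ?_, fun ξ => by rw [hfg]; exact h.sup ξ⟩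
  have : ∀ ξ, ‖g ξ‖ₑ = ‖f ξ‖ₑ := fun ξ => by
    rw [← ofReal_norm, ← ofReal_norm, hfg]
  simpa only [this] using h.lint

theorem Bd.neg (h : Bd m ι a M f) : Bd m ι a M (-f) :=
  h.congr (by simp) h.meas.neg

theorem Bd.of_le (hι : Measurable ι) (h : Bd m ι a M f) {c : ℝ} (hc : 0 ≤ c)
    (hfg : ∀ ξ, ‖g ξ‖ ≤ c * ‖f ξ‖) (hg : Measurable g) : Bd m ι a (c * M) g := by
  have hw : Measurable fun ξ => ENNReal.ofReal (expWeight ι a ξ) := by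
    unfold expWeight; fun_prop
  refine ⟨hg, ?_, fun ξ => ?_⟩
  · calc ∫⁻ ξ, ENNReal.ofReal (expWeight ι a ξ) * ‖g ξ‖ₑ ∂m
        ≤ ∫⁻ ξ, ENNReal.ofReal c * (ENNReal.ofReal (expWeight ι a ξ) * ‖f ξ‖ₑ) ∂m := by
          refine lintegral_mono fun ξ => ?_
          rw [mul_left_comm]
          gcongr
          rw [← ofReal_norm, ← ofReal_norm, ← ENNReal.ofReal_mul hc]
          exact ENNReal.ofReal_le_ofReal (hfg ξ)
      _ = ENNReal.ofReal c * ∫⁻ ξ, ENNReal.ofReal (expWeight ι a ξ) * ‖f ξ‖ₑ ∂m :=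
          lintegral_const_mul _ (hw.mul h.meas.enorm)
      _ ≤ ENNReal.ofReal c * ENNReal.ofReal M := by gcongr; exact h.lint
      _ = _ := (ENNReal.ofReal_mul hc).symm
  · calc expWeight ι a ξ * ‖g ξ‖ ≤ expWeight ι a ξ * (c * ‖f ξ‖) :=
          mul_le_mul_of_nonneg_left (hfg ξ) (expWeight_pos ξ).le
      _ = c * (expWeight ι a ξ * ‖f ξ‖) := by ring
      _ ≤ c * M := mul_le_mul_of_nonneg_left (h.sup ξ) hc

theorem Bd.add (hι : Measurable ι) (hf : Bd m ι a M f) (hg : Bd m ι a M' g) :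
    Bd m ι a (M + M') (f + g) := by
  have hw : Measurable fun ξ => ENNReal.ofReal (expWeight ι a ξ) := by
    unfold expWeight; fun_prop
  refine ⟨hf.meas.add hg.meas, ?_, fun ξ => ?_⟩
  · calc ∫⁻ ξ, ENNReal.ofReal (expWeight ι a ξ) * ‖(f + g) ξ‖ₑ ∂m
        ≤ ∫⁻ ξ, ENNReal.ofReal (expWeight ι a ξ) * ‖f ξ‖ₑ
            + ENNReal.ofReal (expWeight ι a ξ) * ‖g ξ‖ₑ ∂m := by
          refine lintegral_mono fun ξ => ?_
          rw [← mul_add]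
          gcongr
          exact enorm_add_le _ _
      _ = _ := lintegral_add_left (hw.mul hf.meas.enorm) _
      _ ≤ ENNReal.ofReal M + ENNReal.ofReal M' := add_le_add hf.lint hg.lint
      _ = _ := (ENNReal.ofReal_add hf.nonneg hg.nonneg).symm
  · calc expWeight ι a ξ * ‖(f + g) ξ‖ ≤ expWeight ι a ξ * (‖f ξ‖ + ‖g ξ‖) :=
          mul_le_mul_of_nonneg_left (norm_add_le _ _) (expWeight_pos ξ).le
      _ = expWeight ι a ξ * ‖f ξ‖ + expWeight ι a ξ * ‖g ξ‖ := mul_add _ _ _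
      _ ≤ M + M' := add_le_add (hf.sup ξ) (hg.sup ξ)

theorem Bd.sub (hι : Measurable ι) (hf : Bd m ι a M f) (hg : Bd m ι a M' g) :
    Bd m ι a (M + M') (f - g) := by
  rw [sub_eq_add_neg]; exact hf.add hι hg.neg

theorem Bd.sharp [MeasurableNeg G] [m.IsNegInvariant] (hf : Bd m ι a M f) :
    Bd m ι a M (sharp f) := by
  refine ⟨(Complex.continuous_conj.measurable.comp (hf.meas.comp measurable_neg)), ?_, fun ξ => ?_⟩
  · refine le_trans (le_of_eq ?_) hf.lint
    rw [← lintegral_neg_eq_self]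
    refine lintegral_congr fun ξ => ?_
    rw [expWeight_neg]
    congr 1
    rw [← ofReal_norm, ← ofReal_norm]
    simp [NLW.sharp]
  · have := hf.sup (-ξ)
    rw [expWeight_neg] at this
    simpa [NLW.sharp] using this

/-- Pointwise limits of bounded profiles are bounded. -/
theorem Bd.of_tendsto (hι : Measurable ι) {F : ℕ → G → ℂ} (hF : ∀ᶠ k in atTop, Bd m ι a M (F k))
    (hlim : ∀ ξ, Tendsto (fun k => F k ξ) atTop (𝓝 (f ξ))) : Bd m ι a M f := by
  obtain ⟨k₀, hk₀⟩ := eventually_atTop.1 hF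
  have hw : Measurable fun ξ => ENNReal.ofReal (expWeight ι a ξ) := by
    unfold expWeight; fun_prop
  have hF' : ∀ k, Bd m ι a M (F (k + k₀)) := fun k => hk₀ _ (by omega)
  have hlim' : ∀ ξ, Tendsto (fun k => F (k + k₀) ξ) atTop (𝓝 (f ξ)) := fun ξ =>
    (tendsto_add_atTop_iff_nat k₀).2 (hlim ξ)
  refine ⟨measurable_of_tendsto_metrizable (fun k => (hF' k).meas) (tendsto_pi_nhds.2 hlim'),
    ?_, fun ξ => ?_⟩
  · calc ∫⁻ ξ, ENNReal.ofReal (expWeight ι a ξ) * ‖f ξ‖ₑ ∂m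
        = ∫⁻ ξ, liminf (fun k => ENNReal.ofReal (expWeight ι a ξ) * ‖F (k + k₀) ξ‖ₑ) atTop ∂m := by
          refine lintegral_congr fun ξ => (Tendsto.liminf_eq ?_).symm
          exact ENNReal.Tendsto.const_mul ((hlim' ξ).enorm) (Or.inr ENNReal.ofReal_ne_top)
      _ ≤ liminf (fun k => ∫⁻ ξ, ENNReal.ofReal (expWeight ι a ξ) * ‖F (k + k₀) ξ‖ₑ ∂m) atTop :=
          lintegral_liminf_le fun k => hw.mul (hF' k).meas.enorm
      _ ≤ ENNReal.ofReal M := by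
          refine (liminf_le_liminf (Eventually.of_forall fun k => (hF' k).lint)).trans ?_
          simp
  · exact le_of_tendsto (((hlim' ξ).norm).const_mul _) (Eventually.of_forall fun k => (hF' k).sup ξ)

variable [MeasurableAdd₂ G] [MeasurableNeg G] [SFinite m] [m.IsAddLeftInvariant]

theorem measurable_conv (hf : Measurable f) (hg : Measurable g) : Measurable (conv m f g) := by
  have h : StronglyMeasurable (fun z : G × G => f z.2 * g (z.1 - z.2)) :=
    (Measurable.mul (hf.comp measurable_snd)
      (hg.comp (measurable_fst.sub measurable_snd))).stronglyMeasurable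
  exact h.integral_prod_right.measurable

theorem enorm_conv_weight_le (ha : 0 ≤ a) (ξ : G) :
    ENNReal.ofReal (expWeight ι a ξ) * ‖conv m f g ξ‖ₑ ≤
      ∫⁻ η, (ENNReal.ofReal (expWeight ι a η) * ‖f η‖ₑ) *
        (ENNReal.ofReal (expWeight ι a (ξ - η)) * ‖g (ξ - η)‖ₑ) ∂m := by
  calc ENNReal.ofReal (expWeight ι a ξ) * ‖conv m f g ξ‖ₑ
      ≤ ENNReal.ofReal (expWeight ι a ξ) * ∫⁻ η, ‖f η * g (ξ - η)‖ₑ ∂m := by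
        gcongr; exact enorm_integral_le_lintegral_enorm _
    _ = ∫⁻ η, ENNReal.ofReal (expWeight ι a ξ) * ‖f η * g (ξ - η)‖ₑ ∂m :=
        (lintegral_const_mul' _ _ ENNReal.ofReal_ne_top).symm
    _ ≤ _ := by
        refine lintegral_mono fun η => ?_
        rw [enorm_mul, mul_mul_mul_comm, ← ENNReal.ofReal_mul (expWeight_pos _).le]
        gcongr
        exact expWeight_le_mul ha ξ η

/-- The weight is submultiplicative, so this is Young's inequality for L¹ * L¹ and L¹ * L^∞. The
constant is exactly the product, which keeps the later bounds uniform in a. -/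
theorem Bd.conv (hι : Measurable ι) (ha : 0 ≤ a) (hf : Bd m ι a M f) (hg : Bd m ι a M' g) :
    Bd m ι a (M * M') (conv m f g) := by
  have hw : Measurable fun ξ => ENNReal.ofReal (expWeight ι a ξ) := by
    unfold expWeight; fun_prop
  have hF := hw.mul hf.meas.enorm
  have hG := hw.mul hg.meas.enorm
  refine ⟨measurable_conv hf.meas hg.meas, ?_, fun ξ => ?_⟩
  · calc _ ≤ ∫⁻ ξ, ∫⁻ η, (ENNReal.ofReal (expWeight ι a η) * ‖f η‖ₑ) *
          (ENNReal.ofReal (expWeight ι a (ξ - η)) * ‖g (ξ - η)‖ₑ) ∂m ∂m :=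
          lintegral_mono fun ξ => enorm_conv_weight_le ha ξ
      _ = ∫⁻ η, ∫⁻ ξ, (ENNReal.ofReal (expWeight ι a η) * ‖f η‖ₑ) *
          (ENNReal.ofReal (expWeight ι a (ξ - η)) * ‖g (ξ - η)‖ₑ) ∂m ∂m := by
          apply lintegral_lintegral_swap
          exact ((hF.comp measurable_snd).mul
            (hG.comp (measurable_fst.sub measurable_snd))).aemeasurable
      _ = ∫⁻ η, (ENNReal.ofReal (expWeight ι a η) * ‖f η‖ₑ) *
          ∫⁻ ξ, ENNReal.ofReal (expWeight ι a ξ) * ‖g ξ‖ₑ ∂m ∂m := by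
          refine lintegral_congr fun η => ?_
          have hG' : Measurable fun ξ => ENNReal.ofReal (expWeight ι a (ξ - η)) * ‖g (ξ - η)‖ₑ :=
            hG.comp (measurable_id.sub_const η)
          rw [lintegral_const_mul _ hG']
          congr 1
          exact lintegral_sub_right_eq_self
            (fun ξ => ENNReal.ofReal (expWeight ι a ξ) * ‖g ξ‖ₑ) η
      _ ≤ ∫⁻ η, (ENNReal.ofReal (expWeight ι a η) * ‖f η‖ₑ) * ENNReal.ofReal M' ∂m := by
          gcongr; exact hg.lint
      _ = (∫⁻ η, (ENNReal.ofReal (expWeight ι a η) * ‖f η‖ₑ) ∂m) * ENNReal.ofReal M' :=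
          lintegral_mul_const _ hF
      _ ≤ ENNReal.ofReal M * ENNReal.ofReal M' := by gcongr; exact hf.lint
      _ = _ := (ENNReal.ofReal_mul hf.nonneg).symm
  · have hnn : 0 ≤ M * M' := mul_nonneg hf.nonneg hg.nonneg
    rw [← ENNReal.ofReal_le_ofReal_iff hnn, ENNReal.ofReal_mul (expWeight_pos _).le,
      ofReal_norm]
    calc _ ≤ ∫⁻ η, (ENNReal.ofReal (expWeight ι a η) * ‖f η‖ₑ) *
        (ENNReal.ofReal (expWeight ι a (ξ - η)) * ‖g (ξ - η)‖ₑ) ∂m := enorm_conv_weight_le ha ξ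
      _ ≤ ∫⁻ η, (ENNReal.ofReal (expWeight ι a η) * ‖f η‖ₑ) * ENNReal.ofReal M' ∂m := by
          refine lintegral_mono fun η => ?_
          gcongr
          rw [← ofReal_norm, ← ENNReal.ofReal_mul (expWeight_pos _).le]
          exact ENNReal.ofReal_le_ofReal (hg.sup _)
      _ = (∫⁻ η, (ENNReal.ofReal (expWeight ι a η) * ‖f η‖ₑ) ∂m) * ENNReal.ofReal M' :=
          lintegral_mul_const _ hF
      _ ≤ ENNReal.ofReal M * ENNReal.ofReal M' := by gcongr; exact hf.lint
      _ = _ := (ENNReal.ofReal_mul hf.nonneg).symm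

theorem integrable_conv_integrand (ha : 0 ≤ a) (hf : Bd m ι a M f) (hg : Bd m ι a M' g) (ξ : G) :
    Integrable (fun η => f η * g (ξ - η)) m := by
  refine Integrable.mul_bdd (c := M') (hf.integrable ha)
    (hg.meas.comp (measurable_const.sub measurable_id)).aestronglyMeasurable
    (Eventually.of_forall fun η => ?_)
  have h1 := hg.sup (ξ - η)
  nlinarith [one_le_expWeight (ι := ι) ha (ξ - η), norm_nonneg (g (ξ - η))]

end

end

section

/-! ### The nonlinearity and Duhamel's integral on the frequency side -/

variable {d : ℕ} {G : Type} [AddCommGroup G] [MeasurableSpace G]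

/-- The convolution product of `F 0, …, F n`. -/
def convProd (m : Measure G) (F : ℕ → G → ℂ) : ℕ → G → ℂ
  | 0 => F 0
  | n + 1 => conv m (convProd m F n) (F (n + 1))

/-- The profile of `u ^ ρ * ū ^ (σ - ρ)`. -/
def nonlinProfile (m : Measure G) (ρ σ : ℕ) (f : G → ℂ) : G → ℂ :=
  convProd m (fun i => if i < ρ then f else sharp f) (σ - 1)

/-- The multiplier `sin (w t) / w`. -/
def waveKernel (w t : ℝ) : ℝ := if w = 0 then t else Real.sin (w * t) / w

theorem hasDerivAt_waveKernel (w t : ℝ) : HasDerivAt (waveKernel w) (Real.cos (w * t)) t := by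
  unfold waveKernel
  by_cases h : w = 0
  · simpa [h] using hasDerivAt_id' t
  · simp only [h, if_false]
    have h1 := (((hasDerivAt_id' t).const_mul w).sin).div_const w
    exact h1.congr_deriv (by field_simp)

theorem continuous_waveKernel (w : ℝ) : Continuous (waveKernel w) :=
  continuous_iff_continuousAt.2 fun t => (hasDerivAt_waveKernel w t).continuousAt

/-- The bound does not depend on the frequency w; this is why the contraction time below does not
depend on the frequency of the packets. -/
theorem abs_waveKernel_le (w t : ℝ) : |waveKernel w t| ≤ |t| := by
  unfold waveKernel
  split_ifs with h
  · exact le_rfl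
  · rw [abs_div, div_le_iff₀ (abs_pos.2 h), mul_comm, ← abs_mul]
    exact Real.abs_sin_le_abs

/-- The addition formula for the sine separates t from s, so that Duhamel's integral can be
differentiated in t by the fundamental theorem of calculus. -/
theorem waveKernel_sub (w t s : ℝ) : waveKernel w (t - s) =
    waveKernel w t * Real.cos (w * s) - Real.cos (w * t) * waveKernel w s := by
  unfold waveKernel
  split_ifs with h
  · simp [h]
  · rw [mul_sub, Real.sin_sub]
    ring

theorem measurable_waveKernel (t : ℝ) : Measurable fun w => waveKernel w t := by
  unfold waveKernel
  refine Measurable.ite (measurableSet_singleton 0) measurable_const ?_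
  fun_prop

/-- The frequency `2 π |ξ|` of the wave with wave vector `ξ`. -/
def freq (ι : G →+ Space d) (ξ : G) : ℝ := 2 * Real.pi * ‖ι ξ‖

/-- By Duhamel's principle this is the profile of the solution of the wave equation with source
profile f and zero data. -/
def duhamel (ι : G →+ Space d) (f : ℝ → G → ℂ) (t : ℝ) (ξ : G) : ℂ :=
  ∫ s in (0 : ℝ)..t, (waveKernel (freq ι ξ) (t - s) : ℂ) * f s ξ

section

variable {m : Measure G} {ι : G →+ Space d} {a M M' δ : ℝ}

theorem measurable_freq (hι : Measurable ι) : Measurable (freq ι) := by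
  unfold freq; fun_prop

theorem continuous_duhamel {f : ℝ → G → ℂ} (hf : ∀ ξ, Continuous fun t => f t ξ) (ξ : G) :
    Continuous fun t => duhamel ι f t ξ := by
  unfold duhamel
  apply intervalIntegral.continuous_parametric_intervalIntegral_of_continuous _ continuous_id
  have h1 : Continuous fun z : ℝ × ℝ => waveKernel (freq ι ξ) (z.1 - z.2) :=
    (continuous_waveKernel _).comp (continuous_fst.sub continuous_snd)
  exact (Complex.continuous_ofReal.comp h1).mul ((hf ξ).comp continuous_snd)

theorem intervalIntegrable_duhamel {f : ℝ → G → ℂ} (hf : ∀ ξ, Continuous fun t => f t ξ)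
    (t : ℝ) (ξ : G) (b c : ℝ) :
    IntervalIntegrable (fun s => (waveKernel (freq ι ξ) (t - s) : ℂ) * f s ξ) volume b c := by
  refine Continuous.intervalIntegrable ?_ _ _
  have h1 : Continuous fun s : ℝ => waveKernel (freq ι ξ) (t - s) :=
    (continuous_waveKernel _).comp (continuous_const.sub continuous_id)
  exact (Complex.continuous_ofReal.comp h1).mul (hf ξ)

theorem duhamel_sub {f g : ℝ → G → ℂ} (hf : ∀ ξ, Continuous fun t => f t ξ)
    (hg : ∀ ξ, Continuous fun t => g t ξ) (t : ℝ) :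
    duhamel ι (fun s => f s - g s) t = duhamel ι f t - duhamel ι g t := by
  ext ξ
  simp only [duhamel, Pi.sub_apply, mul_sub]
  exact intervalIntegral.integral_sub (intervalIntegrable_duhamel hf t ξ 0 t)
    (intervalIntegrable_duhamel hg t ξ 0 t)

theorem measurable_duhamel [SFinite m] (hι : Measurable ι) {f : ℝ → G → ℂ}
    (hf : ∀ ξ, Continuous fun t => f t ξ) (hm : ∀ t, Measurable (f t)) (t : ℝ) :
    Measurable (duhamel ι f t) := by
  have h1 : Measurable fun z : G × ℝ => f z.2 z.1 :=
    (measurable_uncurry_of_continuous_of_measurable hf hm).comp measurable_swap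
  have h2 : Measurable fun z : G × ℝ => waveKernel (freq ι z.1) (t - z.2) := by
    have := measurable_uncurry_of_continuous_of_measurable (ι := ℝ)
      (u := fun s (w : ℝ) => waveKernel w (t - s))
      (fun w => (continuous_waveKernel w).comp (continuous_const.sub continuous_id))
      (fun s => measurable_waveKernel (t - s))
    exact this.comp (measurable_snd.prodMk ((measurable_freq hι).comp measurable_fst))
  have h3 : StronglyMeasurable fun z : G × ℝ =>
      (waveKernel (freq ι z.1) (t - z.2) : ℂ) * f z.2 z.1 :=
    ((Complex.measurable_ofReal.comp h2).mul h1).stronglyMeasurable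
  unfold duhamel
  simp only [intervalIntegral]
  exact (h3.integral_prod_right.measurable).sub (h3.integral_prod_right.measurable)

theorem enorm_duhamel_le (f : ℝ → G → ℂ) (t : ℝ) (ξ : G) :
    ‖duhamel ι f t ξ‖ₑ ≤ ENNReal.ofReal |t| * ∫⁻ s in uIoc 0 t, ‖f s ξ‖ₑ := by
  unfold duhamel
  rw [← ofReal_norm, intervalIntegral.norm_integral_eq_norm_integral_uIoc, ofReal_norm]
  refine (enorm_integral_le_lintegral_enorm _).trans ?_
  rw [← lintegral_const_mul' _ _ ENNReal.ofReal_ne_top]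
  refine setLIntegral_mono' measurableSet_uIoc fun s hs => ?_
  rw [enorm_mul]
  gcongr
  rw [← ofReal_norm, Complex.norm_real, Real.norm_eq_abs]
  refine ENNReal.ofReal_le_ofReal ((abs_waveKernel_le _ _).trans ?_)
  rcases le_total 0 t with h | h
  · rw [uIoc_of_le h] at hs
    rw [abs_of_nonneg (by linarith [hs.2]), abs_of_nonneg h]
    linarith [hs.1]
  · rw [uIoc_of_ge h] at hs
    rw [abs_of_nonpos (by linarith [hs.1]), abs_of_nonpos h]
    linarith [hs.2]

/-- One factor |t| bounds the kernel, the other is the length of the time interval; Tonelli's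
theorem takes the weighted L¹ norm inside the time integral. -/
theorem Bd.duhamel [SFinite m] (hι : Measurable ι) {f : ℝ → G → ℂ}
    (hf : ∀ ξ, Continuous fun t => f t ξ) (hb : ∀ t, Bd m ι a M (f t)) (t : ℝ) :
    Bd m ι a (t ^ 2 * M) (duhamel ι f t) := by
  have hM := (hb 0).nonneg
  have hw : Measurable fun ξ => ENNReal.ofReal (expWeight ι a ξ) := by
    unfold expWeight; fun_prop
  have hvol : volume (uIoc 0 t) = ENNReal.ofReal |t| := by
    rw [uIoc, Real.volume_Ioc]; rw [max_sub_min_eq_abs, sub_zero]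
  have key : ∀ ξ, ENNReal.ofReal (expWeight ι a ξ) * ‖NLW.duhamel ι f t ξ‖ₑ ≤
      ENNReal.ofReal |t| * ∫⁻ s in uIoc 0 t, ENNReal.ofReal (expWeight ι a ξ) * ‖f s ξ‖ₑ := by
    intro ξ
    rw [lintegral_const_mul' _ _ ENNReal.ofReal_ne_top, mul_left_comm]
    gcongr
    exact enorm_duhamel_le f t ξ
  have hsq : ENNReal.ofReal (t ^ 2 * M) =
      ENNReal.ofReal |t| * (ENNReal.ofReal M * ENNReal.ofReal |t|) := by
    rw [← sq_abs, ← ENNReal.ofReal_mul hM, ← ENNReal.ofReal_mul (abs_nonneg _)]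
    congr 1; ring
  refine ⟨measurable_duhamel (m := m) hι hf (fun s => (hb s).meas) t, ?_, fun ξ => ?_⟩
  · have h1 : Measurable fun z : G × ℝ => ENNReal.ofReal (expWeight ι a z.1) * ‖f z.2 z.1‖ₑ :=
      (hw.comp measurable_fst).mul (((measurable_uncurry_of_continuous_of_measurable hf
        fun s => (hb s).meas).comp measurable_swap).enorm)
    calc _ ≤ ∫⁻ ξ, ENNReal.ofReal |t| *
          (∫⁻ s in uIoc 0 t, ENNReal.ofReal (expWeight ι a ξ) * ‖f s ξ‖ₑ) ∂m :=
          lintegral_mono key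
      _ = ENNReal.ofReal |t| *
          ∫⁻ ξ, (∫⁻ s in uIoc 0 t, ENNReal.ofReal (expWeight ι a ξ) * ‖f s ξ‖ₑ) ∂m :=
          lintegral_const_mul' _ _ ENNReal.ofReal_ne_top
      _ = ENNReal.ofReal |t| *
          ∫⁻ s in uIoc 0 t, ∫⁻ ξ, ENNReal.ofReal (expWeight ι a ξ) * ‖f s ξ‖ₑ ∂m := by
          rw [lintegral_lintegral_swap h1.aemeasurable]
      _ ≤ ENNReal.ofReal |t| * ∫⁻ s in uIoc 0 t, ENNReal.ofReal M := by
          gcongr with s; exact (hb s).lint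
      _ = _ := by rw [setLIntegral_const, hvol, ← hsq]
  · rw [← ENNReal.ofReal_le_ofReal_iff (by positivity), ENNReal.ofReal_mul (expWeight_pos _).le,
      ofReal_norm]
    calc _ ≤ ENNReal.ofReal |t| *
          ∫⁻ s in uIoc 0 t, ENNReal.ofReal (expWeight ι a ξ) * ‖f s ξ‖ₑ := key ξ
      _ ≤ ENNReal.ofReal |t| * ∫⁻ s in uIoc 0 t, ENNReal.ofReal M := by
          gcongr with s
          rw [← ofReal_norm, ← ENNReal.ofReal_mul (expWeight_pos _).le]
          exact ENNReal.ofReal_le_ofReal ((hb s).sup ξ)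
      _ = _ := by rw [setLIntegral_const, hvol, ← hsq]

variable [MeasurableAdd₂ G] [MeasurableNeg G] [SFinite m] [m.IsAddLeftInvariant]

/-- Change one factor at a time: f * g - f' * g' = (f - f') * g + f' * (g - g'). -/
theorem Bd.conv_sub (hι : Measurable ι) (ha : 0 ≤ a) {f f' g g' : G → ℂ} {A B ε : ℝ}
    (hf : Bd m ι a A f) (hf' : Bd m ι a A f') (hg : Bd m ι a B g) (hg' : Bd m ι a B g')
    (hff : Bd m ι a δ (f - f')) (hgg : Bd m ι a ε (g - g')) :
    Bd m ι a (δ * B + A * ε) (NLW.conv m f g - NLW.conv m f' g') := by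
  have h : NLW.conv m f g - NLW.conv m f' g' =
      NLW.conv m (f - f') g + NLW.conv m f' (g - g') := by
    ext ξ
    change (∫ η, f η * g (ξ - η) ∂m) - ∫ η, f' η * g' (ξ - η) ∂m =
      (∫ η, (f - f') η * g (ξ - η) ∂m) + ∫ η, f' η * (g - g') (ξ - η) ∂m
    rw [← integral_sub (integrable_conv_integrand ha hf hg ξ)
      (integrable_conv_integrand ha hf' hg' ξ),
      ← integral_add (integrable_conv_integrand ha hff hg ξ)
      (integrable_conv_integrand ha hf' hgg ξ)]
    refine integral_congr_ae (Eventually.of_forall fun η => ?_)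
    simp only [Pi.sub_apply]
    ring
  rw [h]
  exact (hff.conv hι ha hg).add hι (hf'.conv hι ha hgg)

theorem Bd.convProd (hι : Measurable ι) (ha : 0 ≤ a) {F : ℕ → G → ℂ}
    (hF : ∀ i, Bd m ι a M (F i)) (n : ℕ) : Bd m ι a (M ^ (n + 1)) (convProd m F n) := by
  induction n with
  | zero => simpa [NLW.convProd] using hF 0
  | succ n ih => rw [pow_succ]; exact ih.conv hι ha (hF _)

theorem Bd.convProd_sub (hι : Measurable ι) (ha : 0 ≤ a) {F H : ℕ → G → ℂ}
    (hF : ∀ i, Bd m ι a M (F i)) (hH : ∀ i, Bd m ι a M (H i)) (hFH : ∀ i, Bd m ι a δ (F i - H i))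
    (n : ℕ) : Bd m ι a ((n + 1) * M ^ n * δ) (NLW.convProd m F n - NLW.convProd m H n) := by
  induction n with
  | zero => simpa [NLW.convProd] using hFH 0
  | succ n ih =>
    have := Bd.conv_sub hι ha (Bd.convProd hι ha hF n) (Bd.convProd hι ha hH n) (hF (n + 1))
      (hH (n + 1)) ih (hFH (n + 1))
    have e : ((n + 1 : ℕ) + 1 : ℝ) * M ^ (n + 1) * δ =
        (n + 1) * M ^ n * δ * M + M ^ (n + 1) * δ := by
      push_cast
      ring
    rw [e]
    exact this

variable [m.IsNegInvariant]

theorem sharp_sub (f g : G → ℂ) : sharp f - sharp g = sharp (f - g) := by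
  ext ξ; simp [sharp]

theorem Bd.nonlinProfile (hι : Measurable ι) (ha : 0 ≤ a) {ρ σ : ℕ} (hσ : 1 ≤ σ) {f : G → ℂ}
    (hf : Bd m ι a M f) : Bd m ι a (M ^ σ) (nonlinProfile m ρ σ f) := by
  have := Bd.convProd hι ha (F := fun i => if i < ρ then f else NLW.sharp f) (M := M) (fun i => by
    split_ifs
    exacts [hf, hf.sharp]) (σ - 1)
  rwa [Nat.sub_add_cancel hσ] at this

/-- Conjugation preserves the norms, so each of the σ factors contributes δ M ^ (σ - 1). This
Lipschitz constant governs both the contraction and the error of the first iterate. -/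
theorem Bd.nonlinProfile_sub (hι : Measurable ι) (ha : 0 ≤ a) {ρ σ : ℕ} (hσ : 1 ≤ σ)
    {f g : G → ℂ} (hf : Bd m ι a M f) (hg : Bd m ι a M g) (hfg : Bd m ι a δ (f - g)) :
    Bd m ι a (σ * M ^ (σ - 1) * δ) (NLW.nonlinProfile m ρ σ f - NLW.nonlinProfile m ρ σ g) := by
  have := Bd.convProd_sub hι ha (F := fun i => if i < ρ then f else NLW.sharp f)
    (H := fun i => if i < ρ then g else NLW.sharp g) (M := M) (δ := δ) (fun i => by
      split_ifs
      exacts [hf, hf.sharp]) (fun i => by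
      split_ifs
      exacts [hg, hg.sharp]) (fun i => by
      split_ifs
      exacts [hfg, by rw [sharp_sub]; exact hfg.sharp]) (σ - 1)
  rw [← Nat.cast_add_one, Nat.sub_add_cancel hσ] at this
  exact this

/-- Dominated convergence: the first factor supplies an integrable exponential, which needs a > 0,
and the second is bounded. -/
theorem continuous_conv [IsFrequencySpace m ι] (ha : 0 < a) {f g : ℝ → G → ℂ}
    (hf : ∀ t, Bd m ι a M (f t)) (hg : ∀ t, Bd m ι a M' (g t))
    (hfc : ∀ ξ, Continuous fun t => f t ξ) (hgc : ∀ ξ, Continuous fun t => g t ξ) (ξ : G) :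
    Continuous fun t => conv m (f t) (g t) ξ := by
  have hM := (hf 0).nonneg
  have hM' := (hg 0).nonneg
  refine continuous_of_dominated (bound := fun η => M * Real.exp (-(a * ‖ι η‖)) * M')
    (fun t => (integrable_conv_integrand ha.le (hf t) (hg t) ξ).aestronglyMeasurable)
    (fun t => Eventually.of_forall fun η => ?_)
    (((IsFrequencySpace.integrable_exp a ha).const_mul M).mul_const M')
    (Eventually.of_forall fun η => (hfc η).mul (hgc (ξ - η)))
  rw [norm_mul]
  have h1 := (hf t).norm_le η
  have h2 : ‖g t (ξ - η)‖ ≤ M' := ((hg t).norm_le (ξ - η)).trans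
    (mul_le_of_le_one_right hM' (Real.exp_le_one_iff.2 (by simp; positivity)))
  gcongr

theorem continuous_nonlinProfile [IsFrequencySpace m ι] (ha : 0 < a) {f : ℝ → G → ℂ} (ρ σ : ℕ)
    (hf : ∀ t, Bd m ι a M (f t)) (hfc : ∀ ξ, Continuous fun t => f t ξ) (ξ : G) :
    Continuous fun t => nonlinProfile m ρ σ (f t) ξ := by
  have hι : Measurable ι := IsFrequencySpace.measurable m
  have hs : ∀ t i, Bd m ι a M (if i < ρ then f t else sharp (f t)) := fun t i => by
    split_ifs
    exacts [hf t, (hf t).sharp]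
  have hsc : ∀ i ξ, Continuous fun t => (if i < ρ then f t else sharp (f t)) ξ := fun i ξ => by
    split_ifs
    exacts [hfc ξ, Complex.continuous_conj.comp (hfc (-ξ))]
  unfold nonlinProfile
  generalize σ - 1 = n
  induction n generalizing ξ with
  | zero => exact hsc 0 ξ
  | succ n ih =>
    exact continuous_conv ha (fun t => Bd.convProd hι ha.le (hs t) n) (fun t => hs t (n + 1))
      ih (hsc (n + 1)) ξ

end

end

section

/-! ### Existence by Picard iteration -/

variable {d : ℕ} {G : Type} [AddCommGroup G] [MeasurableSpace G]

/-- The projection of the time axis to `[-τ, τ]`. -/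
def clampTime (τ t : ℝ) : ℝ := max (-τ) (min τ t)

theorem continuous_clampTime (τ : ℝ) : Continuous (clampTime τ) := by
  unfold clampTime; fun_prop

theorem clampTime_mem {τ : ℝ} (hτ : 0 ≤ τ) (t : ℝ) : clampTime τ t ∈ Icc (-τ) τ :=
  ⟨le_max_left _ _, max_le (by linarith) (min_le_left _ _)⟩

theorem clampTime_of_mem {τ t : ℝ} (ht : t ∈ Icc (-τ) τ) : clampTime τ t = t := by
  rw [clampTime, min_eq_right ht.2, max_eq_right ht.1]

/-- The Picard iterates for Duhamel's equation with free part `L`. -/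
def picard (m : Measure G) (ι : G →+ Space d) (μ : ℂ) (ρ σ : ℕ) (τ : ℝ) (L : ℝ → G → ℂ) :
    ℕ → ℝ → G → ℂ
  | 0 => fun t => L (clampTime τ t)
  | k + 1 => fun t => L (clampTime τ t) +
      μ • duhamel ι (fun s => nonlinProfile m ρ σ (picard m ι μ ρ σ τ L k s)) (clampTime τ t)

variable {m : Measure G} {ι : G →+ Space d} {a M : ℝ}
  [MeasurableAdd₂ G] [MeasurableNeg G] [SFinite m] [m.IsAddLeftInvariant] [m.IsNegInvariant]
  [IsFrequencySpace m ι]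

theorem Bd.const_smul {f : G → ℂ} (hι : Measurable ι) (h : Bd m ι a M f) {μ : ℂ} (hμ : ‖μ‖ ≤ 1) :
    Bd m ι a M (μ • f) := by
  have := h.of_le hι zero_le_one (g := μ • f) (fun ξ => by
    simpa using mul_le_of_le_one_left (norm_nonneg (f ξ)) hμ) (h.meas.const_smul μ)
  simpa using this

section

variable {μ : ℂ} {ρ σ : ℕ} {τ : ℝ} {L : ℝ → G → ℂ}

/-- The iterates stay in the ball of radius 2M: the free part uses M, and by smallness of τ the
Duhamel term uses at most M / 2. Clamping the time makes this true for all real t, so that estimates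
for curves on the whole time axis apply. -/
theorem picard_bd_continuous (ha : 0 < a) (hμ : ‖μ‖ ≤ 1) (hσ : 2 ≤ σ) (hτ : 0 ≤ τ)
    (hL : ∀ t ∈ Icc (-τ) τ, Bd m ι a M (L t)) (hLc : ∀ ξ, Continuous fun t => L t ξ)
    (hsmall : σ * τ ^ 2 * (2 * M) ^ (σ - 1) ≤ 1 / 2) (k : ℕ) :
    (∀ t, Bd m ι a (2 * M) (picard m ι μ ρ σ τ L k t)) ∧
      ∀ ξ, Continuous fun t => picard m ι μ ρ σ τ L k t ξ := by
  have hι : Measurable ι := IsFrequencySpace.measurable m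
  have hM : 0 ≤ M := (hL 0 ⟨by linarith, hτ⟩).nonneg
  have hσ' : (2 : ℝ) ≤ σ := by exact_mod_cast hσ
  induction k with
  | zero =>
    exact ⟨fun t => (hL _ (clampTime_mem hτ t)).mono (by linarith),
      fun ξ => (hLc ξ).comp (continuous_clampTime τ)⟩
  | succ k ih =>
    have hN : ∀ s, Bd m ι a ((2 * M) ^ σ) (nonlinProfile m ρ σ (picard m ι μ ρ σ τ L k s)) :=
      fun s => (ih.1 s).nonlinProfile hι ha.le (by omega)
    have hNc := continuous_nonlinProfile ha ρ σ ih.1 ih.2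
    refine ⟨fun t => ?_, fun ξ => ?_⟩
    · have h1 := (Bd.duhamel hι hNc hN (clampTime τ t)).const_smul hι hμ
      refine ((hL _ (clampTime_mem hτ t)).add hι h1).mono ?_
      have hc : clampTime τ t ^ 2 ≤ τ ^ 2 :=
        sq_le_sq' (clampTime_mem hτ t).1 (clampTime_mem hτ t).2
      have e : (2 * M) ^ σ = (2 * M) ^ (σ - 1) * (2 * M) := by
        rw [← pow_succ, Nat.sub_add_cancel (by omega)]
      have hp : 0 ≤ (2 * M) ^ (σ - 1) := by positivity
      have h2 : 2 * (τ ^ 2 * (2 * M) ^ (σ - 1)) ≤ 1 / 2 := by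
        refine le_trans ?_ hsmall
        rw [mul_assoc]
        gcongr
      have h3 : clampTime τ t ^ 2 * (2 * M) ^ σ ≤ τ ^ 2 * (2 * M) ^ (σ - 1) * (2 * M) := by
        rw [e, ← mul_assoc]; gcongr
      nlinarith
    · exact ((hLc ξ).comp (continuous_clampTime τ)).add (((continuous_duhamel hNc ξ).comp
        (continuous_clampTime τ)).const_smul μ)

/-- Contraction with factor 1/2: the Lipschitz constant of the nonlinearity in the ball of radius
2M, times the factor t² of Duhamel's integral. -/
theorem picard_step (ha : 0 < a) (hμ : ‖μ‖ ≤ 1) (hσ : 2 ≤ σ) (hM : 0 ≤ M)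
    (hsmall : σ * τ ^ 2 * (2 * M) ^ (σ - 1) ≤ 1 / 2) {f g : ℝ → G → ℂ} {δ : ℝ}
    (hf : ∀ t, Bd m ι a (2 * M) (f t)) (hg : ∀ t, Bd m ι a (2 * M) (g t))
    (hfc : ∀ ξ, Continuous fun t => f t ξ) (hgc : ∀ ξ, Continuous fun t => g t ξ)
    (hfg : ∀ t, Bd m ι a δ (f t - g t)) (t : ℝ) (ht : t ∈ Icc (-τ) τ) :
    Bd m ι a (δ / 2) ((L t + μ • duhamel ι (fun s => nonlinProfile m ρ σ (f s)) t) -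
      (L t + μ • duhamel ι (fun s => nonlinProfile m ρ σ (g s)) t)) := by
  have hι : Measurable ι := IsFrequencySpace.measurable m
  have hδ : 0 ≤ δ := (hfg 0).nonneg
  have hNf := continuous_nonlinProfile ha ρ σ hf hfc
  have hNg := continuous_nonlinProfile ha ρ σ hg hgc
  rw [add_sub_add_left_eq_sub, ← smul_sub, ← duhamel_sub hNf hNg]
  have h1 := Bd.duhamel (M := σ * (2 * M) ^ (σ - 1) * δ) hι
    (f := fun s => nonlinProfile m ρ σ (f s) - nonlinProfile m ρ σ (g s))
    (fun ξ => (hNf ξ).sub (hNg ξ))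
    (fun s => Bd.nonlinProfile_sub hι ha.le (by omega) (hf s) (hg s) (hfg s)) t
  refine (h1.const_smul hι hμ).mono ?_
  have hc : t ^ 2 ≤ τ ^ 2 := sq_le_sq' ht.1 ht.2
  have hp : 0 ≤ (2 * M) ^ (σ - 1) := by positivity
  calc t ^ 2 * (σ * (2 * M) ^ (σ - 1) * δ) ≤ τ ^ 2 * (σ * (2 * M) ^ (σ - 1) * δ) := by gcongr
    _ = (σ * τ ^ 2 * (2 * M) ^ (σ - 1)) * δ := by ring
    _ ≤ 1 / 2 * δ := by gcongr
    _ = δ / 2 := by ring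

/-- Duhamel's equation is solvable on `[-τ, τ]` if `τ ^ 2 M ^ (σ - 1)` is small, where `M` bounds
the free part. -/
theorem exists_duhamel_solution (ha : 0 < a) (hμ : ‖μ‖ ≤ 1) (hσ : 2 ≤ σ) (hτ : 0 ≤ τ)
    (hL : ∀ t ∈ Icc (-τ) τ, Bd m ι a M (L t)) (hLc : ∀ ξ, Continuous fun t => L t ξ)
    (hsmall : σ * τ ^ 2 * (2 * M) ^ (σ - 1) ≤ 1 / 2) :
    ∃ u : ℝ → G → ℂ, (∀ t, Bd m ι a (2 * M) (u t)) ∧ (∀ ξ, Continuous fun t => u t ξ) ∧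
      ∀ t ∈ Icc (-τ) τ, u t = L t + μ • duhamel ι (fun s => nonlinProfile m ρ σ (u s)) t := by
  have hι : Measurable ι := IsFrequencySpace.measurable m
  have hM : 0 ≤ M := (hL 0 ⟨by linarith, hτ⟩).nonneg
  set U := picard m ι μ ρ σ τ L with hU
  have hUb := fun k => (picard_bd_continuous (ρ := ρ) ha hμ hσ hτ hL hLc hsmall k).1
  have hUc := fun k => (picard_bd_continuous (ρ := ρ) ha hμ hσ hτ hL hLc hsmall k).2
  rw [← hU] at hUb hUc
  have hstep : ∀ k t, U (k + 1) t = L (clampTime τ t) +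
      μ • duhamel ι (fun s => nonlinProfile m ρ σ (U k s)) (clampTime τ t) := fun k t => rfl
  have hdiff : ∀ k t, Bd m ι a (4 * M / 2 ^ k) (U (k + 1) t - U k t) := by
    intro k
    induction k with
    | zero =>
      intro t
      exact ((hUb 1 t).sub hι (hUb 0 t)).mono (by norm_num; linarith)
    | succ k ih =>
      intro t
      have := picard_step (L := L) (ρ := ρ) ha hμ hσ hM hsmall (hUb (k + 1)) (hUb k)
        (hUc (k + 1)) (hUc k) ih (clampTime τ t) (clampTime_mem hτ t)
      rw [hstep (k + 1) t, hstep k t]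
      refine this.mono (le_of_eq ?_)
      rw [pow_succ]
      field_simp
  have hdiff' : ∀ t ξ k, dist (U k t ξ) (U (k + 1) t ξ) ≤ (8 * M) / 2 / 2 ^ k := by
    intro t ξ k
    rw [dist_comm, dist_eq_norm]
    refine ((hdiff k t).norm_le ξ).trans ?_
    have h1 : Real.exp (-(a * ‖ι ξ‖)) ≤ 1 := Real.exp_le_one_iff.2 (by simp; positivity)
    have h2 : 0 ≤ 4 * M / 2 ^ k := by positivity
    have h3 : 8 * M / 2 / 2 ^ k = 4 * M / 2 ^ k := by ring
    rw [h3]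
    nlinarith
  choose u hu using fun t ξ => cauchySeq_tendsto_of_complete
    (cauchySeq_of_le_geometric_two (hdiff' t ξ))
  have hub : ∀ t, Bd m ι a (2 * M) (u t) := fun t =>
    Bd.of_tendsto hι (Eventually.of_forall fun k => hUb k t) (hu t)
  have hdist : ∀ t ξ k, dist (U k t ξ) (u t ξ) ≤ 8 * M / 2 ^ k := fun t ξ k =>
    dist_le_of_le_geometric_two_of_tendsto (hdiff' t ξ) (hu t ξ) k
  have hpow : Tendsto (fun k : ℕ => 8 * M / 2 ^ k) atTop (𝓝 0) :=
    tendsto_const_nhds.div_atTop (tendsto_pow_atTop_atTop_of_one_lt one_lt_two)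
  have huc : ∀ ξ, Continuous fun t => u t ξ := by
    intro ξ
    have : TendstoUniformly (fun k t => U k t ξ) (fun t => u t ξ) atTop := by
      rw [Metric.tendstoUniformly_iff]
      intro ε hε
      filter_upwards [hpow.eventually_lt_const hε] with k hk t
      rw [dist_comm]
      exact (hdist t ξ k).trans_lt hk
    exact this.continuous (Frequently.of_forall fun k => hUc k ξ)
  have hsum : ∀ k t j, Bd m ι a (8 * M / 2 ^ k) (U (k + j) t - U k t) := by
    intro k t j
    -- The subtracted term lets the induction on j close: it leaves exactly the room 4M / 2 ^ (k +
    -- j) for the next difference.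
    have : Bd m ι a (8 * M / 2 ^ k - 8 * M / 2 ^ (k + j)) (U (k + j) t - U k t) := by
      induction j with
      | zero => simpa using Bd.zero
      | succ j ih =>
        have h1 := (hdiff (k + j) t).add hι ih
        have h2 : U (k + j + 1) t - U (k + j) t + (U (k + j) t - U k t)
            = U (k + (j + 1)) t - U k t := by rw [← add_assoc]; abel
        rw [h2] at h1
        refine h1.mono (le_of_eq ?_)
        rw [← add_assoc, pow_succ]
        field_simp
        ring
    exact this.mono (by linarith [show 0 ≤ 8 * M / 2 ^ (k + j) by positivity])
  have hlim : ∀ k t, Bd m ι a (8 * M / 2 ^ k) (u t - U k t) := by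
    intro k t
    refine Bd.of_tendsto hι (F := fun j => U (k + j) t - U k t)
      (Eventually.of_forall fun j => hsum k t j) fun ξ => ?_
    refine Tendsto.sub ?_ tendsto_const_nhds
    have := (tendsto_add_atTop_iff_nat k).2 (hu t ξ)
    simpa only [add_comm] using this
  refine ⟨u, hub, huc, fun t ht => ?_⟩
  ext ξ
  have h1 : Tendsto (fun k => U (k + 1) t ξ) atTop (𝓝 (u t ξ)) :=
    (tendsto_add_atTop_iff_nat 1).2 (hu t ξ)
  -- The iterates also converge to the right-hand side of Duhamel's equation, by the contraction
  -- estimate applied to the limit u and the kth iterate.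
  refine tendsto_nhds_unique h1 ?_
  rw [tendsto_iff_dist_tendsto_zero]
  refine squeeze_zero (fun _ => dist_nonneg) (fun k => ?_) hpow
  have h2 := picard_step (L := L) (ρ := ρ) ha hμ hσ hM hsmall hub (hUb k) huc (hUc k)
    (hlim k) t ht
  have h3 := h2.norm_le ξ
  rw [dist_comm, dist_eq_norm, hstep k t, clampTime_of_mem ht]
  refine h3.trans ?_
  have h4 : Real.exp (-(a * ‖ι ξ‖)) ≤ 1 := Real.exp_le_one_iff.2 (by simp; positivity)
  have h5 : 0 ≤ 8 * M / 2 ^ k := by positivity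
  nlinarith

end

end

section

/-! ### Time regularity of profiles -/

variable {d : ℕ} {G : Type} [AddCommGroup G] [MeasurableSpace G]

/-- The profiles `f t`, `t ∈ I`, decay exponentially, uniformly in `t`, and are continuous
in time. -/
structure DecaysOn (ι : G →+ Space d) (I : Set ℝ) (f : ℝ → G → ℂ) : Prop where
  meas : ∀ t ∈ I, Measurable (f t)
  bound : ∃ a > 0, ∃ C ≥ 0, ∀ t ∈ I, ∀ ξ, ‖f t ξ‖ ≤ C * Real.exp (-(a * ‖ι ξ‖))
  cont : ∀ ξ, ContinuousOn (fun t => f t ξ) I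

/-- Profiles with `k` time derivatives that decay exponentially. -/
def SmoothProfile (ι : G →+ Space d) (I : Set ℝ) : ℕ → (ℝ → G → ℂ) → Prop
  | 0, f => DecaysOn ι I f
  | k + 1, f => DecaysOn ι I f ∧ ∃ g, SmoothProfile ι I k g ∧
      ∀ t ∈ I, ∀ ξ, HasDerivAt (fun s => f s ξ) (g t ξ) t

/-- Multipliers growing slower than any exponential. -/
structure SubExp (ι : G →+ Space d) (p : G → ℂ) : Prop where
  meas : Measurable p
  bound : ∀ b > 0, ∃ C ≥ 0, ∀ ξ, ‖p ξ‖ ≤ C * Real.exp (b * ‖ι ξ‖)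

section

variable {ι : G →+ Space d} {I : Set ℝ} {f g : ℝ → G → ℂ} {p q : G → ℂ} {k : ℕ}

theorem SubExp.mul (hp : SubExp ι p) (hq : SubExp ι q) : SubExp ι (fun ξ => p ξ * q ξ) := by
  refine ⟨hp.meas.mul hq.meas, fun b hb => ?_⟩
  obtain ⟨C, hC, h⟩ := hp.bound (b / 2) (by linarith)
  obtain ⟨C', hC', h'⟩ := hq.bound (b / 2) (by linarith)
  refine ⟨C * C', mul_nonneg hC hC', fun ξ => ?_⟩
  rw [norm_mul]
  calc ‖p ξ‖ * ‖q ξ‖ ≤ (C * Real.exp (b / 2 * ‖ι ξ‖)) * (C' * Real.exp (b / 2 * ‖ι ξ‖)) :=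
        mul_le_mul (h ξ) (h' ξ) (norm_nonneg _) (by positivity)
    _ = C * C' * (Real.exp (b / 2 * ‖ι ξ‖) * Real.exp (b / 2 * ‖ι ξ‖)) := by ring
    _ = _ := by rw [← Real.exp_add]; congr 2; ring

theorem SubExp.of_le_norm (hp : Measurable p) {c : ℝ} (hc : 0 ≤ c)
    (h : ∀ ξ, ‖p ξ‖ ≤ c * ‖ι ξ‖) : SubExp ι p := by
  refine ⟨hp, fun b hb => ⟨c / b, by positivity, fun ξ => (h ξ).trans ?_⟩⟩
  have h1 : b * ‖ι ξ‖ ≤ Real.exp (b * ‖ι ξ‖) := by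
    linarith [Real.add_one_le_exp (b * ‖ι ξ‖)]
  rw [div_mul_eq_mul_div, le_div_iff₀ hb]
  nlinarith

theorem SubExp.const (c : ℂ) : SubExp ι (fun _ => c) :=
  ⟨measurable_const, fun b hb => ⟨‖c‖, norm_nonneg _, fun ξ =>
    le_mul_of_one_le_right (norm_nonneg _) (Real.one_le_exp (by positivity))⟩⟩

theorem SmoothProfile.decaysOn (h : SmoothProfile ι I k f) : DecaysOn ι I f := by
  cases k with
  | zero => exact h
  | succ k => exact h.1

theorem SmoothProfile.pred (h : SmoothProfile ι I (k + 1) f) : SmoothProfile ι I k f := by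
  induction k generalizing f with
  | zero => exact h.1
  | succ k ih =>
    obtain ⟨h0, g, hg, hd⟩ := h
    exact ⟨h0, g, ih hg, hd⟩

theorem DecaysOn.add (hf : DecaysOn ι I f) (hg : DecaysOn ι I g) :
    DecaysOn ι I (fun t => f t + g t) := by
  refine ⟨fun t ht => (hf.meas t ht).add (hg.meas t ht), ?_, fun ξ => (hf.cont ξ).add (hg.cont ξ)⟩
  obtain ⟨a, ha, C, hC, h⟩ := hf.bound
  obtain ⟨a', ha', C', hC', h'⟩ := hg.bound
  refine ⟨min a a', lt_min ha ha', C + C', add_nonneg hC hC', fun t ht ξ => ?_⟩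
  calc ‖f t ξ + g t ξ‖ ≤ ‖f t ξ‖ + ‖g t ξ‖ := norm_add_le _ _
    _ ≤ C * Real.exp (-(a * ‖ι ξ‖)) + C' * Real.exp (-(a' * ‖ι ξ‖)) :=
        add_le_add (h t ht ξ) (h' t ht ξ)
    _ ≤ C * Real.exp (-(min a a' * ‖ι ξ‖)) + C' * Real.exp (-(min a a' * ‖ι ξ‖)) := by
        gcongr
        exacts [min_le_left _ _, min_le_right _ _]
    _ = _ := by ring

/-- Half of the decay rate pays for the multiplier. In particular, symbols of differential operators
keep profiles in the class. -/
theorem DecaysOn.mul (hf : DecaysOn ι I f) (hp : SubExp ι p) :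
    DecaysOn ι I (fun t ξ => p ξ * f t ξ) := by
  refine ⟨fun t ht => hp.meas.mul (hf.meas t ht), ?_, fun ξ => (hf.cont ξ).const_smul (p ξ)⟩
  obtain ⟨a, ha, C, hC, h⟩ := hf.bound
  obtain ⟨C', hC', h'⟩ := hp.bound (a / 2) (by linarith)
  refine ⟨a / 2, by linarith, C' * C, mul_nonneg hC' hC, fun t ht ξ => ?_⟩
  rw [norm_mul]
  calc ‖p ξ‖ * ‖f t ξ‖ ≤ (C' * Real.exp (a / 2 * ‖ι ξ‖)) * (C * Real.exp (-(a * ‖ι ξ‖))) :=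
        mul_le_mul (h' ξ) (h t ht ξ) (norm_nonneg _) (by positivity)
    _ = C' * C * (Real.exp (a / 2 * ‖ι ξ‖) * Real.exp (-(a * ‖ι ξ‖))) := by ring
    _ = _ := by rw [← Real.exp_add]; congr 2; ring

theorem SmoothProfile.add (hf : SmoothProfile ι I k f) (hg : SmoothProfile ι I k g) :
    SmoothProfile ι I k (fun t => f t + g t) := by
  induction k generalizing f g with
  | zero => exact DecaysOn.add hf hg
  | succ k ih =>
    obtain ⟨hf0, f', hf', hfd⟩ := hf
    obtain ⟨hg0, g', hg', hgd⟩ := hg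
    exact ⟨hf0.add hg0, _, ih hf' hg', fun t ht ξ => (hfd t ht ξ).add (hgd t ht ξ)⟩

theorem SmoothProfile.mul (hf : SmoothProfile ι I k f) (hp : SubExp ι p) :
    SmoothProfile ι I k (fun t ξ => p ξ * f t ξ) := by
  induction k generalizing f with
  | zero => exact DecaysOn.mul hf hp
  | succ k ih =>
    obtain ⟨hf0, f', hf', hfd⟩ := hf
    exact ⟨hf0.mul hp, _, ih hf', fun t ht ξ => (hfd t ht ξ).const_mul (p ξ)⟩

theorem SmoothProfile.sharp [MeasurableNeg G] (hf : SmoothProfile ι I k f) :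
    SmoothProfile ι I k (fun t => sharp (f t)) := by
  have h0 : ∀ {f : ℝ → G → ℂ}, DecaysOn ι I f → DecaysOn ι I (fun t => NLW.sharp (f t)) := by
    intro f hf
    refine ⟨fun t ht => Complex.continuous_conj.measurable.comp ((hf.meas t ht).comp
      measurable_neg), ?_, fun ξ => Complex.continuous_conj.comp_continuousOn (hf.cont (-ξ))⟩
    obtain ⟨a, ha, C, hC, h⟩ := hf.bound
    refine ⟨a, ha, C, hC, fun t ht ξ => ?_⟩
    simpa [NLW.sharp] using h t ht (-ξ)
  induction k generalizing f with
  | zero => exact h0 hf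
  | succ k ih =>
    obtain ⟨hf0, f', hf', hfd⟩ := hf
    refine ⟨h0 hf0, _, ih hf', fun t ht ξ => ?_⟩
    exact (hfd t ht (-ξ)).star

variable {m : Measure G} [MeasurableAdd₂ G] [MeasurableNeg G] [SFinite m] [m.IsAddLeftInvariant]
  [IsFrequencySpace m ι]

/-- With c = min a b and |ξ| ≤ |η| + |ξ - η|, one half of c gives decay in ξ and the other half
integrability in η. -/
theorem exp_mul_exp_sub_le {a b : ℝ} (ha : 0 < a) (hb : 0 < b) (ξ η : G) :
    Real.exp (-(a * ‖ι η‖)) * Real.exp (-(b * ‖ι (ξ - η)‖)) ≤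
      Real.exp (-(min a b / 2 * ‖ι ξ‖)) * Real.exp (-(min a b / 2 * ‖ι η‖)) := by
  rw [← Real.exp_add, ← Real.exp_add]
  apply Real.exp_le_exp.2
  have h1 : ‖ι ξ‖ ≤ ‖ι η‖ + ‖ι (ξ - η)‖ := by
    calc ‖ι ξ‖ = ‖ι η + ι (ξ - η)‖ := by rw [← map_add]; simp
      _ ≤ _ := norm_add_le _ _
  have h2 := mul_le_mul_of_nonneg_right (min_le_left a b) (norm_nonneg (ι η))
  have h3 := mul_le_mul_of_nonneg_right (min_le_right a b) (norm_nonneg (ι (ξ - η)))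
  have h4 : 0 < min a b := lt_min ha hb
  nlinarith [norm_nonneg (ι η), norm_nonneg (ι (ξ - η))]

/-- A common integrable bound for the integrands of a convolution. -/
theorem DecaysOn.exists_conv_bound (hf : DecaysOn ι I f) (hg : DecaysOn ι I g) :
    ∃ c > 0, ∃ C ≥ 0, ∀ t ∈ I, ∀ ξ η, ‖f t η * g t (ξ - η)‖ ≤
      C * Real.exp (-(c * ‖ι ξ‖)) * Real.exp (-(c * ‖ι η‖)) := by
  obtain ⟨a, ha, C, hC, h⟩ := hf.bound
  obtain ⟨b, hb, C', hC', h'⟩ := hg.bound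
  refine ⟨min a b / 2, by positivity, C * C', mul_nonneg hC hC', fun t ht ξ η => ?_⟩
  rw [norm_mul]
  calc ‖f t η‖ * ‖g t (ξ - η)‖ ≤
        (C * Real.exp (-(a * ‖ι η‖))) * (C' * Real.exp (-(b * ‖ι (ξ - η)‖))) :=
        mul_le_mul (h t ht η) (h' t ht _) (norm_nonneg _) (by positivity)
    _ = C * C' * (Real.exp (-(a * ‖ι η‖)) * Real.exp (-(b * ‖ι (ξ - η)‖))) := by ring
    _ ≤ C * C' * (Real.exp (-(min a b / 2 * ‖ι ξ‖)) * Real.exp (-(min a b / 2 * ‖ι η‖))) := by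
        exact mul_le_mul_of_nonneg_left (exp_mul_exp_sub_le ha hb ξ η) (mul_nonneg hC hC')
    _ = _ := by ring

theorem DecaysOn.aestronglyMeasurable_integrand (hf : DecaysOn ι I f) (hg : DecaysOn ι I g)
    {t : ℝ} (ht : t ∈ I) (ξ : G) : AEStronglyMeasurable (fun η => f t η * g t (ξ - η)) m :=
  ((hf.meas t ht).mul ((hg.meas t ht).comp (measurable_const.sub measurable_id))
    ).aestronglyMeasurable

theorem DecaysOn.integrable_integrand (hf : DecaysOn ι I f) (hg : DecaysOn ι I g)
    {t : ℝ} (ht : t ∈ I) (ξ : G) : Integrable (fun η => f t η * g t (ξ - η)) m := by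
  obtain ⟨c, hc, C, hC, h⟩ := hf.exists_conv_bound hg
  exact Integrable.mono' ((IsFrequencySpace.integrable_exp c hc).const_mul _)
    (hf.aestronglyMeasurable_integrand hg ht ξ) (Eventually.of_forall fun η => h t ht ξ η)

theorem DecaysOn.conv (hf : DecaysOn ι I f) (hg : DecaysOn ι I g) :
    DecaysOn ι I (fun t => conv m (f t) (g t)) := by
  obtain ⟨c, hc, C, hC, h⟩ := hf.exists_conv_bound hg
  have hintg := IsFrequencySpace.integrable_exp (m := m) (ι := ι) c hc
  refine ⟨fun t ht => measurable_conv (hf.meas t ht) (hg.meas t ht), ?_, fun ξ => ?_⟩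
  · refine ⟨c, hc, C * ∫ η, Real.exp (-(c * ‖ι η‖)) ∂m,
      mul_nonneg hC (integral_nonneg fun _ => (Real.exp_pos _).le), fun t ht ξ => ?_⟩
    calc ‖NLW.conv m (f t) (g t) ξ‖ ≤
          ∫ η, C * Real.exp (-(c * ‖ι ξ‖)) * Real.exp (-(c * ‖ι η‖)) ∂m :=
          norm_integral_le_of_norm_le (hintg.const_mul _) (Eventually.of_forall fun η => h t ht ξ η)
      _ = _ := by rw [integral_const_mul]; ring
  · refine continuousOn_of_dominated
      (bound := fun η => C * Real.exp (-(c * ‖ι ξ‖)) * Real.exp (-(c * ‖ι η‖)))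
      (fun t ht => hf.aestronglyMeasurable_integrand hg ht ξ)
      (fun t ht => Eventually.of_forall fun η => h t ht ξ η) (hintg.const_mul _)
      (Eventually.of_forall fun η => (hf.cont η).mul (hg.cont (ξ - η)))

/-- Leibniz' rule under the integral sign, by induction on the number of derivatives. The decay is
uniform in time on the open set I, which provides the dominating function. -/
theorem SmoothProfile.conv (hI : IsOpen I) (hf : SmoothProfile ι I k f)
    (hg : SmoothProfile ι I k g) : SmoothProfile ι I k (fun t => conv m (f t) (g t)) := by
  induction k generalizing f g with
  | zero => exact DecaysOn.conv hf hg
  | succ k ih =>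
    have hf1 := hf.pred
    have hg1 := hg.pred
    obtain ⟨hf0, f', hf', hfd⟩ := hf
    obtain ⟨hg0, g', hg', hgd⟩ := hg
    refine ⟨hf0.conv hg0, _, (ih hf' hg1).add (ih hf1 hg'), fun t ht ξ => ?_⟩
    obtain ⟨c₁, hc₁, C₁, hC₁, h₁⟩ := hf'.decaysOn.exists_conv_bound hg0
    obtain ⟨c₂, hc₂, C₂, hC₂, h₂⟩ := hf0.exists_conv_bound hg'.decaysOn
    have key := hasDerivAt_integral_of_dominated_loc_of_deriv_le (μ := m)
      (F := fun t η => f t η * g t (ξ - η))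
      (F' := fun t η => f' t η * g t (ξ - η) + f t η * g' t (ξ - η)) (x₀ := t)
      (bound := fun η => C₁ * Real.exp (-(c₁ * ‖ι ξ‖)) * Real.exp (-(c₁ * ‖ι η‖)) +
        C₂ * Real.exp (-(c₂ * ‖ι ξ‖)) * Real.exp (-(c₂ * ‖ι η‖)))
      (hI.mem_nhds ht)
      (eventually_of_mem (hI.mem_nhds ht) fun s hs => hf0.aestronglyMeasurable_integrand hg0 hs ξ)
      (hf0.integrable_integrand hg0 ht ξ)
      ((hf'.decaysOn.aestronglyMeasurable_integrand hg0 ht ξ).add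
        (hf0.aestronglyMeasurable_integrand hg'.decaysOn ht ξ))
      (Eventually.of_forall fun η s hs =>
        (norm_add_le _ _).trans (add_le_add (h₁ s hs ξ η) (h₂ s hs ξ η)))
      (((IsFrequencySpace.integrable_exp c₁ hc₁).const_mul _).add
        ((IsFrequencySpace.integrable_exp c₂ hc₂).const_mul _))
      (Eventually.of_forall fun η s hs => (hfd s hs η).mul (hgd s hs (ξ - η)))
    refine key.2.congr_deriv ?_
    exact integral_add (hf'.decaysOn.integrable_integrand hg0 ht ξ)
      (hf0.integrable_integrand hg'.decaysOn ht ξ)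

theorem SmoothProfile.nonlinProfile (hI : IsOpen I) (ρ σ : ℕ) (hf : SmoothProfile ι I k f) :
    SmoothProfile ι I k (fun t => nonlinProfile m ρ σ (f t)) := by
  have hs : ∀ i, SmoothProfile ι I k (fun t => if i < ρ then f t else NLW.sharp (f t)) := by
    intro i
    split_ifs
    exacts [hf, hf.sharp]
  unfold NLW.nonlinProfile
  generalize σ - 1 = n
  induction n with
  | zero => exact hs 0
  | succ n ih => exact SmoothProfile.conv hI ih (hs (n + 1))

end

end

section

/-! ### Synthesis of functions from profiles -/

variable {d : ℕ} {G : Type} [AddCommGroup G] [MeasurableSpace G]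

/-- The character `exp (2 π i ⟨ξ, x⟩)`. -/
def planeWave (ι : G →+ Space d) (ξ : G) (x : Space d) : ℂ :=
  Complex.exp (2 * Real.pi * Complex.I * ((∑ i, ι ξ i * x i : ℝ) : ℂ))

/-- The function with profile `h`. -/
def synth (m : Measure G) (ι : G →+ Space d) (h : G → ℂ) (x : Space d) : ℂ :=
  ∫ ξ, h ξ * planeWave ι ξ x ∂m

/-- The symbol `2 π i ξⱼ` of `∂ⱼ`. -/
def derivSymbol (ι : G →+ Space d) (j : Fin d) (ξ : G) : ℂ :=
  2 * Real.pi * Complex.I * ((ι ξ j : ℝ) : ℂ)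

/-- The differential of time, with complex values. -/
def timeForm (d : ℕ) : ℝ × Space d →L[ℝ] ℂ :=
  Complex.ofRealCLM ∘L ContinuousLinearMap.fst ℝ ℝ (Space d)

/-- The differential of the `j`th space coordinate, with complex values. -/
def coordForm {d : ℕ} (j : Fin d) : Space d →L[ℝ] ℂ :=
  Complex.ofRealCLM ∘L EuclideanSpace.proj j

section

variable {m : Measure G} {ι : G →+ Space d} {I : Set ℝ} {f : ℝ → G → ℂ} {k : ℕ}

theorem norm_planeWave (ξ : G) (x : Space d) : ‖planeWave ι ξ x‖ = 1 := by
  unfold planeWave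
  rw [Complex.norm_exp]
  simp

theorem planeWave_add (ξ η : G) (x : Space d) :
    planeWave ι (ξ + η) x = planeWave ι ξ x * planeWave ι η x := by
  simp only [planeWave, ← Complex.exp_add, map_add, PiLp.add_apply, add_mul,
    Finset.sum_add_distrib]
  push_cast
  ring_nf

theorem planeWave_neg (ξ : G) (x : Space d) :
    planeWave ι (-ξ) x = starRingEnd ℂ (planeWave ι ξ x) := by
  simp only [planeWave, ← Complex.exp_conj, map_neg, PiLp.neg_apply, neg_mul,
    Finset.sum_neg_distrib]
  simp [map_ofNat]

theorem continuous_planeWave (ξ : G) : Continuous (planeWave ι ξ) := by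
  unfold planeWave
  fun_prop

theorem measurable_planeWave (hι : Measurable ι) (x : Space d) :
    Measurable fun ξ => planeWave ι ξ x := by
  unfold planeWave
  have h : ∀ i, Measurable fun ξ => ι ξ i := fun i =>
    (EuclideanSpace.proj (𝕜 := ℝ) i).measurable.comp hι
  fun_prop

theorem hasFDerivAt_planeWave (ξ : G) (x : Space d) :
    HasFDerivAt (planeWave ι ξ) (∑ j, (derivSymbol ι j ξ * planeWave ι ξ x) • coordForm j) x := by
  have h1 : HasFDerivAt (fun x : Space d => ((∑ i, ι ξ i * x i : ℝ) : ℂ))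
      (∑ j, ((ι ξ j : ℝ) : ℂ) • (coordForm j : Space d →L[ℝ] ℂ)) x := by
    have : (fun x : Space d => ((∑ i, ι ξ i * x i : ℝ) : ℂ)) =
        (∑ j, ((ι ξ j : ℝ) : ℂ) • (coordForm j : Space d →L[ℝ] ℂ)) := by
      ext x
      simp [coordForm]
    rw [this]
    exact ContinuousLinearMap.hasFDerivAt _
  have h2 := (h1.const_mul (2 * Real.pi * Complex.I)).cexp
  refine h2.congr_fderiv ?_
  rw [Finset.smul_sum, Finset.smul_sum]
  refine Finset.sum_congr rfl fun j _ => ?_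
  rw [smul_smul, smul_smul, derivSymbol]
  congr 1
  simp only [planeWave]
  ring

theorem subExp_derivSymbol (hι : Measurable ι) (j : Fin d) : SubExp ι (derivSymbol ι j) := by
  refine SubExp.of_le_norm (c := 2 * Real.pi) ?_ (by positivity) fun ξ => ?_
  · unfold derivSymbol
    have h : Measurable fun ξ => ι ξ j :=
      (EuclideanSpace.proj (𝕜 := ℝ) j).measurable.comp hι
    fun_prop
  · have := PiLp.norm_apply_le (ι ξ) j
    simp only [derivSymbol, norm_mul, Complex.norm_I, Complex.norm_real, mul_one, Complex.norm_two,
      Real.norm_of_nonneg Real.pi_pos.le]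
    gcongr

theorem DecaysOn.integrable [IsFrequencySpace m ι] (hf : DecaysOn ι I f) {t : ℝ} (ht : t ∈ I) :
    Integrable (f t) m := by
  obtain ⟨a, ha, C, hC, h⟩ := hf.bound
  exact Integrable.mono' ((IsFrequencySpace.integrable_exp a ha).const_mul C)
    (hf.meas t ht).aestronglyMeasurable (Eventually.of_forall fun ξ => h t ht ξ)

theorem integrable_mul_planeWave (hι : Measurable ι) {h : G → ℂ} (hh : Integrable h m)
    (x : Space d) : Integrable (fun ξ => h ξ * planeWave ι ξ x) m :=
  hh.mul_bdd (c := 1) (measurable_planeWave hι x).aestronglyMeasurable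
    (Eventually.of_forall fun ξ => (norm_planeWave ξ x).le)

/-- Differentiation under the integral sign, for differentials that are combinations of finitely
many fixed linear forms. -/
theorem hasFDerivAt_integral_form {W κ : Type*} [NormedAddCommGroup W] [NormedSpace ℝ W] [Fintype κ]
    (S : κ → W →L[ℝ] ℂ) {F : W → G → ℂ} {B : κ → W → G → ℂ} {z : W} {s : Set W} (hs : s ∈ 𝓝 z)
    (hF : ∀ y ∈ s, Integrable (F y) m) (hB : ∀ j, Integrable (B j z) m)
    {β : κ → G → ℝ} (hβ : ∀ j, Integrable (β j) m)
    (hBβ : ∀ j, ∀ y ∈ s, ∀ ξ, ‖B j y ξ‖ ≤ β j ξ)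
    (hd : ∀ y ∈ s, ∀ ξ, HasFDerivAt (fun y => F y ξ) (∑ j, B j y ξ • S j) y) :
    HasFDerivAt (fun y => ∫ ξ, F y ξ ∂m) (∑ j, (∫ ξ, B j z ξ ∂m) • S j) z := by
  have hint2 : ∀ j, Integrable (fun ξ => B j z ξ • S j) m := fun j => (hB j).smul_const _
  have hint3 : Integrable (fun ξ => ∑ j, B j z ξ • S j) m :=
    integrable_finsetSum (f := fun j ξ => B j z ξ • S j) Finset.univ fun j _ => hint2 j
  have hbound : ∀ ξ, ∀ y ∈ s, ‖∑ j, B j y ξ • S j‖ ≤ ∑ j, β j ξ * ‖S j‖ := by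
    intro ξ y hy
    refine (norm_sum_le _ _).trans (Finset.sum_le_sum fun j _ => ?_)
    rw [norm_smul]
    exact mul_le_mul_of_nonneg_right (hBβ j y hy ξ) (norm_nonneg _)
  have hbint : Integrable (fun ξ => ∑ j, β j ξ * ‖S j‖) m :=
    integrable_finsetSum _ fun j _ => (hβ j).mul_const _
  have key := hasFDerivAt_integral_of_dominated_of_fderiv_le (𝕜 := ℝ) (μ := m) (F := F)
    (F' := fun y ξ => ∑ j, B j y ξ • S j) hs
    (eventually_of_mem hs fun y hy => (hF y hy).aestronglyMeasurable)
    (hF z (mem_of_mem_nhds hs)) hint3.aestronglyMeasurable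
    (Eventually.of_forall hbound) hbint (Eventually.of_forall fun ξ y hy => hd y hy ξ)
  refine key.congr_fderiv ?_
  rw [integral_finsetSum _ fun j _ => hint2 j]
  exact Finset.sum_congr rfl fun j _ => integral_smul_const _ _

variable [IsFrequencySpace m ι]

theorem DecaysOn.continuousOn_synth (hf : DecaysOn ι I f) :
    ContinuousOn (fun z : ℝ × Space d => synth m ι (f z.1) z.2) (I ×ˢ univ) := by
  have hι : Measurable ι := IsFrequencySpace.measurable m
  obtain ⟨a, ha, C, hC, h⟩ := hf.bound
  refine continuousOn_of_dominated (bound := fun ξ => C * Real.exp (-(a * ‖ι ξ‖)))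
    (fun z hz => (integrable_mul_planeWave hι (hf.integrable hz.1) z.2).aestronglyMeasurable)
    (fun z hz => Eventually.of_forall fun ξ => ?_)
    ((IsFrequencySpace.integrable_exp a ha).const_mul C) (Eventually.of_forall fun ξ => ?_)
  · rw [norm_mul, norm_planeWave, mul_one]
    exact h z.1 hz.1 ξ
  · exact ((hf.cont ξ).comp continuousOn_fst fun z hz => hz.1).mul
      ((continuous_planeWave ξ).comp continuous_snd).continuousOn

/-- The differential of the `j`th space coordinate, on space-time. -/
def spaceForm {d : ℕ} (j : Fin d) : ℝ × Space d →L[ℝ] ℂ :=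
  coordForm j ∘L ContinuousLinearMap.snd ℝ ℝ (Space d)

theorem hasFDerivAt_mul_planeWave {φ : ℝ → ℂ} {φ' : ℂ} {z : ℝ × Space d} (hφ : HasDerivAt φ φ' z.1)
    (ξ : G) : HasFDerivAt (fun y : ℝ × Space d => φ y.1 * planeWave ι ξ y.2)
      ((φ' * planeWave ι ξ z.2) • timeForm d +
        ∑ j, (derivSymbol ι j ξ * φ z.1 * planeWave ι ξ z.2) • spaceForm j) z := by
  have h1 : HasFDerivAt (fun y : ℝ × Space d => φ y.1) (φ' • timeForm d) z := by
    refine (hφ.hasFDerivAt.comp z hasFDerivAt_fst).congr_fderiv ?_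
    ext v <;> simp [timeForm]
  have h2 : HasFDerivAt (fun y : ℝ × Space d => planeWave ι ξ y.2)
      (∑ j, (derivSymbol ι j ξ * planeWave ι ξ z.2) • spaceForm j) z := by
    refine ((hasFDerivAt_planeWave ξ z.2).comp z hasFDerivAt_snd).congr_fderiv ?_
    ext v <;> simp [spaceForm]
  refine (h1.mul h2).congr_fderiv ?_
  rw [add_comm, Finset.smul_sum, smul_smul, mul_comm (planeWave ι ξ z.2)]
  congr 1
  refine Finset.sum_congr rfl fun j _ => ?_
  rw [smul_smul]
  congr 1
  ring

/-- The differential of a synthesized function on space-time. -/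
theorem hasFDerivAt_synth (hI : IsOpen I) (hf : DecaysOn ι I f) {g : ℝ → G → ℂ}
    (hg : DecaysOn ι I g) (hd : ∀ t ∈ I, ∀ ξ, HasDerivAt (fun s => f s ξ) (g t ξ) t)
    {z : ℝ × Space d} (hz : z.1 ∈ I) :
    HasFDerivAt (fun z : ℝ × Space d => synth m ι (f z.1) z.2)
      (synth m ι (g z.1) z.2 • timeForm d + ∑ j, synth m ι (fun ξ => derivSymbol ι j ξ * f z.1 ξ)
        z.2 • spaceForm j) z := by
  have hι : Measurable ι := IsFrequencySpace.measurable m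
  have hj : ∀ j, DecaysOn ι I (fun t ξ => derivSymbol ι j ξ * f t ξ) := fun j =>
    hf.mul (subExp_derivSymbol hι j)
  obtain ⟨a, ha, C, hC, hgb⟩ := hg.bound
  choose b hb B hB hjb using fun j => (hj j).bound
  have hmem : I ×ˢ (univ : Set (Space d)) ∈ 𝓝 z := (hI.prod isOpen_univ).mem_nhds ⟨hz, mem_univ _⟩
  -- The index `none` stands for the time direction and `some j` for the jth space direction.
  have key := hasFDerivAt_integral_form (m := m)
    (fun o : Option (Fin d) => o.elim (timeForm d) spaceForm)
    (F := fun (y : ℝ × Space d) ξ => f y.1 ξ * planeWave ι ξ y.2)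
    (B := fun o y ξ => o.elim (g y.1 ξ) (fun j => derivSymbol ι j ξ * f y.1 ξ) *
      planeWave ι ξ y.2)
    (β := fun o ξ => o.elim (C * Real.exp (-(a * ‖ι ξ‖)))
      fun j => B j * Real.exp (-(b j * ‖ι ξ‖))) hmem
    (fun y hy => integrable_mul_planeWave hι (hf.integrable hy.1) y.2)
    (fun o => ?_) (fun o => ?_) (fun o y hy ξ => ?_) (fun y hy ξ => ?_)
  · simpa only [Fintype.sum_option] using! key
  · cases o with
    | none => exact integrable_mul_planeWave hι (hg.integrable hz) z.2
    | some j => exact integrable_mul_planeWave hι ((hj j).integrable hz) z.2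
  · cases o with
    | none => exact (IsFrequencySpace.integrable_exp a ha).const_mul C
    | some j => exact (IsFrequencySpace.integrable_exp (b j) (hb j)).const_mul (B j)
  · rw [norm_mul, norm_planeWave, mul_one]
    cases o with
    | none => exact hgb _ hy.1 ξ
    | some j => exact hjb j _ hy.1 ξ
  · simpa only [Fintype.sum_option] using! hasFDerivAt_mul_planeWave (hd y.1 hy.1 ξ) ξ

/-- The differential is a combination of fixed linear forms whose coefficients are again
synthesized, from the time derivative of the profile and from its products with the symbols 2πi ξⱼ.
Space derivatives only cost decay, so induction on k applies. -/
theorem SmoothProfile.contDiffOn_synth (hI : IsOpen I) (hf : SmoothProfile ι I k f) :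
    ContDiffOn ℝ k (fun z : ℝ × Space d => synth m ι (f z.1) z.2) (I ×ˢ univ) := by
  have hι : Measurable ι := IsFrequencySpace.measurable m
  have hO : IsOpen (I ×ˢ (univ : Set (Space d))) := hI.prod isOpen_univ
  induction k generalizing f with
  | zero => exact contDiffOn_zero.2 (DecaysOn.continuousOn_synth hf)
  | succ k ih =>
    have hf1 := hf.pred
    obtain ⟨hf0, g, hg, hd⟩ := hf
    have hD := fun (z : ℝ × Space d) (hz : z ∈ I ×ˢ (univ : Set (Space d))) =>
      hasFDerivAt_synth (m := m) hI hf0 hg.decaysOn hd hz.1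
    rw [Nat.cast_succ, contDiffOn_succ_iff_fderiv_of_isOpen hO]
    refine ⟨fun z hz => (hD z hz).differentiableAt.differentiableWithinAt, by simp, ?_⟩
    refine ContDiffOn.congr ?_ fun z hz => (hD z hz).fderiv
    refine ((ih hg).smul contDiffOn_const).add (ContDiffOn.sum fun j _ => ?_)
    exact (ih (hf1.mul (subExp_derivSymbol hι j))).smul contDiffOn_const

theorem hasDerivAt_synth (hI : IsOpen I) (hf : DecaysOn ι I f) {g : ℝ → G → ℂ}
    (hg : DecaysOn ι I g) (hd : ∀ t ∈ I, ∀ ξ, HasDerivAt (fun s => f s ξ) (g t ξ) t)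
    {t : ℝ} (ht : t ∈ I) (x : Space d) :
    HasDerivAt (fun s => synth m ι (f s) x) (synth m ι (g t) x) t := by
  have h1 := hasFDerivAt_synth (m := m) hI hf hg hd (z := (t, x)) ht
  have h2 : HasDerivAt (fun s : ℝ => (s, x)) (1, 0) t :=
    (hasDerivAt_id' t).prodMk (hasDerivAt_const t x)
  have h3 := h1.comp_hasDerivAt t h2
  refine h3.congr_deriv ?_
  simp [timeForm, spaceForm, coordForm]

/-- Profiles with exponential decay. -/
def Decays (ι : G →+ Space d) (h : G → ℂ) : Prop :=
  Measurable h ∧ ∃ a > 0, ∃ C ≥ 0, ∀ ξ, ‖h ξ‖ ≤ C * Real.exp (-(a * ‖ι ξ‖))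

theorem Decays.decaysOn {h : G → ℂ} (hh : Decays ι h) (I : Set ℝ) :
    DecaysOn ι I (fun _ => h) := by
  obtain ⟨hm, a, ha, C, hC, hb⟩ := hh
  exact ⟨fun _ _ => hm, ⟨a, ha, C, hC, fun _ _ => hb⟩, fun _ => continuousOn_const⟩

theorem DecaysOn.decays (hf : DecaysOn ι I f) {t : ℝ} (ht : t ∈ I) : Decays ι (f t) := by
  obtain ⟨a, ha, C, hC, h⟩ := hf.bound
  exact ⟨hf.meas t ht, a, ha, C, hC, h t ht⟩

theorem Decays.mul {h p : G → ℂ} (hh : Decays ι h) (hp : SubExp ι p) :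
    Decays ι (fun ξ => p ξ * h ξ) :=
  ((hh.decaysOn univ).mul hp).decays (mem_univ 0)

theorem Decays.integrable {h : G → ℂ} (hh : Decays ι h) : Integrable h m :=
  (hh.decaysOn univ).integrable (mem_univ 0)

theorem Decays.hasFDerivAt_synth {h : G → ℂ} (hh : Decays ι h) (x : Space d) :
    HasFDerivAt (synth m ι h)
      (∑ j, synth m ι (fun ξ => derivSymbol ι j ξ * h ξ) x • coordForm j) x := by
  have hz : DecaysOn ι univ (fun (_ : ℝ) (_ : G) => (0 : ℂ)) :=
    ⟨fun _ _ => measurable_const, ⟨1, one_pos, 0, le_rfl, by simp⟩, fun _ => continuousOn_const⟩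
  have h1 := NLW.hasFDerivAt_synth (m := m) isOpen_univ (hh.decaysOn univ) hz
    (fun t _ ξ => hasDerivAt_const t (h ξ)) (z := (0, x)) (mem_univ _)
  have h2 : HasFDerivAt (fun y : Space d => ((0 : ℝ), y))
    (ContinuousLinearMap.inr ℝ ℝ (Space d)) x :=
    (ContinuousLinearMap.inr ℝ ℝ (Space d)).hasFDerivAt
  have h3 := h1.comp x h2
  refine h3.congr_fderiv ?_
  ext v
  simp [timeForm, spaceForm, coordForm]

theorem Decays.continuous_synth {h : G → ℂ} (hh : Decays ι h) : Continuous (synth m ι h) :=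
  continuous_iff_continuousAt.2 fun x => (hh.hasFDerivAt_synth x).continuousAt

/-- Each second derivative multiplies the profile by (2πi ξⱼ)², and the sum of these symbols is
-(2π|ξ|)². -/
theorem Decays.laplacian_synth {h : G → ℂ} (hh : Decays ι h) (x : Space d) :
    (Δ (synth m ι h)) x = synth m ι (fun ξ => -((freq ι ξ : ℂ)) ^ 2 * h ξ) x := by
  have hι : Measurable ι := IsFrequencySpace.measurable m
  have hj : ∀ j, Decays ι (fun ξ => derivSymbol ι j ξ * h ξ) := fun j =>
    hh.mul (subExp_derivSymbol hι j)
  have hjj : ∀ j, Decays ι (fun ξ => derivSymbol ι j ξ * (derivSymbol ι j ξ * h ξ)) := fun j =>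
    (hj j).mul (subExp_derivSymbol hι j)
  have hfd : fderiv ℝ (synth m ι h) =
      fun x => ∑ j, synth m ι (fun ξ => derivSymbol ι j ξ * h ξ) x • coordForm j := by
    ext1 x; exact (hh.hasFDerivAt_synth x).fderiv
  have hfd2 : ∀ x, HasFDerivAt (fderiv ℝ (synth m ι h))
      (∑ j, (∑ i, synth m ι (fun ξ => derivSymbol ι i ξ * (derivSymbol ι j ξ * h ξ)) x •
        coordForm i).smulRight (coordForm j : Space d →L[ℝ] ℂ)) x := by
    intro x
    rw [hfd]
    exact HasFDerivAt.fun_sum fun j _ => ((hj j).hasFDerivAt_synth (m := m) x).smul_const (coordForm j)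
  have hco : ∀ i j : Fin d, (coordForm j : Space d →L[ℝ] ℂ)
      (EuclideanSpace.single i 1) = if j = i then 1 else 0 := by
    intro i j
    by_cases h : j = i <;> simp [coordForm, h]
  have hlap := congrFun (InnerProductSpace.laplacian_eq_iteratedFDeriv_orthonormalBasis
    (synth m ι h) (EuclideanSpace.basisFun (Fin d) ℝ)) x
  rw [hlap]
  have hterm : ∀ i, iteratedFDeriv ℝ 2 (synth m ι h) x
      ![EuclideanSpace.basisFun (Fin d) ℝ i, EuclideanSpace.basisFun (Fin d) ℝ i] =
      synth m ι (fun ξ => derivSymbol ι i ξ * (derivSymbol ι i ξ * h ξ)) x := by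
    intro i
    rw [iteratedFDeriv_two_apply, (hfd2 x).fderiv]
    simp [hco]
  rw [Finset.sum_congr rfl fun i _ => hterm i]
  simp only [synth]
  rw [← integral_finsetSum _ fun j _ => integrable_mul_planeWave hι (hjj j).integrable x]
  refine integral_congr_ae (Eventually.of_forall fun ξ => ?_)
  simp only
  rw [← Finset.sum_mul]
  congr 1
  have hn : ‖ι ξ‖ ^ 2 = ∑ i, (ι ξ i) ^ 2 := EuclideanSpace.real_norm_sq_eq _
  have hn' : ((‖ι ξ‖ : ℝ) : ℂ) ^ 2 = ∑ i, ((ι ξ i : ℝ) : ℂ) ^ 2 := by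
    exact_mod_cast congrArg (fun r : ℝ => (r : ℂ)) hn
  simp only [freq, derivSymbol]
  push_cast
  rw [mul_pow, hn', Finset.mul_sum, ← Finset.sum_neg_distrib, Finset.sum_mul]
  refine Finset.sum_congr rfl fun i _ => ?_
  ring_nf
  rw [Complex.I_sq]
  ring

theorem SmoothProfile.iteratedDeriv_synth (hI : IsOpen I) {g e : ℝ → G → ℂ} (hf : DecaysOn ι I f)
    (hg : DecaysOn ι I g) (he : DecaysOn ι I e)
    (hfd : ∀ t ∈ I, ∀ ξ, HasDerivAt (fun s => f s ξ) (g t ξ) t)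
    (hgd : ∀ t ∈ I, ∀ ξ, HasDerivAt (fun s => g s ξ) (e t ξ) t) {t : ℝ} (ht : t ∈ I)
    (x : Space d) : iteratedDeriv 2 (fun s => synth m ι (f s) x) t = synth m ι (e t) x := by
  rw [iteratedDeriv_succ, iteratedDeriv_one]
  have h1 : deriv (fun s => synth m ι (f s) x) =ᶠ[𝓝 t] fun s => synth m ι (g s) x :=
    eventually_of_mem (hI.mem_nhds ht) fun s hs => (hasDerivAt_synth hI hf hg hfd hs x).deriv
  rw [h1.deriv_eq]
  exact (hasDerivAt_synth hI hg he hgd ht x).deriv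

end

end

section

/-! ### From Duhamel's equation to classical solutions -/

variable {d : ℕ} {G : Type} [AddCommGroup G] [MeasurableSpace G]

/-- The profile of the free wave with data `h₀`, `h₁`. -/
def freeWave (ι : G →+ Space d) (h₀ h₁ : G → ℂ) (t : ℝ) (ξ : G) : ℂ :=
  (Real.cos (freq ι ξ * t) : ℂ) * h₀ ξ + (waveKernel (freq ι ξ) t : ℂ) * h₁ ξ

section

variable {m : Measure G} {ι : G →+ Space d} {I : Set ℝ} {k : ℕ}
  [MeasurableAdd₂ G] [MeasurableNeg G] [SFinite m] [m.IsAddLeftInvariant] [m.IsNegInvariant]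
  [IsFrequencySpace m ι]

/-- Fubini's theorem and the multiplicativity of the characters; exponential decay gives the
integrability on the product. -/
theorem synth_conv {f g : G → ℂ} (hf : Decays ι f) (hg : Decays ι g) (x : Space d) :
    synth m ι (conv m f g) x = synth m ι f x * synth m ι g x := by
  have hι : Measurable ι := IsFrequencySpace.measurable m
  have h1 : Integrable (fun p : G × G => f p.2 * g (p.1 - p.2)) (m.prod m) :=
    (hf.integrable (m := m)).convolution_integrand (ContinuousLinearMap.mul ℂ ℂ)
      (hg.integrable (m := m))
  have h2 : Integrable (fun p : G × G => f p.2 * g (p.1 - p.2) * planeWave ι p.1 x) (m.prod m) :=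
    h1.mul_bdd (c := 1) ((measurable_planeWave hι x).comp measurable_fst).aestronglyMeasurable
      (Eventually.of_forall fun p => (norm_planeWave p.1 x).le)
  calc synth m ι (conv m f g) x
      = ∫ ξ, ∫ η, f η * g (ξ - η) * planeWave ι ξ x ∂m ∂m := by
        simp only [synth, conv, integral_mul_const]
    _ = ∫ η, ∫ ξ, f η * g (ξ - η) * planeWave ι ξ x ∂m ∂m := integral_integral_swap h2
    _ = ∫ η, f η * planeWave ι η x * synth m ι g x ∂m := by
        refine integral_congr_ae (Eventually.of_forall fun η => ?_)
        simp only [synth]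
        rw [← integral_sub_right_eq_self (fun ξ => g ξ * planeWave ι ξ x) η, ← integral_const_mul]
        refine integral_congr_ae (Eventually.of_forall fun ξ => ?_)
        simp only
        rw [show planeWave ι ξ x = planeWave ι η x * planeWave ι (ξ - η) x by
          rw [← planeWave_add]; simp]
        ring
    _ = _ := by rw [integral_mul_const]; rfl

theorem synth_sharp (f : G → ℂ) (x : Space d) :
    synth m ι (sharp f) x = starRingEnd ℂ (synth m ι f x) := by
  unfold synth
  rw [← integral_conj, ← integral_neg_eq_self]
  refine integral_congr_ae (Eventually.of_forall fun ξ => ?_)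
  simp [sharp, planeWave_neg]

theorem Decays.conv {f g : G → ℂ} (hf : Decays ι f) (hg : Decays ι g) :
    Decays ι (conv m f g) :=
  ((hf.decaysOn univ).conv (hg.decaysOn univ)).decays (mem_univ 0)

theorem Decays.sharp {f : G → ℂ} (hf : Decays ι f) : Decays ι (sharp f) :=
  (SmoothProfile.sharp (k := 0) (hf.decaysOn univ)).decays (mem_univ 0)

theorem synth_nonlinProfile {f : G → ℂ} (hf : Decays ι f) {ρ σ : ℕ} (hσ : 1 ≤ σ) (hρ : ρ ≤ σ)
    (x : Space d) : synth m ι (nonlinProfile m ρ σ f) x =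
      synth m ι f x ^ ρ * starRingEnd ℂ (synth m ι f x) ^ (σ - ρ) := by
  set F : ℕ → G → ℂ := fun i => if i < ρ then f else NLW.sharp f with hF
  have hs : ∀ i, Decays ι (F i) := fun i => by
    simp only [hF]
    split_ifs
    exacts [hf, hf.sharp]
  have key : ∀ n, Decays ι (convProd m F n) ∧
      synth m ι (convProd m F n) x = ∏ i ∈ Finset.range (n + 1), synth m ι (F i) x := by
    intro n
    induction n with
    | zero => exact ⟨hs 0, by simp [convProd]⟩
    | succ n ih =>
      refine ⟨ih.1.conv (hs _), ?_⟩
      rw [Finset.prod_range_succ, ← ih.2]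
      exact synth_conv ih.1 (hs _) x
  have hval : ∀ i, synth m ι (F i) x =
      if i < ρ then synth m ι f x else starRingEnd ℂ (synth m ι f x) := fun i => by
    simp only [hF]
    split_ifs
    exacts [rfl, synth_sharp f x]
  unfold nonlinProfile
  rw [(key (σ - 1)).2, Nat.sub_add_cancel hσ, ← Nat.add_sub_of_le hρ, Finset.prod_range_add,
    Nat.add_sub_cancel_left]
  congr 1
  · rw [Finset.prod_congr rfl fun i hi => by rw [hval, if_pos (Finset.mem_range.1 hi)]]
    simp
  · rw [Finset.prod_congr rfl fun i hi => by rw [hval, if_neg (by omega)]]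
    simp

theorem mul_waveKernel (w t : ℝ) : (w : ℂ) * waveKernel w t = Real.sin (w * t) := by
  by_cases h : w = 0
  · simp [h]
  · rw [waveKernel, if_neg h]
    push_cast
    field_simp [Complex.ofReal_ne_zero.2 h]

theorem hasDerivAt_ofReal_cos (w t : ℝ) : HasDerivAt (fun t : ℝ => (Real.cos (w * t) : ℂ))
    (-(w * Real.sin (w * t)) : ℂ) t := by
  refine (((hasDerivAt_id' t).const_mul w).cos).ofReal_comp.congr_deriv ?_
  push_cast
  ring

theorem hasDerivAt_ofReal_mul_sin (w t : ℝ) : HasDerivAt (fun t : ℝ => (w * Real.sin (w * t) : ℂ))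
    (w * (w * Real.cos (w * t)) : ℂ) t := by
  refine ((((hasDerivAt_id' t).const_mul w).sin).ofReal_comp.const_mul (w : ℂ)).congr_deriv ?_
  push_cast
  ring

theorem subExp_neg_freq_sq (hι : Measurable ι) : SubExp ι (fun ξ => -(freq ι ξ : ℂ) ^ 2) := by
  have hfreq : SubExp ι (fun ξ => (freq ι ξ : ℂ)) :=
    SubExp.of_le_norm (c := 2 * Real.pi) (Complex.measurable_ofReal.comp (measurable_freq hι))
      (by positivity) fun ξ => by
        rw [Complex.norm_real, Real.norm_of_nonneg (by unfold freq; positivity), freq]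
  have := (SubExp.const (-1)).mul (hfreq.mul hfreq)
  refine cast ?_ this
  congr 1
  ext ξ; ring

/-- Both integrals on the right depend on t only through their upper limit, so the next two
derivatives need no differentiation under the integral. -/
theorem duhamel_eq {f : ℝ → G → ℂ} (hf : ∀ ξ, Continuous fun t => f t ξ) (t : ℝ) (ξ : G) :
    duhamel ι f t ξ = (waveKernel (freq ι ξ) t : ℂ) *
        (∫ s in (0 : ℝ)..t, (Real.cos (freq ι ξ * s) : ℂ) * f s ξ) -
      (Real.cos (freq ι ξ * t) : ℂ) *
        ∫ s in (0 : ℝ)..t, (waveKernel (freq ι ξ) s : ℂ) * f s ξ := by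
  have hc : Continuous fun s => (Real.cos (freq ι ξ * s) : ℂ) * f s ξ := by
    have := hf ξ
    fun_prop
  have hk : Continuous fun s => (waveKernel (freq ι ξ) s : ℂ) * f s ξ :=
    (Complex.continuous_ofReal.comp (continuous_waveKernel _)).mul (hf ξ)
  rw [← intervalIntegral.integral_const_mul, ← intervalIntegral.integral_const_mul,
    ← intervalIntegral.integral_sub ((hc.const_mul _).intervalIntegrable _ _)
      ((hk.const_mul _).intervalIntegrable _ _)]
  refine intervalIntegral.integral_congr fun s _ => ?_
  rw [waveKernel_sub]
  push_cast
  ring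

/-- The two boundary terms cancel, because the kernel vanishes at s = t. -/
theorem hasDerivAt_duhamel {f : ℝ → G → ℂ} (hf : ∀ ξ, Continuous fun t => f t ξ) (t : ℝ) (ξ : G) :
    HasDerivAt (fun t => duhamel ι f t ξ)
      ((Real.cos (freq ι ξ * t) : ℂ) * (∫ s in (0 : ℝ)..t, (Real.cos (freq ι ξ * s) : ℂ) * f s ξ) +
        (freq ι ξ * Real.sin (freq ι ξ * t) : ℂ) *
          ∫ s in (0 : ℝ)..t, (waveKernel (freq ι ξ) s : ℂ) * f s ξ) t := by
  set w := freq ι ξ with hw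
  have hc : Continuous fun s => (Real.cos (w * s) : ℂ) * f s ξ := by
    have := hf ξ
    fun_prop
  have hk : Continuous fun s => (waveKernel w s : ℂ) * f s ξ :=
    (Complex.continuous_ofReal.comp (continuous_waveKernel w)).mul (hf ξ)
  rw [show (fun t => duhamel ι f t ξ) = _ from funext fun t => duhamel_eq hf t ξ]
  have h1 := (hasDerivAt_waveKernel w t).ofReal_comp
  have h2 := hasDerivAt_ofReal_cos w t
  have h3 := intervalIntegral.integral_hasDerivAt_right (hc.intervalIntegrable 0 t)
    (hc.stronglyMeasurableAtFilter _ _) hc.continuousAt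
  have h4 := intervalIntegral.integral_hasDerivAt_right (hk.intervalIntegrable 0 t)
    (hk.stronglyMeasurableAtFilter _ _) hk.continuousAt
  refine ((h1.mul h3).sub (h2.mul h4)).congr_deriv ?_
  ring

/-- Here the boundary terms add up to the source, by cos² + sin² = 1. So Duhamel's integral
satisfies the forced oscillator equation at every frequency. -/
theorem hasDerivAt_duhamel' {f : ℝ → G → ℂ} (hf : ∀ ξ, Continuous fun t => f t ξ) (t : ℝ) (ξ : G) :
    HasDerivAt (fun t => (Real.cos (freq ι ξ * t) : ℂ) *
        (∫ s in (0 : ℝ)..t, (Real.cos (freq ι ξ * s) : ℂ) * f s ξ) +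
        (freq ι ξ * Real.sin (freq ι ξ * t) : ℂ) *
          ∫ s in (0 : ℝ)..t, (waveKernel (freq ι ξ) s : ℂ) * f s ξ)
      (-(freq ι ξ : ℂ) ^ 2 * duhamel ι f t ξ + f t ξ) t := by
  set w := freq ι ξ with hw
  have hc : Continuous fun s => (Real.cos (w * s) : ℂ) * f s ξ := by
    have := hf ξ
    fun_prop
  have hk : Continuous fun s => (waveKernel w s : ℂ) * f s ξ :=
    (Complex.continuous_ofReal.comp (continuous_waveKernel w)).mul (hf ξ)
  have h1 := hasDerivAt_ofReal_mul_sin w t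
  have h2 := hasDerivAt_ofReal_cos w t
  have h3 := intervalIntegral.integral_hasDerivAt_right (hc.intervalIntegrable 0 t)
    (hc.stronglyMeasurableAtFilter _ _) hc.continuousAt
  have h4 := intervalIntegral.integral_hasDerivAt_right (hk.intervalIntegrable 0 t)
    (hk.stronglyMeasurableAtFilter _ _) hk.continuousAt
  refine ((h2.mul h3).add (h1.mul h4)).congr_deriv ?_
  have hsc : (Real.cos (w * t) : ℂ) ^ 2 + (Real.sin (w * t) : ℂ) ^ 2 = 1 := by
    exact_mod_cast Real.cos_sq_add_sin_sq (w * t)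
  rw [duhamel_eq hf, ← hw]
  have e := mul_waveKernel w t
  linear_combination (f t ξ) * hsc + ((Real.sin (w * t) : ℂ) * f t ξ -
    w * (∫ s in (0 : ℝ)..t, (Real.cos (w * s) : ℂ) * f s ξ) * (-1)) * e

theorem decaysOn_primitive {e : ℝ → G → ℂ} {h : G → ℂ} (hh : Decays ι h) (hm : ∀ t, Measurable (e t))
    (hc : ∀ ξ, Continuous fun t => e t ξ) {a C : ℝ} (ha : 0 < a) (hC : 0 ≤ C)
    (hb : ∀ t ξ, ‖e t ξ‖ ≤ C * Real.exp (-(a * ‖ι ξ‖))) (τ : ℝ) :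
    DecaysOn ι (Ioo (-τ) τ) (fun t ξ => h ξ + ∫ s in (0 : ℝ)..t, e s ξ) := by
  have h1 : StronglyMeasurable fun z : G × ℝ => e z.2 z.1 :=
    ((measurable_uncurry_of_continuous_of_measurable hc hm).comp measurable_swap).stronglyMeasurable
  have hP : DecaysOn ι (Ioo (-τ) τ) (fun t ξ => ∫ s in (0 : ℝ)..t, e s ξ) := by
    refine ⟨fun t _ => ?_, ⟨a, ha, C * |τ|, by positivity, fun t ht ξ => ?_⟩, fun ξ => ?_⟩
    · simp only [intervalIntegral]
      exact (h1.integral_prod_right.measurable).sub (h1.integral_prod_right.measurable)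
    · have := intervalIntegral.norm_integral_le_of_norm_le_const (a := 0) (b := t)
        (f := fun s => e s ξ) (C := C * Real.exp (-(a * ‖ι ξ‖))) fun s _ => hb s ξ
      have ht' : |t - 0| ≤ |τ| := by
        rw [sub_zero]
        exact (abs_le.2 ⟨ht.1.le, ht.2.le⟩).trans (le_abs_self τ)
      calc _ ≤ C * Real.exp (-(a * ‖ι ξ‖)) * |t - 0| := this
        _ ≤ C * Real.exp (-(a * ‖ι ξ‖)) * |τ| := by gcongr
        _ = _ := by ring
    · exact (intervalIntegral.continuous_primitive
        (fun b c => (hc ξ).intervalIntegrable b c) 0).continuousOn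
  exact (hh.decaysOn _).add hP

/-- Bounded solutions of Duhamel's equation are smooth in time. -/
theorem exists_smoothProfile {μ : ℂ} {ρ σ : ℕ} {τ a M : ℝ} (hτ : 0 < τ) (ha : 0 < a) (hσ : 1 ≤ σ)
    {h₀ h₁ : G → ℂ} (hh₁ : Decays ι h₁) {u : ℝ → G → ℂ} (hu : ∀ t, Bd m ι a M (u t))
    (huc : ∀ ξ, Continuous fun t => u t ξ) (hD : ∀ t ∈ Icc (-τ) τ, u t =
      freeWave ι h₀ h₁ t + μ • duhamel ι (fun s => nonlinProfile m ρ σ (u s)) t) :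
    ∃ g : ℝ → G → ℂ, (∀ k, SmoothProfile ι (Ioo (-τ) τ) k u) ∧
      (∀ k, SmoothProfile ι (Ioo (-τ) τ) k g) ∧ u 0 = h₀ ∧ g 0 = h₁ ∧
      (∀ t ∈ Ioo (-τ) τ, ∀ ξ, HasDerivAt (fun s => u s ξ) (g t ξ) t) ∧
      ∀ t ∈ Ioo (-τ) τ, ∀ ξ, HasDerivAt (fun s => g s ξ)
        (-(freq ι ξ : ℂ) ^ 2 * u t ξ + μ * nonlinProfile m ρ σ (u t) ξ) t := by
  have hι : Measurable ι := IsFrequencySpace.measurable m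
  set I := Ioo (-τ) τ with hI
  have hIo : IsOpen I := isOpen_Ioo
  have h0I : (0 : ℝ) ∈ I := ⟨by linarith, hτ⟩
  have hM := (hu 0).nonneg
  have hNc := continuous_nonlinProfile ha ρ σ hu huc
  have hN : ∀ s, Bd m ι a (M ^ σ) (nonlinProfile m ρ σ (u s)) := fun s =>
    (hu s).nonlinProfile hι ha.le hσ
  have hfreq2 := subExp_neg_freq_sq hι
  set e : ℝ → G → ℂ := fun t ξ => -(freq ι ξ : ℂ) ^ 2 * u t ξ + μ * nonlinProfile m ρ σ (u t) ξ
    with he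
  have hec : ∀ ξ, Continuous fun t => e t ξ := fun ξ =>
    ((huc ξ).const_mul _).add ((hNc ξ).const_mul _)
  have hem : ∀ t, Measurable (e t) := fun t =>
    (hfreq2.meas.mul (hu t).meas).add ((hN t).meas.const_mul μ)
  have hu0 : DecaysOn ι univ u := ⟨fun t _ => (hu t).meas, ⟨a, ha, M, hM, fun t _ ξ =>
    (hu t).norm_le ξ⟩, fun ξ => (huc ξ).continuousOn⟩
  have hN0 : DecaysOn ι univ (fun s => nonlinProfile m ρ σ (u s)) :=
    ⟨fun t _ => (hN t).meas, ⟨a, ha, M ^ σ, by positivity, fun t _ ξ => (hN t).norm_le ξ⟩,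
      fun ξ => (hNc ξ).continuousOn⟩
  have he0 : DecaysOn ι univ e := (hu0.mul hfreq2).add (hN0.mul (SubExp.const μ))
  obtain ⟨b, hb, C, hC, heb⟩ := he0.bound
  -- The velocity is defined as the primitive of the acceleration e that the equation prescribes, so
  -- that it inherits the decay of e and h₁. The explicit derivative v of Duhamel's formula is
  -- identified with it below: v has derivative e and starts at h₁.
  set g : ℝ → G → ℂ := fun t ξ => h₁ ξ + ∫ s in (0 : ℝ)..t, e s ξ with hg
  have hg0 : DecaysOn ι I g :=
    decaysOn_primitive hh₁ hem hec hb hC (fun t ξ => heb t (mem_univ _) ξ) τ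
  have hgd : ∀ t ξ, HasDerivAt (fun s => g s ξ) (e t ξ) t := fun t ξ =>
    (intervalIntegral.integral_hasDerivAt_right ((hec ξ).intervalIntegrable 0 t)
      ((hec ξ).stronglyMeasurableAtFilter _ _) (hec ξ).continuousAt).const_add (h₁ ξ)
  have hud : ∀ t ∈ I, ∀ ξ, HasDerivAt (fun s => u s ξ) (g t ξ) t := by
    intro t ht ξ
    set w := freq ι ξ with hw
    set D : ℝ → ℂ := fun t => (Real.cos (w * t) : ℂ) *
        (∫ s in (0 : ℝ)..t, (Real.cos (w * s) : ℂ) * nonlinProfile m ρ σ (u s) ξ) +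
        (w * Real.sin (w * t) : ℂ) *
          ∫ s in (0 : ℝ)..t, (waveKernel w s : ℂ) * nonlinProfile m ρ σ (u s) ξ with hDdef
    set v : ℝ → ℂ := fun t => (-(w * Real.sin (w * t)) : ℂ) * h₀ ξ +
      (Real.cos (w * t) : ℂ) * h₁ ξ + μ * D t with hv
    have hcos := hasDerivAt_ofReal_cos w
    have hsin := fun t => (hasDerivAt_ofReal_mul_sin w t).neg
    have h1 : ∀ t ∈ I, HasDerivAt (fun s => u s ξ) (v t) t := by
      intro t ht
      have h2 : (fun s => u s ξ) =ᶠ[𝓝 t] fun s => freeWave ι h₀ h₁ s ξ +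
          μ * duhamel ι (fun s => nonlinProfile m ρ σ (u s)) s ξ :=
        eventually_of_mem (hIo.mem_nhds ht) fun s hs =>
          congrFun (hD s (Ioo_subset_Icc_self hs)) ξ
      refine HasDerivAt.congr_of_eventuallyEq ?_ h2
      exact (((hcos t).mul_const (h₀ ξ)).add
        (((hasDerivAt_waveKernel w t).ofReal_comp).mul_const (h₁ ξ))).add
        ((hasDerivAt_duhamel hNc t ξ).const_mul μ)
    have h3 : ∀ t ∈ I, HasDerivAt v (e t ξ) t := by
      intro t ht
      have h4 := (((hsin t).mul_const (h₀ ξ)).add ((hcos t).mul_const (h₁ ξ))).add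
        ((hasDerivAt_duhamel' (ι := ι) hNc t ξ).const_mul μ)
      refine h4.congr_deriv ?_
      simp only [he]
      rw [hD t (Ioo_subset_Icc_self ht)]
      simp only [Pi.add_apply, Pi.smul_apply, smul_eq_mul, freeWave, ← hw]
      linear_combination (w : ℂ) * h₁ ξ * mul_waveKernel w t
    have h5 : v t - v 0 = ∫ s in (0 : ℝ)..t, e s ξ := by
      refine (intervalIntegral.integral_eq_sub_of_hasDerivAt (fun s hs => h3 s ?_)
        ((hec ξ).intervalIntegrable _ _)).symm
      exact (ordConnected_Ioo.uIcc_subset h0I ht) hs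
    have h6 : v 0 = h₁ ξ := by simp [hv, hDdef]
    have h7 : g t ξ = v t := by
      rw [h6] at h5
      simp only [hg, ← h5]
      ring
    rw [h7]
    exact h1 t ht
  have key : ∀ k, SmoothProfile ι I k u ∧ SmoothProfile ι I k g := by
    have huI : DecaysOn ι I u := ⟨fun t _ => hu0.meas t (mem_univ _), by
      obtain ⟨a, ha, C, hC, h⟩ := hu0.bound
      exact ⟨a, ha, C, hC, fun t _ => h t (mem_univ _)⟩, fun ξ => (huc ξ).continuousOn⟩
    intro k
    -- Bootstrap: u' = g and g' = e, where e is made of u by a multiplier and the nonlinearity. So k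
    -- derivatives of u give k derivatives of e, hence one more for u and g.
    induction k with
    | zero => exact ⟨huI, hg0⟩
    | succ k ih =>
      refine ⟨⟨huI, g, ih.2, hud⟩, hg0, e, ?_, fun t _ ξ => hgd t ξ⟩
      exact (ih.1.mul hfreq2).add ((SmoothProfile.nonlinProfile hIo ρ σ ih.1).mul (SubExp.const μ))
  refine ⟨g, fun k => (key k).1, fun k => (key k).2, ?_, by ext ξ; simp [hg], hud,
    fun t _ ξ => hgd t ξ⟩
  ext ξ
  rw [hD 0 ⟨by linarith, hτ.le⟩]
  simp [freeWave, duhamel, waveKernel]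

/-- A smooth profile that solves the equation on the frequency side synthesizes to a classical
solution. -/
theorem isClassicalSolution_synth {μ : ℂ} {ρ σ : ℕ} {τ T : ℝ} (hσ : 1 ≤ σ) (hρ : ρ ≤ σ)
    (hT : 0 < T) (hTτ : T < τ) {u g : ℝ → G → ℂ}
    (hu : ∀ k, SmoothProfile ι (Ioo (-τ) τ) k u) (hg : ∀ k, SmoothProfile ι (Ioo (-τ) τ) k g)
    (hud : ∀ t ∈ Ioo (-τ) τ, ∀ ξ, HasDerivAt (fun s => u s ξ) (g t ξ) t)
    (hgd : ∀ t ∈ Ioo (-τ) τ, ∀ ξ, HasDerivAt (fun s => g s ξ)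
        (-(freq ι ξ : ℂ) ^ 2 * u t ξ + μ * nonlinProfile m ρ σ (u t) ξ) t) :
    IsClassicalSolution μ ρ σ T (fun t => synth m ι (u t)) := by
  have hι : Measurable ι := IsFrequencySpace.measurable m
  have hIo : IsOpen (Ioo (-τ) τ) := isOpen_Ioo
  have hsub : Icc 0 T ⊆ Ioo (-τ) τ := fun t ht => ⟨by linarith [ht.1], by linarith [ht.2]⟩
  refine ⟨?_, fun t ht x => ?_⟩
  · refine (contDiffOn_infty.2 fun k => (hu k).contDiffOn_synth (m := m) hIo).mono ?_
    exact prod_mono hsub subset_rfl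
  · have htI := hsub ⟨ht.1.le, ht.2.le⟩
    have hfreq2 := subExp_neg_freq_sq hι
    have h1 : DecaysOn ι (Ioo (-τ) τ) (fun t ξ => -(freq ι ξ : ℂ) ^ 2 * u t ξ) :=
      DecaysOn.mul (hu 0) hfreq2
    have h2 : DecaysOn ι (Ioo (-τ) τ) (fun t ξ => μ * nonlinProfile m ρ σ (u t) ξ) :=
      DecaysOn.mul (SmoothProfile.nonlinProfile (k := 0) hIo ρ σ (hu 0)) (SubExp.const μ)
    have hut : Decays ι (u t) := (hu 0).decaysOn.decays htI
    rw [SmoothProfile.iteratedDeriv_synth (m := m) hIo (hu 0) (hg 0) (h1.add h2) hud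
      (fun t ht ξ => hgd t ht ξ) htI x, hut.laplacian_synth, mul_assoc,
      ← synth_nonlinProfile (m := m) hut hσ hρ, sub_eq_iff_eq_add]
    simp only [synth]
    rw [← integral_const_mul, ← integral_add]
    · refine integral_congr_ae (Eventually.of_forall fun ξ => ?_)
      simp only [Pi.add_apply]
      ring
    · have := integrable_mul_planeWave hι (h2.integrable (m := m) htI) x
      simpa only [mul_assoc] using this
    · exact integrable_mul_planeWave hι (h1.integrable (m := m) htI) x

end

end

section

/-! ### Uniqueness of classical solutions by a local energy estimate -/

theorem two_le_infty : (2 : ℕ∞ω) ≤ (∞ : ℕ∞ω) := WithTop.coe_le_coe.2 (le_top : (2 : ℕ∞) ≤ ⊤)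

section Energy

variable {d : ℕ} {w : ℝ × Space d → ℂ}

/-- The unit vector in direction of time. -/
def timeVec (d : ℕ) : ℝ × Space d := (1, 0)

/-- The unit vector in direction of the `j`th space coordinate. -/
def spaceVec {d : ℕ} (j : Fin d) : ℝ × Space d := (0, EuclideanSpace.single j 1)

theorem iteratedDeriv_two_eq_fderiv {t : ℝ} {x : Space d} (hw : ContDiffAt ℝ 2 w (t, x)) :
    iteratedDeriv 2 (fun s => w (s, x)) t =
      fderiv ℝ (fderiv ℝ w) (t, x) (timeVec d) (timeVec d) := by
  have hc : ∀ s : ℝ, HasDerivAt (fun s : ℝ => (s, x)) (timeVec d) s := fun s =>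
    (hasDerivAt_id' s).prodMk (hasDerivAt_const s x)
  have hnear : ∀ᶠ z in 𝓝 (t, x), DifferentiableAt ℝ w z :=
    (hw.eventually (by simp)).mono fun z hz => hz.differentiableAt (by simp)
  rw [iteratedDeriv_succ, iteratedDeriv_one]
  have h1 : deriv (fun s => w (s, x)) =ᶠ[𝓝 t] fun s => fderiv ℝ w (s, x) (timeVec d) := by
    filter_upwards [(hc t).continuousAt.eventually hnear] with s hs
    exact (hs.hasFDerivAt.comp_hasDerivAt s (hc s)).deriv
  rw [h1.deriv_eq]
  have h2 : DifferentiableAt ℝ (fderiv ℝ w) (t, x) :=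
    (hw.fderiv_right (m := 1) (by norm_num)).differentiableAt (by simp)
  have h3 : HasDerivAt (fun s => fderiv ℝ w (s, x)) (fderiv ℝ (fderiv ℝ w) (t, x) (timeVec d)) t :=
    h2.hasFDerivAt.comp_hasDerivAt t (hc t)
  exact ((ContinuousLinearMap.apply ℝ ℂ (timeVec d)).hasFDerivAt.comp_hasDerivAt t h3).deriv

theorem laplacian_slice_eq_fderiv {t : ℝ} {x : Space d} (hw : ContDiffAt ℝ 2 w (t, x)) :
    (Δ (fun y => w (t, y))) x =
      ∑ j, fderiv ℝ (fderiv ℝ w) (t, x) (spaceVec j) (spaceVec j) := by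
  have hc : ∀ y : Space d, HasFDerivAt (fun y : Space d => (t, y))
      (ContinuousLinearMap.inr ℝ ℝ (Space d)) y := fun y =>
    (hasFDerivAt_const t y).prodMk (hasFDerivAt_id y)
  have hnear : ∀ᶠ z in 𝓝 (t, x), DifferentiableAt ℝ w z :=
    (hw.eventually (by simp)).mono fun z hz => hz.differentiableAt (by simp)
  rw [congrFun (InnerProductSpace.laplacian_eq_iteratedFDeriv_orthonormalBasis
    (fun y => w (t, y)) (EuclideanSpace.basisFun (Fin d) ℝ)) x]
  refine Finset.sum_congr rfl fun j _ => ?_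
  rw [iteratedFDeriv_two_apply]
  have h1 : fderiv ℝ (fun y => w (t, y)) =ᶠ[𝓝 x]
      fun y => (fderiv ℝ w (t, y)) ∘L ContinuousLinearMap.inr ℝ ℝ (Space d) := by
    filter_upwards [(hc x).continuousAt.eventually hnear] with y hy
    exact (hy.hasFDerivAt.comp y (hc y)).fderiv
  rw [h1.fderiv_eq]
  have h2 : DifferentiableAt ℝ (fderiv ℝ w) (t, x) :=
    (hw.fderiv_right (m := 1) (by norm_num)).differentiableAt (by simp)
  have h3 := (h2.hasFDerivAt.comp x (hc x)).clm_comp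
    (hasFDerivAt_const (ContinuousLinearMap.inr ℝ ℝ (Space d)) x)
  have h4 := h3.fderiv
  simp only [Function.comp_def] at h4
  rw [h4]
  simp [spaceVec]

/-- Differentiation under the integral sign for families with common compact support. -/
theorem hasDerivAt_integral_of_support {f f' : ℝ → Space d → ℝ} {J : Set ℝ} {K : Set (Space d)}
    (hJ : IsOpen J) (hK : IsCompact K) (hf : ContinuousOn (Function.uncurry f) (J ×ˢ univ))
    (hf' : ContinuousOn (Function.uncurry f') (J ×ˢ univ))
    (hs : ∀ t ∈ J, ∀ x ∉ K, f t x = 0) (hs' : ∀ t ∈ J, ∀ x ∉ K, f' t x = 0)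
    (hd : ∀ t ∈ J, ∀ x, HasDerivAt (fun s => f s x) (f' t x) t) {t : ℝ} (ht : t ∈ J) :
    HasDerivAt (fun s => ∫ x, f s x) (∫ x, f' t x) t := by
  have hslice : ∀ {g : ℝ → Space d → ℝ}, ContinuousOn (Function.uncurry g) (J ×ˢ univ) →
      ∀ s ∈ J, Continuous (g s) := fun {g} hg s hs =>
    hg.comp_continuous (f := fun x => (s, x)) (by fun_prop) fun x => ⟨hs, mem_univ _⟩
  have hintg : ∀ s ∈ J, Integrable (f s) := fun s hsJ =>
    (hslice hf s hsJ).integrable_of_hasCompactSupport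
      (HasCompactSupport.intro hK fun x hx => hs s hsJ x hx)
  obtain ⟨δ, hδ, hball⟩ := Metric.nhds_basis_closedBall.mem_iff.1 (hJ.mem_nhds ht)
  obtain ⟨C, hC⟩ := ((isCompact_closedBall t δ).prod hK).exists_bound_of_continuousOn
    (hf'.mono (prod_mono hball (subset_univ _)))
  refine (hasDerivAt_integral_of_dominated_loc_of_deriv_le (F := f) (F' := f')
    (bound := K.indicator fun _ => C) (Metric.closedBall_mem_nhds t hδ)
    (eventually_of_mem (hJ.mem_nhds ht) fun s hs => (hintg s hs).aestronglyMeasurable)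
    (hintg t ht) (hslice hf' t ht).aestronglyMeasurable
    (Eventually.of_forall fun x s hsb => ?_) ?_
    (Eventually.of_forall fun x s hs => hd s (hball hs) x)).2
  · by_cases hx : x ∈ K
    · rw [indicator_of_mem hx]
      exact hC (s, x) ⟨hsb, hx⟩
    · rw [indicator_of_notMem hx, hs' s (hball hsb) x hx, norm_zero]
  · exact (integrable_indicator_iff hK.measurableSet).2
      (integrableOn_const hK.measure_lt_top.ne)

/-- Grönwall's argument: exp(-Kt) E(t) is nonincreasing and starts at 0. The derivative is needed in
the open interval only, where the second derivatives of the solution are available. -/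
theorem eq_zero_of_deriv_le {E E' : ℝ → ℝ} {T K : ℝ} (hE : ContinuousOn E (Icc 0 T))
    (hd : ∀ t ∈ Ioo 0 T, HasDerivAt E (E' t) t) (hle : ∀ t ∈ Ioo 0 T, E' t ≤ K * E t)
    (hpos : ∀ t ∈ Icc 0 T, 0 ≤ E t) (h0 : E 0 = 0) {t : ℝ} (ht : t ∈ Icc 0 T) : E t = 0 := by
  have hanti : AntitoneOn (fun t => Real.exp (-(K * t)) * E t) (Icc 0 T) := by
    have hder : ∀ t ∈ Ioo 0 T, HasDerivAt (fun t => Real.exp (-(K * t)) * E t)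
        (Real.exp (-(K * t)) * (E' t - K * E t)) t := fun t ht => by
      have h1 := (((hasDerivAt_id' t).const_mul K).neg).exp
      refine (h1.mul (hd t ht)).congr_deriv ?_
      simp only [Pi.neg_apply]
      ring
    refine antitoneOn_of_deriv_nonpos (convex_Icc 0 T) ?_ ?_ ?_
    · exact (Continuous.continuousOn (by fun_prop)).mul hE
    · rw [interior_Icc]
      exact fun t ht => (hder t ht).differentiableAt.differentiableWithinAt
    · rw [interior_Icc]
      intro t ht
      rw [(hder t ht).deriv]
      exact mul_nonpos_of_nonneg_of_nonpos (Real.exp_pos _).le (by linarith [hle t ht])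
  have h1 := hanti ⟨le_rfl, ht.1.trans ht.2⟩ ht ht.1
  simp only [h0, mul_zero] at h1
  have h2 : E t ≤ 0 := by
    by_contra hc
    push Not at hc
    exact absurd h1 (not_le.2 (mul_pos (Real.exp_pos _) hc))
  exact le_antisymm h2 (hpos t ht)

theorem expNegInvGlue_deriv_eq_zero {y : ℝ} (hy : y ≤ 0) : deriv expNegInvGlue y = 0 := by
  apply IsLocalMin.deriv_eq_zero
  exact Eventually.of_forall fun z => by
    rw [expNegInvGlue.zero_of_nonpos hy]
    exact expNegInvGlue.nonneg z

theorem expNegInvGlue_deriv_nonneg (y : ℝ) : 0 ≤ deriv expNegInvGlue y :=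
  expNegInvGlue.monotone.deriv_nonneg

/-- The argument of the cut-off of the energy: its positivity set is a truncated cone. -/
def conePhase (r : ℝ) (z : ℝ × Space d) : ℝ := r ^ 2 - 2 * r * z.1 - ‖z.2‖ ^ 2

theorem hasFDerivAt_conePhase (r : ℝ) (z : ℝ × Space d) :
    HasFDerivAt (conePhase (d := d) r) (-(2 * r) • ContinuousLinearMap.fst ℝ ℝ (Space d) -
      (2 • innerSL ℝ z.2) ∘L ContinuousLinearMap.snd ℝ ℝ (Space d)) z := by
  have h1 : HasFDerivAt (fun z : ℝ × Space d => r ^ 2 - 2 * r * z.1)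
      (-(2 * r) • ContinuousLinearMap.fst ℝ ℝ (Space d)) z := by
    have := ((hasFDerivAt_fst (𝕜 := ℝ) (p := z)).const_mul (2 * r)).const_sub (r ^ 2)
    refine this.congr_fderiv ?_
    ext <;> simp
  exact h1.sub (hasFDerivAt_snd.norm_sq)

/-- The energy density. -/
def energyDensity (w : ℝ × Space d → ℂ) (D : ℝ × Space d → ℝ × Space d →L[ℝ] ℂ)
    (z : ℝ × Space d) : ℝ :=
  ‖D z (timeVec d)‖ ^ 2 + ∑ j, ‖D z (spaceVec j)‖ ^ 2 + ‖w z‖ ^ 2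

/-- The first derivatives `D` and the second derivatives `A` of a function `w` which is smooth on
`[0, T] × ℝᵈ`. -/
structure HasSecondOrderJet (w : ℝ × Space d → ℂ) (D : ℝ × Space d → ℝ × Space d →L[ℝ] ℂ)
    (A : ℝ × Space d → ℝ × Space d →L[ℝ] ℝ × Space d →L[ℝ] ℂ) (T : ℝ) : Prop where
  contOn : ContinuousOn w (Icc 0 T ×ˢ univ)
  contOn_deriv : ContinuousOn D (Icc 0 T ×ˢ univ)
  contOn_deriv₂ : ContinuousOn A (Ioo 0 T ×ˢ univ)
  hasFDerivAt : ∀ z ∈ Ioo 0 T ×ˢ (univ : Set (Space d)), HasFDerivAt w (D z) z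
  hasFDerivAt₂ : ∀ z ∈ Ioo 0 T ×ˢ (univ : Set (Space d)), HasFDerivAt D (A z) z
  symm : ∀ z ∈ Ioo 0 T ×ˢ (univ : Set (Space d)), ∀ u v, A z u v = A z v u

theorem isOpen_slab (T : ℝ) : IsOpen (Ioo 0 T ×ˢ (univ : Set (Space d))) :=
  isOpen_Ioo.prod isOpen_univ

theorem slab_subset (T : ℝ) : Ioo 0 T ×ˢ (univ : Set (Space d)) ⊆ Icc 0 T ×ˢ univ :=
  prod_mono Ioo_subset_Icc_self Subset.rfl

theorem slab_mem_nhds {T : ℝ} {z : ℝ × Space d} (hz : z ∈ Ioo 0 T ×ˢ (univ : Set (Space d))) :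
    Icc 0 T ×ˢ (univ : Set (Space d)) ∈ 𝓝 z :=
  mem_of_superset ((isOpen_slab T).mem_nhds hz) (slab_subset T)

/-- The first derivatives are taken within the closed slab, so that they are continuous up to t = 0,
where the Cauchy data enter. The second derivatives matter only inside. -/
theorem hasSecondOrderJet {T : ℝ} (hT : 0 < T)
    (hw : ContDiffOn ℝ ∞ w (Icc 0 T ×ˢ univ)) :
    HasSecondOrderJet w (fderivWithin ℝ w (Icc 0 T ×ˢ univ)) (fderiv ℝ (fderiv ℝ w)) T := by
  have hU : UniqueDiffOn ℝ (Icc 0 T ×ˢ (univ : Set (Space d))) :=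
    (uniqueDiffOn_Icc hT).prod uniqueDiffOn_univ
  have hat : ∀ z ∈ Ioo 0 T ×ˢ (univ : Set (Space d)), ContDiffAt ℝ ∞ w z := fun z hz =>
    hw.contDiffAt (slab_mem_nhds hz)
  have heq : ∀ z ∈ Ioo 0 T ×ˢ (univ : Set (Space d)),
      fderivWithin ℝ w (Icc 0 T ×ˢ univ) z = fderiv ℝ w z := fun z hz =>
    fderivWithin_of_mem_nhds (slab_mem_nhds hz)
  have hfd : ContDiffOn ℝ ∞ (fderiv ℝ w) (Ioo 0 T ×ˢ univ) :=
    (hw.mono (slab_subset T)).fderiv_of_isOpen (isOpen_slab T) (by simp)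
  refine ⟨hw.continuousOn, hw.continuousOn_fderivWithin hU (by simp),
    hfd.continuousOn_fderiv_of_isOpen (isOpen_slab T) (by simp), fun z hz => ?_, fun z hz => ?_,
    fun z hz u v => ?_⟩
  · rw [heq z hz]
    exact ((hat z hz).differentiableAt (by simp)).hasFDerivAt
  · refine HasFDerivAt.congr_of_eventuallyEq ?_
      (eventually_of_mem ((isOpen_slab T).mem_nhds hz) heq)
    exact ((hfd.contDiffAt ((isOpen_slab T).mem_nhds hz)).differentiableAt (by simp)).hasFDerivAt
  · exact (hat z hz).isSymmSndFDerivAt (by simpa using two_le_infty) u v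

/-- The cut-off of the energy. -/
def coneCutoff (r : ℝ) (z : ℝ × Space d) : ℝ := expNegInvGlue (conePhase r z)

/-- The derivative of the profile of the cut-off. -/
def coneSlope (r : ℝ) (z : ℝ × Space d) : ℝ := deriv expNegInvGlue (conePhase r z)

theorem continuous_conePhase (r : ℝ) : Continuous (conePhase (d := d) r) := by
  unfold conePhase
  fun_prop

theorem continuous_coneCutoff (r : ℝ) : Continuous (coneCutoff (d := d) r) :=
  (expNegInvGlue.contDiff (n := 0)).continuous.comp (continuous_conePhase r)

theorem continuous_coneSlope (r : ℝ) : Continuous (coneSlope (d := d) r) :=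
  ((expNegInvGlue.contDiff (n := 1)).continuous_deriv le_rfl).comp (continuous_conePhase r)

theorem conePhase_nonpos {r : ℝ} (hr : 0 < r) {t : ℝ} (ht : 0 ≤ t) {x : Space d}
    (hx : r ≤ ‖x‖) : conePhase r (t, x) ≤ 0 := by
  have h1 : r ^ 2 ≤ ‖x‖ ^ 2 := pow_le_pow_left₀ hr.le hx 2
  have h2 : 0 ≤ 2 * r * t := by positivity
  simp only [conePhase]
  linarith

theorem coneCutoff_eq_zero {r : ℝ} (hr : 0 < r) {t : ℝ} (ht : 0 ≤ t) {x : Space d}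
    (hx : x ∉ Metric.closedBall (0 : Space d) r) : coneCutoff r (t, x) = 0 := by
  rw [mem_closedBall_zero_iff, not_le] at hx
  exact expNegInvGlue.zero_of_nonpos (conePhase_nonpos hr ht hx.le)

theorem coneSlope_eq_zero {r : ℝ} (hr : 0 < r) {t : ℝ} (ht : 0 ≤ t) {x : Space d}
    (hx : x ∉ Metric.closedBall (0 : Space d) r) : coneSlope r (t, x) = 0 := by
  rw [mem_closedBall_zero_iff, not_le] at hx
  exact expNegInvGlue_deriv_eq_zero (conePhase_nonpos hr ht hx.le)

theorem coneCutoff_nonneg (r : ℝ) (z : ℝ × Space d) : 0 ≤ coneCutoff r z :=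
  expNegInvGlue.nonneg _

theorem coneSlope_nonneg (r : ℝ) (z : ℝ × Space d) : 0 ≤ coneSlope r z :=
  expNegInvGlue_deriv_nonneg _

theorem hasFDerivAt_coneCutoff (r : ℝ) (z : ℝ × Space d) :
    HasFDerivAt (coneCutoff (d := d) r) (coneSlope r z • (-(2 * r) •
      ContinuousLinearMap.fst ℝ ℝ (Space d) -
        (2 • innerSL ℝ z.2) ∘L ContinuousLinearMap.snd ℝ ℝ (Space d))) z := by
  have h : HasDerivAt expNegInvGlue (deriv expNegInvGlue (conePhase r z)) (conePhase r z) :=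
    ((expNegInvGlue.contDiff (n := 1)).differentiable (by simp) _).hasDerivAt
  exact h.comp_hasFDerivAt z (hasFDerivAt_conePhase r z)

/-- A continuous function on a slab which vanishes outside a ball is integrable on each slice. -/
theorem integrable_slice {f : ℝ × Space d → ℝ} {J : Set ℝ} {r : ℝ}
    (hf : ContinuousOn f (J ×ˢ univ)) {t : ℝ} (ht : t ∈ J)
    (hs : ∀ x ∉ Metric.closedBall (0 : Space d) r, f (t, x) = 0) :
    Integrable (fun x => f (t, x)) := by
  have hc : Continuous fun x => f (t, x) :=
    hf.comp_continuous (f := fun x => (t, x)) (by fun_prop) fun x => ⟨ht, mem_univ _⟩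
  exact hc.integrable_of_hasCompactSupport
    (HasCompactSupport.intro (isCompact_closedBall 0 r) fun x hx => hs x hx)

/-- Integration by parts against the constant function 1. -/
theorem integral_fderiv_apply_eq_zero {g : Space d → ℝ} {v : Space d} (hg : Integrable g)
    (hg' : Integrable fun x => fderiv ℝ g x v) (hd : Differentiable ℝ g) :
    ∫ x, fderiv ℝ g x v = 0 := by
  have := integral_mul_fderiv_eq_neg_fderiv_mul_of_integrable (μ := (volume : Measure (Space d)))
    (f := fun _ => (1 : ℝ)) (g := g) (v := v) (by simp) (by simpa using hg') (by simpa using hg)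
    (fun x _ => differentiableAt_const _) (fun x _ => hd x)
  simpa using this

/-! ### The energy estimate in a truncated cone -/

section Estimate

variable {D : ℝ × Space d → ℝ × Space d →L[ℝ] ℂ}
  {A : ℝ × Space d → ℝ × Space d →L[ℝ] ℝ × Space d →L[ℝ] ℂ} {T r : ℝ}

/-- The time derivative of the localised energy density. -/
def energyRate (r : ℝ) (w : ℝ × Space d → ℂ) (D : ℝ × Space d → ℝ × Space d →L[ℝ] ℂ)
    (A : ℝ × Space d → ℝ × Space d →L[ℝ] ℝ × Space d →L[ℝ] ℂ) (z : ℝ × Space d) : ℝ :=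
  coneSlope r z * (-(2 * r)) * energyDensity w D z +
    coneCutoff r z * (2 * inner ℝ (D z (timeVec d)) (A z (timeVec d) (timeVec d)) +
      ∑ j, 2 * inner ℝ (D z (spaceVec j)) (A z (timeVec d) (spaceVec j)) +
      2 * inner ℝ (w z) (D z (timeVec d)))

/-- The divergence part of the rate of change of the energy. -/
def energyFlux (r : ℝ) (D : ℝ × Space d → ℝ × Space d →L[ℝ] ℂ)
    (A : ℝ × Space d → ℝ × Space d →L[ℝ] ℝ × Space d →L[ℝ] ℂ) (j : Fin d) (z : ℝ × Space d) : ℝ :=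
  coneSlope r z * (-(2 * z.2 j)) * inner ℝ (D z (timeVec d)) (D z (spaceVec j)) +
    coneCutoff r z * (inner ℝ (D z (timeVec d)) (A z (spaceVec j) (spaceVec j)) +
      inner ℝ (A z (spaceVec j) (timeVec d)) (D z (spaceVec j)))

theorem HasSecondOrderJet.continuousOn_density (h : HasSecondOrderJet w D A T) :
    ContinuousOn (energyDensity w D) (Icc 0 T ×ˢ univ) := by
  have h1 := h.contOn
  have h2 : ∀ v, ContinuousOn (fun z => D z v) (Icc 0 T ×ˢ univ) := fun v =>
    h.contOn_deriv.clm_apply continuousOn_const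
  unfold energyDensity
  exact (((h2 _).norm.pow 2).add (continuousOn_finsetSum _ fun j _ => (h2 _).norm.pow 2)).add
    (h1.norm.pow 2)

theorem HasSecondOrderJet.continuousOn_rate (h : HasSecondOrderJet w D A T) (r : ℝ) :
    ContinuousOn (energyRate r w D A) (Ioo 0 T ×ˢ univ) := by
  have h0 := h.continuousOn_density.mono (slab_subset T)
  have h1 := h.contOn.mono (slab_subset T)
  have h2 : ∀ v, ContinuousOn (fun z => D z v) (Ioo 0 T ×ˢ univ) := fun v =>
    (h.contOn_deriv.mono (slab_subset T)).clm_apply continuousOn_const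
  have h3 : ∀ u v, ContinuousOn (fun z => A z u v) (Ioo 0 T ×ˢ univ) := fun u v =>
    (h.contOn_deriv₂.clm_apply continuousOn_const).clm_apply continuousOn_const
  unfold energyRate
  refine ContinuousOn.add (((continuous_coneSlope r).continuousOn.mul continuousOn_const).mul h0)
    ((continuous_coneCutoff r).continuousOn.mul (ContinuousOn.add (ContinuousOn.add
      (continuousOn_const.mul ((h2 _).inner (𝕜 := ℝ) (h3 _ _)))
      (continuousOn_finsetSum _ fun j _ => continuousOn_const.mul ((h2 _).inner (𝕜 := ℝ) (h3 _ _))))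
      (continuousOn_const.mul (h1.inner (𝕜 := ℝ) (h2 _)))))

theorem HasSecondOrderJet.continuousOn_flux (h : HasSecondOrderJet w D A T) (r : ℝ) (j : Fin d) :
    ContinuousOn (energyFlux r D A j) (Ioo 0 T ×ˢ univ) := by
  have h2 : ∀ v, ContinuousOn (fun z => D z v) (Ioo 0 T ×ˢ univ) := fun v =>
    (h.contOn_deriv.mono (slab_subset T)).clm_apply continuousOn_const
  have h3 : ∀ u v, ContinuousOn (fun z => A z u v) (Ioo 0 T ×ˢ univ) := fun u v =>
    (h.contOn_deriv₂.clm_apply continuousOn_const).clm_apply continuousOn_const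
  unfold energyFlux
  refine ContinuousOn.add (((continuous_coneSlope r).continuousOn.mul
    (Continuous.continuousOn (by fun_prop))).mul ((h2 _).inner (𝕜 := ℝ) (h2 _)))
    ((continuous_coneCutoff r).continuousOn.mul (ContinuousOn.add
      ((h2 _).inner (𝕜 := ℝ) (h3 _ _)) ((h3 _ _).inner (𝕜 := ℝ) (h2 _))))

theorem HasSecondOrderJet.hasFDerivAt_apply (h : HasSecondOrderJet w D A T) {z : ℝ × Space d}
    (hz : z ∈ Ioo 0 T ×ˢ (univ : Set (Space d))) (v : ℝ × Space d) :
    HasFDerivAt (fun z => D z v) ((ContinuousLinearMap.apply ℝ ℂ v) ∘L (A z)) z :=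
  (ContinuousLinearMap.apply ℝ ℂ v).hasFDerivAt.comp z (h.hasFDerivAt₂ z hz)

theorem HasSecondOrderJet.hasDerivAt_energy (h : HasSecondOrderJet w D A T) {t : ℝ}
    (ht : t ∈ Ioo 0 T) (x : Space d) :
    HasDerivAt (fun s => coneCutoff r (s, x) * energyDensity w D (s, x))
      (energyRate r w D A (t, x)) t := by
  have hz : (t, x) ∈ Ioo 0 T ×ˢ (univ : Set (Space d)) := ⟨ht, mem_univ _⟩
  have hc : HasDerivAt (fun s : ℝ => (s, x)) (timeVec d) t :=
    (hasDerivAt_id' t).prodMk (hasDerivAt_const t x)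
  have h1 : HasDerivAt (fun s => coneCutoff r (s, x)) (coneSlope r (t, x) * (-(2 * r))) t := by
    refine ((hasFDerivAt_coneCutoff r (t, x)).comp_hasDerivAt t hc).congr_deriv ?_
    simp [timeVec]
  have h2 : HasDerivAt (fun s => w (s, x)) (D (t, x) (timeVec d)) t :=
    (h.hasFDerivAt _ hz).comp_hasDerivAt t hc
  have h3 : ∀ v, HasDerivAt (fun s => D (s, x) v) (A (t, x) (timeVec d) v) t := fun v => by
    have h5 := h.hasFDerivAt_apply hz v
    exact h5.comp_hasDerivAt t hc
  have h4 : HasDerivAt (fun s => energyDensity w D (s, x)) _ t :=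
    ((h3 (timeVec d)).norm_sq.add
      (HasDerivAt.fun_sum fun j (_ : j ∈ Finset.univ) => (h3 (spaceVec j)).norm_sq)).add h2.norm_sq
  exact h1.mul h4

/-- The flux is the jth partial derivative of a function that the cut-off makes compactly supported;
hence its integral over space will vanish. -/
theorem HasSecondOrderJet.hasFDerivAt_flux (h : HasSecondOrderJet w D A T) {t : ℝ}
    (ht : t ∈ Ioo 0 T) (x : Space d) (j : Fin d) :
    ∃ L : Space d →L[ℝ] ℝ, HasFDerivAt (fun y => coneCutoff r (t, y) *
      inner ℝ (D (t, y) (timeVec d)) (D (t, y) (spaceVec j))) L x ∧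
      L (EuclideanSpace.single j 1) = energyFlux r D A j (t, x) := by
  have hz : (t, x) ∈ Ioo 0 T ×ˢ (univ : Set (Space d)) := ⟨ht, mem_univ _⟩
  have hc : HasFDerivAt (fun y : Space d => (t, y)) (ContinuousLinearMap.inr ℝ ℝ (Space d)) x :=
    (hasFDerivAt_const t x).prodMk (hasFDerivAt_id x)
  have h1 := (hasFDerivAt_coneCutoff r (t, x)).comp x hc
  have h3 := fun v => (h.hasFDerivAt_apply hz v).comp x hc
  refine ⟨_, h1.mul ((h3 (timeVec d)).inner ℝ (h3 (spaceVec j))), ?_⟩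
  simp [energyFlux, spaceVec, PiLp.inner_apply]
  ring

/-- After subtraction of the divergence the mixed second derivatives cancel by symmetry. There
remain the cut-off times terms with the wave operator and with w, and the slope of the cut-off times
a quantity that is nonpositive for |x| ≤ r, because the cone closes faster than waves propagate. -/
theorem HasSecondOrderJet.rate_sub_flux_le (h : HasSecondOrderJet w D A T) (hr : 0 < r) {C : ℝ}
    (hC : 0 ≤ C) {t : ℝ} (ht : t ∈ Ioo 0 T) (x : Space d)
    (hw : ‖x‖ ≤ r → ‖A (t, x) (timeVec d) (timeVec d) -
      ∑ j, A (t, x) (spaceVec j) (spaceVec j)‖ ≤ C * ‖w (t, x)‖) :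
    energyRate r w D A (t, x) - ∑ j, 2 * energyFlux r D A j (t, x) ≤
      (C + 1) * (coneCutoff r (t, x) * energyDensity w D (t, x)) := by
  by_cases hx : x ∈ Metric.closedBall (0 : Space d) r
  swap
  · simp [energyRate, energyFlux, coneCutoff_eq_zero hr ht.1.le hx, coneSlope_eq_zero hr ht.1.le hx]
  rw [mem_closedBall_zero_iff] at hx
  replace hw := hw hx
  have hz : (t, x) ∈ Ioo 0 T ×ˢ (univ : Set (Space d)) := ⟨ht, mem_univ _⟩
  set z : ℝ × Space d := (t, x) with hzdef
  set P := D z (timeVec d) with hP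
  set Q := fun j => D z (spaceVec j) with hQ
  set W := w z
  have key : energyRate r w D A z - ∑ j, 2 * energyFlux r D A j z =
      coneSlope r z * ((∑ j, 4 * x j * inner ℝ P (Q j)) - 2 * r * energyDensity w D z) +
      coneCutoff r z * (2 * inner ℝ P (A z (timeVec d) (timeVec d) -
        ∑ j, A z (spaceVec j) (spaceVec j)) + 2 * inner ℝ W P) := by
    have e1 : ∀ j, 2 * energyFlux r D A j z = - (coneSlope r z * (4 * x j * inner ℝ P (Q j))) +
        coneCutoff r z * (2 * inner ℝ P (A z (spaceVec j) (spaceVec j))) +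
        coneCutoff r z * (2 * inner ℝ (Q j) (A z (timeVec d) (spaceVec j))) := fun j => by
      rw [energyFlux, h.symm z hz (spaceVec j) (timeVec d)]
      simp only [hzdef, hP, hQ]
      rw [real_inner_comm (D (t, x) (spaceVec j)) (A (t, x) (timeVec d) (spaceVec j))]
      ring
    simp only [e1, Finset.sum_add_distrib, Finset.sum_neg_distrib, ← Finset.mul_sum, inner_sub_right,
      inner_sum, energyRate, mul_sub]
    ring
  rw [key]
  have hx2 : ∑ j, x j ^ 2 ≤ r ^ 2 := by
    have := EuclideanSpace.real_norm_sq_eq x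
    rw [← this]
    exact pow_le_pow_left₀ (norm_nonneg _) hx 2
  -- Multiplied by r, each summand splits by the inequality of means into a part with xⱼ² |P|² and a
  -- part with r² |Qⱼ|². Then the sum of the xⱼ² is at most r².
  have hbr : (∑ j, 4 * x j * inner ℝ P (Q j)) ≤ 2 * r * energyDensity w D z := by
    have e2 : ∀ j, r * (4 * x j * inner ℝ P (Q j)) ≤ 2 * (x j ^ 2 * ‖P‖ ^ 2 + r ^ 2 * ‖Q j‖ ^ 2) :=
      fun j => by
        have h1 : x j * inner ℝ P (Q j) ≤ |x j| * (‖P‖ * ‖Q j‖) := by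
          refine (le_abs_self _).trans ?_
          rw [abs_mul]
          exact mul_le_mul_of_nonneg_left (abs_real_inner_le_norm _ _) (abs_nonneg _)
        have h2 := sq_nonneg (|x j| * ‖P‖ - r * ‖Q j‖)
        have h3 : |x j| ^ 2 = x j ^ 2 := sq_abs _
        have h4 : r * (x j * inner ℝ P (Q j)) ≤ r * (|x j| * (‖P‖ * ‖Q j‖)) :=
          mul_le_mul_of_nonneg_left h1 hr.le
        nlinarith
    have e3 : r * ∑ j, 4 * x j * inner ℝ P (Q j) ≤ r * (2 * r * energyDensity w D z) := by
      rw [Finset.mul_sum]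
      refine (Finset.sum_le_sum fun j _ => e2 j).trans ?_
      rw [← Finset.mul_sum, Finset.sum_add_distrib, ← Finset.sum_mul, ← Finset.mul_sum]
      have h5 := mul_le_mul_of_nonneg_right hx2 (sq_nonneg ‖P‖)
      have h6 : energyDensity w D z = ‖P‖ ^ 2 + ∑ j, ‖Q j‖ ^ 2 + ‖W‖ ^ 2 := rfl
      rw [h6]
      have h7 : 0 ≤ r ^ 2 * ‖W‖ ^ 2 := by positivity
      nlinarith
    exact le_of_mul_le_mul_left e3 hr
  have hlow : 2 * inner ℝ P (A z (timeVec d) (timeVec d) -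
        ∑ j, A z (spaceVec j) (spaceVec j)) + 2 * inner ℝ W P ≤ (C + 1) * energyDensity w D z := by
    have h1 : inner ℝ P (A z (timeVec d) (timeVec d) - ∑ j, A z (spaceVec j) (spaceVec j)) ≤
        ‖P‖ * (C * ‖W‖) :=
      (real_inner_le_norm _ _).trans (mul_le_mul_of_nonneg_left hw (norm_nonneg _))
    have h2 : inner ℝ W P ≤ ‖W‖ * ‖P‖ := real_inner_le_norm _ _
    have h6 : energyDensity w D z = ‖P‖ ^ 2 + ∑ j, ‖Q j‖ ^ 2 + ‖W‖ ^ 2 := rfl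
    have h7 : 0 ≤ ∑ j, ‖Q j‖ ^ 2 := Finset.sum_nonneg fun j _ => sq_nonneg _
    have h8 : 2 * (‖P‖ * ‖W‖) ≤ energyDensity w D z := by
      rw [h6]
      nlinarith [sq_nonneg (‖P‖ - ‖W‖)]
    have h9 := mul_le_mul_of_nonneg_left h8 hC
    nlinarith
  have h1 := mul_nonpos_of_nonneg_of_nonpos (coneSlope_nonneg r z) (sub_nonpos.2 hbr)
  have h2 := mul_le_mul_of_nonneg_left hlow (coneCutoff_nonneg r z)
  nlinarith

theorem HasSecondOrderJet.integral_flux (h : HasSecondOrderJet w D A T) (hr : 0 < r) {t : ℝ}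
    (ht : t ∈ Ioo 0 T) (j : Fin d) :
    Integrable (fun x => energyFlux r D A j (t, x)) ∧ ∫ x, energyFlux r D A j (t, x) = 0 := by
  have hi : Integrable (fun x => energyFlux r D A j (t, x)) :=
    integrable_slice (h.continuousOn_flux r j) ht (r := r) fun x hx => by
      simp [energyFlux, coneCutoff_eq_zero hr ht.1.le hx, coneSlope_eq_zero hr ht.1.le hx]
  refine ⟨hi, ?_⟩
  choose L hL hLe using fun x => h.hasFDerivAt_flux (r := r) ht x j
  have hfd : ∀ x, fderiv ℝ (fun y => coneCutoff r (t, y) *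
      inner ℝ (D (t, y) (timeVec d)) (D (t, y) (spaceVec j))) x (EuclideanSpace.single j 1) =
      energyFlux r D A j (t, x) := fun x => by rw [(hL x).fderiv, hLe x]
  have hg : Integrable (fun y => coneCutoff r (t, y) *
      inner ℝ (D (t, y) (timeVec d)) (D (t, y) (spaceVec j))) := by
    refine integrable_slice (f := fun z => coneCutoff r z *
      inner ℝ (D z (timeVec d)) (D z (spaceVec j))) (J := Ioo 0 T) (r := r) ?_ ht fun x hx => by
        simp [coneCutoff_eq_zero hr ht.1.le hx]
    have h2 : ∀ v, ContinuousOn (fun z => D z v) (Ioo 0 T ×ˢ univ) := fun v =>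
      (h.contOn_deriv.mono (slab_subset T)).clm_apply continuousOn_const
    exact (continuous_coneCutoff r).continuousOn.mul ((h2 _).inner (𝕜 := ℝ) (h2 _))
  have := integral_fderiv_apply_eq_zero (v := EuclideanSpace.single j 1) hg (by simpa only [hfd])
    fun x => (hL x).differentiableAt
  simpa only [hfd] using this

/-- The localized energy vanishes initially and satisfies E' ≤ (C + 1) E, since the flux integrates
to zero. Hence it vanishes at all times, and w with it wherever the cut-off is positive. -/
theorem HasSecondOrderJet.eq_zero (h : HasSecondOrderJet w D A T)
    (hw : ∀ r : ℝ, ∃ C, ∀ t ∈ Ioo 0 T, ∀ x : Space d, ‖x‖ ≤ r →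
      ‖A (t, x) (timeVec d) (timeVec d) - ∑ j, A (t, x) (spaceVec j) (spaceVec j)‖ ≤
        C * ‖w (t, x)‖)
    (h0 : ∀ x, energyDensity w D (0, x) = 0) {t : ℝ} (ht : t ∈ Icc 0 T) (x : Space d) :
    w (t, x) = 0 := by
  -- This radius puts (t, x) inside the cone: r² - 2rt is at least r (|x| + 1), which exceeds |x|².
  set r := 2 * T + ‖x‖ + 1 with hrdef
  have hT : 0 ≤ T := ht.1.trans ht.2
  have hr : 0 < r := by positivity
  obtain ⟨C₀, hC₀⟩ := hw r
  set C := max C₀ 0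
  have hd0 : ∀ z, 0 ≤ energyDensity w D z := fun z => by unfold energyDensity; positivity
  have hcont : ContinuousOn (fun z => coneCutoff r z * energyDensity w D z) (Icc 0 T ×ˢ univ) :=
    (continuous_coneCutoff r).continuousOn.mul h.continuousOn_density
  have hE : (∫ y, coneCutoff r (t, y) * energyDensity w D (t, y)) = 0 := by
    refine eq_zero_of_deriv_le (T := T) (K := C + 1)
      (E := fun t => ∫ y, coneCutoff r (t, y) * energyDensity w D (t, y))
      (E' := fun t => ∫ y, energyRate r w D A (t, y)) ?_ ?_ ?_ ?_ ?_ ht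
    · exact continuousOn_integral_of_compact_support
        (f := fun t y => coneCutoff r (t, y) * energyDensity w D (t, y))
        (isCompact_closedBall (0 : Space d) r) hcont fun s y hs hy => by
          simp [coneCutoff_eq_zero hr hs.1 hy]
    · intro s hs
      exact hasDerivAt_integral_of_support (J := Ioo 0 T)
        (f := fun t y => coneCutoff r (t, y) * energyDensity w D (t, y))
        (f' := fun t y => energyRate r w D A (t, y)) isOpen_Ioo (isCompact_closedBall 0 r)
        (hcont.mono (slab_subset T)) (h.continuousOn_rate r)
        (fun s hs y hy => by simp [coneCutoff_eq_zero hr hs.1.le hy])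
        (fun s hs y hy => by
          simp [energyRate, coneCutoff_eq_zero hr hs.1.le hy, coneSlope_eq_zero hr hs.1.le hy])
        (fun s hs y => h.hasDerivAt_energy hs y) hs
    · intro s hs
      have hrate : Integrable fun y => energyRate r w D A (s, y) :=
        integrable_slice (h.continuousOn_rate r) hs (r := r) fun y hy => by
          simp [energyRate, coneCutoff_eq_zero hr hs.1.le hy, coneSlope_eq_zero hr hs.1.le hy]
      have hflux : Integrable fun y => ∑ j, 2 * energyFlux r D A j (s, y) :=
        integrable_finsetSum _ fun j _ => ((h.integral_flux hr hs j).1).const_mul 2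
      have hen : Integrable fun y => coneCutoff r (s, y) * energyDensity w D (s, y) :=
        integrable_slice hcont (Ioo_subset_Icc_self hs) (r := r) fun y hy => by
          simp [coneCutoff_eq_zero hr hs.1.le hy]
      have e1 : ∫ y, energyRate r w D A (s, y) =
          ∫ y, (energyRate r w D A (s, y) - ∑ j, 2 * energyFlux r D A j (s, y)) := by
        rw [integral_sub hrate hflux, integral_finsetSum _ fun j _ =>
          ((h.integral_flux hr hs j).1).const_mul 2]
        simp [integral_const_mul, (h.integral_flux hr hs _).2]
      change ∫ y, energyRate r w D A (s, y) ≤ _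
      rw [e1, ← integral_const_mul]
      refine integral_mono (hrate.sub hflux) (hen.const_mul _) fun y => ?_
      refine h.rate_sub_flux_le hr (le_max_right _ _) hs y fun hy => (hC₀ s hs y hy).trans ?_
      exact mul_le_mul_of_nonneg_right (le_max_left _ _) (norm_nonneg _)
    · exact fun s _ => integral_nonneg fun y => mul_nonneg (coneCutoff_nonneg _ _) (hd0 _)
    · simp [h0]
  by_contra hne
  have hph : 0 < conePhase r (t, x) := by
    simp only [conePhase]
    have := ht.2
    have h1 : 2 * r * t ≤ 2 * r * T := by gcongr
    have h2 : 0 ≤ ‖x‖ := norm_nonneg x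
    nlinarith
  have hpos : coneCutoff r (t, x) * energyDensity w D (t, x) ≠ 0 := by
    refine mul_ne_zero (expNegInvGlue.pos_of_pos hph).ne' (ne_of_gt ?_)
    have : 0 < ‖w (t, x)‖ := norm_pos_iff.2 hne
    unfold energyDensity
    positivity
  have hc : Continuous fun y => coneCutoff r (t, y) * energyDensity w D (t, y) :=
    hcont.comp_continuous (f := fun y => (t, y)) (by fun_prop) fun y => ⟨ht, mem_univ _⟩
  have := hc.integral_pos_of_hasCompactSupport_nonneg_nonzero (μ := volume) (x := x)
    (HasCompactSupport.intro (isCompact_closedBall 0 r) fun y hy => by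
      simp [coneCutoff_eq_zero hr ht.1 hy])
    (fun y => mul_nonneg (coneCutoff_nonneg _ _) (hd0 _)) hpos
  exact this.ne' hE

/-- The full gradient vanishes at t = 0: the time derivative by assumption, the space derivatives
because w vanishes on the initial slice. So the initial energy density is zero. -/
theorem wave_eq_zero (hT : 0 < T) (hw : ContDiffOn ℝ ∞ w (Icc 0 T ×ˢ univ))
    (heq : ∀ r : ℝ, ∃ C, ∀ t ∈ Ioo 0 T, ∀ x : Space d, ‖x‖ ≤ r →
      ‖iteratedDeriv 2 (fun s => w (s, x)) t - (Δ (fun y => w (t, y))) x‖ ≤ C * ‖w (t, x)‖)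
    (h0 : ∀ x, w (0, x) = 0) (h1 : ∀ x, derivWithin (fun s => w (s, x)) (Icc 0 T) 0 = 0)
    {t : ℝ} (ht : t ∈ Icc 0 T) (x : Space d) : w (t, x) = 0 := by
  have hmem : (0 : ℝ) ∈ Icc 0 T := ⟨le_rfl, hT.le⟩
  refine (hasSecondOrderJet hT hw).eq_zero (fun r => ?_) (fun y => ?_) ht x
  · obtain ⟨C, hC⟩ := heq r
    refine ⟨C, fun t ht y hy => ?_⟩
    have h2 : ContDiffAt ℝ 2 w (t, y) :=
      (hw.contDiffAt (slab_mem_nhds ⟨ht, mem_univ _⟩)).of_le two_le_infty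
    have := hC t ht y hy
    rwa [iteratedDeriv_two_eq_fderiv h2, laplacian_slice_eq_fderiv h2] at this
  · have hD : HasFDerivWithinAt w (fderivWithin ℝ w (Icc 0 T ×ˢ univ) (0, y)) (Icc 0 T ×ˢ univ)
        (0, y) :=
      ((hw.differentiableOn (by simp)) (0, y) ⟨hmem, mem_univ _⟩).hasFDerivWithinAt
    have ht0 : fderivWithin ℝ w (Icc 0 T ×ˢ univ) (0, y) (timeVec d) = 0 := by
      have hc : HasDerivWithinAt (fun s : ℝ => (s, y)) (timeVec d) (Icc 0 T) 0 :=
        ((hasDerivAt_id' (0 : ℝ)).prodMk (hasDerivAt_const 0 y)).hasDerivWithinAt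
      have hmaps : MapsTo (fun s : ℝ => (s, y)) (Icc 0 T) (Icc 0 T ×ˢ univ) :=
        fun s hs => ⟨hs, mem_univ _⟩
      have := (HasFDerivWithinAt.comp_hasDerivWithinAt (0 : ℝ) hD hc hmaps).derivWithin
        (uniqueDiffOn_Icc hT 0 hmem)
      rw [← this]
      exact h1 y
    have hs0 : ∀ j, fderivWithin ℝ w (Icc 0 T ×ˢ univ) (0, y) (spaceVec j) = 0 := fun j => by
      have hc : HasFDerivWithinAt (fun y : Space d => ((0 : ℝ), y))
          (ContinuousLinearMap.inr ℝ ℝ (Space d)) univ y :=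
        ((hasFDerivAt_const (0 : ℝ) y).prodMk (hasFDerivAt_id y)).hasFDerivWithinAt
      have h3 := hD.comp y hc fun x _ => ⟨hmem, mem_univ _⟩
      have h4 : (w ∘ fun y : Space d => ((0 : ℝ), y)) = fun _ => 0 := funext fun y => h0 y
      rw [h4, hasFDerivWithinAt_univ] at h3
      have h5 := h3.unique (hasFDerivAt_const 0 y)
      have h6 := congrArg (fun L => L (EuclideanSpace.single j 1)) h5
      simpa [spaceVec] using h6
    simp [energyDensity, ht0, hs0, h0]

end Estimate

end Energy

theorem exists_lipschitz_nonlinearity (ρ k : ℕ) (B : ℝ) : ∃ C, ∀ a b : ℂ, ‖a‖ ≤ B → ‖b‖ ≤ B →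
    ‖a ^ ρ * (starRingEnd ℂ a) ^ k - b ^ ρ * (starRingEnd ℂ b) ^ k‖ ≤ C * ‖a - b‖ := by
  have hc : ContDiff ℝ 1 (fun a : ℂ => a ^ ρ * (starRingEnd ℂ a) ^ k) :=
    (contDiff_id.pow ρ).mul ((Complex.conjCLE.contDiff).pow k)
  obtain ⟨K, hK⟩ := (hc.locallyLipschitz.locallyLipschitzOn
    (s := Metric.closedBall (0 : ℂ) B)).exists_lipschitzOnWith_of_compact
    (isCompact_closedBall 0 B)
  refine ⟨K, fun a b ha hb => ?_⟩
  exact hK.norm_sub_le (by simpa using ha) (by simpa using hb)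

/-- Classical solutions are determined by their Cauchy data. -/
theorem IsClassicalSolution.unique {d : ℕ} {μ : ℂ} {ρ σ : ℕ} {T : ℝ} {u u' : ℝ → Space d → ℂ}
    (hT : 0 < T) (hu : IsClassicalSolution μ ρ σ T u) (hu' : IsClassicalSolution μ ρ σ T u')
    (h0 : u 0 = u' 0) (h1 : ∀ x, derivWithin (fun τ => u τ x) (Icc 0 T) 0 =
      derivWithin (fun τ => u' τ x) (Icc 0 T) 0) {t : ℝ} (ht : t ∈ Icc 0 T) : u t = u' t := by
  have hmem : (0 : ℝ) ∈ Icc 0 T := ⟨le_rfl, hT.le⟩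
  have hslice : ∀ {v : ℝ → Space d → ℂ}, ContDiffOn ℝ ∞ (fun z : ℝ × Space d => v z.1 z.2)
      (Icc 0 T ×ˢ univ) → ∀ x, ContDiffOn ℝ ∞ (fun s => v s x) (Icc 0 T) := fun {v} hv x =>
    hv.comp (f := fun s : ℝ => (s, x)) (by fun_prop) fun s hs => ⟨hs, mem_univ _⟩
  have hslice' : ∀ {v : ℝ → Space d → ℂ}, ContDiffOn ℝ ∞ (fun z : ℝ × Space d => v z.1 z.2)
      (Icc 0 T ×ˢ univ) → ∀ t ∈ Icc 0 T, ContDiff ℝ ∞ (v t) := fun {v} hv t ht =>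
    hv.comp_contDiff (f := fun x : Space d => (t, x)) (by fun_prop) fun s => ⟨ht, mem_univ _⟩
  funext x
  rw [← sub_eq_zero]
  refine wave_eq_zero (w := fun z => u z.1 z.2 - u' z.1 z.2) hT (hu.1.sub hu'.1) (fun r => ?_)
    (fun x => by simp [h0]) (fun x => ?_) ht x
  · have hK : IsCompact (Icc 0 T ×ˢ Metric.closedBall (0 : Space d) r) :=
      isCompact_Icc.prod (isCompact_closedBall 0 r)
    have hsub : Icc 0 T ×ˢ Metric.closedBall (0 : Space d) r ⊆ Icc 0 T ×ˢ univ :=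
      prod_mono Subset.rfl (subset_univ _)
    -- No global bound on the solutions is assumed. The energy estimate only looks at a ball, where
    -- both solutions are bounded and the nonlinearity is Lipschitz.
    obtain ⟨B, hB⟩ := hK.exists_bound_of_continuousOn (hu.1.continuousOn.mono hsub)
    obtain ⟨B', hB'⟩ := hK.exists_bound_of_continuousOn (hu'.1.continuousOn.mono hsub)
    obtain ⟨C, hC⟩ := exists_lipschitz_nonlinearity ρ (σ - ρ) (max B B')
    refine ⟨‖μ‖ * C, fun t ht x hx => ?_⟩
    have htc := Ioo_subset_Icc_self ht
    have hz : (t, x) ∈ Icc 0 T ×ˢ Metric.closedBall (0 : Space d) r := ⟨htc, by simpa using hx⟩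
    have hs : ∀ {v : ℝ → Space d → ℂ}, ContDiffOn ℝ ∞ (fun z : ℝ × Space d => v z.1 z.2)
      (Icc 0 T ×ˢ univ) → ContDiffAt ℝ (2 : ℕ) (fun s => v s x) t := fun hv =>
      ((hslice hv x).contDiffAt (Icc_mem_nhds ht.1 ht.2)).of_le two_le_infty
    have e1 : iteratedDeriv 2 (fun s => u s x - u' s x) t =
        iteratedDeriv 2 (fun s => u s x) t - iteratedDeriv 2 (fun s => u' s x) t :=
      iteratedDeriv_fun_sub (hs hu.1) (hs hu'.1)
    have e2 : (Δ (fun y => u t y - u' t y)) x = (Δ (u t)) x - (Δ (u' t)) x :=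
      ContDiffAt.laplacian_sub ((hslice' hu.1 t htc).contDiffAt.of_le two_le_infty)
        ((hslice' hu'.1 t htc).contDiffAt.of_le two_le_infty)
    simp only [e1, e2]
    rw [sub_sub_sub_comm, hu.2 t ht x, hu'.2 t ht x, mul_assoc, mul_assoc, ← mul_sub, norm_mul,
      mul_assoc]
    exact mul_le_mul_of_nonneg_left (hC _ _ ((hB _ hz).trans (le_max_left _ _))
      ((hB' _ hz).trans (le_max_right _ _))) (norm_nonneg _)
  · have hd : ∀ {v : ℝ → Space d → ℂ}, ContDiffOn ℝ ∞ (fun z : ℝ × Space d => v z.1 z.2)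
      (Icc 0 T ×ˢ univ) → DifferentiableWithinAt ℝ (fun s => v s x) (Icc 0 T) 0 := fun hv =>
      (hslice hv x).differentiableOn (by simp) 0 hmem
    rw [derivWithin_fun_sub (hd hu.1) (hd hu'.1), h1, sub_self]

end

section

/-! ### Wave packets -/

variable {d : ℕ} {G : Type} [AddCommGroup G] [MeasurableSpace G]

/-- The indicator function of a frequency ball. -/
def bump (ι : G →+ Space d) (r : ℝ) (ξ : G) : ℂ := if ‖ι ξ‖ ≤ r then 1 else 0

/-- The multiples of the basic frequency at which the wave packets sit. -/
def mode : Fin 4 → ℤ := ![1, -1, 2, -2]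

/-- The sum of the packets at the frequencies `k • η` with amplitudes `c k`. -/
def packets (ι : G →+ Space d) (r : ℝ) (η : G) (c : ℤ → ℂ) (ξ : G) : ℂ :=
  ∑ i, c (mode i) * bump ι r (ξ - mode i • η)

theorem one_le_abs_mode (i : Fin 4) : 1 ≤ |mode i| := by
  revert i; decide

theorem abs_mode_le (i : Fin 4) : |mode i| ≤ 2 := by
  revert i; decide

section

variable {m : Measure G} {ι : G →+ Space d} {a r : ℝ} {η : G}

theorem norm_map_zsmul (k : ℤ) (η : G) : ‖ι (k • η)‖ = |(k : ℝ)| * ‖ι η‖ := by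
  rw [map_zsmul, ← Int.cast_smul_eq_zsmul ℝ, norm_smul, Real.norm_eq_abs]

theorem norm_bump_le (ξ : G) : ‖bump ι r ξ‖ ≤ 1 := by
  unfold bump
  split_ifs <;> simp

theorem bump_neg (ξ : G) : bump ι r (-ξ) = bump ι r ξ := by
  simp [bump]

theorem bump_eq_norm (ξ : G) : bump ι r ξ = (‖bump ι r ξ‖ : ℂ) := by
  unfold bump
  split_ifs <;> simp

theorem bump_eq_zero {ξ : G} (h : r < ‖ι ξ‖) : bump ι r ξ = 0 := if_neg (not_le.2 h)

theorem measurableSet_frequencyBall (hι : Measurable ι) (r : ℝ) :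
    MeasurableSet {ξ : G | ‖ι ξ‖ ≤ r} := measurableSet_le hι.norm measurable_const

theorem measurable_bump (hι : Measurable ι) : Measurable (bump ι r) :=
  Measurable.ite (measurableSet_frequencyBall hι r) measurable_const measurable_const

/-- Chebyshev's inequality for the integrable function exp(-|ξ|), which is at least exp(-r) on the
ball. -/
theorem frequencyBall_lt_top [IsFrequencySpace m ι] (r : ℝ) : m {ξ | ‖ι ξ‖ ≤ r} < ⊤ := by
  refine lt_of_le_of_lt (measure_mono fun ξ hξ => ?_)
    ((IsFrequencySpace.integrable_exp (m := m) (ι := ι) 1 one_pos).measure_norm_ge_lt_top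
      (Real.exp_pos (-r)))
  simp only [mem_ofPred_eq, Real.norm_eq_abs, abs_of_pos (Real.exp_pos _)] at hξ ⊢
  exact Real.exp_le_exp.2 (by linarith)

/-- Where a|ξ| ≤ 1 the weight is at most e, so the bound involves neither a nor the position of the
support. This keeps the constants for the packets independent of their frequency. -/
theorem bd_of_support {h : G → ℂ} (hm : Measurable h) {A : Set G}
    (hA : MeasurableSet A) {B v : ℝ} (hB : 0 ≤ B) (hv : 0 ≤ v) (hAm : m A ≤ ENNReal.ofReal v)
    (hb : ∀ ξ, ‖h ξ‖ ≤ B) (hs : ∀ ξ ∉ A, h ξ = 0) (hAa : ∀ ξ ∈ A, a * ‖ι ξ‖ ≤ 1) :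
    Bd m ι a (Real.exp 1 * B * (1 + v)) h := by
  have he : 0 ≤ Real.exp 1 * B := by positivity
  have hpt : ∀ ξ, expWeight ι a ξ * ‖h ξ‖ ≤ Real.exp 1 * B := fun ξ => by
    by_cases hξ : ξ ∈ A
    · exact mul_le_mul (Real.exp_le_exp.2 (hAa ξ hξ)) (hb ξ) (norm_nonneg _) (Real.exp_pos _).le
    · rw [hs ξ hξ, norm_zero, mul_zero]
      exact he
  refine ⟨hm, ?_, fun ξ => (hpt ξ).trans (le_mul_of_one_le_right he (by linarith))⟩
  calc ∫⁻ ξ, ENNReal.ofReal (expWeight ι a ξ) * ‖h ξ‖ₑ ∂m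
      ≤ ∫⁻ ξ, A.indicator (fun _ => ENNReal.ofReal (Real.exp 1 * B)) ξ ∂m := by
        refine lintegral_mono fun ξ => ?_
        by_cases hξ : ξ ∈ A
        · rw [indicator_of_mem hξ, ← ofReal_norm, ← ENNReal.ofReal_mul (expWeight_pos ξ).le]
          exact ENNReal.ofReal_le_ofReal (hpt ξ)
        · simp [hs ξ hξ]
    _ = ENNReal.ofReal (Real.exp 1 * B) * m A := by rw [lintegral_indicator hA]; simp
    _ ≤ ENNReal.ofReal (Real.exp 1 * B) * ENNReal.ofReal v := by gcongr
    _ ≤ ENNReal.ofReal (Real.exp 1 * B * (1 + v)) := by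
        rw [← ENNReal.ofReal_mul he]
        exact ENNReal.ofReal_le_ofReal (by nlinarith)

theorem norm_packets_const (R : ℝ) (hR : 0 ≤ R) (ξ : G) :
    ‖packets ι r η (fun _ => (R : ℂ)) ξ‖ = ∑ i, R * ‖bump ι r (ξ - mode i • η)‖ := by
  have : packets ι r η (fun _ => (R : ℂ)) ξ =
      ((∑ i, R * ‖bump ι r (ξ - mode i • η)‖ : ℝ) : ℂ) := by
    unfold packets
    push_cast
    exact Finset.sum_congr rfl fun i _ => by rw [← bump_eq_norm]
  rw [this, Complex.norm_real, Real.norm_eq_abs, abs_of_nonneg]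
  positivity

/-- The coefficients may depend on the given ξ, as those of an evolved packet do. The comparison
profile has nonnegative equal amplitudes, so its modulus is the sum of the moduli even if packets
overlap. -/
theorem norm_sum_packets_le {c : Fin 4 → ℂ} {R δ : ℝ} (hR : 0 ≤ R) (ξ : G)
    (hc : ∀ i, ‖ι (ξ - mode i • η)‖ ≤ r → ‖c i‖ ≤ δ * R) :
    ‖∑ i, c i * bump ι r (ξ - mode i • η)‖ ≤ δ * ‖packets ι r η (fun _ => (R : ℂ)) ξ‖ := by
  rw [norm_packets_const R hR, Finset.mul_sum]
  refine (norm_sum_le _ _).trans (Finset.sum_le_sum fun i _ => ?_)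
  rw [norm_mul, ← mul_assoc]
  by_cases h : ‖ι (ξ - mode i • η)‖ ≤ r
  · exact mul_le_mul_of_nonneg_right (hc i h) (norm_nonneg _)
  · simp [bump_eq_zero (not_le.1 h)]

/-- The constant in the bound for one packet. -/
def packetConst (m : Measure G) (ι : G →+ Space d) (r : ℝ) : ℝ :=
  Real.exp 1 * 1 * (1 + (m {ξ | ‖ι ξ‖ ≤ r}).toReal)

theorem packetConst_pos (r : ℝ) : 0 < packetConst m ι r := by
  unfold packetConst
  positivity

variable [MeasurableAdd₂ G] [MeasurableNeg G] [SFinite m] [m.IsAddLeftInvariant]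
  [IsFrequencySpace m ι]

theorem bd_shift_bump {k : ℤ} (ha : 0 ≤ a) (hk : a * (|(k : ℝ)| * ‖ι η‖ + r) ≤ 1) :
    Bd m ι a (packetConst m ι r) (fun ξ => bump ι r (ξ - k • η)) := by
  have hι : Measurable ι := IsFrequencySpace.measurable m
  have hsub : Measurable fun ξ : G => ξ - k • η := by
    simp only [sub_eq_add_neg]
    exact measurable_id.add_const _
  have hA : MeasurableSet {ξ : G | ‖ι (ξ - k • η)‖ ≤ r} :=
    hsub (measurableSet_frequencyBall hι r)
  refine bd_of_support ((measurable_bump hι).comp hsub) hA zero_le_one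
    ENNReal.toReal_nonneg ?_ (fun ξ => norm_bump_le _) (fun ξ hξ => bump_eq_zero (not_le.1 hξ))
    fun ξ hξ => ?_
  · rw [ENNReal.ofReal_toReal (frequencyBall_lt_top r).ne]
    have := measure_preimage_add_right m (-(k • η)) {ξ : G | ‖ι ξ‖ ≤ r}
    simp only [← sub_eq_add_neg] at this
    exact this.le
  · have h1 : ‖ι ξ‖ ≤ ‖ι (k • η)‖ + ‖ι (ξ - k • η)‖ := by
      have : ι ξ = ι (k • η) + ι (ξ - k • η) := by rw [← map_add]; congr 1; abel
      rw [this]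
      exact norm_add_le _ _
    rw [norm_map_zsmul] at h1
    refine (mul_le_mul_of_nonneg_left (h1.trans (add_le_add_right hξ _)) ha).trans hk

theorem bd_packets {c : ℤ → ℂ} {R : ℝ} (hR : 0 ≤ R) (ha : 0 ≤ a)
    (hη : a * (2 * ‖ι η‖ + r) ≤ 1) (hc : ∀ i, ‖c (mode i)‖ ≤ R) :
    Bd m ι a (4 * R * packetConst m ι r) (packets ι r η c) := by
  have hι : Measurable ι := IsFrequencySpace.measurable m
  have h1 : ∀ i, Bd m ι a (R * packetConst m ι r)
      (fun ξ => c (mode i) * bump ι r (ξ - mode i • η)) := fun i => by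
    have hb : Bd m ι a (packetConst m ι r) (fun ξ => bump ι r (ξ - mode i • η)) := by
      refine bd_shift_bump ha (le_trans ?_ hη)
      have : |((mode i : ℤ) : ℝ)| ≤ 2 := by exact_mod_cast abs_mode_le i
      gcongr
    refine hb.of_le hι hR (fun ξ => ?_) (hb.meas.const_mul _)
    rw [norm_mul]
    exact mul_le_mul_of_nonneg_right (hc i) (norm_nonneg _)
  have h2 := (((h1 0).add hι (h1 1)).add hι (h1 2)).add hι (h1 3)
  have h3 : packets ι r η c = (fun ξ => c (mode 0) * bump ι r (ξ - mode 0 • η)) +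
      (fun ξ => c (mode 1) * bump ι r (ξ - mode 1 • η)) +
      (fun ξ => c (mode 2) * bump ι r (ξ - mode 2 • η)) +
      (fun ξ => c (mode 3) * bump ι r (ξ - mode 3 • η)) := by
    funext ξ
    simp [packets, Fin.sum_univ_four]
  rw [h3]
  exact h2.mono (by linarith)

end

/-- On a packet, the wave with matching initial velocity is nearly a travelling wave. -/
theorem norm_travelling_sub_le {w W t n : ℝ} (hn : 2 ≤ n) (hW : 2 * Real.pi * n ≤ |W|)
    (hw : |w - abs W| ≤ 2 * Real.pi) :
    ‖(Real.cos (w * t) : ℂ) + Complex.I * W * (waveKernel w t : ℂ) -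
      Complex.exp (Complex.I * (W * t : ℝ))‖ ≤ 4 * Real.pi * |t| + 2 / n := by
  have hpi := Real.pi_pos
  -- For n ≥ 2 the bound 2πn - 2π is at least πn. The term 2 / n of the claim arises as 2π / (πn),
  -- from the relative error (|W| - w) / w.
  have hw0 : Real.pi * n ≤ w := by
    have := (abs_le.1 hw).1
    nlinarith
  have hwpos : 0 < w := lt_of_lt_of_le (by positivity) hw0
  have e1 : (Real.cos (w * t) : ℂ) + Complex.I * W * (waveKernel w t : ℂ) -
      Complex.exp (Complex.I * (W * t : ℝ)) = ((Real.cos (w * t) - Real.cos (W * t) : ℝ) : ℂ) +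
        Complex.I * ((W * waveKernel w t - Real.sin (W * t) : ℝ) : ℂ) := by
    rw [mul_comm Complex.I (((W * t : ℝ)) : ℂ), Complex.exp_mul_I]
    push_cast
    ring
  have hcos : |Real.cos (w * t) - Real.cos (W * t)| ≤ 2 * Real.pi * |t| := by
    rw [← Real.cos_abs (W * t), ← Real.cos_abs (w * t), abs_mul, abs_mul, abs_of_pos hwpos]
    refine (Real.abs_cos_sub_cos_le _ _).trans ?_
    rw [← sub_mul, abs_mul, abs_abs]
    exact mul_le_mul_of_nonneg_right hw (abs_nonneg _)
  have hsin : |W * waveKernel w t - Real.sin (W * t)| ≤ 2 / n + 2 * Real.pi * |t| := by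
    have hk : waveKernel w t = Real.sin (w * t) / w := if_neg hwpos.ne'
    have key : |(|W|) * waveKernel w t - Real.sin (|W| * t)| ≤ 2 / n + 2 * Real.pi * |t| := by
      have e2 : |W| * waveKernel w t - Real.sin (|W| * t) =
          (|W| - w) / w * Real.sin (w * t) + (Real.sin (w * t) - Real.sin (|W| * t)) := by
        rw [hk]; field_simp; ring
      rw [e2]
      refine (abs_add_le _ _).trans (add_le_add ?_ ?_)
      · rw [abs_mul, abs_div, abs_of_pos hwpos, abs_sub_comm]
        refine (mul_le_of_le_one_right (by positivity) (Real.abs_sin_le_one _)).trans ?_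
        rw [div_le_div_iff₀ hwpos (by linarith)]
        have h1 : |w - abs W| * n ≤ 2 * Real.pi * n := by gcongr
        linarith
      · refine (Real.abs_sin_sub_sin_le _ _).trans ?_
        rw [← sub_mul, abs_mul]
        exact mul_le_mul_of_nonneg_right hw (abs_nonneg _)
    rcases abs_cases W with ⟨h, _⟩ | ⟨h, _⟩
    · rwa [h] at key
    · rw [h] at key
      rw [← abs_neg]
      convert key using 2
      rw [neg_mul W t, Real.sin_neg]
      ring
  rw [e1]
  refine (norm_add_le _ _).trans ?_
  rw [norm_mul, Complex.norm_I, one_mul, Complex.norm_real, Complex.norm_real, Real.norm_eq_abs,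
    Real.norm_eq_abs]
  linarith

/-! ### Convolution powers of packets -/

/-- The index set of the terms in an `(n + 1)`-fold convolution product of packets. -/
def ModeIndex : ℕ → Type
  | 0 => Fin 4
  | n + 1 => ModeIndex n × Fin 4

instance modeIndexFintype : ∀ n, Fintype (ModeIndex n)
  | 0 => inferInstanceAs (Fintype (Fin 4))
  | n + 1 => @instFintypeProd (ModeIndex n) (Fin 4) (modeIndexFintype n) _

/-- The frequency of a term of a convolution product. -/
def totalMode : ∀ n, ModeIndex n → ℤ
  | 0, i => mode i
  | n + 1, p => totalMode n p.1 + mode p.2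

/-- The four modes reach every such j with any number of at least two summands: a last mode can
always be chosen so that the remaining sum again lies in [-2, 2]. The modes ±1 alone would give no
vanishing sum of an odd number of terms. -/
theorem exists_totalMode_eq (n : ℕ) {j : ℤ} (hj : |j| ≤ 2) :
    ∃ p : ModeIndex (n + 1), totalMode (n + 1) p = j := by
  have hj' : j ∈ Finset.Icc (-2 : ℤ) 2 := Finset.mem_Icc.2 (abs_le.1 hj)
  induction n generalizing j with
  | zero =>
    have h : ∀ j ∈ Finset.Icc (-2 : ℤ) 2, ∃ p : Fin 4 × Fin 4, mode p.1 + mode p.2 = j := by decide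
    obtain ⟨p, hp⟩ := h j hj'
    exact ⟨(p.1, p.2), hp⟩
  | succ n ih =>
    have h : ∀ j ∈ Finset.Icc (-2 : ℤ) 2, ∃ i : Fin 4, j - mode i ∈ Finset.Icc (-2 : ℤ) 2 := by
      decide
    obtain ⟨i, hi⟩ := h j hj'
    obtain ⟨p, hp⟩ := ih (abs_le.2 (Finset.mem_Icc.1 hi)) hi
    exact ⟨(p, i), by change totalMode (n + 1) p + mode i = j; rw [hp]; ring⟩

section

variable {m : Measure G} {ι : G →+ Space d} {a r : ℝ} {η : G}
  [MeasurableAdd₂ G] [MeasurableNeg G] [SFinite m] [m.IsAddLeftInvariant]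
  [IsFrequencySpace m ι]

theorem conv_shift (f g : G → ℂ) (η η' ξ : G) :
    conv m (fun ξ => f (ξ - η)) (fun ξ => g (ξ - η')) ξ = conv m f g (ξ - (η + η')) := by
  unfold conv
  rw [← integral_sub_right_eq_self (fun ζ => f ζ * g (ξ - (η + η') - ζ)) η]
  refine integral_congr_ae (Eventually.of_forall fun ζ => ?_)
  simp only
  congr 2
  abel

theorem Bd.decays {f : G → ℂ} {M : ℝ} (ha : 0 < a) (h : Bd m ι a M f) : Decays ι f :=
  ⟨h.meas, a, ha, M, h.nonneg, h.norm_le⟩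

theorem exists_bd_bump (m : Measure G) [SFinite m] [m.IsAddLeftInvariant] (ι : G →+ Space d)
    [IsFrequencySpace m ι] (r : ℝ) : ∃ a > 0, Bd m ι a (packetConst m ι r) (bump ι r) := by
  refine ⟨1 / (1 + |r|), by positivity, ?_⟩
  have := bd_shift_bump (m := m) (ι := ι) (η := 0) (r := r) (k := 0) (a := 1 / (1 + |r|))
    (by positivity) ?_
  · simpa using this
  · simp only [Int.cast_zero, abs_zero, zero_mul, zero_add]
    rw [one_div, inv_mul_le_iff₀ (by positivity)]
    linarith [le_abs_self r]

theorem conv_sum_shift {I J : Type} [Fintype I] [Fintype J] {f g : G → ℂ} {M M' : ℝ} (ha : 0 ≤ a)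
    (hf : Bd m ι a M f) (hg : Bd m ι a M' g) (c : I → ℂ) (c' : J → ℂ) (k : I → G) (l : J → G)
    (ξ : G) :
    conv m (fun ξ => ∑ i, c i * f (ξ - k i)) (fun ξ => ∑ j, c' j * g (ξ - l j)) ξ =
      ∑ p : I × J, c p.1 * c' p.2 * conv m f g (ξ - (k p.1 + l p.2)) := by
  have hintg : ∀ p : I × J, Integrable (fun ζ => f (ζ - k p.1) * g (ξ - ζ - l p.2)) m := fun p => by
    have := (integrable_conv_integrand ha hf hg (ξ - (k p.1 + l p.2))).comp_sub_right (k p.1)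
    refine this.congr (Eventually.of_forall fun ζ => ?_)
    simp only
    congr 2
    abel
  have h1 : ∀ p : I × J, conv m f g (ξ - (k p.1 + l p.2)) =
      ∫ ζ, f (ζ - k p.1) * g (ξ - ζ - l p.2) ∂m := fun p => (conv_shift f g _ _ ξ).symm
  simp only [h1, ← integral_const_mul]
  rw [← integral_finsetSum _ fun p _ => (hintg p).const_mul _]
  unfold conv
  refine integral_congr_ae (Eventually.of_forall fun ζ => ?_)
  simp only
  rw [Fintype.sum_mul_sum, Fintype.sum_prod_type]
  exact Finset.sum_congr rfl fun i _ => Finset.sum_congr rfl fun j _ => by ring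

/-- The expansion has one term for each choice of a packet in every factor. Since the phase of a
packet is z to the power of its mode, a term depends on z only through its total mode. -/
theorem convProd_packets {z : ℂ} (hz : z ≠ 0) (R : ℝ) (n : ℕ) (ξ : G) :
    convProd m (fun _ => packets ι r η (fun k => R * z ^ k)) n ξ =
      ∑ p : ModeIndex n, (R : ℂ) ^ (n + 1) * z ^ (totalMode n p) *
        convProd m (fun _ => bump ι r) n (ξ - totalMode n p • η) := by
  obtain ⟨a, ha, hb⟩ := exists_bd_bump m ι r
  have hι : Measurable ι := IsFrequencySpace.measurable m
  induction n generalizing ξ with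
  | zero =>
    simp only [zero_add, pow_one]
    rfl
  | succ n ih =>
    change conv m (convProd m (fun _ => packets ι r η (fun k => R * z ^ k)) n)
      (packets ι r η (fun k => R * z ^ k)) ξ = _
    rw [show convProd m (fun _ => packets ι r η (fun k => R * z ^ k)) n = _ from funext ih]
    refine (conv_sum_shift ha.le (Bd.convProd hι ha.le (fun _ => hb) n) hb _ _ _ _ ξ).trans ?_
    refine Fintype.sum_equiv (Equiv.refl (ModeIndex n × Fin 4)) _ _ fun p => ?_
    change _ = (R : ℂ) ^ (n + 1 + 1) * z ^ (totalMode n p.1 + mode p.2) *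
      conv m (convProd m (fun _ => bump ι r) n) (bump ι r) (ξ - (totalMode n p.1 + mode p.2) • η)
    rw [zpow_add₀ hz, add_zsmul]
    ring

/-- Convolutions of nonnegative functions are nonnegative; this rules out cancellation in the lower
bound for the interaction. -/
theorem convProd_bump_eq_norm (n : ℕ) (ξ : G) :
    convProd m (fun _ => bump ι r) n ξ = (‖convProd m (fun _ => bump ι r) n ξ‖ : ℂ) := by
  induction n generalizing ξ with
  | zero => exact bump_eq_norm ξ
  | succ n ih =>
    have h : convProd m (fun _ => bump ι r) (n + 1) ξ =
        ((∫ ζ, ‖convProd m (fun _ => bump ι r) n ζ‖ * ‖bump ι r (ξ - ζ)‖ ∂m : ℝ) : ℂ) := by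
      rw [← integral_complex_ofReal]
      refine integral_congr_ae (Eventually.of_forall fun ζ => ?_)
      simp only
      push_cast
      rw [← ih ζ, ← bump_eq_norm]
    rw [h, Complex.norm_real, Real.norm_eq_abs, abs_of_nonneg]
    exact integral_nonneg fun ζ => by positivity

theorem convProd_bump_eq_zero (n : ℕ) {ξ : G} (hξ : (n + 1) * r < ‖ι ξ‖) :
    convProd m (fun _ => bump ι r) n ξ = 0 := by
  induction n generalizing ξ with
  | zero => exact bump_eq_zero (by simpa using hξ)
  | succ n ih =>
    refine integral_eq_zero_of_ae (Eventually.of_forall fun ζ => ?_)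
    simp only [Pi.zero_apply]
    by_cases h : (n + 1) * r < ‖ι ζ‖
    · rw [ih h, zero_mul]
    · rw [bump_eq_zero, mul_zero]
      have h1 : ‖ι ξ‖ ≤ ‖ι ζ‖ + ‖ι (ξ - ζ)‖ := by
        have : ι ξ = ι ζ + ι (ξ - ζ) := by rw [← map_add]; congr 1; abel
        rw [this]
        exact norm_add_le _ _
      push_cast at hξ
      linarith [not_lt.1 h]

theorem synth_zero (h : G → ℂ) : synth m ι h 0 = ∫ ξ, h ξ ∂m := by
  simp [synth, planeWave]

variable [m.IsNegInvariant]

/-- The integral of a profile is the value at x = 0 of the synthesized function, and there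
convolutions become products. -/
theorem integral_convProd_bump (n : ℕ) :
    Decays ι (convProd m (fun _ => bump ι r) n) ∧
      ∫ ξ, convProd m (fun _ => bump ι r) n ξ ∂m = ((m {ξ | ‖ι ξ‖ ≤ r}).toReal : ℂ) ^ (n + 1) := by
  obtain ⟨a, ha, hb⟩ := exists_bd_bump m ι r
  have hι : Measurable ι := IsFrequencySpace.measurable m
  have h0 : ∫ ξ, bump ι r ξ ∂m = ((m {ξ | ‖ι ξ‖ ≤ r}).toReal : ℂ) := by
    have : bump ι r = {ξ : G | ‖ι ξ‖ ≤ r}.indicator fun _ => (1 : ℂ) := by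
      funext ξ
      simp [bump, indicator]
    rw [this, integral_indicator (measurableSet_frequencyBall hι r)]
    simp [Measure.real]
  induction n with
  | zero => exact ⟨hb.decays ha, by simpa [convProd] using h0⟩
  | succ n ih =>
    refine ⟨ih.1.conv (hb.decays ha), ?_⟩
    rw [← synth_zero (ι := ι)]
    change synth m ι (conv m _ _) 0 = _
    rw [synth_conv ih.1 (hb.decays ha), synth_zero, synth_zero, ih.2, h0,
      ← pow_succ]

/-- For |z| = 1 the conjugate of z^k is z^(-k), and the modes are symmetric about 0. So the packets
describe a real-valued function, and u and its conjugate give the same factor in the nonlinearity.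
-/
theorem sharp_packets {z : ℂ} (hz : ‖z‖ = 1) (R : ℝ) :
    sharp (packets ι r η (fun k => R * z ^ k)) = packets ι r η (fun k => R * z ^ k) := by
  have hc : ∀ k : ℤ, starRingEnd ℂ (z ^ k) = z ^ (-k) := fun k => by
    rw [map_zpow₀, zpow_neg, ← inv_zpow]
    congr 1
    exact (Complex.inv_eq_conj hz).symm
  have hb : ∀ ξ, starRingEnd ℂ (bump ι r ξ) = bump ι r ξ := fun ξ => by
    unfold bump
    split_ifs <;> simp
  have hn : ∀ (k : ℤ) (ξ : G), bump ι r (-ξ - k • η) = bump ι r (ξ - (-k) • η) := fun k ξ => by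
    rw [← bump_neg]
    congr 1
    rw [neg_zsmul]
    abel
  funext ξ
  simp only [sharp, packets, hn, Fin.sum_univ_four, map_add, map_mul, hc, hb, Complex.conj_ofReal]
  simp only [mode, Matrix.cons_val, neg_neg]
  ring

/-- At low frequencies the nonlinear interaction of the packets does not depend on time. -/
theorem nonlinProfile_packets {z : ℂ} (hz : ‖z‖ = 1) (R : ℝ) (ρ : ℕ) {σ : ℕ} (hσ : 2 ≤ σ) {ξ : G}
    {s : ℝ} (hξ : ‖ι ξ‖ ≤ s) (hη : s + σ * r < ‖ι η‖) :
    nonlinProfile m ρ σ (packets ι r η (fun k => R * z ^ k)) ξ =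
      (Fintype.card {p : ModeIndex (σ - 1) // totalMode (σ - 1) p = 0} : ℂ) * (R : ℂ) ^ σ *
        convProd m (fun _ => bump ι r) (σ - 1) ξ := by
  have hz0 : z ≠ 0 := fun h => by simp [h] at hz
  have hσ' : σ - 1 + 1 = σ := by omega
  have e1 : nonlinProfile m ρ σ (packets ι r η (fun k => R * z ^ k)) =
      convProd m (fun _ => packets ι r η (fun k => R * z ^ k)) (σ - 1) := by
    simp only [nonlinProfile, sharp_packets hz, ite_self]
  rw [e1, convProd_packets hz0, hσ']
  -- Terms of nonzero total mode sit at distance at least |η| from the origin and do not reach ξ;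
  -- for total mode zero the phase is z^0 = 1.
  have e2 : ∀ p : ModeIndex (σ - 1), (R : ℂ) ^ σ * z ^ (totalMode (σ - 1) p) *
      convProd m (fun _ => bump ι r) (σ - 1) (ξ - totalMode (σ - 1) p • η) =
      if totalMode (σ - 1) p = 0 then
        (R : ℂ) ^ σ * convProd m (fun _ => bump ι r) (σ - 1) ξ else 0 := fun p => by
    split_ifs with h
    · simp [h]
    · rw [convProd_bump_eq_zero, mul_zero]
      have h1 : (1 : ℝ) ≤ |((totalMode (σ - 1) p : ℤ) : ℝ)| := by
        exact_mod_cast Int.one_le_abs h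
      have h2 := norm_map_zsmul (ι := ι) (totalMode (σ - 1) p) η
      have h3 : ‖ι (totalMode (σ - 1) p • η)‖ ≤
          ‖ι ξ‖ + ‖ι (ξ - totalMode (σ - 1) p • η)‖ := by
        have : ι (totalMode (σ - 1) p • η) = ι ξ - ι (ξ - totalMode (σ - 1) p • η) := by
          rw [← map_sub]; congr 1; abel
        rw [this]
        exact norm_sub_le _ _
      have h4 : ‖ι η‖ ≤ |((totalMode (σ - 1) p : ℤ) : ℝ)| * ‖ι η‖ :=
        le_mul_of_one_le_left (norm_nonneg _) h1
      have h5 : ((σ - 1 : ℕ) : ℝ) + 1 = σ := by exact_mod_cast hσ'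
      rw [h5]
      linarith
  rw [Finset.sum_congr rfl fun p _ => e2 p, ← Finset.sum_filter, Finset.sum_const,
    ← Fintype.card_subtype, nsmul_eq_mul, mul_assoc]

theorem one_le_card_totalMode_eq_zero {σ : ℕ} (hσ : 2 ≤ σ) :
    1 ≤ Fintype.card {p : ModeIndex (σ - 1) // totalMode (σ - 1) p = 0} := by
  obtain ⟨n, rfl⟩ : ∃ n, σ = n + 2 := ⟨σ - 2, by omega⟩
  obtain ⟨p, hp⟩ := exists_totalMode_eq n (j := 0) (by simp)
  exact Fintype.card_pos_iff.2 ⟨⟨p, hp⟩⟩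

end

end

section

/-! ### Norm inflation on the frequency side -/

variable {d : ℕ} {G : Type} [AddCommGroup G] [MeasurableSpace G]

/-- Bounded profiles with bounded support. -/
def Nice (ι : G →+ Space d) (h : G → ℂ) : Prop :=
  Measurable h ∧ ∃ B ≥ 0, ∃ K ≥ 0, ∀ ξ, ‖h ξ‖ ≤ B ∧ (K < ‖ι ξ‖ → h ξ = 0)

/-- The initial amplitudes of the packets. -/
def packetAmplitude (R : ℝ) (_ : ℤ) : ℂ := R

/-- The initial velocities of the packets, for which they travel in one direction. -/
def packetVelocity (R n : ℝ) (k : ℤ) : ℂ := Complex.I * ((2 * Real.pi * n * k : ℝ) : ℂ) * R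

/-- The amplitudes of the packets at time `t`. -/
def packetPhase (R n t : ℝ) (k : ℤ) : ℂ :=
  R * Complex.exp (Complex.I * ((2 * Real.pi * n * t : ℝ) : ℂ)) ^ k

theorem norm_packetPhase {R : ℝ} (hR : 0 ≤ R) (n t : ℝ) (k : ℤ) : ‖packetPhase R n t k‖ = R := by
  rw [packetPhase, norm_mul, norm_zpow, mul_comm Complex.I, Complex.norm_exp_ofReal_mul_I, one_zpow,
    mul_one, Complex.norm_real, Real.norm_eq_abs, abs_of_nonneg hR]

theorem packetPhase_eq (R n t : ℝ) (k : ℤ) :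
    packetPhase R n t k = R * Complex.exp (Complex.I * ((2 * Real.pi * n * k * t : ℝ) : ℂ)) := by
  rw [packetPhase, ← Complex.exp_int_mul]
  congr 2
  push_cast
  ring

theorem duhamel_congr {ι : G →+ Space d} {f g : ℝ → G → ℂ} {t : ℝ}
    (h : ∀ s ∈ uIcc 0 t, f s = g s) : duhamel ι f t = duhamel ι g t := by
  funext ξ
  exact intervalIntegral.integral_congr fun s hs => by simp only [h s hs]

/-- At low frequencies and short times the wave has not started to oscillate: Jordan's inequality
sin x ≥ 2x/π, with π ≤ 4. -/
theorem half_le_waveKernel {w t : ℝ} (hw : 0 ≤ w) (ht : 0 ≤ t) (hwt : w * t ≤ 1) :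
    t / 2 ≤ waveKernel w t := by
  unfold waveKernel
  split_ifs with h
  · linarith
  · have hwp : 0 < w := lt_of_le_of_ne hw (Ne.symm h)
    rw [le_div_iff₀ hwp]
    have h1 := Real.mul_le_sin (x := w * t) (by positivity) (by linarith [Real.pi_gt_three])
    have h2 : (1 : ℝ) / 2 ≤ 2 / Real.pi := by
      rw [div_le_div_iff₀ (by norm_num) Real.pi_pos]
      linarith [Real.pi_le_four]
    have h3 : 1 / 2 * (w * t) ≤ 2 / Real.pi * (w * t) := by gcongr
    linarith

theorem integral_waveKernel_ge {w T : ℝ} (hw : 0 ≤ w) (hT : 0 ≤ T) (hwT : w * T ≤ 1) :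
    T ^ 2 / 4 ≤ ∫ s in (0 : ℝ)..T, waveKernel w (T - s) := by
  have h1 : ∫ s in (0 : ℝ)..T, (T - s) / 2 = T ^ 2 / 4 := by
    rw [intervalIntegral.integral_div, intervalIntegral.integral_sub (by simp) (by simp)]
    simp
    ring
  rw [← h1]
  refine intervalIntegral.integral_mono_on hT
    (Continuous.intervalIntegrable (by fun_prop) _ _)
    (Continuous.intervalIntegrable ((continuous_waveKernel w).comp (by fun_prop)) _ _)
    fun s hs => half_le_waveKernel hw (by linarith [hs.2]) (le_trans ?_ hwT)
  exact mul_le_mul_of_nonneg_left (by linarith [hs.1]) hw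

section

variable {m : Measure G} {ι : G →+ Space d} {a r : ℝ} {η : G}
  [MeasurableAdd₂ G] [MeasurableNeg G] [SFinite m] [m.IsAddLeftInvariant]
  [IsFrequencySpace m ι]

/-- The bound M is chosen before a; this matters because a shrinks later as the frequency of the
packets grows. -/
theorem Nice.exists_bd {h : G → ℂ} (m : Measure G) [IsFrequencySpace m ι] (hh : Nice ι h) :
    ∃ M K, 0 ≤ M ∧ ∀ a, 0 ≤ a → a * K ≤ 1 → Bd m ι a M h := by
  obtain ⟨hm, B, hB, K, hK, hb⟩ := hh
  have hι : Measurable ι := IsFrequencySpace.measurable m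
  refine ⟨Real.exp 1 * B * (1 + (m {ξ | ‖ι ξ‖ ≤ K}).toReal), K, by positivity, fun a ha haK => ?_⟩
  refine bd_of_support hm (measurableSet_frequencyBall hι K) hB ENNReal.toReal_nonneg
    (ENNReal.ofReal_toReal (frequencyBall_lt_top K).ne).ge (fun ξ => (hb ξ).1)
    (fun ξ hξ => (hb ξ).2 (not_le.1 hξ)) fun ξ hξ => ?_
  exact (mul_le_mul_of_nonneg_left hξ ha).trans haK

theorem norm_integral_cutoff_le {κ : Space d → ℝ} (hκ : ∀ x, κ x ∈ Icc (0 : ℝ) 1) {f : G → ℂ}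
    {M : ℝ} (ha : 0 ≤ a) (hf : Bd m ι a M f) : ‖∫ ξ, (κ (ι ξ) : ℂ) * f ξ ∂m‖ ≤ M := by
  refine (norm_integral_le_integral_norm _).trans (le_trans ?_ (hf.integral_norm_le ha))
  refine integral_mono_of_nonneg (Eventually.of_forall fun ξ => norm_nonneg _)
    (hf.integrable ha).norm (Eventually.of_forall fun ξ => ?_)
  simp only [norm_mul, Complex.norm_real, Real.norm_eq_abs, abs_of_nonneg (hκ _).1]
  exact mul_le_of_le_one_left (norm_nonneg _) (hκ _).2

theorem integrable_cutoff {κ : Space d → ℝ} (hκm : Measurable κ) (hκ : ∀ x, κ x ∈ Icc (0 : ℝ) 1)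
    {f : G → ℂ} {M : ℝ} (ha : 0 ≤ a) (hf : Bd m ι a M f) :
    Integrable (fun ξ => (κ (ι ξ) : ℂ) * f ξ) m := by
  have hι : Measurable ι := IsFrequencySpace.measurable m
  refine (hf.integrable ha).bdd_mul (c := 1)
    (Complex.measurable_ofReal.comp (hκm.comp hι)).aestronglyMeasurable
    (Eventually.of_forall fun ξ => ?_)
  rw [Complex.norm_real, Real.norm_eq_abs, abs_of_nonneg (hκ _).1]
  exact (hκ _).2

theorem measurable_freeWave (hι : Measurable ι) {h₀ h₁ : G → ℂ} (hm₀ : Measurable h₀)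
    (hm₁ : Measurable h₁) (t : ℝ) : Measurable (freeWave ι h₀ h₁ t) := by
  have h1 := measurable_freq hι
  unfold freeWave
  exact (((Complex.measurable_ofReal.comp (Real.measurable_cos.comp (h1.mul_const t))).mul hm₀).add
    ((Complex.measurable_ofReal.comp ((measurable_waveKernel t).comp h1)).mul hm₁))

theorem bd_freeWave {h₀ h₁ : G → ℂ} {M₀ M₁ t : ℝ} (hh₀ : Bd m ι a M₀ h₀) (hh₁ : Bd m ι a M₁ h₁)
    (ht : |t| ≤ 1) : Bd m ι a (M₀ + M₁) (freeWave ι h₀ h₁ t) := by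
  have hι : Measurable ι := IsFrequencySpace.measurable m
  have h1 : Bd m ι a (1 * M₀) (fun ξ => (Real.cos (freq ι ξ * t) : ℂ) * h₀ ξ) := by
    refine hh₀.of_le hι zero_le_one (fun ξ => ?_)
      ((Complex.measurable_ofReal.comp
        (Real.measurable_cos.comp ((measurable_freq hι).mul_const t))).mul hh₀.meas)
    rw [norm_mul, Complex.norm_real, Real.norm_eq_abs]
    gcongr
    exact Real.abs_cos_le_one _
  have h2 : Bd m ι a (1 * M₁) (fun ξ => (waveKernel (freq ι ξ) t : ℂ) * h₁ ξ) := by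
    refine hh₁.of_le hι zero_le_one (fun ξ => ?_)
      ((Complex.measurable_ofReal.comp
        ((measurable_waveKernel t).comp (measurable_freq hι))).mul hh₁.meas)
    rw [norm_mul, Complex.norm_real, Real.norm_eq_abs]
    gcongr
    exact (abs_waveKernel_le _ _).trans ht
  have h3 := h1.add hι h2
  rw [one_mul, one_mul] at h3
  exact h3

/-- On the packet of mode k the point ξ is within r ≤ 1 of kη, so its wave frequency differs from
2πn|k| by at most 2π. Then `norm_travelling_sub_le` bounds the error of each coefficient. -/
theorem bd_freeWave_packets_sub {R n t : ℝ} (hR : 0 ≤ R) (hn : 2 ≤ n) (hη : ‖ι η‖ = n)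
    (hr : r ≤ 1) (ha : 0 ≤ a) (han : a * (2 * n + r) ≤ 1) :
    Bd m ι a ((4 * Real.pi * |t| + 2 / n) * (4 * R * packetConst m ι r))
      (freeWave ι (packets ι r η (packetAmplitude R)) (packets ι r η (packetVelocity R n)) t -
        packets ι r η (packetPhase R n t)) := by
  have hι : Measurable ι := IsFrequencySpace.measurable m
  have hmeas : ∀ c : ℤ → ℂ, Measurable (packets ι r η c) := fun c => by
    refine Finset.measurable_fun_sum _ fun i _ => Measurable.const_mul ?_ _
    refine (measurable_bump hι).comp ?_
    simp only [sub_eq_add_neg]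
    exact measurable_id.add_const _
  have hb : Bd m ι a (4 * R * packetConst m ι r) (packets ι r η (packetAmplitude R)) :=
    bd_packets hR ha (by rwa [hη]) fun i => by simp [packetAmplitude, abs_of_nonneg hR]
  refine hb.of_le hι (by have := Real.pi_pos; positivity) (fun ξ => ?_)
    ((measurable_freeWave hι (hmeas _) (hmeas _) t).sub (hmeas _))
  have e1 : (freeWave ι (packets ι r η (packetAmplitude R)) (packets ι r η (packetVelocity R n)) t -
        packets ι r η (packetPhase R n t)) ξ =
      ∑ i, (R * ((Real.cos (freq ι ξ * t) : ℂ) + Complex.I * (2 * Real.pi * n * mode i : ℝ) *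
        (waveKernel (freq ι ξ) t : ℂ) - Complex.exp (Complex.I * ((2 * Real.pi * n * mode i) * t : ℝ))))
          * bump ι r (ξ - mode i • η) := by
    simp only [Pi.sub_apply, freeWave, packets, Finset.mul_sum, ← Finset.sum_add_distrib,
      ← Finset.sum_sub_distrib]
    refine Finset.sum_congr rfl fun i _ => ?_
    rw [packetPhase_eq, packetAmplitude, packetVelocity]
    ring
  rw [e1]
  refine norm_sum_packets_le hR ξ fun i hi => ?_
  rw [norm_mul, Complex.norm_real, Real.norm_eq_abs, abs_of_nonneg hR, mul_comm R]
  refine mul_le_mul_of_nonneg_right (norm_travelling_sub_le hn ?_ ?_) hR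
  all_goals
    have hpi := Real.pi_pos
    have hm1 : (1 : ℝ) ≤ |((mode i : ℤ) : ℝ)| := by exact_mod_cast one_le_abs_mode i
    have hW : |2 * Real.pi * n * mode i| = 2 * Real.pi * n * |((mode i : ℤ) : ℝ)| := by
      rw [abs_mul, abs_of_nonneg (by positivity)]
    rw [hW]
  · exact le_mul_of_one_le_right (by positivity) hm1
  · have h2 : |‖ι ξ‖ - ‖ι (mode i • η)‖| ≤ ‖ι (ξ - mode i • η)‖ := by
      rw [map_sub]
      exact abs_norm_sub_norm_le _ _
    rw [norm_map_zsmul, hη] at h2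
    have e2 : freq ι ξ - 2 * Real.pi * n * |((mode i : ℤ) : ℝ)| =
        2 * Real.pi * (‖ι ξ‖ - |((mode i : ℤ) : ℝ)| * n) := by
      unfold freq
      ring
    rw [e2, abs_mul, abs_of_pos (by positivity)]
    exact mul_le_of_le_one_right (by positivity) (h2.trans (hi.trans hr))

theorem continuous_packetPhase (R n : ℝ) (ξ : G) :
    Continuous fun t => packets ι r η (packetPhase R n t) ξ := by
  unfold packets
  refine continuous_finsetSum _ fun i _ => Continuous.mul ?_ continuous_const
  simp only [packetPhase_eq]
  fun_prop

theorem integral_cutoff_packets {κ : Space d → ℝ} (hκ0 : ∀ x : Space d, 1 / 4 < ‖x‖ → κ x = 0)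
    (hr : r ≤ 1 / 4) (hη : 1 ≤ ‖ι η‖) (c : ℤ → ℂ) :
    ∫ ξ, (κ (ι ξ) : ℂ) * packets ι r η c ξ ∂m = 0 := by
  refine integral_eq_zero_of_ae (Eventually.of_forall fun ξ => ?_)
  simp only [Pi.zero_apply]
  by_cases h : 1 / 4 < ‖ι ξ‖
  · simp [hκ0 _ h]
  · have : packets ι r η c ξ = 0 := Finset.sum_eq_zero fun i _ => by
      rw [bump_eq_zero, mul_zero]
      have h2 : ‖ι (mode i • η)‖ - ‖ι ξ‖ ≤ ‖ι (ξ - mode i • η)‖ := by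
        rw [map_sub, norm_sub_rev]
        exact norm_sub_norm_le _ _
      have hm1 : (1 : ℝ) ≤ |((mode i : ℤ) : ℝ)| := by exact_mod_cast one_le_abs_mode i
      rw [norm_map_zsmul] at h2
      have : 1 ≤ |((mode i : ℤ) : ℝ)| * ‖ι η‖ := one_le_mul_of_one_le_of_one_le hm1 hη
      linarith
    rw [this, mul_zero]

variable [m.IsNegInvariant]

/-- The interaction of the packets has a large low-frequency part. -/
theorem norm_integral_duhamel_packets_ge {κ : Space d → ℝ} (hκm : Measurable κ)
    (hκ : ∀ x, κ x ∈ Icc (0 : ℝ) 1) {r₀ : ℝ} (hr₀' : r₀ ≤ 1 / 4)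
    (hκ1 : ∀ x : Space d, ‖x‖ ≤ r₀ → κ x = 1) (hκ0 : ∀ x : Space d, 1 / 4 < ‖x‖ → κ x = 0)
    {R n T : ℝ} (hR : 0 ≤ R) (hη : 1 ≤ ‖ι η‖) (ρ : ℕ) {σ : ℕ} (hσ : 2 ≤ σ) (hr : σ * r = r₀)
    (ha : 0 < a) (han : a * (2 * ‖ι η‖ + r) ≤ 1) (hT : 0 ≤ T) (hT' : T ≤ 1 / 2) :
    R ^ σ * (T ^ 2 / 4) * (m {ξ | ‖ι ξ‖ ≤ r}).toReal ^ σ ≤ ‖∫ ξ, (κ (ι ξ) : ℂ) * duhamel ι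
      (fun s => nonlinProfile m ρ σ (packets ι r η (packetPhase R n s))) T ξ ∂m‖ := by
  have hι : Measurable ι := IsFrequencySpace.measurable m
  have hσ' : σ - 1 + 1 = σ := by omega
  set c₀ := Fintype.card {p : ModeIndex (σ - 1) // totalMode (σ - 1) p = 0} with hc₀
  have hc₀' : (1 : ℝ) ≤ c₀ := by exact_mod_cast one_le_card_totalMode_eq_zero hσ
  set B := convProd m (fun _ => bump ι r) (σ - 1) with hB
  have hBd : ∀ t, Bd m ι a (4 * R * packetConst m ι r) (packets ι r η (packetPhase R n t)) :=
    fun t => bd_packets hR ha.le han fun i => (norm_packetPhase hR n t _).le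
  have hF := fun t => (hBd t).nonlinProfile hι ha.le (ρ := ρ) (σ := σ) (by omega)
  have hFc := continuous_nonlinProfile ha ρ σ hBd (continuous_packetPhase R n)
  have hdu := Bd.duhamel hι hFc hF T
  set k := fun ξ => ∫ s in (0 : ℝ)..T, waveKernel (freq ι ξ) (T - s) with hk
  -- Where κ does not vanish the source is constant in time and comes out of Duhamel's integral. The
  -- average becomes the integral of a real function, which is bounded below pointwise.
  have hpt : ∀ ξ, (κ (ι ξ) : ℂ) * duhamel ι
      (fun s => nonlinProfile m ρ σ (packets ι r η (packetPhase R n s))) T ξ =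
      ((κ (ι ξ) * (c₀ * R ^ σ * k ξ * ‖B ξ‖) : ℝ) : ℂ) := fun ξ => by
    by_cases h : 1 / 4 < ‖ι ξ‖
    · simp [hκ0 _ h]
    · have h1 : ∀ s, nonlinProfile m ρ σ (packets ι r η (packetPhase R n s)) ξ =
          (c₀ : ℂ) * (R : ℂ) ^ σ * B ξ := fun s => by
        refine nonlinProfile_packets ?_ R ρ hσ (not_lt.1 h) (by rw [hr]; linarith)
        rw [mul_comm Complex.I, Complex.norm_exp_ofReal_mul_I]
      have h2 : duhamel ι (fun s => nonlinProfile m ρ σ (packets ι r η (packetPhase R n s))) T ξ =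
          (k ξ : ℂ) * ((c₀ : ℂ) * (R : ℂ) ^ σ * B ξ) := by
        simp only [duhamel, h1, hk]
        rw [intervalIntegral.integral_mul_const, intervalIntegral.integral_ofReal]
      have h3 : B ξ = (‖B ξ‖ : ℂ) := convProd_bump_eq_norm (σ - 1) ξ
      rw [h2]
      push_cast
      rw [← h3]
      ring
  have hintg : Integrable (fun ξ => κ (ι ξ) * (c₀ * R ^ σ * k ξ * ‖B ξ‖)) m := by
    have := integrable_cutoff hκm hκ ha.le hdu
    simp only [hpt] at this
    exact_mod_cast this.re
  have hBint := (integral_convProd_bump (m := m) (ι := ι) (r := r) (σ - 1)).1.integrable (m := m)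
  have hBI : ∫ ξ, ‖B ξ‖ ∂m = (m {ξ | ‖ι ξ‖ ≤ r}).toReal ^ σ := by
    have h1 := (integral_convProd_bump (m := m) (ι := ι) (r := r) (σ - 1)).2
    rw [integral_congr_ae (Eventually.of_forall fun ξ => convProd_bump_eq_norm (σ - 1) ξ),
      integral_complex_ofReal, hσ'] at h1
    exact_mod_cast h1
  rw [integral_congr_ae (Eventually.of_forall hpt), integral_complex_ofReal, Complex.norm_real]
  refine le_trans ?_ (le_abs_self _)
  rw [← hBI, ← integral_const_mul]
  refine integral_mono (hBint.norm.const_mul _) hintg fun ξ => ?_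
  simp only
  by_cases hBξ : B ξ = 0
  · simp [hBξ]
  -- The σ-fold convolution of bumps of radius r is supported in the ball of radius σ r = r₀, on
  -- which κ = 1.
  have hξ : ‖ι ξ‖ ≤ r₀ := by
    by_contra hc
    refine hBξ (convProd_bump_eq_zero _ ?_)
    have h5 : ((σ - 1 : ℕ) : ℝ) + 1 = σ := by exact_mod_cast hσ'
    rw [h5, hr]
    exact not_le.1 hc
  -- Here |ξ| ≤ 1/4 gives a frequency of at most π/2 ≤ 2, and T ≤ 1/2.
  have hfreq : 0 ≤ freq ι ξ ∧ freq ι ξ * T ≤ 1 := by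
    have hpi := Real.pi_pos
    have hpi4 := Real.pi_le_four
    have h0 : 0 ≤ freq ι ξ := by unfold freq; positivity
    have h1 : freq ι ξ ≤ 2 := by
      unfold freq
      nlinarith [norm_nonneg (ι ξ)]
    exact ⟨h0, by nlinarith⟩
  have hkξ := integral_waveKernel_ge hfreq.1 hT hfreq.2
  rw [hκ1 _ hξ, one_mul]
  refine mul_le_mul_of_nonneg_right ?_ (norm_nonneg _)
  have h6 : R ^ σ * (T ^ 2 / 4) ≤ R ^ σ * k ξ := mul_le_mul_of_nonneg_left hkξ (by positivity)
  have h7 : 0 ≤ R ^ σ * k ξ := le_trans (by positivity) h6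
  nlinarith

/-- At time T the solution is Φ + (L - Φ) + μ (D₁ + D₂), where D₁ is Duhamel's integral with source
N(Φ) and D₂ the one with source N(u) - N(Φ). Averaging against κ isolates D₁ up to the size of the
other terms, because |μ| = 1. Working on [-2T, 2T] leaves room around [0, T] for differentiation. -/
theorem exists_duhamel_solution_integral_ge {μ : ℂ} (hμ : ‖μ‖ = 1) (ρ : ℕ) {σ : ℕ} (hσ : 2 ≤ σ)
    {κ : Space d → ℝ} (hκm : Measurable κ) (hκ : ∀ x, κ x ∈ Icc (0 : ℝ) 1) (ha : 0 < a)
    {L Φ : ℝ → G → ℂ} {T M δ : ℝ} (hT : 0 < T)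
    (hL : ∀ t ∈ Icc (-(2 * T)) (2 * T), Bd m ι a M (L t)) (hLc : ∀ ξ, Continuous fun t => L t ξ)
    (hΦ : ∀ t, Bd m ι a (2 * M) (Φ t)) (hΦc : ∀ ξ, Continuous fun t => Φ t ξ)
    (hLΦ : ∀ t ∈ Icc (-(2 * T)) (2 * T), Bd m ι a δ (L t - Φ t))
    (hsmall : σ * (2 * T) ^ 2 * (2 * M) ^ (σ - 1) ≤ 1 / 2) :
    ∃ u : ℝ → G → ℂ, (∀ t, Bd m ι a (2 * M) (u t)) ∧ (∀ ξ, Continuous fun t => u t ξ) ∧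
      (∀ t ∈ Icc (-(2 * T)) (2 * T), u t =
        L t + μ • duhamel ι (fun s => nonlinProfile m ρ σ (u s)) t) ∧
      ‖∫ ξ, (κ (ι ξ) : ℂ) * duhamel ι (fun s => nonlinProfile m ρ σ (Φ s)) T ξ ∂m‖ ≤
        ‖∫ ξ, (κ (ι ξ) : ℂ) * u T ξ ∂m‖ + ‖∫ ξ, (κ (ι ξ) : ℂ) * Φ T ξ ∂m‖ + δ +
          T ^ 2 * (σ * (2 * M) ^ (σ - 1) * (δ + (2 * T) ^ 2 * (2 * M) ^ σ)) := by
  have hι : Measurable ι := IsFrequencySpace.measurable m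
  obtain ⟨u, hub, huc, hu⟩ := exists_duhamel_solution (ρ := ρ) ha hμ.le hσ (by positivity) hL hLc
    hsmall
  refine ⟨u, hub, huc, hu, ?_⟩
  have hTmem : T ∈ Icc (-(2 * T)) (2 * T) := ⟨by linarith, by linarith⟩
  have hM : 0 ≤ 2 * M := (hub 0).nonneg
  have hNu := fun t => (hub t).nonlinProfile hι ha.le (ρ := ρ) (σ := σ) (by omega)
  have hNΦ := fun t => (hΦ t).nonlinProfile hι ha.le (ρ := ρ) (σ := σ) (by omega)
  have hNuc := continuous_nonlinProfile ha ρ σ hub huc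
  have hNΦc := continuous_nonlinProfile ha ρ σ hΦ hΦc
  have hdiff : ∀ t ∈ Icc (-(2 * T)) (2 * T),
      Bd m ι a (δ + (2 * T) ^ 2 * (2 * M) ^ σ) (u t - Φ t) := fun t ht => by
    have e1 : u t - Φ t = (L t - Φ t) + μ • duhamel ι (fun s => nonlinProfile m ρ σ (u s)) t := by
      rw [hu t ht]
      abel
    rw [e1]
    refine ((hLΦ t ht).add hι ((Bd.duhamel hι hNuc hNu t).const_smul hι hμ.le)).mono ?_
    have h1 : t ^ 2 ≤ (2 * T) ^ 2 := sq_le_sq' ht.1 ht.2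
    gcongr
  have hD₂ : Bd m ι a (T ^ 2 * (σ * (2 * M) ^ (σ - 1) * (δ + (2 * T) ^ 2 * (2 * M) ^ σ)))
      (duhamel ι (fun s => nonlinProfile m ρ σ (u s) - nonlinProfile m ρ σ (Φ s)) T) := by
    -- The difference u - Φ is controlled on [-2T, 2T] only, whereas `Bd.duhamel` asks for all
    -- times; clamping the time changes nothing on [0, T].
    have e1 : duhamel ι (fun s => nonlinProfile m ρ σ (u s) - nonlinProfile m ρ σ (Φ s)) T =
        duhamel ι (fun s => nonlinProfile m ρ σ (u (clampTime (2 * T) s)) -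
          nonlinProfile m ρ σ (Φ (clampTime (2 * T) s))) T := by
      refine duhamel_congr fun s hs => ?_
      rw [uIcc_of_le hT.le] at hs
      rw [clampTime_of_mem ⟨by linarith [hs.1], by linarith [hs.2]⟩]
    rw [e1]
    refine Bd.duhamel hι (fun ξ => ?_) (fun s => ?_) T
    · exact ((hNuc ξ).comp (continuous_clampTime _)).sub ((hNΦc ξ).comp (continuous_clampTime _))
    · exact Bd.nonlinProfile_sub hι ha.le (by omega) (hub _) (hΦ _)
        (hdiff _ (clampTime_mem (by positivity) s))
  have hD₁ := Bd.duhamel hι hNΦc hNΦ T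
  have hsub := duhamel_sub (ι := ι) hNuc hNΦc T
  generalize duhamel ι (fun s => nonlinProfile m ρ σ (Φ s)) T = D₁ at *
  generalize duhamel ι (fun s => nonlinProfile m ρ σ (u s) - nonlinProfile m ρ σ (Φ s)) T = D₂ at *
  have hsplit : ∀ ξ, (κ (ι ξ) : ℂ) * u T ξ = (κ (ι ξ) : ℂ) * Φ T ξ + (κ (ι ξ) : ℂ) * (L T - Φ T) ξ +
      (μ * ((κ (ι ξ) : ℂ) * D₁ ξ) + μ * ((κ (ι ξ) : ℂ) * D₂ ξ)) := fun ξ => by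
    rw [hsub, hu T hTmem]
    simp only [Pi.add_apply, Pi.sub_apply, Pi.smul_apply, smul_eq_mul]
    ring
  have i1 := integrable_cutoff hκm hκ ha.le (hΦ T)
  have i2 := integrable_cutoff hκm hκ ha.le (hLΦ T hTmem)
  have i3 := (integrable_cutoff hκm hκ ha.le hD₁).const_mul μ
  have i4 := (integrable_cutoff hκm hκ ha.le hD₂).const_mul μ
  have hintg : ∫ ξ, (κ (ι ξ) : ℂ) * u T ξ ∂m = (∫ ξ, (κ (ι ξ) : ℂ) * Φ T ξ ∂m) +
      (∫ ξ, (κ (ι ξ) : ℂ) * (L T - Φ T) ξ ∂m) +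
      (μ * (∫ ξ, (κ (ι ξ) : ℂ) * D₁ ξ ∂m) + μ * ∫ ξ, (κ (ι ξ) : ℂ) * D₂ ξ ∂m) := by
    rw [← integral_const_mul, ← integral_const_mul, ← integral_add i1 i2, ← integral_add i3 i4]
    exact (integral_congr_ae (Eventually.of_forall hsplit)).trans
      (integral_add (i1.add i2) (i3.add i4))
  rw [hintg]
  clear hintg
  have b2 := norm_integral_cutoff_le hκ ha.le (hLΦ T hTmem)
  have b4 := norm_integral_cutoff_le hκ ha.le hD₂
  generalize ∫ ξ, (κ (ι ξ) : ℂ) * D₁ ξ ∂m = X₁ at *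
  generalize ∫ ξ, (κ (ι ξ) : ℂ) * D₂ ξ ∂m = X₂ at *
  generalize ∫ ξ, (κ (ι ξ) : ℂ) * (L T - Φ T) ξ ∂m = Y at *
  generalize ∫ ξ, (κ (ι ξ) : ℂ) * Φ T ξ ∂m = Z at *
  have e2 : ‖X₁‖ = ‖μ * X₁‖ := by rw [norm_mul, hμ, one_mul]
  have e3 : ‖X₂‖ = ‖μ * X₂‖ := by rw [norm_mul, hμ, one_mul]
  have tri : ‖μ * X₁‖ ≤ ‖Z + Y + (μ * X₁ + μ * X₂)‖ + ‖Z‖ + ‖Y‖ + ‖μ * X₂‖ := by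
    calc ‖μ * X₁‖ = ‖(Z + Y + (μ * X₁ + μ * X₂)) - Z - Y - μ * X₂‖ := by congr 1; ring
      _ ≤ _ := (norm_sub_le _ _).trans (add_le_add_left ((norm_sub_le _ _).trans
          (add_le_add_left (norm_sub_le _ _) _)) _)
  rw [e2]
  rw [e3] at b4
  linarith only [tri, b2, b4]

/-- The nice part of the data contributes M₀ + M₁, and the packets a multiple of (4π|t| + 2/n) R.
The short time absorbs R in the first summand and the large frequency n ≥ R absorbs it in the
second, so the total is O(P). -/
theorem bd_freeWave_add_packets_sub {R n t M₀ M₁ P : ℝ} {h₀ h₁ : G → ℂ} (hR : 0 ≤ R) (hn : 2 ≤ n)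
    (hη : ‖ι η‖ = n) (hr : r ≤ 1) (ha : 0 ≤ a) (han : a * (2 * n + r) ≤ 1)
    (hh₀ : Bd m ι a M₀ h₀) (hh₁ : Bd m ι a M₁ h₁) (ht : |t| ≤ 1) (htR : |t| * R ≤ 2 * P)
    (hRn : R ≤ n) (hP : 1 ≤ P) :
    Bd m ι a ((M₀ + M₁ + 4 * packetConst m ι r * (8 * Real.pi + 2)) * P)
      (freeWave ι (h₀ + packets ι r η (packetAmplitude R)) (h₁ + packets ι r η (packetVelocity R n)) t
        - packets ι r η (packetPhase R n t)) := by
  have hι : Measurable ι := IsFrequencySpace.measurable m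
  have e1 : freeWave ι (h₀ + packets ι r η (packetAmplitude R))
      (h₁ + packets ι r η (packetVelocity R n)) t - packets ι r η (packetPhase R n t) =
      freeWave ι h₀ h₁ t + (freeWave ι (packets ι r η (packetAmplitude R))
        (packets ι r η (packetVelocity R n)) t - packets ι r η (packetPhase R n t)) := by
    funext ξ
    simp only [freeWave, Pi.add_apply, Pi.sub_apply]
    ring
  rw [e1]
  refine ((bd_freeWave hh₀ hh₁ ht).add hι (bd_freeWave_packets_sub hR hn hη hr ha han)).mono ?_
  have hV := packetConst_pos (m := m) (ι := ι) r
  generalize packetConst m ι r = V at *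
  have hM₀ := hh₀.nonneg
  have hM₁ := hh₁.nonneg
  have hpi := Real.pi_pos
  have h2 : R / n ≤ 1 := by
    rw [div_le_one (by linarith only [hn])]
    exact hRn
  have h4 : (4 * Real.pi * |t| + 2 / n) * R ≤ (8 * Real.pi + 2) * P := by
    have h5 := mul_le_mul_of_nonneg_left htR (by positivity : 0 ≤ 4 * Real.pi)
    have h6 : (4 * Real.pi * |t| + 2 / n) * R = 4 * Real.pi * (|t| * R) + 2 * (R / n) := by ring
    rw [h6]
    linarith only [h5, h2, hP]
  have h7 : M₀ + M₁ ≤ (M₀ + M₁) * P := le_mul_of_one_le_right (by positivity) hP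
  calc M₀ + M₁ + (4 * Real.pi * |t| + 2 / n) * (4 * R * V)
      = M₀ + M₁ + 4 * V * ((4 * Real.pi * |t| + 2 / n) * R) := by ring
    _ ≤ (M₀ + M₁) * P + 4 * V * ((8 * Real.pi + 2) * P) := by gcongr
    _ = _ := by ring

theorem exists_large_parameter {ε I A Cr C₂ C₃ : ℝ} (hε : 0 < ε) (hI : 0 < I) (hCr : 0 ≤ Cr)
    (hC₂ : 0 ≤ C₂) (hC₃ : 0 ≤ C₃) :
    ∃ P : ℝ, 2 ≤ P ∧ 1 / P < ε ∧ C₃ ≤ P ∧ A + Cr * P + C₂ < P ^ 2 * I / 4 := by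
  have p1 : 0 < 1 / ε := by positivity
  have p2 := abs_nonneg A
  have p3 : 0 ≤ 4 * (Cr + 1 + C₂) / I := by positivity
  -- One summand for each requirement. The fourth makes P² I / 4 dominate (Cr + 1 + C₂) P, where one
  -- P is reserved for A.
  obtain ⟨P, hP⟩ : ∃ P, P = 2 + 1 / ε + |A| + 4 * (Cr + 1 + C₂) / I + C₃ := ⟨_, rfl⟩
  have hP0 : 0 < P := by linarith
  have hP1 : 1 ≤ P := by linarith
  refine ⟨P, by linarith, ?_, by linarith, ?_⟩
  · rw [div_lt_iff₀ hP0]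
    have : 1 / ε < P := by linarith
    rw [div_lt_iff₀ hε] at this
    linarith
  · have h1 : 4 * (Cr + 1 + C₂) / I ≤ P := by linarith
    rw [div_le_iff₀ hI] at h1
    have h2 := mul_le_mul_of_nonneg_right h1 hP0.le
    have h3 : A < P := lt_of_le_of_lt (le_abs_self A) (by linarith)
    have h4 : C₂ ≤ C₂ * P := le_mul_of_one_le_right hC₂ hP1
    linarith only [h2, h3, h4]

/-- The scales in the inflation argument: `R = P ^ 4` is the size of the data and
`T = P ^ (1 - 2 * σ)` the time. -/
theorem inflation_scales {P T M C : ℝ} (hP : 2 ≤ P) {σ : ℕ} (hσ : 2 ≤ σ)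
    (hT : T = 1 / P ^ (2 * σ - 1)) (hM : M = C * P ^ 4) :
    0 < T ∧ T ≤ 1 / P ∧ T * P ^ 4 ≤ P ∧ T ^ 2 * (P ^ 4) ^ σ = P ^ 2 ∧
      T ^ 2 * (2 * M) ^ σ = (2 * C) ^ σ * P ^ 2 ∧
      T ^ 2 * (2 * M) ^ (σ - 1) * P ^ 2 = (2 * C) ^ (σ - 1) := by
  have hP0 : 0 < P := by linarith
  have hP1 : 1 ≤ P := by linarith
  obtain ⟨n, rfl⟩ : ∃ n, σ = n + 2 := ⟨σ - 2, by omega⟩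
  have e0 : 2 * (n + 2) - 1 = 2 * n + 3 := by omega
  rw [e0] at hT
  have hTP : T * P ^ (2 * n + 3) = 1 := by rw [hT]; field_simp
  have hTpos : 0 < T := by rw [hT]; positivity
  -- With σ = n + 2 the exponent is 4σ - 2; the last three identities are this one multiplied by
  -- powers of P.
  have hT2 : T ^ 2 * P ^ (4 * n + 6) = 1 := by
    have := congrArg (· ^ 2) hTP
    simp only [mul_pow, one_pow, ← pow_mul] at this
    rw [← this]
    congr 2
    ring
  refine ⟨hTpos, ?_, ?_, ?_, ?_, ?_⟩
  · rw [hT]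
    refine one_div_le_one_div_of_le hP0 ?_
    exact le_self_pow₀ hP1 (by omega)
  · have h1 : T * P ^ 3 ≤ 1 := by
      rw [← hTP]
      exact mul_le_mul_of_nonneg_left (pow_le_pow_right₀ hP1 (by omega)) hTpos.le
    calc T * P ^ 4 = T * P ^ 3 * P := by ring
      _ ≤ 1 * P := by gcongr
      _ = P := one_mul P
  · calc T ^ 2 * (P ^ 4) ^ (n + 2) = T ^ 2 * P ^ (4 * n + 6) * P ^ 2 := by rw [← pow_mul]; ring
      _ = P ^ 2 := by rw [hT2, one_mul]
  · calc T ^ 2 * (2 * M) ^ (n + 2) = (2 * C) ^ (n + 2) * P ^ 2 * (T ^ 2 * P ^ (4 * n + 6)) := by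
          rw [hM, ← mul_assoc, mul_pow, ← pow_mul]; ring
      _ = _ := by rw [hT2, mul_one]
  · have e1 : n + 2 - 1 = n + 1 := by omega
    rw [e1]
    calc T ^ 2 * (2 * M) ^ (n + 1) * P ^ 2 = (2 * C) ^ (n + 1) * (T ^ 2 * P ^ (4 * n + 6)) := by
          rw [hM, ← mul_assoc, mul_pow, ← pow_mul]; ring
      _ = _ := by rw [hT2, mul_one]

end

section

variable [MeasurableAdd₂ G] [MeasurableNeg G]

/-- Small high-frequency perturbations of the data make a low-frequency average of the solution
large. -/
theorem exists_inflating_profile (m : Measure G) [SFinite m] [m.IsAddLeftInvariant]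
    [m.IsNegInvariant] (ι : G →+ Space d) [IsFrequencySpace m ι] {μ : ℂ} (hμ : ‖μ‖ = 1) (ρ : ℕ)
    {σ : ℕ} (hσ : 2 ≤ σ) {κ : Space d → ℝ} (hκm : Measurable κ) (hκ : ∀ x, κ x ∈ Icc (0 : ℝ) 1)
    {r₀ : ℝ} (hr₀ : 0 < r₀) (hr₀' : r₀ ≤ 1 / 4) (hκ1 : ∀ x : Space d, ‖x‖ ≤ r₀ → κ x = 1)
    (hκ0 : ∀ x : Space d, 1 / 4 < ‖x‖ → κ x = 0) {e : G} (he : ‖ι e‖ = 1) {h₀ h₁ : G → ℂ}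
    (hh₀ : Nice ι h₀) (hh₁ : Nice ι h₁) (A : ℝ) {ε : ℝ} (hε : 0 < ε) :
    ∃ R T : ℝ, 0 ≤ R ∧ 0 < T ∧ T < ε ∧ ∃ N₀ : ℕ, ∀ N : ℕ, N₀ ≤ N → ∃ (a M : ℝ) (u : ℝ → G → ℂ),
      0 < a ∧ (∀ t, Bd m ι a M (u t)) ∧ (∀ ξ, Continuous fun t => u t ξ) ∧
      (∀ t ∈ Icc (-(2 * T)) (2 * T), u t =
        freeWave ι (h₀ + packets ι (r₀ / σ) (N • e) (packetAmplitude R))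
          (h₁ + packets ι (r₀ / σ) (N • e) (packetVelocity R N)) t +
          μ • duhamel ι (fun s => nonlinProfile m ρ σ (u s)) t) ∧
      A < ‖∫ ξ, (κ (ι ξ) : ℂ) * u T ξ ∂m‖ := by
  have hσ1 : (1 : ℝ) ≤ σ := by exact_mod_cast (by omega : 1 ≤ σ)
  have hσ0 : (0 : ℝ) < σ := lt_of_lt_of_le one_pos hσ1
  have hσr : σ * (r₀ / σ) = r₀ := by field_simp
  have hrpos : 0 < r₀ / σ := by positivity
  have hrle : r₀ / σ ≤ 1 / 4 := (div_le_self hr₀.le hσ1).trans hr₀'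
  generalize r₀ / (σ : ℝ) = r at hσr hrpos hrle ⊢
  obtain ⟨M₀, K₀, hM₀, hb₀⟩ := hh₀.exists_bd m
  obtain ⟨M₁, K₁, hM₁, hb₁⟩ := hh₁.exists_bd m
  have hVpos : 0 < packetConst m ι r := packetConst_pos r
  have hIpos : 0 < (m {ξ | ‖ι ξ‖ ≤ r}).toReal ^ σ :=
    pow_pos (ENNReal.toReal_pos (IsFrequencySpace.ball_pos r hrpos).ne'
      (frequencyBall_lt_top r).ne) σ
  obtain ⟨Cr, hCr⟩ : ∃ C, C = M₀ + M₁ + 4 * packetConst m ι r * (8 * Real.pi + 2) := ⟨_, rfl⟩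
  have hpi := Real.pi_pos
  have hCr0 : 0 ≤ Cr := by rw [hCr]; positivity
  obtain ⟨CL, hCL⟩ : ∃ C, C = Cr + 4 * packetConst m ι r := ⟨_, rfl⟩
  have hCL0 : 0 ≤ CL := by rw [hCL]; positivity
  -- C₂ bounds the error of the first iterate uniformly in P, and C₃ is what the smallness condition
  -- of the Picard iteration requires. Nothing here involves the frequency N.
  obtain ⟨P, hP2, hPε, hP₃, hPA⟩ := exists_large_parameter (A := A)
    (C₂ := σ * (2 * CL) ^ (σ - 1) * (Cr + 4 * (2 * CL) ^ σ)) (C₃ := 8 * σ * (2 * CL) ^ (σ - 1))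
    hε hIpos hCr0 (by positivity) (by positivity)
  have hP1 : 1 ≤ P := by linarith only [hP2]
  have hP0 : 0 < P := by linarith only [hP2]
  obtain ⟨T, hT⟩ : ∃ T, T = 1 / P ^ (2 * σ - 1) := ⟨_, rfl⟩
  obtain ⟨M, hM⟩ : ∃ M, M = CL * P ^ 4 := ⟨_, rfl⟩
  obtain ⟨hTpos, hTP, hTR, hTRσ, hTMσ, hTM⟩ := inflation_scales hP2 hσ hT hM
  clear hT
  have hThalf : T ≤ 1 / 2 := hTP.trans (one_div_le_one_div_of_le (by norm_num) hP2)
  have hR0 : 0 ≤ P ^ 4 := by positivity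
  -- The bounds 2 and P⁴ on N serve the travelling wave approximation; K₀ and K₁ keep the supports
  -- of h₀ and h₁ below the frequency N.
  refine ⟨P ^ 4, T, hR0, hTpos, lt_of_le_of_lt hTP hPε,
    max 2 (max ⌈P ^ 4⌉₊ (max ⌈K₀⌉₊ ⌈K₁⌉₊)), fun N hN => ?_⟩
  simp only [max_le_iff] at hN
  obtain ⟨hN2, hNR, hNK₀, hNK₁⟩ := hN
  have hN2' : (2 : ℝ) ≤ N := by exact_mod_cast hN2
  have hNR' : P ^ 4 ≤ N := Nat.ceil_le.1 hNR
  have hK₀' : K₀ ≤ N := Nat.ceil_le.1 hNK₀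
  have hK₁' : K₁ ≤ N := Nat.ceil_le.1 hNK₁
  have hη : ‖ι (N • e)‖ = N := by
    rw [map_nsmul, ← Nat.cast_smul_eq_nsmul ℝ, norm_smul, he, mul_one]
    simp
  generalize hηdef : N • e = η at hη ⊢
  generalize hRdef : P ^ 4 = R at *
  -- For this a the weight is at most e up to frequency 2N + 1, which covers all packets and the
  -- supports of h₀ and h₁. So no constant depends on N.
  obtain ⟨a, haDef⟩ : ∃ a : ℝ, a = 1 / (2 * N + 1) := ⟨_, rfl⟩
  have ha : 0 < a := by rw [haDef]; positivity
  have haN : ∀ K : ℝ, K ≤ 2 * N + 1 → a * K ≤ 1 := fun K hK => by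
    rw [haDef, one_div, inv_mul_le_iff₀ (by positivity)]
    linarith only [hK]
  have han : a * (2 * N + r) ≤ 1 := haN _ (by linarith only [hrle])
  have hb₀' := hb₀ a ha.le (haN _ (by linarith only [hK₀', hN2']))
  have hb₁' := hb₁ a ha.le (haN _ (by linarith only [hK₁', hN2']))
  have hRP : P ≤ R := by
    rw [← hRdef]
    exact le_self_pow₀ hP1 (by norm_num)
  have hΦb : ∀ t, Bd m ι a (4 * R * packetConst m ι r) (packets ι r η (packetPhase R N t)) :=
    fun t => bd_packets hR0 ha.le (by rwa [hη]) fun i => (norm_packetPhase hR0 _ t _).le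
  have hrem : ∀ t ∈ Icc (-(2 * T)) (2 * T), Bd m ι a (Cr * P) _ := fun t ht => by
    have htabs : |t| ≤ 2 * T := abs_le.2 ht
    have htR := mul_le_mul_of_nonneg_right htabs hR0
    rw [hCr]
    exact bd_freeWave_add_packets_sub (t := t) hR0 hN2' hη (by linarith only [hrle]) ha.le han hb₀'
      hb₁' (by linarith only [htabs, hThalf]) (by linarith only [htR, hTR]) hNR' hP1
  have hCrP : Cr * P ≤ Cr * R := by gcongr
  have hLb : ∀ t ∈ Icc (-(2 * T)) (2 * T), Bd m ι a M (freeWave ι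
      (h₀ + packets ι r η (packetAmplitude R)) (h₁ + packets ι r η (packetVelocity R N)) t) :=
    fun t ht => by
    have h1 := (hrem t ht).add (IsFrequencySpace.measurable m) (hΦb t)
    rw [sub_add_cancel] at h1
    refine h1.mono ?_
    rw [hM, hCL]
    linarith only [hCrP]
  have hΦM : ∀ t, Bd m ι a (2 * M) (packets ι r η (packetPhase R N t)) := fun t =>
    (hΦb t).mono (by
      have h1 : 0 ≤ Cr * R := by positivity
      have h2 : 0 ≤ packetConst m ι r * R := by positivity
      rw [hM, hCL]
      linarith only [h1, h2])
  have hM0 : 0 ≤ M := by rw [hM]; positivity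
  have hsmall : σ * (2 * T) ^ 2 * (2 * M) ^ (σ - 1) ≤ 1 / 2 := by
    have h1 : σ * (2 * T) ^ 2 * (2 * M) ^ (σ - 1) * P ^ 2 = 4 * σ * (2 * CL) ^ (σ - 1) := by
      rw [← hTM]; ring
    have h2 : P ≤ P ^ 2 := le_self_pow₀ hP1 (by norm_num)
    have hP2' : 0 < P ^ 2 := by positivity
    refine le_of_mul_le_mul_right ?_ hP2'
    rw [h1]
    linarith only [hP₃, h2]
  obtain ⟨u, hub, huc, hu, hmain⟩ := exists_duhamel_solution_integral_ge hμ ρ hσ hκm hκ ha hTpos hLb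
    (fun ξ => by
      refine Continuous.add (Continuous.mul ?_ continuous_const)
        (Continuous.mul ?_ continuous_const)
      · exact Complex.continuous_ofReal.comp (Real.continuous_cos.comp (by fun_prop))
      · exact Complex.continuous_ofReal.comp (continuous_waveKernel _))
    hΦM (continuous_packetPhase R N) hrem hsmall
  refine ⟨a, 2 * M, u, ha, hub, huc, hu, ?_⟩
  have hlow := norm_integral_duhamel_packets_ge (m := m) (n := N) (T := T) (η := η) hκm hκ hr₀'
    hκ1 hκ0 hR0 (by rw [hη]; linarith only [hN2']) ρ hσ hσr ha (by rwa [hη]) hTpos.le hThalf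
  rw [integral_cutoff_packets hκ0 hrle (by rw [hη]; linarith only [hN2']), norm_zero,
    add_zero] at hmain
  have e1 : R ^ σ * (T ^ 2 / 4) * (m {ξ | ‖ι ξ‖ ≤ r}).toReal ^ σ =
      P ^ 2 * (m {ξ | ‖ι ξ‖ ≤ r}).toReal ^ σ / 4 := by
    rw [← hTRσ]; ring
  -- The deviation of the solution from the packets is O(P²), and T² times the Lipschitz constant is
  -- O(P⁻²), so this error is O(1).
  have e2 : T ^ 2 * (σ * (2 * M) ^ (σ - 1) * (Cr * P + (2 * T) ^ 2 * (2 * M) ^ σ)) ≤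
      σ * (2 * CL) ^ (σ - 1) * (Cr + 4 * (2 * CL) ^ σ) := by
    have h1 : Cr * P + (2 * T) ^ 2 * (2 * M) ^ σ ≤ (Cr + 4 * (2 * CL) ^ σ) * P ^ 2 := by
      have h2 : P ≤ P ^ 2 := le_self_pow₀ hP1 (by norm_num)
      have h3 : Cr * P ≤ Cr * P ^ 2 := by gcongr
      have h4 : (2 * T) ^ 2 * (2 * M) ^ σ = 4 * ((2 * CL) ^ σ * P ^ 2) := by rw [← hTMσ]; ring
      rw [h4]
      linarith only [h3]
    calc T ^ 2 * (σ * (2 * M) ^ (σ - 1) * (Cr * P + (2 * T) ^ 2 * (2 * M) ^ σ))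
        ≤ T ^ 2 * (σ * (2 * M) ^ (σ - 1) * ((Cr + 4 * (2 * CL) ^ σ) * P ^ 2)) := by gcongr
      _ = σ * (T ^ 2 * (2 * M) ^ (σ - 1) * P ^ 2) * (Cr + 4 * (2 * CL) ^ σ) := by ring
      _ = _ := by rw [hTM]
  rw [e1] at hlow
  linarith only [hlow, hmain, e2, hPA]

end

end

section

/-! ### Geometry of the unit cubes and weighted sums over the lattice -/

section

variable {d : ℕ}

/-- The lattice point of `ξ`'s unit cube. -/
def nearestPt (ξ : Space d) : Lattice d := fun i => ⌈ξ i - 1 / 2⌉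

theorem mem_unitCube_nearestPt (ξ : Space d) : ξ ∈ unitCube (nearestPt ξ) := fun i => by
  have h1 := Int.le_ceil (ξ i - 1 / 2)
  have h2 := Int.ceil_lt_add_one (ξ i - 1 / 2)
  exact ⟨by simp only [nearestPt]; linarith, by simp only [nearestPt]; linarith⟩

theorem int_eq_of_abs_sub_lt_one {m n : ℤ} (h : |(m : ℝ) - n| < 1) : m = n := by
  have h1 : |m - n| < 1 := by exact_mod_cast h
  rw [Int.abs_lt_one_iff] at h1
  omega

theorem eq_of_mem_unitCube {ξ : Space d} {m n : Lattice d} (hm : ξ ∈ unitCube m)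
    (hn : ξ ∈ unitCube n) : m = n := by
  funext i
  obtain ⟨h1, h2⟩ := hm i
  obtain ⟨h3, h4⟩ := hn i
  exact int_eq_of_abs_sub_lt_one (abs_lt.2 ⟨by linarith, by linarith⟩)

theorem pairwise_disjoint_unitCube :
    Pairwise (Function.onFun Disjoint (unitCube : Lattice d → Set (Space d))) := fun _ _ hmn =>
  Set.disjoint_left.2 fun _ h1 h2 => hmn (eq_of_mem_unitCube h1 h2)

theorem iUnion_unitCube : ⋃ n : Lattice d, unitCube n = univ :=
  eq_univ_of_forall fun ξ => mem_iUnion.2 ⟨_, mem_unitCube_nearestPt ξ⟩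

theorem measurableSet_unitCube (n : Lattice d) : MeasurableSet (unitCube n) := by
  have : unitCube n = ⋂ i, (fun ξ : Space d => ξ i - (n i : ℝ)) ⁻¹' Ioc (-(1 / 2) : ℝ) (1 / 2) := by
    ext ξ
    simp [unitCube]
  rw [this]
  exact MeasurableSet.iInter fun i => by
    have : Measurable fun ξ : Space d => ξ i - (n i : ℝ) := by fun_prop
    exact this measurableSet_Ioc

theorem volume_unitCube (n : Lattice d) : volume (unitCube n) = 1 := by
  have h : unitCube n = (@WithLp.ofLp 2 (Fin d → ℝ)) ⁻¹'
      (Set.pi univ fun i => Ioc ((n i : ℝ) - 1 / 2) ((n i : ℝ) + 1 / 2)) := by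
    ext ξ
    simp only [unitCube, mem_preimage, Set.mem_pi, mem_univ, true_implies, mem_Ioc]
    refine forall_congr' fun i => ?_
    constructor <;> rintro ⟨h1, h2⟩ <;> constructor <;> linarith
  rw [h, (PiLp.volume_preserving_ofLp (Fin d)).measure_preimage
    (MeasurableSet.univ_pi fun i => measurableSet_Ioc).nullMeasurableSet, Real.volume_pi_Ioc]
  refine Finset.prod_eq_one fun i _ => ?_
  rw [show (n i : ℝ) + 1 / 2 - ((n i : ℝ) - 1 / 2) = 1 by ring, ENNReal.ofReal_one]

theorem norm_latticePt_sq (n : Lattice d) : ‖latticePt n‖ ^ 2 = ∑ i, (n i : ℝ) ^ 2 := by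
  rw [EuclideanSpace.real_norm_sq_eq]
  rfl

theorem norm_le_of_abs_le {x : Space d} {c : ℝ} (h : ∀ i, |x i| ≤ c) : ‖x‖ ≤ d * c := by
  have h1 : ‖x‖ ≤ ∑ i, |x i| := by
    have h2 : x = ∑ i, EuclideanSpace.single i (x i) := by
      ext j
      simp [Finset.sum_apply, Pi.single_apply]
    calc ‖x‖ = ‖∑ i, EuclideanSpace.single i (x i)‖ := by rw [← h2]
      _ ≤ ∑ i, ‖EuclideanSpace.single i (x i)‖ := norm_sum_le _ _
      _ = ∑ i, |x i| := by simp
  refine h1.trans ((Finset.sum_le_sum fun i _ => h i).trans ?_)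
  simp

theorem norm_sub_latticePt_le {ξ : Space d} {n : Lattice d} (h : ξ ∈ unitCube n) :
    ‖ξ - latticePt n‖ ≤ d := by
  have := norm_le_of_abs_le (x := ξ - latticePt n) (c := 1) fun i => by
    obtain ⟨h1, h2⟩ := h i
    exact abs_le.2 ⟨by simp only [PiLp.sub_apply, latticePt]; linarith,
      by simp only [PiLp.sub_apply, latticePt]; linarith⟩
  simpa using this

theorem norm_latticePt_le {ξ : Space d} {n : Lattice d} (h : ξ ∈ unitCube n) :
    ‖latticePt n‖ ≤ ‖ξ‖ + d := by
  have h1 := norm_sub_latticePt_le h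
  have h2 := norm_sub_norm_le (latticePt n) ξ
  rw [norm_sub_rev] at h2
  linarith

theorem norm_le_norm_latticePt {ξ : Space d} {n : Lattice d} (h : ξ ∈ unitCube n) :
    ‖ξ‖ ≤ ‖latticePt n‖ + d := by
  have h1 := norm_sub_latticePt_le h
  have h2 := norm_sub_norm_le ξ (latticePt n)
  linarith

theorem exists_one_add_pow_le {b p : ℝ} (hb : 0 < b) (hp : 0 ≤ p) :
    ∃ C > 0, ∀ x : ℝ, 0 ≤ x → (1 + x) ^ p ≤ C * Real.exp (b * x) := by
  -- The power p turns the rate c into cp ≤ b; the summand 1 avoids dividing by p = 0.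
  set c := b / (p + 1) with hc
  have hc0 : 0 < c := by positivity
  refine ⟨(1 + 1 / c) ^ p, by positivity, fun x hx => ?_⟩
  have h1 : 1 + x ≤ (1 + 1 / c) * Real.exp (c * x) := by
    have h2 := Real.add_one_le_exp (c * x)
    have h3 : 1 + x ≤ (1 + 1 / c) * (c * x + 1) := by
      have : (1 + 1 / c) * (c * x + 1) = c * x + 1 + x + 1 / c := by field_simp; ring
      rw [this]
      have : 0 ≤ c * x := by positivity
      have : 0 < 1 / c := by positivity
      linarith
    exact h3.trans (mul_le_mul_of_nonneg_left h2 (by positivity))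
  calc (1 + x) ^ p ≤ ((1 + 1 / c) * Real.exp (c * x)) ^ p :=
        Real.rpow_le_rpow (by positivity) h1 hp
    _ = (1 + 1 / c) ^ p * Real.exp (c * x * p) := by
        rw [Real.mul_rpow (by positivity) (Real.exp_pos _).le, ← Real.exp_mul]
    _ ≤ (1 + 1 / c) ^ p * Real.exp (b * x) := by
        refine mul_le_mul_of_nonneg_left (Real.exp_le_exp.2 ?_) (by positivity)
        have : c * x * p = b * x * (p / (p + 1)) := by rw [hc]; field_simp
        rw [this]
        exact mul_le_of_le_one_right (by positivity) ((div_le_one (by positivity)).2 (by linarith))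

theorem exists_weight_le (s : ℝ) {b : ℝ} (hb : 0 < b) :
    ∃ C > 0, ∀ n : Lattice d, weight s n ≤ ENNReal.ofReal (C * Real.exp (b * ‖latticePt n‖)) := by
  obtain ⟨C, hC, h⟩ := exists_one_add_pow_le hb (abs_nonneg s)
  refine ⟨C, hC, fun n => ENNReal.ofReal_le_ofReal (le_trans ?_ (h _ (norm_nonneg _)))⟩
  rw [← norm_latticePt_sq]
  have hx := norm_nonneg (latticePt n)
  generalize ‖latticePt n‖ = x at hx ⊢
  calc (1 + x ^ 2) ^ (s / 2) ≤ (1 + x ^ 2) ^ (|s| / 2) :=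
        Real.rpow_le_rpow_of_exponent_le (by nlinarith) (by linarith [le_abs_self s])
    _ ≤ ((1 + x) ^ (2 : ℕ)) ^ (|s| / 2) :=
        Real.rpow_le_rpow (by positivity) (by nlinarith) (by positivity)
    _ = (1 + x) ^ |s| := by
        rw [← Real.rpow_natCast, ← Real.rpow_mul (by positivity)]
        congr 1
        push_cast
        ring

theorem integrable_exp_neg_norm {a : ℝ} (ha : 0 < a) :
    Integrable (fun ξ : Space d => Real.exp (-(a * ‖ξ‖))) := by
  obtain ⟨C, hC, h⟩ := exists_one_add_pow_le ha (by positivity : (0 : ℝ) ≤ d + 1)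
  have hintg := (integrable_one_add_norm (E := Space d) (μ := volume) (r := d + 1)
    (by simp)).const_mul C
  refine hintg.mono' (by fun_prop) (Eventually.of_forall fun ξ => ?_)
  rw [Real.norm_eq_abs, abs_of_pos (Real.exp_pos _), Real.exp_neg, Real.rpow_neg (by positivity)]
  have h1 := h ‖ξ‖ (norm_nonneg _)
  rw [inv_le_iff_one_le_mul₀ (Real.exp_pos _), mul_comm C, mul_assoc, inv_mul_eq_div,
    le_div_iff₀ (by positivity), one_mul]
  exact h1

/-- Comparison with the integral: on the unit cube of n, exp(-a|n|) is at most a constant times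
exp(-a|ξ|). -/
theorem tsum_exp_lt_top {a : ℝ} (ha : 0 < a) :
    ∑' n : Lattice d, ENNReal.ofReal (Real.exp (-(a * ‖latticePt n‖))) < ⊤ := by
  have hintg := (integrable_exp_neg_norm (d := d) ha).const_mul (Real.exp (a * d))
  have hfin : ∫⁻ ξ : Space d, ENNReal.ofReal (Real.exp (a * d) * Real.exp (-(a * ‖ξ‖))) < ⊤ := by
    have := hintg.2
    rw [hasFiniteIntegral_iff_ofReal (Eventually.of_forall fun ξ => by positivity)] at this
    exact this
  refine lt_of_le_of_lt ?_ hfin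
  rw [← setLIntegral_univ, ← iUnion_unitCube, lintegral_iUnion measurableSet_unitCube
    pairwise_disjoint_unitCube]
  refine ENNReal.tsum_le_tsum fun n => ?_
  calc ENNReal.ofReal (Real.exp (-(a * ‖latticePt n‖)))
      = ∫⁻ _ in unitCube n, ENNReal.ofReal (Real.exp (-(a * ‖latticePt n‖))) := by
        rw [setLIntegral_const, volume_unitCube, mul_one]
    _ ≤ _ := by
        refine setLIntegral_mono' (measurableSet_unitCube n) fun ξ hξ => ?_
        refine ENNReal.ofReal_le_ofReal ?_
        rw [← Real.exp_add]
        have := norm_le_norm_latticePt hξ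
        exact Real.exp_le_exp.2 (by nlinarith)

theorem tsum_exp_mul_weight_lt_top (s : ℝ) {a : ℝ} (ha : 0 < a) :
    ∑' n : Lattice d, ENNReal.ofReal (Real.exp (-(a * ‖latticePt n‖))) * weight s n < ⊤ := by
  obtain ⟨C, hC, h⟩ := exists_weight_le (d := d) s (by positivity : 0 < a / 2)
  have : ∑' n : Lattice d, ENNReal.ofReal (Real.exp (-(a * ‖latticePt n‖))) * weight s n ≤
      ∑' n : Lattice d, ENNReal.ofReal C *
        ENNReal.ofReal (Real.exp (-(a / 2 * ‖latticePt n‖))) := by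
    refine ENNReal.tsum_le_tsum fun n => ?_
    refine (mul_le_mul_right (h n) _).trans ?_
    rw [← ENNReal.ofReal_mul (Real.exp_pos _).le, ← ENNReal.ofReal_mul hC.le]
    refine ENNReal.ofReal_le_ofReal (le_of_eq ?_)
    rw [mul_left_comm, ← Real.exp_add]
    congr 2
    ring
  refine lt_of_le_of_lt this ?_
  rw [ENNReal.tsum_mul_left]
  exact ENNReal.mul_lt_top ENNReal.ofReal_lt_top (tsum_exp_lt_top (by positivity))

/-- The lattice as a group of frequencies. -/
def latticeHom (d : ℕ) : Lattice d →+ Space d where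
  toFun := latticePt
  map_zero' := by ext i; simp [latticePt]
  map_add' m n := by ext i; simp [latticePt]

@[simp] theorem latticeHom_apply (n : Lattice d) : latticeHom d n = latticePt n := rfl

instance isFrequencySpace_volume :
    IsFrequencySpace (volume : Measure (Space d)) (AddMonoidHom.id (Space d)) where
  measurable := measurable_id
  integrable_exp a ha := integrable_exp_neg_norm ha
  ball_pos r hr := by
    have := Metric.measure_closedBall_pos (volume : Measure (Space d)) 0 hr
    convert this using 2
    ext ξ
    simp

instance isFrequencySpace_count :
    IsFrequencySpace (Measure.count : Measure (Lattice d)) (latticeHom d) where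
  measurable := measurable_of_countable _
  integrable_exp a ha := by
    rw [integrable_count_iff]
    refine (ENNReal.summable_toReal (tsum_exp_lt_top (d := d) ha).ne).congr fun n => ?_
    rw [ENNReal.toReal_ofReal (Real.exp_pos _).le, latticeHom_apply, Real.norm_eq_abs,
      abs_of_pos (Real.exp_pos _)]
  ball_pos r hr := by
    refine lt_of_lt_of_le ?_ (measure_mono (t := {ξ : Lattice d | ‖latticeHom d ξ‖ ≤ r})
      (s := {(0 : Lattice d)}) fun ξ hξ => by
        rw [mem_singleton_iff.1 hξ]
        simpa only [mem_ofPred_eq, map_zero, norm_zero] using hr.le)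
    simp

theorem map_count_equiv (f : Lattice d ≃ Lattice d) :
    Measure.map f (Measure.count : Measure (Lattice d)) = Measure.count := by
  ext A hA
  have hf : Measurable f := measurable_of_countable f
  rw [Measure.map_apply hf hA, Measure.count_apply (hf hA), Measure.count_apply hA]
  exact_mod_cast ENat.card_congr (f.subtypeEquiv fun a => by simp)

instance : (Measure.count : Measure (Lattice d)).IsAddLeftInvariant where
  map_add_left_eq_self g := map_count_equiv (Equiv.addLeft g)

instance : (Measure.count : Measure (Lattice d)).IsNegInvariant where
  neg_eq_self := map_count_equiv (Equiv.neg (Lattice d))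

end

end

section

/-! ### Norm inflation for spaces of distributions with a Fourier description -/

section

variable {d : ℕ} {G : Type} [AddCommGroup G] [MeasurableSpace G] {D : Type} [AddCommGroup D]

/-- The distributions in `D` have Fourier transforms on `G`: `Prof f h` says that the Fourier
transform of `f` is the function `h`, and `Rep g f` that `f` is the function `g`. -/
structure IsRealization (m : Measure G) (ι : G →+ Space d) (Rep : (Space d → ℂ) → D → Prop)
    (Prof : D → (G → ℂ) → Prop) : Prop where
  sub : ∀ {f f' h h'}, Prof f h → Prof f' h' → Prof (f - f') (h - h')
  exists_profile : ∀ {h}, Decays ι h → ∃ f, Prof f h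
  rep : ∀ {f h}, Prof f h → Decays ι h → Rep (synth m ι h) f
  rep_unique : ∀ {f g g'}, Continuous g → Continuous g' → Rep g f → Rep g' f → g = g'
  eq_of_rep : ∀ {f f' g}, Rep g f → Rep g f' → f = f'

/-- The norm `Y` is controlled by the weighted `ℓ¹` sum of the suprema of the Fourier transform over
the unit cubes. -/
def HasUpperBound (ι : G →+ Space d) (Prof : D → (G → ℂ) → Prop) (Y : D → ℝ≥0∞) (s : ℝ) : Prop :=
  ∃ C : ℝ≥0∞, C ≠ ⊤ ∧ ∀ f h, Prof f h → Measurable h → ∀ β : Lattice d → ℝ≥0∞,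
    (∀ ξ n, ι ξ ∈ unitCube n → ‖h ξ‖ₑ ≤ β n) → Y f ≤ C * ∑' n, β n * weight s n

/-- The norm `Y` controls the average of the Fourier transform against the cut-off `κ`. -/
def HasLowerBound (m : Measure G) (ι : G →+ Space d) (Prof : D → (G → ℂ) → Prop)
    (κ : Space d → ℝ) (Y : D → ℝ≥0∞) : Prop :=
  ∃ C : ℝ≥0∞, C ≠ ⊤ ∧ ∀ f h, Prof f h → Decays ι h →
    ‖∫ ξ, (κ (ι ξ) : ℂ) * h ξ ∂m‖ₑ ≤ C * Y f

/-- A smooth cut-off around the origin. -/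
structure IsLowCutoff (κ : Space d → ℝ) (r₀ : ℝ) : Prop where
  smooth : ContDiff ℝ ∞ κ
  mem_unit : ∀ x, κ x ∈ Icc (0 : ℝ) 1
  pos : 0 < r₀
  le : r₀ ≤ 1 / 4
  eq_one : ∀ x : Space d, ‖x‖ ≤ r₀ → κ x = 1
  eq_zero : ∀ x : Space d, 1 / 4 < ‖x‖ → κ x = 0

theorem exists_isLowCutoff (d : ℕ) : ∃ κ : Space d → ℝ, IsLowCutoff κ (1 / 8) := by
  let b : ContDiffBump (0 : Space d) := ⟨1 / 8, 1 / 4, by norm_num, by norm_num⟩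
  refine ⟨b, b.contDiff, fun x => ⟨b.nonneg, b.le_one⟩, by norm_num, by norm_num, fun x hx => ?_,
    fun x hx => ?_⟩
  · exact b.one_of_mem_closedBall (by rw [mem_closedBall_zero_iff]; exact hx)
  · exact b.zero_of_le_dist (by rw [dist_zero_right]; exact hx.le)

variable {m : Measure G} {ι : G →+ Space d} {Rep : (Space d → ℂ) → D → Prop}
  {Prof : D → (G → ℂ) → Prop} {Y : D → ℝ≥0∞} {s : ℝ}

theorem IsRealization.zero (hr : IsRealization m ι Rep Prof) {f : D} {h : G → ℂ} (hf : Prof f h) :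
    Prof 0 0 := by
  simpa using hr.sub hf hf

theorem IsRealization.neg (hr : IsRealization m ι Rep Prof) {f : D} {h : G → ℂ} (hf : Prof f h) :
    Prof (-f) (-h) := by
  simpa using hr.sub (hr.zero hf) hf

theorem IsRealization.add (hr : IsRealization m ι Rep Prof) {f f' : D} {h h' : G → ℂ}
    (hf : Prof f h) (hf' : Prof f' h') : Prof (f + f') (h + h') := by
  simpa using hr.sub hf (hr.neg hf')

/-- Uniqueness of smooth solutions. -/
theorem IsRealization.smoothSolution_unique (hr : IsRealization m ι Rep Prof) {N : D → ℝ≥0∞} {μ : ℂ}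
    {ρ σ : ℕ} {T : ℝ} (hT : 0 < T) {v : D × D} {U U' : ℝ → D}
    (hU : IsSmoothSolution Rep N μ ρ σ T v U) (hU' : IsSmoothSolution Rep N μ ρ σ T v U') {t : ℝ}
    (ht : t ∈ Icc 0 T) : U' t = U t := by
  obtain ⟨-, u, hu, hrep, h0, h1⟩ := hU
  obtain ⟨-, u', hu', hrep', h0', h1'⟩ := hU'
  have hmem : (0 : ℝ) ∈ Icc 0 T := ⟨le_rfl, hT.le⟩
  -- Initial values and velocities are given only as distributions. Being continuous functions they
  -- are determined by these, and the pointwise uniqueness of classical solutions becomes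
  -- applicable.
  have hslice : ∀ {v : ℝ → Space d → ℂ}, IsClassicalSolution μ ρ σ T v → Continuous (v 0) :=
    fun {v} hv => hv.1.continuousOn.comp_continuous (f := fun x : Space d => ((0 : ℝ), x))
      (by fun_prop) fun x => ⟨hmem, mem_univ _⟩
  have hder : ∀ {v : ℝ → Space d → ℂ}, IsClassicalSolution μ ρ σ T v →
      Continuous fun x => derivWithin (fun τ => v τ x) (Icc 0 T) 0 := fun {v} hv => by
    have hD := (hasSecondOrderJet hT hv.1).contOn_deriv
    have hc : Continuous fun x : Space d => fderivWithin ℝ (fun z : ℝ × Space d => v z.1 z.2)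
        (Icc 0 T ×ˢ univ) (0, x) (timeVec d) :=
      (hD.comp_continuous (f := fun x : Space d => ((0 : ℝ), x)) (by fun_prop)
        fun x => ⟨hmem, mem_univ _⟩).clm_apply continuous_const
    convert hc using 2 with x
    have hd : HasFDerivWithinAt (fun z : ℝ × Space d => v z.1 z.2) _ (Icc 0 T ×ˢ univ) (0, x) :=
      ((hv.1.differentiableOn (by simp)) (0, x) ⟨hmem, mem_univ _⟩).hasFDerivWithinAt
    have hcurve : HasDerivWithinAt (fun s : ℝ => (s, x)) (timeVec d) (Icc 0 T) 0 :=
      ((hasDerivAt_id' (0 : ℝ)).prodMk (hasDerivAt_const 0 x)).hasDerivWithinAt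
    have hmaps : MapsTo (fun s : ℝ => (s, x)) (Icc 0 T) (Icc 0 T ×ˢ univ) :=
      fun s hs => ⟨hs, mem_univ _⟩
    exact (HasFDerivWithinAt.comp_hasDerivWithinAt (0 : ℝ) hd hcurve hmaps).derivWithin
      (uniqueDiffOn_Icc hT 0 hmem)
  have e0 : u 0 = u' 0 := hr.rep_unique (hslice hu) (hslice hu') h0 h0'
  have e1 := hr.rep_unique (hder hu) (hder hu') h1 h1'
  have e2 := hu.unique hT hu' e0 (fun x => congrFun e1 x) ht
  have h3 := hrep' t ht
  rw [← e2] at h3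
  exact hr.eq_of_rep h3 (hrep t ht)

theorem exp_le_of_mem_unitCube {a : ℝ} (ha : 0 ≤ a) {ξ : Space d} {n : Lattice d}
    (h : ξ ∈ unitCube n) :
    Real.exp (-(a * ‖ξ‖)) ≤ Real.exp (a * d) * Real.exp (-(a * ‖latticePt n‖)) := by
  rw [← Real.exp_add]
  have := norm_latticePt_le h
  exact Real.exp_le_exp.2 (by nlinarith)

/-- Norms with an upper bound are finite for exponentially decaying profiles, linearly in the
amplitude. -/
theorem HasUpperBound.exists_le (hY : HasUpperBound ι Prof Y s) {a : ℝ} (ha : 0 < a) :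
    ∃ K : ℝ≥0∞, K ≠ ⊤ ∧ ∀ (f : D) (h : G → ℂ) (A : ℝ), Prof f h → Measurable h → 0 ≤ A →
      (∀ ξ, ‖h ξ‖ ≤ A * Real.exp (-(a * ‖ι ξ‖))) → Y f ≤ ENNReal.ofReal A * K := by
  obtain ⟨C, hC, hub⟩ := hY
  refine ⟨C * (ENNReal.ofReal (Real.exp (a * d)) *
    ∑' n : Lattice d, ENNReal.ofReal (Real.exp (-(a * ‖latticePt n‖))) * weight s n),
    ENNReal.mul_ne_top hC (ENNReal.mul_ne_top ENNReal.ofReal_ne_top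
      (tsum_exp_mul_weight_lt_top s ha).ne), fun f h A hf hm hA hb => ?_⟩
  refine (hub f h hf hm (fun n => ENNReal.ofReal A * (ENNReal.ofReal (Real.exp (a * d)) *
    ENNReal.ofReal (Real.exp (-(a * ‖latticePt n‖))))) fun ξ n hξ => ?_).trans (le_of_eq ?_)
  · rw [← ENNReal.ofReal_mul (Real.exp_pos _).le, ← ENNReal.ofReal_mul hA, ← ofReal_norm]
    exact ENNReal.ofReal_le_ofReal ((hb ξ).trans
      (mul_le_mul_of_nonneg_left (exp_le_of_mem_unitCube ha.le hξ) hA))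
  · simp only [mul_assoc, ENNReal.tsum_mul_left]
    rw [mul_left_comm]

theorem HasUpperBound.lt_top (hY : HasUpperBound ι Prof Y s) {f : D} {h : G → ℂ} (hf : Prof f h)
    (hh : Decays ι h) : Y f < ⊤ := by
  obtain ⟨hm, a, ha, A, hA, hb⟩ := hh
  obtain ⟨K, hK, hle⟩ := hY.exists_le ha
  exact lt_of_le_of_lt (hle f h A hf hm hA hb)
    (ENNReal.mul_lt_top ENNReal.ofReal_lt_top hK.lt_top)

/-- A curve of distributions whose Fourier transform is differentiable in time is continuous. -/
theorem HasUpperBound.continuousInto (hr : IsRealization m ι Rep Prof)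
    (hY : HasUpperBound ι Prof Y s) {τ T : ℝ} (hT : 0 < T) (hTτ : T < τ) {u g : ℝ → G → ℂ}
    (hu : DecaysOn ι (Ioo (-τ) τ) u) (hg : DecaysOn ι (Ioo (-τ) τ) g)
    (hud : ∀ t ∈ Ioo (-τ) τ, ∀ ξ, HasDerivAt (fun s => u s ξ) (g t ξ) t) {U : ℝ → D}
    (hU : ∀ t ∈ Ioo (-τ) τ, Prof (U t) (u t)) : ContinuousInto Y T U := by
  have hsub : Icc 0 T ⊆ Ioo (-τ) τ := fun t ht => ⟨by linarith [ht.1], by linarith [ht.2]⟩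
  refine ⟨fun t ht => hY.lt_top (hU t (hsub ht)) (hu.decays (hsub ht)), fun t₀ ht₀ => ?_⟩
  obtain ⟨a, ha, C, hC, hb⟩ := hg.bound
  obtain ⟨K, hK, hle⟩ := hY.exists_le ha
  have key : ∀ t ∈ Icc 0 T, Y (U t - U t₀) ≤ ENNReal.ofReal (|t - t₀| * C) * K := fun t ht => by
    refine hle _ (u t - u t₀) _ (hr.sub (hU t (hsub ht)) (hU t₀ (hsub ht₀)))
      ((hu.meas t (hsub ht)).sub (hu.meas t₀ (hsub ht₀))) (by positivity) fun ξ => ?_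
    -- The mean value inequality at each frequency, with a bound that decays in ξ: the curve is
    -- Lipschitz in time.
    have := (convex_Ioo (-τ) τ).norm_image_sub_le_of_norm_hasDerivWithin_le
      (f := fun s => u s ξ) (f' := fun s => g s ξ)
      (C := C * Real.exp (-(a * ‖ι ξ‖))) (fun s hs => (hud s hs ξ).hasDerivWithinAt)
      (fun s hs => hb s hs ξ) (hsub ht₀) (hsub ht)
    refine this.trans (le_of_eq ?_)
    rw [Real.norm_eq_abs]
    ring
  have hlim : Tendsto (fun t => ENNReal.ofReal (|t - t₀| * C) * K) (𝓝[Icc 0 T] t₀) (𝓝 0) := by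
    have h1 : Tendsto (fun t : ℝ => |t - t₀| * C) (𝓝[Icc 0 T] t₀) (𝓝 0) := by
      have : Continuous fun t : ℝ => |t - t₀| * C := by fun_prop
      simpa using (this.tendsto t₀).mono_left nhdsWithin_le_nhds
    have h2 := ENNReal.Tendsto.mul_const (ENNReal.tendsto_ofReal h1) (Or.inr hK) (b := K)
    simpa using h2
  refine tendsto_of_tendsto_of_tendsto_of_le_of_le' tendsto_const_nhds hlim
    (Eventually.of_forall fun _ => zero_le) ?_
  filter_upwards [self_mem_nhdsWithin] with t ht using key t ht

/-- The lattice point at which a packet sits. -/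
def packetPt {d : ℕ} (i : Fin d) (k : ℤ) : Lattice d := Pi.single i k

theorem latticePt_packetPt (i : Fin d) (k : ℤ) :
    latticePt (packetPt i k) = (k : ℝ) • EuclideanSpace.single i (1 : ℝ) := by
  ext j
  by_cases h : j = i
  · subst h
    simp [latticePt, packetPt]
  · simp [latticePt, packetPt, h]

theorem weight_packetPt_le (i : Fin d) {k : ℤ} (hk : 1 ≤ |k|) {N : ℕ} (hN : 1 ≤ N) {s : ℝ}
    (hs : s ≤ 0) : weight s (packetPt i (k * N)) ≤ ENNReal.ofReal ((N : ℝ) ^ s) := by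
  refine ENNReal.ofReal_le_ofReal ?_
  have hN' : (1 : ℝ) ≤ N := by exact_mod_cast hN
  have h1 : ∑ j, ((packetPt i (k * N) j : ℤ) : ℝ) ^ 2 = ((k * N : ℤ) : ℝ) ^ 2 := by
    rw [Finset.sum_eq_single i]
    · simp [packetPt]
    · intro j _ hj
      simp [packetPt, hj]
    · simp
  rw [h1]
  have h2 : ((N : ℝ)) ^ 2 ≤ 1 + ((k * N : ℤ) : ℝ) ^ 2 := by
    have hk' : (1 : ℝ) ≤ (k : ℝ) ^ 2 := by
      have : (1 : ℝ) ≤ |(k : ℝ)| := by exact_mod_cast hk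
      rw [← sq_abs]
      nlinarith
    push_cast
    rw [mul_pow]
    nlinarith [sq_nonneg (N : ℝ)]
  calc (1 + ((k * N : ℤ) : ℝ) ^ 2) ^ (s / 2) ≤ ((N : ℝ) ^ 2) ^ (s / 2) :=
        Real.rpow_le_rpow_of_nonpos (by positivity) h2 (by linarith)
    _ = (N : ℝ) ^ s := by
        rw [← Real.rpow_natCast, ← Real.rpow_mul (by positivity)]
        congr 1
        push_cast
        ring

/-- Each packet lies in one unit cube, centred at kN times a unit vector, so only four weights
enter, each at most N^s. For s < 0 this makes packets of any fixed amplitude small. -/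
theorem HasUpperBound.packets_le (hY : HasUpperBound ι Prof Y s) (hs : s ≤ 0) (hι : Measurable ι)
    [MeasurableAdd₂ G] {r : ℝ} (hr : r ≤ 1 / 4) {i₀ : Fin d} {e : G}
    (he : ι e = EuclideanSpace.single i₀ 1) :
    ∃ C : ℝ≥0∞, C ≠ ⊤ ∧ ∀ (N : ℕ) (f : D) (c : ℤ → ℂ) (A : ℝ), 1 ≤ N →
      Prof f (packets ι r (N • e) c) → (∀ i, ‖c (mode i)‖ ≤ A) →
        Y f ≤ C * ENNReal.ofReal (A * (N : ℝ) ^ s) := by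
  obtain ⟨C, hC, hub⟩ := hY
  refine ⟨C * 4, ENNReal.mul_ne_top hC (by simp), fun N f c A hN hf hc => ?_⟩
  have hA : 0 ≤ A := (norm_nonneg _).trans (hc 0)
  have hm : Measurable (packets ι r (N • e) c) := by
    refine Finset.measurable_fun_sum _ fun i _ => Measurable.const_mul ?_ _
    refine (measurable_bump hι).comp ?_
    simp only [sub_eq_add_neg]
    exact measurable_id.add_const _
  refine (hub f _ hf hm (fun n => ∑ i : Fin 4, if n = packetPt i₀ (mode i * N) then
    ENNReal.ofReal A else 0) fun ξ n hξ => ?_).trans ?_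
  · refine (enorm_sum_le _ _).trans (Finset.sum_le_sum fun i _ => ?_)
    split_ifs with h
    · rw [← ofReal_norm, norm_mul]
      exact ENNReal.ofReal_le_ofReal ((mul_le_of_le_one_right (norm_nonneg _)
        (norm_bump_le _)).trans (hc i))
    · rw [bump_eq_zero, mul_zero, enorm_zero]
      by_contra hcon
      -- In every coordinate ξ is within 1/2 of n and within 1/4 of the centre of the packet, and
      -- integers at distance below 1 coincide.
      refine h (funext fun j => int_eq_of_abs_sub_lt_one ?_)
      have e1 : ι (ξ - mode i • N • e) = ι ξ - latticePt (packetPt i₀ (mode i * N)) := by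
        rw [map_sub, map_zsmul, map_nsmul, he, latticePt_packetPt, ← Int.cast_smul_eq_zsmul ℝ,
          ← Nat.cast_smul_eq_nsmul ℝ, smul_smul]
        push_cast
        rfl
      rw [e1, not_lt] at hcon
      have h1 := (PiLp.norm_apply_le (ι ξ - latticePt (packetPt i₀ (mode i * N))) j).trans
        (hcon.trans hr)
      rw [Real.norm_eq_abs] at h1
      obtain ⟨h2, h3⟩ := hξ j
      obtain ⟨h4, h5⟩ := abs_le.1 h1
      simp only [PiLp.sub_apply, latticePt] at h4 h5
      exact abs_lt.2 ⟨by linarith, by linarith⟩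
  · rw [mul_assoc]
    refine mul_le_mul_right ?_ C
    calc ∑' n, (∑ i : Fin 4, if n = packetPt i₀ (mode i * N) then ENNReal.ofReal A else 0) *
          weight s n
        = ∑ i : Fin 4, ENNReal.ofReal A * weight s (packetPt i₀ (mode i * N)) := by
          simp only [Finset.sum_mul]
          rw [Summable.tsum_finsetSum fun i _ => ENNReal.summable]
          refine Finset.sum_congr rfl fun i _ => ?_
          rw [tsum_eq_single (packetPt i₀ (mode i * N))]
          · simp
          · intro n hn
            simp [hn]
      _ ≤ ∑ i : Fin 4, ENNReal.ofReal (A * (N : ℝ) ^ s) := by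
          refine Finset.sum_le_sum fun i _ => ?_
          rw [ENNReal.ofReal_mul hA]
          exact mul_le_mul_right (weight_packetPt_le i₀ (one_le_abs_mode i) hN hs) _
      _ = 4 * ENNReal.ofReal (A * (N : ℝ) ^ s) := by simp

end

/-! ### Inflation and ill-posedness for spaces with a Fourier description -/

section

variable {d : ℕ} {G : Type} [AddCommGroup G] [MeasurableSpace G] {D : Type} [AddCommGroup D]
  {m : Measure G} {ι : G →+ Space d} {Rep : (Space d → ℂ) → D → Prop}
  {Prof : D → (G → ℂ) → Prop} [MeasurableAdd₂ G] [MeasurableNeg G] [SFinite m]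
  [m.IsAddLeftInvariant] [m.IsNegInvariant] [IsFrequencySpace m ι]

/-- The distributions with a bounded Fourier transform of bounded support come arbitrarily close
to `f` in the norm `Y`. -/
def NiceApprox (ι : G →+ Space d) (Prof : D → (G → ℂ) → Prop) (Y : D → ℝ≥0∞) (f : D) : Prop :=
  ∀ δ : ℝ≥0∞, 0 < δ → ∃ g h, Prof g h ∧ Nice ι h ∧ Y (f - g) < δ

theorem Nice.decays {h : G → ℂ} (m : Measure G) [SFinite m] [m.IsAddLeftInvariant]
    [IsFrequencySpace m ι] (hh : Nice ι h) : Decays ι h := by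
  obtain ⟨M, K, -, hb⟩ := hh.exists_bd m
  have hK : 0 < 1 / (1 + |K|) := by positivity
  refine (hb (1 / (1 + |K|)) hK.le ?_).decays hK
  rw [one_div, inv_mul_le_iff₀ (by positivity)]
  linarith [le_abs_self K]

theorem decays_packets {r : ℝ} (m : Measure G) [SFinite m] [m.IsAddLeftInvariant]
    [IsFrequencySpace m ι] (η : G) (c : ℤ → ℂ) : Decays ι (packets ι r η c) := by
  have hpos : 0 < 1 / (1 + |2 * ‖ι η‖ + r|) := by positivity
  refine (bd_packets (m := m) (a := 1 / (1 + |2 * ‖ι η‖ + r|)) (R := ∑ i, ‖c (mode i)‖)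
    (by positivity) hpos.le ?_ fun i => ?_).decays hpos
  · rw [one_div, inv_mul_le_iff₀ (by positivity)]
    linarith [le_abs_self (2 * ‖ι η‖ + r)]
  · exact Finset.single_le_sum (f := fun i => ‖c (mode i)‖) (fun j _ => norm_nonneg _)
      (Finset.mem_univ i)

theorem Decays.add {h h' : G → ℂ} (hh : Decays ι h) (hh' : Decays ι h') : Decays ι (h + h') :=
  ((hh.decaysOn univ).add (hh'.decaysOn univ)).decays (mem_univ (0 : ℝ))

theorem Decays.neg {h : G → ℂ} (hh : Decays ι h) : Decays ι (-h) := by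
  obtain ⟨hm, a, ha, C, hC, hb⟩ := hh
  exact ⟨hm.neg, a, ha, C, hC, fun ξ => by simpa using hb ξ⟩

/-- The abstract form of norm inflation. -/
theorem IsRealization.normInflationAt (hr : IsRealization m ι Rep Prof) {X : ℝ → D → ℝ≥0∞}
    {N : D → ℝ≥0∞} (hN : HasUpperBound ι Prof N 0) (hX : ∀ θ, HasUpperBound ι Prof (X θ) θ)
    {κ : Space d → ℝ} {r₀ : ℝ} (hκ : IsLowCutoff κ r₀)
    (hXκ : ∀ θ, HasLowerBound m ι Prof κ (X θ))
    (hadd : ∀ θ f g, X θ (f + g) ≤ X θ f + X θ g) {i₀ : Fin d} {e : G}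
    (he : ι e = EuclideanSpace.single i₀ 1) {μ : ℂ} (hμ : ‖μ‖ = 1) {ρ σ : ℕ} (hσ : 2 ≤ σ)
    (hρ : ρ ≤ σ) {s : ℝ} (hs : s < 0) {v : D × D} (hv₀ : NiceApprox ι Prof (X s) v.1)
    (hv₁ : NiceApprox ι Prof (X (s - 1)) v.2) :
    NormInflationAt X (IsSmoothSolution Rep N μ ρ σ) s v := by
  intro θ ε hε
  have hι : Measurable ι := IsFrequencySpace.measurable m
  have hσ1 : (1 : ℝ) ≤ σ := by exact_mod_cast (by omega : 1 ≤ σ)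
  have hrle : r₀ / σ ≤ 1 / 4 := (div_le_self hκ.pos.le hσ1).trans hκ.le
  have hε8 : 0 < ENNReal.ofReal (ε / 8) := ENNReal.ofReal_pos.2 (by positivity)
  obtain ⟨g₀, h₀, hg₀, hn₀, hd₀⟩ := hv₀ _ hε8
  obtain ⟨g₁, h₁, hg₁, hn₁, hd₁⟩ := hv₁ _ hε8
  obtain ⟨Cθ, hCθ, hlow⟩ := hXκ θ
  have hnorm_e : ‖ι e‖ = 1 := by simp [he]
  -- The low-frequency average is required to exceed Cθ / ε, which forces the X_θ norm above 1 / ε.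
  obtain ⟨R, T, hR, hT, hTε, N₀, hinf⟩ := exists_inflating_profile m ι hμ ρ hσ
    hκ.smooth.continuous.measurable hκ.mem_unit hκ.pos hκ.le hκ.eq_one hκ.eq_zero hnorm_e hn₀ hn₁
    (Cθ.toReal * (1 / ε)) hε
  obtain ⟨C₀, hC₀, hp₀⟩ := (hX s).packets_le hs.le hι hrle he
  obtain ⟨C₁, hC₁, hp₁⟩ := (hX (s - 1)).packets_le (by linarith) hι hrle he
  -- R is fixed and n tends to infinity. The same limit serves the velocities: their amplitude is at
  -- most 4πRn, and n · n^(s-1) = n^s.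
  have hlim : ∀ (C : ℝ≥0∞) (B : ℝ), C ≠ ⊤ → ∀ᶠ n : ℕ in atTop,
      C * ENNReal.ofReal (B * (n : ℝ) ^ s) < ENNReal.ofReal (ε / 8) := fun C B hC => by
    have h1 : Tendsto (fun n : ℕ => (n : ℝ) ^ s) atTop (𝓝 0) := by
      have := (tendsto_rpow_neg_atTop (y := -s) (by linarith)).comp
        (tendsto_natCast_atTop_atTop (R := ℝ))
      simpa [Function.comp_def] using this
    have h2 := ENNReal.Tendsto.const_mul (a := C) (ENNReal.tendsto_ofReal (h1.const_mul B))
      (Or.inr hC)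
    rw [mul_zero, ENNReal.ofReal_zero, mul_zero] at h2
    exact h2.eventually_lt_const hε8
  obtain ⟨n, hn1, hnN, hs₀, hs₁⟩ := ((eventually_ge_atTop 1).and ((eventually_ge_atTop N₀).and
    ((hlim C₀ R hC₀).and (hlim C₁ (4 * Real.pi * R) hC₁)))).exists
  obtain ⟨a, M, u, ha, hub, huc, hu, hbig⟩ := hinf n hnN
  set r := r₀ / (σ : ℝ) with hrdef
  set φ₀ := packets ι r (n • e) (packetAmplitude R) with hφ₀
  set φ₁ := packets ι r (n • e) (packetVelocity R n) with hφ₁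
  have hφ₀d : Decays ι φ₀ := decays_packets m _ _
  have hφ₁d : Decays ι φ₁ := decays_packets m _ _
  obtain ⟨f₀, hf₀⟩ := hr.exists_profile hφ₀d
  obtain ⟨f₁, hf₁⟩ := hr.exists_profile hφ₁d
  have hneg : ∀ c : ℤ → ℂ, -packets ι r (n • e) c = packets ι r (n • e) (-c) := fun c => by
    funext ξ
    simp [packets]
  have hw₀ := hr.add hg₀ hf₀
  have hw₁ := hr.add hg₁ hf₁
  have hw₀d : Decays ι (h₀ + φ₀) := (hn₀.decays m).add hφ₀d
  have hw₁d : Decays ι (h₁ + φ₁) := (hn₁.decays m).add hφ₁d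
  have hn0 : (0 : ℝ) < n := by exact_mod_cast hn1
  -- The norms are not assumed to be even; instead, -f₀ has packets of opposite amplitude as its
  -- profile.
  have hXf₀ : X s (-f₀) < ENNReal.ofReal (ε / 8) := by
    refine lt_of_le_of_lt (hp₀ n (-f₀) (-packetAmplitude R) R hn1 ?_ fun i => ?_) hs₀
    · rw [← hneg]
      exact hr.neg hf₀
    · simp [packetAmplitude, abs_of_nonneg hR]
  have hXf₁ : X (s - 1) (-f₁) < ENNReal.ofReal (ε / 8) := by
    refine lt_of_le_of_lt (hp₁ n (-f₁) (-packetVelocity R n) (4 * Real.pi * R * n) hn1 ?_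
      fun i => ?_) (lt_of_eq_of_lt ?_ hs₁)
    · rw [← hneg]
      exact hr.neg hf₁
    · have h2 : |((mode i : ℤ) : ℝ)| ≤ 2 := by exact_mod_cast abs_mode_le i
      have hpi := Real.pi_pos
      rw [Pi.neg_apply, norm_neg, packetVelocity, norm_mul, norm_mul, Complex.norm_I, one_mul,
        Complex.norm_real, Complex.norm_real, Real.norm_eq_abs, Real.norm_eq_abs,
        abs_of_nonneg hR, abs_mul, abs_of_nonneg (by positivity)]
      calc 2 * Real.pi * n * |((mode i : ℤ) : ℝ)| * R ≤ 2 * Real.pi * n * 2 * R := by gcongr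
        _ = 4 * Real.pi * R * n := by ring
    · congr 2
      rw [Real.rpow_sub_one hn0.ne']
      field_simp
  -- The profiles are smooth on (-2T, 2T), a neighbourhood of [0, T]; this gives smoothness up to
  -- both end points and the initial velocity.
  obtain ⟨g, hsu, hsg, hu0, hgz, hud, hgd⟩ := exists_smoothProfile (by linarith : 0 < 2 * T) ha
    (by omega) hw₁d hub huc hu
  have hudec : ∀ t, Decays ι (u t) := fun t => (hub t).decays ha
  choose U hU using fun t => hr.exists_profile (hudec t)
  have hT2 : T < 2 * T := by linarith
  have hcont : ∀ {Y : D → ℝ≥0∞} {s'}, HasUpperBound ι Prof Y s' → ContinuousInto Y T U :=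
    fun hY => hY.continuousInto hr hT hT2 (hsu 0).decaysOn (hsg 0).decaysOn hud fun t _ => hU t
  have h0mem : (0 : ℝ) ∈ Ioo (-(2 * T)) (2 * T) := ⟨by linarith, by linarith⟩
  have hder : ∀ x, derivWithin (fun τ => synth m ι (u τ) x) (Icc 0 T) 0 =
      synth m ι (h₁ + φ₁) x := fun x => by
    rw [← hgz]
    exact (hasDerivAt_synth (m := m) isOpen_Ioo (hsu 0).decaysOn (hsg 0).decaysOn hud h0mem
      x).hasDerivWithinAt.derivWithin (uniqueDiffOn_Icc hT 0 ⟨le_rfl, hT.le⟩)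
  have hsol : IsSmoothSolution Rep N μ ρ σ T (g₀ + f₀, g₁ + f₁) U := by
    refine ⟨hcont hN, fun t => synth m ι (u t), isClassicalSolution_synth (by omega) hρ hT hT2 hsu
      hsg hud hgd, fun t _ => hr.rep (hU t) (hudec t), ?_, ?_⟩
    · simp only [hu0]
      exact hr.rep hw₀ hw₀d
    · simp only [hder]
      exact hr.rep hw₁ hw₁d
  have hsqrt : ENNReal.ofReal (Real.sqrt 2) ≤ 2 := by
    rw [← ENNReal.ofReal_ofNat]
    refine ENNReal.ofReal_le_ofReal ?_
    rw [Real.sqrt_le_left (by norm_num)]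
    norm_num
  refine ⟨(g₀ + f₀, g₁ + f₁), ?_, ?_, T, hT, hTε, U, hsol, fun U' hU' t ht =>
    hr.smoothSolution_unique hT hsol hU' ht, hcont (hX θ), ?_⟩
  · exact ENNReal.add_lt_top.2 ⟨(hX s).lt_top hw₀ hw₀d,
      ENNReal.mul_lt_top ENNReal.ofReal_lt_top ((hX (s - 1)).lt_top hw₁ hw₁d)⟩
  · have e0 : X s (v.1 - (g₀ + f₀)) ≤ ENNReal.ofReal (ε / 8) + ENNReal.ofReal (ε / 8) := by
      have : v.1 - (g₀ + f₀) = (v.1 - g₀) + (-f₀) := by abel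
      rw [this]
      exact (hadd _ _ _).trans (add_le_add hd₀.le hXf₀.le)
    have e1 : X (s - 1) (v.2 - (g₁ + f₁)) ≤ ENNReal.ofReal (ε / 8) + ENNReal.ofReal (ε / 8) := by
      have : v.2 - (g₁ + f₁) = (v.2 - g₁) + (-f₁) := by abel
      rw [this]
      exact (hadd _ _ _).trans (add_le_add hd₁.le hXf₁.le)
    rw [← ENNReal.ofReal_add (by positivity) (by positivity)] at e0 e1
    calc pairNorm X s (v - (g₀ + f₀, g₁ + f₁))
        ≤ ENNReal.ofReal (ε / 8 + ε / 8) + 2 * ENNReal.ofReal (ε / 8 + ε / 8) :=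
          add_le_add e0 (mul_le_mul' hsqrt e1)
      _ = ENNReal.ofReal (3 * ε / 4) := by
          rw [← ENNReal.ofReal_ofNat, ← ENNReal.ofReal_mul (by norm_num),
            ← ENNReal.ofReal_add (by positivity) (by positivity)]
          congr 1
          ring
      _ < ENNReal.ofReal ε := (ENNReal.ofReal_lt_ofReal_iff hε).2 (by linarith)
  · by_contra hcon
    rw [not_lt] at hcon
    have h1 := (hlow (U T) (u T) (hU T) (hudec T)).trans (mul_le_mul_right hcon Cθ)
    rw [← ENNReal.ofReal_toReal hCθ, ← ENNReal.ofReal_mul ENNReal.toReal_nonneg, ← ofReal_norm] at h1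
    have h2 := (ENNReal.ofReal_le_ofReal_iff (by positivity)).1 h1
    linarith

/-- The abstract form of the main theorem. -/
theorem IsRealization.stronglyIllPosed (hr : IsRealization m ι Rep Prof) {X : ℝ → D → ℝ≥0∞}
    {N : D → ℝ≥0∞} (hN : HasUpperBound ι Prof N 0) (hX : ∀ θ, HasUpperBound ι Prof (X θ) θ)
    (hXκ : ∀ κ : Space d → ℝ, IsLowCutoff κ (1 / 8) → ∀ θ, HasLowerBound m ι Prof κ (X θ))
    (hadd : ∀ θ f g, X θ (f + g) ≤ X θ f + X θ g) (hzero : ∀ θ, X θ 0 = 0) {i₀ : Fin d} {e : G}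
    (he : ι e = EuclideanSpace.single i₀ 1) {BL : D → Prop} {q : ℝ≥0∞}
    (hdense : q ≠ ⊤ → ∀ θ f, X θ f < ⊤ → NiceApprox ι Prof (X θ) f)
    (hBL : q = ⊤ → ∀ θ f, BL f → X θ f < ⊤ → NiceApprox ι Prof (X θ) f)
    {μ : ℂ} (hμ : ‖μ‖ = 1) {ρ σ : ℕ} (hσ : 2 ≤ σ) (hρ : ρ ≤ σ) {s : ℝ} (hs : s < 0) :
    StronglyIllPosed X (IsSmoothSolution Rep N μ ρ σ) BL q s := by
  intro v hv hcl
  obtain ⟨κ, hκ⟩ := exists_isLowCutoff d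
  have hsqrt : (1 : ℝ≥0∞) ≤ ENNReal.ofReal (Real.sqrt 2) := by
    rw [← ENNReal.ofReal_one]
    exact ENNReal.ofReal_le_ofReal (Real.one_le_sqrt.2 (by norm_num))
  have hfst : ∀ w : D × D, X s w.1 ≤ pairNorm X s w := fun w => le_self_add
  have hsnd : ∀ w : D × D, X (s - 1) w.2 ≤ pairNorm X s w := fun w =>
    (le_mul_of_one_le_left' hsqrt).trans le_add_self
  have happrox : NiceApprox ι Prof (X s) v.1 ∧ NiceApprox ι Prof (X (s - 1)) v.2 := by
    -- For q = ∞ nice distributions are reached in two steps, first a band-limited pair from the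
    -- closure hypothesis, then its approximation, each within δ / 2.
    by_cases hq : q = ⊤
    · have hstep : ∀ (δ : ℝ≥0∞), 0 < δ → ∃ w : D × D, BL w.1 ∧ BL w.2 ∧ pairNorm X s w < ⊤ ∧
          pairNorm X s (v - w) < δ / 2 := fun δ hδ => by
        rcases eq_or_ne δ ⊤ with rfl | hδ'
        · obtain ⟨w, h1, h2, h3, h4⟩ := hcl hq 1 one_pos
          exact ⟨w, h1, h2, h3, h4.trans_le (by simp [ENNReal.top_div_of_ne_top])⟩
        · obtain ⟨w, h1, h2, h3, h4⟩ := hcl hq (δ / 2).toReal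
            (ENNReal.toReal_pos (ENNReal.half_pos hδ.ne').ne' (by finiteness))
          exact ⟨w, h1, h2, h3, by rwa [ENNReal.ofReal_toReal (by finiteness)] at h4⟩
      have hcomb : ∀ {θ f b δ}, X θ (f - b) < δ / 2 → ∀ {g}, X θ (b - g) < δ / 2 →
          X θ (f - g) < δ := fun {θ f b δ} h1 {g} h2 => by
        have : f - g = (f - b) + (b - g) := by abel
        rw [this]
        refine (hadd _ _ _).trans_lt ((ENNReal.add_lt_add h1 h2).trans_le ?_)
        rw [ENNReal.add_halves]
      constructor
      · intro δ hδ
        obtain ⟨w, hw1, -, hw3, hw4⟩ := hstep δ hδ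
        obtain ⟨g, h, hg, hh, hlt⟩ := hBL hq s w.1 hw1 ((hfst w).trans_lt hw3) (δ / 2)
          (ENNReal.half_pos hδ.ne')
        exact ⟨g, h, hg, hh, hcomb ((hfst (v - w)).trans_lt hw4) hlt⟩
      · intro δ hδ
        obtain ⟨w, -, hw2, hw3, hw4⟩ := hstep δ hδ
        obtain ⟨g, h, hg, hh, hlt⟩ := hBL hq (s - 1) w.2 hw2 ((hsnd w).trans_lt hw3) (δ / 2)
          (ENNReal.half_pos hδ.ne')
        exact ⟨g, h, hg, hh, hcomb ((hsnd (v - w)).trans_lt hw4) hlt⟩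
    · exact ⟨hdense hq s v.1 ((hfst v).trans_lt hv), hdense hq (s - 1) v.2 ((hsnd v).trans_lt hv)⟩
  have hinfl := hr.normInflationAt hN hX hκ (hXκ κ hκ) hadd he hμ hσ hρ hs happrox.1 happrox.2
  exact ⟨hinfl, hinfl.solutionMapDiscontinuousAt hadd hzero hv⟩

end

end

section

/-! ### The norm of `ℓ^q` -/

section

variable {d : ℕ} {q : ℝ≥0∞} {a b : Lattice d → ℝ≥0∞}

theorem ellNorm_mono (h : ∀ n, a n ≤ b n) : ellNorm q a ≤ ellNorm q b :=
  eLpNorm_mono_enorm fun n => by simpa using h n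

theorem ellNorm_zero : ellNorm q (fun _ : Lattice d => (0 : ℝ≥0∞)) = 0 :=
  eLpNorm_zero' 

theorem ellNorm_add_le (hq : 1 ≤ q) : ellNorm q (fun n => a n + b n) ≤ ellNorm q a + ellNorm q b :=
  eLpNorm_add_le (measurable_of_countable a).aestronglyMeasurable
    (measurable_of_countable b).aestronglyMeasurable hq

theorem ellNorm_top : ellNorm ⊤ a = ⨆ n, a n := by
  rw [ellNorm, eLpNorm_exponent_top, eLpNormEssSup, essSup_count]
  simp

theorem ellNorm_eq_tsum (hq : q ≠ 0) (hq' : q ≠ ⊤) :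
    ellNorm q a = (∑' n, a n ^ q.toReal) ^ (1 / q.toReal) := by
  rw [ellNorm, eLpNorm_eq_lintegral_rpow_enorm_toReal hq hq', lintegral_count]
  simp

theorem le_ellNorm (hq : q ≠ 0) (n : Lattice d) : a n ≤ ellNorm q a := by
  rcases eq_or_ne q ⊤ with rfl | hq'
  · rw [ellNorm_top]
    exact le_iSup a n
  · have hpos := ENNReal.toReal_pos hq hq'
    rw [ellNorm_eq_tsum hq hq']
    calc a n = (a n ^ q.toReal) ^ (1 / q.toReal) := by
          rw [← ENNReal.rpow_mul, mul_one_div_cancel hpos.ne', ENNReal.rpow_one]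
      _ ≤ _ := ENNReal.rpow_le_rpow (ENNReal.le_tsum n) (by positivity)

/-- With S the sum, each term satisfies a^q = a · a^(q-1) ≤ a S^(q-1). -/
theorem ellNorm_le_tsum (hq : 1 ≤ q) : ellNorm q a ≤ ∑' n, a n := by
  rcases eq_or_ne q ⊤ with rfl | hq'
  · rw [ellNorm_top]
    exact iSup_le fun n => ENNReal.le_tsum n
  have hq0 : q ≠ 0 := (one_pos.trans_le hq).ne'
  have hpos := ENNReal.toReal_pos hq0 hq'
  have h1 : 1 ≤ q.toReal := by
    rw [← ENNReal.toReal_one]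
    exact ENNReal.toReal_mono hq' hq
  rw [ellNorm_eq_tsum hq0 hq']
  set S := ∑' n, a n with hS
  rcases eq_or_ne S ⊤ with h | h
  · rw [h]
    exact le_top
  have h2 : ∑' n, a n ^ q.toReal ≤ S ^ q.toReal := by
    have hsplit : ∀ x : ℝ≥0∞, x ^ q.toReal = x * x ^ (q.toReal - 1) := fun x => by
      rcases eq_or_ne x 0 with rfl | hx
      · rw [ENNReal.zero_rpow_of_pos hpos, zero_mul]
      rcases eq_or_ne x ⊤ with rfl | hx'
      · rw [ENNReal.top_rpow_of_pos hpos, ENNReal.top_mul]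
        rcases h1.eq_or_lt with h3 | h3
        · simp [← h3]
        · rw [ENNReal.top_rpow_of_pos (by linarith)]
          simp
      · conv_rhs => rw [← ENNReal.rpow_one x, ← ENNReal.rpow_mul, one_mul,
          ← ENNReal.rpow_add _ _ hx hx']
        congr 1
        ring
    calc ∑' n, a n ^ q.toReal ≤ ∑' n, a n * S ^ (q.toReal - 1) := by
          refine ENNReal.tsum_le_tsum fun n => ?_
          rw [hsplit]
          exact mul_le_mul_right (ENNReal.rpow_le_rpow (ENNReal.le_tsum n) (by linarith)) _
      _ = S * S ^ (q.toReal - 1) := by rw [ENNReal.tsum_mul_right]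
      _ = S ^ q.toReal := (hsplit S).symm
  calc (∑' n, a n ^ q.toReal) ^ (1 / q.toReal) ≤ (S ^ q.toReal) ^ (1 / q.toReal) :=
        ENNReal.rpow_le_rpow h2 (by positivity)
    _ = S := by rw [← ENNReal.rpow_mul, mul_one_div_cancel hpos.ne', ENNReal.rpow_one]

/-- Tails of a convergent series. This fails for q = ∞, which is why the closure hypothesis is made
there. -/
theorem exists_ellNorm_tail_lt (hq : 1 ≤ q) (hq' : q ≠ ⊤) (ha : ellNorm q a < ⊤) {δ : ℝ≥0∞}
    (hδ : 0 < δ) : ∃ F : Finset (Lattice d), ellNorm q (fun n => if n ∈ F then 0 else a n) < δ := by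
  have hq0 : q ≠ 0 := (one_pos.trans_le hq).ne'
  have hpos := ENNReal.toReal_pos hq0 hq'
  rw [ellNorm_eq_tsum hq0 hq'] at ha
  have hfin : ∑' n, a n ^ q.toReal ≠ ⊤ := fun h => by
    rw [h, ENNReal.top_rpow_of_pos (by positivity)] at ha
    exact ha.ne rfl
  have hlim := ENNReal.tendsto_tsum_compl_atTop_zero hfin
  have hδ' : 0 < δ ^ q.toReal := by
    rcases eq_or_ne δ ⊤ with rfl | h
    · rw [ENNReal.top_rpow_of_pos hpos]; simp
    · exact ENNReal.rpow_pos hδ h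
  obtain ⟨F, hF⟩ := (hlim.eventually_lt_const hδ').exists
  refine ⟨F, ?_⟩
  rw [ellNorm_eq_tsum hq0 hq']
  have e1 : ∑' n, (if n ∈ F then 0 else a n) ^ q.toReal = ∑' n : {x // x ∉ F}, a n ^ q.toReal := by
    refine Eq.trans ?_ (tsum_subtype {x | x ∉ F} fun n => a n ^ q.toReal).symm
    refine tsum_congr fun n => ?_
    by_cases h : n ∈ F
    · simp [h, hpos]
    · simp [h]
  rw [e1]
  calc (∑' n : {x // x ∉ F}, a n ^ q.toReal) ^ (1 / q.toReal) < (δ ^ q.toReal) ^ (1 / q.toReal) :=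
        ENNReal.rpow_lt_rpow hF (by positivity)
    _ = δ := by rw [← ENNReal.rpow_mul, mul_one_div_cancel hpos.ne', ENNReal.rpow_one]

theorem weight_pos (s : ℝ) (n : Lattice d) : 0 < weight s n :=
  ENNReal.ofReal_pos.2 (by positivity)

theorem weight_ne_top (s : ℝ) (n : Lattice d) : weight s n ≠ ⊤ := ENNReal.ofReal_ne_top

theorem weight_zero_right (s : ℝ) : weight s (0 : Lattice d) = 1 := by
  simp [weight]

end

end

section

/-! ### Functions and distributions on the torus -/

section

variable {d : ℕ}

theorem isPeriodic_planeWave (n : Lattice d) : IsPeriodic (planeWave (latticeHom d) n) :=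
  (characterFun_mem n).2

theorem integral_unitCube_prod (f : Fin d → ℝ → ℂ) :
    ∫ x in unitCube (0 : Lattice d), ∏ i, f i (x i) =
      ∏ i, ∫ x in Ioc (-(1 / 2) : ℝ) (1 / 2), f i x := by
  rw [← integral_indicator (measurableSet_unitCube 0)]
  simp_rw [← integral_indicator (measurableSet_Ioc (a := (-(1 / 2) : ℝ)) (b := 1 / 2))]
  rw [← integral_fintype_prod_volume_eq_prod,
    ← (PiLp.volume_preserving_ofLp (Fin d)).integral_comp
      (MeasurableEquiv.toLp 2 (Fin d → ℝ)).symm.measurableEmbedding]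
  refine integral_congr_ae (Eventually.of_forall fun x => ?_)
  by_cases hx : x ∈ unitCube (0 : Lattice d)
  · simp only [indicator_of_mem hx]
    refine Finset.prod_congr rfl fun i _ => ?_
    have := hx i
    rw [Pi.zero_apply, Int.cast_zero, sub_zero] at this
    rw [indicator_of_mem this]
  · simp only [indicator_of_notMem hx]
    have : ∃ i, x i ∉ Ioc (-(1 / 2) : ℝ) (1 / 2) := by
      by_contra! h
      exact hx fun i => by simpa using h i
    obtain ⟨i, hi⟩ := this
    exact (Finset.prod_eq_zero (Finset.mem_univ i) (indicator_of_notMem hi _)).symm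

theorem integral_exp_two_pi_int {k : ℤ} (hk : k ≠ 0) :
    ∫ x in Ioc (-(1 / 2) : ℝ) (1 / 2), Complex.exp (2 * Real.pi * Complex.I * ((k * x : ℝ) : ℂ)) =
      0 := by
  have hc : (2 * Real.pi * Complex.I * k : ℂ) ≠ 0 := by
    have : (k : ℂ) ≠ 0 := by exact_mod_cast hk
    simp [Real.pi_ne_zero, this]
  rw [← intervalIntegral.integral_of_le (by norm_num)]
  have e : ∀ x : ℝ, Complex.exp (2 * Real.pi * Complex.I * ((k * x : ℝ) : ℂ)) =
      Complex.exp ((2 * Real.pi * Complex.I * k : ℂ) * x) := fun x => by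
    push_cast
    ring_nf
  simp_rw [e]
  rw [integral_exp_mul_complex hc, div_eq_zero_iff, sub_eq_zero]
  refine Or.inl (Complex.exp_eq_exp_iff_exists_int.2 ⟨k, ?_⟩)
  push_cast
  ring

theorem integral_planeWave (n : Lattice d) :
    ∫ x in unitCube (0 : Lattice d), planeWave (latticeHom d) n x = if n = 0 then 1 else 0 := by
  split_ifs with hn
  · subst hn
    simp only [planeWave, map_zero, PiLp.zero_apply, zero_mul, Finset.sum_const_zero,
      Complex.ofReal_zero, mul_zero, Complex.exp_zero]
    simp [Measure.real, volume_unitCube]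
  · have : ∃ i, n i ≠ 0 := by
      by_contra! h
      exact hn (funext h)
    obtain ⟨i, hi⟩ := this
    have e : ∀ x : Space d, planeWave (latticeHom d) n x =
        ∏ i, Complex.exp (2 * Real.pi * Complex.I * ((n i * x i : ℝ) : ℂ)) := fun x => by
      rw [← Complex.exp_sum, ← Finset.mul_sum, ← Complex.ofReal_sum]
      rfl
    simp_rw [e]
    rw [integral_unitCube_prod
      fun i x => Complex.exp (2 * Real.pi * Complex.I * ((n i * x : ℝ) : ℂ))]
    exact Finset.prod_eq_zero (Finset.mem_univ i) (integral_exp_two_pi_int hi)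

theorem isBounded_unitCube (n : Lattice d) : Bornology.IsBounded (unitCube n) :=
  isBounded_iff_forall_norm_le.2 ⟨_, fun _ h => norm_le_norm_latticePt h⟩

theorem integrableOn_unitCube {g : Space d → ℂ} (hg : Continuous g) (n : Lattice d) :
    IntegrableOn g (unitCube n) :=
  (hg.continuousOn.integrableOn_compact (isBounded_unitCube n).isCompact_closure).mono_set
    subset_closure

variable {h : Lattice d → ℂ}

theorem isPeriodic_synth (h : Lattice d → ℂ) :
    IsPeriodic (synth Measure.count (latticeHom d) h) := fun k x => by
  unfold synth
  simp_rw [isPeriodic_planeWave _ k x]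

theorem Decays.integrable_mul_planeWave {G : Type} [AddCommGroup G] [MeasurableSpace G]
    {m : Measure G} {ι : G →+ Space d} [IsFrequencySpace m ι] {h : G → ℂ} (hh : Decays ι h)
    (x : Space d) : Integrable (fun ξ => h ξ * planeWave ι ξ x) m :=
  (hh.integrable (m := m)).mul_bdd (c := 1)
    (measurable_planeWave (IsFrequencySpace.measurable m) x).aestronglyMeasurable
    (Eventually.of_forall fun ξ => (norm_planeWave ξ x).le)

theorem Decays.synth_eq_tsum (hh : Decays (latticeHom d) h) (x : Space d) :
    synth Measure.count (latticeHom d) h x = ∑' n, h n * planeWave (latticeHom d) n x := by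
  rw [synth, integral_countable (hh.integrable_mul_planeWave x)]
  simp [Measure.real]

/-- The Fourier coefficients of a trigonometric series. -/
theorem Decays.integral_planeWave_mul_synth (hh : Decays (latticeHom d) h) (n : Lattice d) :
    ∫ x in unitCube (0 : Lattice d), planeWave (latticeHom d) (-n) x *
      synth Measure.count (latticeHom d) h x = h n := by
  have e : ∀ x : Space d, planeWave (latticeHom d) (-n) x *
      synth Measure.count (latticeHom d) h x =
      ∑' k, h k * planeWave (latticeHom d) (-n + k) x := fun x => by
    rw [hh.synth_eq_tsum, ← tsum_mul_left]
    refine tsum_congr fun k => ?_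
    rw [planeWave_add]
    ring
  simp_rw [e]
  have hs : Summable fun k => ‖h k‖ := by
    have := hh.integrable (m := (Measure.count : Measure (Lattice d)))
    exact integrable_count_iff.1 this
  have hsum := hasSum_integral_of_summable_integral_norm
    (μ := (volume : Measure (Space d)).restrict (unitCube 0))
    (F := fun (k : Lattice d) x => h k * planeWave (latticeHom d) (-n + k) x)
    (fun k => integrableOn_unitCube
      (continuous_const.mul (continuous_planeWave _)) 0) (by
      simp only [norm_mul, norm_planeWave, mul_one, integral_const, smul_eq_mul, Measure.real,
        Measure.restrict_apply_univ, volume_unitCube, ENNReal.toReal_one, one_mul]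
      exact hs)
  rw [← hsum.tsum_eq]
  simp_rw [integral_const_mul, integral_planeWave]
  rw [tsum_eq_single n fun k hk => ?_]
  · simp
  · rw [if_neg, mul_zero]
    intro h0
    exact hk (by rw [neg_add_eq_zero] at h0; exact h0.symm)

theorem torusCoeff_eq_of_torusRepresents (hh : Decays (latticeHom d) h) {f : torusDistribution d}
    (hf : TorusRepresents (synth Measure.count (latticeHom d) h) f) (n : Lattice d) :
    torusCoeff f n = h n := by
  rw [torusCoeff, hf.2.2]
  exact hh.integral_planeWave_mul_synth n

/-- The distribution given by a continuous periodic function. -/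
theorem exists_torusRepresents {g : Space d → ℂ} (hg : Continuous g) (hp : IsPeriodic g) :
    ∃ f : torusDistribution d, TorusRepresents g f := by
  have hintg : ∀ φ : torusTest d, IntegrableOn (fun x => (φ : Space d → ℂ) x * g x) (unitCube 0) :=
    fun φ => integrableOn_unitCube (φ.2.1.continuous.mul hg) 0
  let f : Module.Dual ℂ (torusTest d) :=
    { toFun := fun φ => ∫ x in unitCube 0, (φ : Space d → ℂ) x * g x
      map_add' := fun φ ψ => by
        refine Eq.trans ?_ (integral_add (hintg φ) (hintg ψ))
        refine integral_congr_ae (Eventually.of_forall fun x => ?_)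
        simp [add_mul]
      map_smul' := fun c φ => by
        rw [RingHom.id_apply, smul_eq_mul, ← integral_const_mul]
        refine integral_congr_ae (Eventually.of_forall fun x => ?_)
        simp [mul_assoc] }
  refine ⟨⟨f, ∫ x in unitCube 0, ‖g x‖, 0, fun φ B hB => ?_⟩, hp,
    integrableOn_unitCube hg 0, fun φ => rfl⟩
  rw [mul_comm, ← integral_const_mul]
  refine norm_integral_le_of_norm_le ((integrableOn_unitCube hg 0).norm.const_mul B)
    (Eventually.of_forall fun x => ?_)
  have := hB 0 le_rfl x
  rw [norm_iteratedFDeriv_zero] at this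
  rw [norm_mul]
  exact mul_le_mul_of_nonneg_right this (norm_nonneg _)

theorem isCompact_cube : IsCompact {x : Space d | ∀ i, |x i| ≤ 1 / 2} := by
  refine Metric.isCompact_of_isClosed_isBounded ?_
    (isBounded_iff_forall_norm_le.2 ⟨_, fun x hx => norm_le_of_abs_le hx⟩)
  simp only [Set.ofPred_forall]
  exact isClosed_iInter fun i => isClosed_le (by fun_prop) continuous_const

theorem isOpen_cube : IsOpen {x : Space d | ∀ i, |x i| < 1 / 2} := by
  simp only [Set.ofPred_forall]
  exact isOpen_iInter_of_finite fun i => isOpen_lt (by fun_prop) continuous_const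

theorem unitCube_ae_eq_cube :
    unitCube (0 : Lattice d) =ᵐ[volume] {x : Space d | ∀ i, |x i| ≤ 1 / 2} := by
  have h1 : unitCube (0 : Lattice d) = (@WithLp.ofLp 2 (Fin d → ℝ)) ⁻¹'
      (Set.pi univ fun i => Ioc (-(1 / 2) : ℝ) (1 / 2)) := by
    ext ξ
    simp [unitCube]
  have h2 : {x : Space d | ∀ i, |x i| ≤ 1 / 2} = (@WithLp.ofLp 2 (Fin d → ℝ)) ⁻¹'
      (Icc (fun _ => -(1 / 2) : Fin d → ℝ) (fun _ => 1 / 2)) := by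
    ext ξ
    simp [abs_le, Pi.le_def, forall_and]
  rw [h1, h2]
  exact (PiLp.volume_preserving_ofLp (Fin d)).quasiMeasurePreserving.preimage_ae_eq
    Measure.univ_pi_Ioc_ae_eq_Icc

/-- A trigonometric polynomial whose maximum on the torus is attained at `a` only. -/
def peak (a x : Space d) : ℝ := 1 + ∑ i, (1 + Real.cos (2 * Real.pi * (x i - a i)))

theorem peak_pow_mem (a : Space d) (N : ℕ) :
    (fun x => ((peak a x ^ N : ℝ) : ℂ)) ∈ torusTest d := by
  refine ⟨?_, fun k x => ?_⟩
  · have : ContDiff ℝ ∞ fun x => peak a x ^ N := by unfold peak; fun_prop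
    exact Complex.ofRealCLM.contDiff.comp this
  · have : peak a (x + latticePt k) = peak a x := by
      unfold peak
      refine congrArg _ (Finset.sum_congr rfl fun i _ => congrArg _ ?_)
      rw [show 2 * Real.pi * ((x + latticePt k) i - a i) =
        2 * Real.pi * (x i - a i) + k i * (2 * Real.pi) by
          simp only [latticePt, PiLp.add_apply]; ring, Real.cos_add_int_mul_two_pi]
    simp only [this]

theorem peak_lt {a x : Space d} (ha : ∀ i, |a i| < 1 / 2) (hx : ∀ i, |x i| ≤ 1 / 2) (hxa : x ≠ a) :
    peak a x < peak a a := by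
  have : ∃ i, x i ≠ a i := by
    by_contra! h
    exact hxa (PiLp.ext h)
  obtain ⟨i, hi⟩ := this
  refine (add_lt_add_iff_left 1).2 (Finset.sum_lt_sum (fun j _ => ?_) ⟨i, Finset.mem_univ i, ?_⟩)
  · simpa using Real.cos_le_one _
  · rw [sub_self, mul_zero, Real.cos_zero]
    refine (add_lt_add_iff_left 1).2 (lt_of_le_of_ne (Real.cos_le_one _) fun h => hi ?_)
    have h1 := abs_lt.1 (ha i)
    have h2 := abs_le.1 (hx i)
    have hpi := Real.pi_pos
    have := (Real.cos_eq_one_iff_of_lt_of_lt (x := 2 * Real.pi * (x i - a i)) (by nlinarith)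
      (by nlinarith)).1 h
    rcases mul_eq_zero.1 this with h3 | h3
    · exact absurd h3 (by positivity)
    · linarith

/-- A continuous periodic function that is orthogonal to all test functions vanishes. -/
theorem eq_zero_of_forall_torusTest {w : Space d → ℂ} (hw : Continuous w) (hp : IsPeriodic w)
    (h : ∀ φ : torusTest d, ∫ x in unitCube 0, (φ : Space d → ℂ) x * w x = 0) : w = 0 := by
  have hopen : ∀ a ∈ {x : Space d | ∀ i, |x i| < 1 / 2}, w a = 0 := fun a ha => by
    -- The normalized powers of `peak a` are an approximate identity at a, and all of them are test
    -- functions, so the integrals that converge to w a are zero.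
    have hlim := tendsto_setIntegral_pow_smul_of_unique_maximum_of_isCompact_of_continuousOn
      (μ := (volume : Measure (Space d))) isCompact_cube (c := peak a) (x₀ := a) (g := w)
      (by unfold peak; fun_prop) (fun y hy hya => peak_lt ha hy hya)
      (fun x _ => add_nonneg zero_le_one (Finset.sum_nonneg fun i _ => by
        linarith [Real.neg_one_le_cos (2 * Real.pi * (x i - a i))]))
      (add_pos_of_pos_of_nonneg one_pos (Finset.sum_nonneg fun i _ => by
        linarith [Real.neg_one_le_cos (2 * Real.pi * (a i - a i))]))
      (subset_closure (interior_maximal (fun x hx i => (hx i).le) isOpen_cube ha)) hw.continuousOn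
    refine tendsto_nhds_unique hlim (tendsto_const_nhds.congr fun N => ?_)
    rw [← setIntegral_congr_set unitCube_ae_eq_cube (f := fun x => peak a x ^ N • w x)]
    have := h ⟨_, peak_pow_mem a N⟩
    simp only [Complex.real_smul]
    rw [this, mul_zero]
  -- Opposite faces of the cube are identified on the torus, so the maximum of the peak is unique
  -- only for interior points. The boundary is reached along t • a with t < 1, by continuity.
  have hcl : ∀ a ∈ {x : Space d | ∀ i, |x i| ≤ 1 / 2}, w a = 0 := fun a ha => by
    have h1 : Tendsto (fun t : ℝ => w (t • a)) (𝓝[<] 1) (𝓝 (w a)) := by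
      have : Continuous fun t : ℝ => w (t • a) := by fun_prop
      simpa using (this.tendsto 1).mono_left nhdsWithin_le_nhds
    refine tendsto_nhds_unique h1 (tendsto_const_nhds.congr' ?_)
    filter_upwards [Ioo_mem_nhdsLT (zero_lt_one' ℝ)] with t ht
    refine (hopen _ fun i => ?_).symm
    rw [PiLp.smul_apply, smul_eq_mul, abs_mul, abs_of_pos ht.1]
    have := ha i
    nlinarith [abs_nonneg (a i), ht.2, ht.1]
  funext x
  have h1 := hp (-nearestPt x) x
  rw [← h1]
  refine hcl _ fun i => ?_
  have h2 := mem_unitCube_nearestPt x i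
  simp only [latticePt, PiLp.add_apply, Pi.neg_apply, Int.cast_neg]
  exact abs_le.2 ⟨by linarith [h2.1], by linarith [h2.2]⟩

/-- The distribution `f` is the trigonometric series with the coefficients `h`. -/
def TorusProfile (f : torusDistribution d) (h : Lattice d → ℂ) : Prop :=
  Decays (latticeHom d) h ∧ TorusRepresents (synth Measure.count (latticeHom d) h) f

theorem TorusProfile.coeff {f : torusDistribution d} (hf : TorusProfile f h) (n : Lattice d) :
    torusCoeff f n = h n :=
  torusCoeff_eq_of_torusRepresents hf.1 hf.2 n

theorem torusCoeff_add (f g : torusDistribution d) (n : Lattice d) :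
    torusCoeff (f + g) n = torusCoeff f n + torusCoeff g n := rfl

theorem torusCoeff_sub (f g : torusDistribution d) (n : Lattice d) :
    torusCoeff (f - g) n = torusCoeff f n - torusCoeff g n := rfl

/-- The substantial point is that a continuous periodic function is determined by its distribution,
which is `eq_zero_of_forall_torusTest`. -/
theorem isRealization_torus :
    IsRealization Measure.count (latticeHom d) TorusRepresents TorusProfile where
  sub := by
    rintro f f' h h' ⟨hh, hp, hi, hf⟩ ⟨hh', -, hi', hf'⟩
    have e : synth Measure.count (latticeHom d) (h - h') = fun x =>
        synth Measure.count (latticeHom d) h x - synth Measure.count (latticeHom d) h' x := by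
      funext x
      refine Eq.trans ?_ (integral_sub (hh.integrable_mul_planeWave x)
        (hh'.integrable_mul_planeWave x))
      simp [synth, sub_mul]
    refine ⟨by rw [sub_eq_add_neg]; exact hh.add hh'.neg, isPeriodic_synth _, ?_, fun φ => ?_⟩
    · rw [e]
      exact hi.sub hi'
    · have hc := φ.2.1.continuous
      have h1 := integrableOn_unitCube (hc.mul (hh.continuous_synth (m := Measure.count))) 0
      have h2 := integrableOn_unitCube (hc.mul (hh'.continuous_synth (m := Measure.count))) 0
      calc (f - f').1 φ = f.1 φ - f'.1 φ := rfl
        _ = _ := by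
          rw [hf, hf', e]
          refine (integral_sub h1 h2).symm.trans ?_
          simp only [mul_sub, Pi.mul_apply]
  exists_profile := fun {h} hh => by
    obtain ⟨f, hf⟩ := exists_torusRepresents (hh.continuous_synth (m := Measure.count))
      (isPeriodic_synth h)
    exact ⟨f, hh, hf⟩
  rep := fun hf _ => hf.2
  rep_unique := by
    rintro f g g' hg hg' ⟨hp, -, hf⟩ ⟨hp', -, hf'⟩
    rw [← sub_eq_zero]
    refine eq_zero_of_forall_torusTest (hg.sub hg') (fun k x => by simp [hp k x, hp' k x])
      fun φ => ?_
    have hc := φ.2.1.continuous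
    have h1 := integrableOn_unitCube (hc.mul hg) 0
    have h2 := integrableOn_unitCube (hc.mul hg') 0
    have h3 := integral_sub h1 h2
    simp only [Pi.sub_apply, mul_sub]
    refine h3.trans ?_
    rw [sub_eq_zero]
    exact (hf φ).symm.trans (hf' φ)
  eq_of_rep := by
    rintro f f' g ⟨-, -, hf⟩ ⟨-, -, hf'⟩
    exact Subtype.ext (LinearMap.ext fun φ => (hf φ).trans (hf' φ).symm)

theorem latticePt_mem_unitCube (n : Lattice d) : latticePt n ∈ unitCube n := fun i => by
  simp [latticePt]

theorem hasUpperBound_torus {q : ℝ≥0∞} (hq : 1 ≤ q) (s : ℝ) :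
    HasUpperBound (latticeHom d) TorusProfile (torusFourierLebesgueNorm q s) s := by
  refine ⟨1, ENNReal.one_ne_top, fun f h hf _ β hβ => ?_⟩
  rw [one_mul]
  refine (ellNorm_mono fun n => ?_).trans (ellNorm_le_tsum hq)
  rw [hf.coeff]
  exact mul_le_mul_left (hβ n n (latticePt_mem_unitCube n)) _

/-- The only lattice point in the support of κ is 0, so the average is the zeroth coefficient, whose
weight is 1 for every s. -/
theorem hasLowerBound_torus {q : ℝ≥0∞} (hq : 1 ≤ q) (s : ℝ) {κ : Space d → ℝ} {r₀ : ℝ}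
    (hκ : IsLowCutoff κ r₀) :
    HasLowerBound Measure.count (latticeHom d) TorusProfile κ (torusFourierLebesgueNorm q s) := by
  refine ⟨1, ENNReal.one_ne_top, fun f h hf hh => ?_⟩
  rw [one_mul]
  have h0 : ∀ n : Lattice d, n ≠ 0 → κ (latticeHom d n) = 0 := fun n hn => by
    refine hκ.eq_zero _ ?_
    have : ∃ i, n i ≠ 0 := by
      by_contra! h
      exact hn (funext h)
    obtain ⟨i, hi⟩ := this
    have h1 := PiLp.norm_apply_le (latticePt n) i
    have h2 : (1 : ℝ) ≤ |(n i : ℝ)| := by exact_mod_cast Int.one_le_abs hi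
    have h3 : ‖latticePt n i‖ = |(n i : ℝ)| := rfl
    rw [latticeHom_apply]
    linarith
  have e : (fun n => (κ (latticeHom d n) : ℂ) * h n) = Pi.single 0 (h 0) := by
    funext n
    by_cases hn : n = 0
    · subst hn
      rw [map_zero, hκ.eq_one 0 (by simpa using hκ.pos.le)]
      simp
    · rw [h0 n hn, Pi.single_eq_of_ne hn]
      simp
  have hi : Integrable (Pi.single 0 (h 0) : Lattice d → ℂ) Measure.count := by
    rw [integrable_count_iff]
    exact (hasSum_single 0 fun n hn => by rw [Pi.single_eq_of_ne hn, norm_zero]).summable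
  rw [e, integral_countable hi, tsum_eq_single 0 fun n hn => by
    rw [Pi.single_eq_of_ne hn, smul_zero]]
  refine le_trans (le_of_eq ?_) (le_ellNorm (one_pos.trans_le hq).ne' 0)
  simp [Measure.real, weight_zero_right, hf.coeff]

theorem torusFourierLebesgueNorm_add_le {q : ℝ≥0∞} (hq : 1 ≤ q) (s : ℝ) (f g : torusDistribution d) :
    torusFourierLebesgueNorm q s (f + g) ≤
      torusFourierLebesgueNorm q s f + torusFourierLebesgueNorm q s g := by
  refine le_trans (ellNorm_mono fun n => ?_) (ellNorm_add_le hq)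
  rw [torusCoeff_add, ← add_mul]
  exact mul_le_mul_left (enorm_add_le _ _) _

theorem torusFourierLebesgueNorm_zero (q : ℝ≥0∞) (s : ℝ) :
    torusFourierLebesgueNorm q s (0 : torusDistribution d) = 0 := by
  refine (congrArg (ellNorm q) (funext fun n => ?_)).trans ellNorm_zero
  rw [show torusCoeff (0 : torusDistribution d) n = 0 from rfl, enorm_zero, zero_mul]

theorem exists_torusProfile_restrict (f : torusDistribution d) (F : Finset (Lattice d)) :
    ∃ g, TorusProfile g (fun n => if n ∈ F then torusCoeff f n else 0) ∧
      Nice (latticeHom d) (fun n => if n ∈ F then torusCoeff f n else 0) := by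
  have hn : Nice (latticeHom d) (fun n => if n ∈ F then torusCoeff f n else 0) := by
    refine ⟨measurable_of_countable _, ∑ n ∈ F, ‖torusCoeff f n‖, by positivity,
      ∑ n ∈ F, ‖latticePt n‖, by positivity, fun n => ⟨?_, fun h => if_neg fun hn => ?_⟩⟩
    · dsimp only
      split_ifs with hn
      · exact Finset.single_le_sum (f := fun n => ‖torusCoeff f n‖) (fun _ _ => norm_nonneg _) hn
      · rw [norm_zero]
        positivity
    · exact h.not_ge (Finset.single_le_sum (f := fun n => ‖latticePt n‖)
        (fun _ _ => norm_nonneg _) hn)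
  obtain ⟨g, hg⟩ := isRealization_torus.exists_profile (hn.decays Measure.count)
  exact ⟨g, hg, hn⟩

theorem niceApprox_torus {q : ℝ≥0∞} (hq : 1 ≤ q) (hq' : q ≠ ⊤) (s : ℝ) {f : torusDistribution d}
    (hf : torusFourierLebesgueNorm q s f < ⊤) :
    NiceApprox (latticeHom d) TorusProfile (torusFourierLebesgueNorm q s) f := fun δ hδ => by
  obtain ⟨F, hF⟩ := exists_ellNorm_tail_lt hq hq' hf hδ
  obtain ⟨g, hg, hn⟩ := exists_torusProfile_restrict f F
  refine ⟨g, _, hg, hn, lt_of_le_of_lt (ellNorm_mono fun n => ?_) hF⟩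
  rw [torusCoeff_sub, hg.coeff]
  by_cases h : n ∈ F <;> simp [h]

theorem niceApprox_torus_of_bandLimited (q : ℝ≥0∞) (s : ℝ) {f : torusDistribution d}
    (hf : TorusBandLimited f) :
    NiceApprox (latticeHom d) TorusProfile (torusFourierLebesgueNorm q s) f := fun δ hδ => by
  have hfin : {n : Lattice d | torusCoeff f n ≠ 0}.Finite := hf
  obtain ⟨g, hg, hn⟩ := exists_torusProfile_restrict f hfin.toFinset
  refine ⟨g, _, hg, hn, lt_of_le_of_lt (le_of_eq ?_) hδ⟩
  refine (congrArg (ellNorm q) (funext fun n => ?_)).trans ellNorm_zero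
  rw [torusCoeff_sub, hg.coeff]
  have h : (if n ∈ hfin.toFinset then torusCoeff f n else 0) = torusCoeff f n := by
    simp only [Set.Finite.mem_toFinset, mem_ofPred_eq]
    split_ifs with h
    · rfl
    · exact (not_not.1 h).symm
  rw [h, sub_self, enorm_zero, zero_mul]

theorem latticePt_single (i : Fin d) :
    latticePt (Pi.single i 1 : Lattice d) = EuclideanSpace.single i 1 := by
  ext j
  by_cases h : j = i
  · subst h
    simp [latticePt]
  · simp [latticePt, h]

theorem stronglyIllPosed_torus (i₀ : Fin d) {σ ρ : ℕ} (hσ : 2 ≤ σ) (hρ : ρ ≤ σ) {μ : ℂ}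
    (hμ : ‖μ‖ = 1) {q : ℝ≥0∞} (hq : 1 ≤ q) {s : ℝ} (hs : s < 0) :
    StronglyIllPosed (torusFourierLebesgueNorm (d := d) q) (SolTorus μ ρ σ) TorusBandLimited q s :=
  isRealization_torus.stronglyIllPosed (hasUpperBound_torus le_rfl 0)
    (fun θ => hasUpperBound_torus hq θ) (fun _ hκ θ => hasLowerBound_torus hq θ hκ)
    (fun θ => torusFourierLebesgueNorm_add_le hq θ) (fun θ => torusFourierLebesgueNorm_zero q θ)
    (latticePt_single i₀) (fun hq' θ _ hf => niceApprox_torus hq hq' θ hf)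
    (fun _ θ _ hf _ => niceApprox_torus_of_bandLimited q θ hf) hμ hσ hρ hs

end

end

section

/-! ### Functions as tempered distributions -/

section

variable {d : ℕ} {g g' : Space d → ℂ} {f f' : 𝓢'(Space d, ℂ)}

/-- A smooth function of compact support, as a Schwartz function. -/
theorem exists_schwartz_eq {ψ : Space d → ℝ} (hψ : ContDiff ℝ ∞ ψ) (hc : HasCompactSupport ψ) :
    ∃ φ : 𝓢(Space d, ℂ), ∀ x, φ x = (ψ x : ℂ) := by
  have hc' : HasCompactSupport (fun x => (ψ x : ℂ)) := hc.comp_left (g := Complex.ofReal) rfl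
  exact ⟨hc'.toSchwartzMap (Complex.ofRealCLM.contDiff.comp hψ), fun x => rfl⟩

/-- Test with a Schwartz function that equals 1 on a ball containing the compact set. -/
theorem Represents.locallyIntegrable (h : Represents g f) : LocallyIntegrable g volume := by
  rw [locallyIntegrable_iff]
  intro K hK
  obtain ⟨R, hR⟩ := hK.isBounded.subset_closedBall 0
  let b : ContDiffBump (0 : Space d) := ⟨|R| + 1, |R| + 2, by positivity, by linarith⟩
  obtain ⟨φ, hφ⟩ := exists_schwartz_eq b.contDiff b.hasCompactSupport
  refine ((h.2 φ).1.integrableOn (s := K)).congr_fun (fun x hx => ?_) hK.measurableSet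
  have hx' : x ∈ Metric.closedBall (0 : Space d) b.rIn :=
    Metric.closedBall_subset_closedBall (by
      change R ≤ |R| + 1
      linarith [le_abs_self R]) (hR hx)
  simp only [hφ, b.one_of_mem_closedBall hx', Complex.ofReal_one, one_mul]

theorem Represents.ae_eq (h : Represents g f) (h' : Represents g' f) : g =ᵐ[volume] g' := by
  refine ae_eq_of_integral_contDiff_smul_eq h.locallyIntegrable h'.locallyIntegrable
    fun ψ hψ hc => ?_
  obtain ⟨φ, hφ⟩ := exists_schwartz_eq hψ hc
  have := (h.2 φ).2.symm.trans (h'.2 φ).2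
  simpa only [hφ, Complex.real_smul] using this

theorem Represents.congr (h : Represents g f) (hg : g =ᵐ[volume] g') : Represents g' f := by
  refine ⟨h.1.congr hg, fun φ => ?_⟩
  have e : (fun x => φ x * g x) =ᵐ[volume] fun x => φ x * g' x := by
    filter_upwards [hg] with x hx
    rw [hx]
  exact ⟨(h.2 φ).1.congr e, (h.2 φ).2.trans (integral_congr_ae e)⟩

theorem Represents.sub (h : Represents g f) (h' : Represents g' f') :
    Represents (g - g') (f - f') := by
  refine ⟨h.1.sub h'.1, fun φ => ?_⟩
  have e : (fun x => φ x * (g - g') x) = (fun x => φ x * g x) - fun x => φ x * g' x := by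
    funext x
    simp [mul_sub]
  rw [e]
  refine ⟨(h.2 φ).1.sub (h'.2 φ).1, ?_⟩
  refine Eq.trans ?_ (integral_sub (h.2 φ).1 (h'.2 φ).1).symm
  rw [← (h.2 φ).2, ← (h'.2 φ).2]
  rfl

theorem Represents.zero : Represents 0 (0 : 𝓢'(Space d, ℂ)) := by
  refine ⟨aestronglyMeasurable_const, fun φ => ?_⟩
  simp

theorem Represents.neg (h : Represents g f) : Represents (-g) (-f) := by
  simpa using Represents.zero.sub h

theorem Represents.add (h : Represents g f) (h' : Represents g' f') :
    Represents (g + g') (f + f') := by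
  simpa using h.sub h'.neg

theorem Represents.sum {ι : Type} (F : Finset ι) {g : ι → Space d → ℂ} {f : ι → 𝓢'(Space d, ℂ)}
    (h : ∀ i ∈ F, Represents (g i) (f i)) : Represents (∑ i ∈ F, g i) (∑ i ∈ F, f i) := by
  classical
  induction F using Finset.induction_on with
  | empty => simpa using Represents.zero
  | insert i F hi ih =>
    rw [Finset.sum_insert hi, Finset.sum_insert hi]
    exact (h i (Finset.mem_insert_self i F)).add
      (ih fun j hj => h j (Finset.mem_insert_of_mem hj))

theorem Represents.eq (h : Represents g f) (h' : Represents g f') : f = f' := by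
  ext φ
  rw [(h.2 φ).2, (h'.2 φ).2]

theorem represents_toTemperedDistribution {p : ℝ≥0∞} [hp : Fact (1 ≤ p)]
    (g : Lp (α := Space d) ℂ p) : Represents g (g : 𝓢'(Space d, ℂ)) := by
  refine ⟨(Lp.memLp g).1, fun φ => ⟨?_, ?_⟩⟩
  · have := ENNReal.HolderConjugate.conjExponent hp.out
    exact MemLp.integrable_mul (p := ENNReal.conjExponent p) (q := p) (φ.memLp _ volume)
      (Lp.memLp g)
  · rw [Lp.toTemperedDistribution_apply]
    simp only [smul_eq_mul]

theorem exists_represents_of_memLp {p : ℝ≥0∞} (hp : 1 ≤ p) (hg : MemLp g p volume) :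
    ∃ f, Represents g f := by
  have : Fact (1 ≤ p) := ⟨hp⟩
  exact ⟨_, (represents_toTemperedDistribution (hg.toLp g)).congr hg.coeFn_toLp⟩

theorem exists_Lp_ae_eq {p : ℝ≥0∞} (hg : MemLp g p (volume : Measure (Space d))) :
    ∃ G : Lp ℂ p (volume : Measure (Space d)), (G : Space d → ℂ) =ᵐ[volume] g :=
  ⟨MemLp.toLp g hg, MemLp.coeFn_toLp hg⟩

/-- Plancherel's theorem for the inverse Fourier transform. -/
theorem Represents.exists_of_fourier (h : Represents g (𝓕 f)) (hg : MemLp g 2 volume) :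
    ∃ v, Represents v f ∧ eLpNorm v 2 volume = eLpNorm g 2 volume := by
  obtain ⟨G, hG⟩ := exists_Lp_ae_eq hg
  have h1 : (𝓕 f : 𝓢'(Space d, ℂ)) = G :=
    h.eq ((represents_toTemperedDistribution G).congr hG)
  have h2 : f = (𝓕⁻ G : Lp ℂ 2 (volume : Measure (Space d))) := by
    rw [← Lp.fourierInv_toTemperedDistribution_eq, ← h1, FourierTransform.fourierInv_fourier_eq]
  refine ⟨(𝓕⁻ G : Lp ℂ 2 (volume : Measure (Space d))), ?_, ?_⟩
  · rw [h2]
    exact represents_toTemperedDistribution _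
  · have h3 : ‖(𝓕⁻ G : Lp ℂ 2 (volume : Measure (Space d)))‖ = ‖G‖ := (Lp.fourierTransformₗᵢ _ _).symm.norm_map G
    rw [← eLpNorm_congr_ae hG, ← Lp.enorm_def, ← Lp.enorm_def, ← ofReal_norm, h3, ofReal_norm]

/-- Plancherel's theorem for the Fourier transform. -/
theorem Represents.exists_fourier (h : Represents g f) (hg : MemLp g 2 volume) :
    ∃ v, Represents v (𝓕 f) ∧ eLpNorm v 2 volume = eLpNorm g 2 volume := by
  obtain ⟨G, hG⟩ := exists_Lp_ae_eq hg
  have h1 : f = G := h.eq ((represents_toTemperedDistribution G).congr hG)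
  refine ⟨(𝓕 G : Lp ℂ 2 (volume : Measure (Space d))), ?_, ?_⟩
  · rw [h1, Lp.fourier_toTemperedDistribution_eq]
    exact represents_toTemperedDistribution _
  · rw [← eLpNorm_congr_ae hG, ← Lp.enorm_def, ← Lp.enorm_def, ← ofReal_norm, Lp.norm_fourier_eq,
      ofReal_norm]

theorem synth_eq_fourierInv (h : Space d → ℂ) :
    synth volume (AddMonoidHom.id (Space d)) h = 𝓕⁻ h := by
  funext x
  rw [Real.fourierInv_eq', synth]
  refine integral_congr_ae (Eventually.of_forall fun ξ => ?_)
  simp only [planeWave, smul_eq_mul, AddMonoidHom.id_apply]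
  rw [mul_comm]
  congr 2
  have : inner ℝ ξ x = ∑ i, ξ i * x i := by
    rw [PiLp.inner_apply]
    exact Finset.sum_congr rfl fun i _ => by simp [mul_comm]
  rw [this]
  push_cast
  ring

theorem integral_fourierInv_mul_eq_flip (φ : 𝓢(Space d, ℂ)) {h : Space d → ℂ}
    (hh : Integrable h volume) :
    ∫ ξ, (𝓕⁻ φ : 𝓢(Space d, ℂ)) ξ * h ξ = ∫ x, φ x * (𝓕⁻ h) x := by
  have hflip : (-innerₗ (Space d)).flip = -innerₗ (Space d) := by
    ext x y
    simp [real_inner_comm]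
  have := VectorFourier.integral_fourierIntegral_smul_eq_flip (L := -innerₗ (Space d))
    (μ := volume) (ν := volume) (f := φ) (g := h) Real.continuous_fourierChar
    (continuous_inner (𝕜 := ℝ) (E := Space d)).neg φ.integrable hh
  rw [hflip] at this
  rw [SchwartzMap.fourierInv_coe]
  exact this

/-- By duality: the inverse Fourier transform moves from the function h to the test function, where
it cancels the Fourier transform of the distribution. -/
theorem Represents.synth {h : Space d → ℂ} (hf : Represents h (𝓕 f))
    (hh : Decays (AddMonoidHom.id (Space d)) h) :
    Represents (synth volume (AddMonoidHom.id (Space d)) h) f := by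
  have hi : Integrable h volume := hh.integrable
  have hc : Continuous (NLW.synth volume (AddMonoidHom.id (Space d)) h) := hh.continuous_synth
  have hb : ∀ x, ‖NLW.synth volume (AddMonoidHom.id (Space d)) h x‖ ≤ ∫ ξ, ‖h ξ‖ := fun x => by
    refine (norm_integral_le_integral_norm _).trans (le_of_eq ?_)
    simp only [norm_mul, norm_planeWave, mul_one]
  refine ⟨hc.aestronglyMeasurable, fun φ => ⟨?_, ?_⟩⟩
  · exact φ.integrable.mul_bdd hc.aestronglyMeasurable (Eventually.of_forall hb)
  · rw [synth_eq_fourierInv, ← integral_fourierInv_mul_eq_flip φ hi, ← (hf.2 (𝓕⁻ φ)).2,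
      TemperedDistribution.fourier_apply, FourierTransform.fourier_fourierInv_eq]

/-- The Fourier transform of `f` is the function `h` of exponential decay. -/
def FourierProfile (f : 𝓢'(Space d, ℂ)) (h : Space d → ℂ) : Prop :=
  Decays (AddMonoidHom.id (Space d)) h ∧ Represents h (𝓕 f)

theorem fourier_sub (f f' : 𝓢'(Space d, ℂ)) : 𝓕 (f - f') = 𝓕 f - 𝓕 f' := by
  ext φ
  rfl

theorem fourier_add (f f' : 𝓢'(Space d, ℂ)) : 𝓕 (f + f') = 𝓕 f + 𝓕 f' := by
  ext φ
  rfl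

theorem isRealization_space :
    IsRealization volume (AddMonoidHom.id (Space d)) Represents FourierProfile where
  sub := by
    rintro f f' h h' ⟨hh, hf⟩ ⟨hh', hf'⟩
    refine ⟨by rw [sub_eq_add_neg]; exact hh.add hh'.neg, ?_⟩
    rw [fourier_sub]
    exact hf.sub hf'
  exists_profile := fun {h} hh => by
    obtain ⟨f, hf⟩ := exists_represents_of_memLp le_rfl
      (memLp_one_iff_integrable.2 (hh.integrable (m := volume)))
    exact ⟨𝓕⁻ f, hh, by rwa [FourierTransform.fourier_fourierInv_eq]⟩
  rep := fun hf hh => hf.2.synth hh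
  rep_unique := fun hg hg' h h' => (hg.ae_eq_iff_eq volume hg').1 (h.ae_eq h')
  eq_of_rep := fun h h' => h.eq h'

theorem Represents.ae_eq_zero_of_isVanishingOn (h : Represents g f) {U : Set (Space d)}
    (hU : IsOpen U) (hf : Distribution.IsVanishingOn f U) : ∀ᵐ x, x ∈ U → g x = 0 := by
  refine hU.ae_eq_zero_of_integral_contDiff_smul_eq_zero
    (h.locallyIntegrable.locallyIntegrableOn U) fun ψ hψ hc hs => ?_
  obtain ⟨φ, hφ⟩ := exists_schwartz_eq hψ hc
  have h1 := hf φ (by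
    refine subset_trans (closure_mono fun x hx => ?_) hs
    rw [Function.mem_support, hφ] at hx
    exact_mod_cast hx)
  rw [(h.2 φ).2] at h1
  simpa only [hφ, Complex.real_smul] using h1

end

end

section

/-! ### Fourier amalgam spaces -/

section

variable {d : ℕ} {p q : ℝ≥0∞} {s : ℝ} {g : Space d → ℂ} {f f' : 𝓢'(Space d, ℂ)}

/-- Representatives agree almost everywhere, so the infimum is over equal values. -/
theorem fourierAmalgamNorm_eq (hg : Represents g (𝓕 f)) :
    fourierAmalgamNorm p q s f =
      ellNorm q (fun n : Lattice d => eLpNorm g p (volume.restrict (unitCube n)) * weight s n) := by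
  refine le_antisymm (iInf₂_le g hg) (le_iInf₂ fun g' hg' => le_of_eq ?_)
  congr 1
  funext n
  rw [eLpNorm_congr_ae (ae_restrict_of_ae (hg.ae_eq hg'))]

theorem exists_represents_of_fourierAmalgamNorm_lt_top (hf : fourierAmalgamNorm p q s f < ⊤) :
    ∃ g, Represents g (𝓕 f) := by
  obtain ⟨g, hg⟩ := iInf_lt_iff.1 hf
  obtain ⟨hg, -⟩ := iInf_lt_iff.1 hg
  exact ⟨g, hg⟩

theorem fourierAmalgamNorm_add_le (hp : 1 ≤ p) (hq : 1 ≤ q) (s : ℝ) (f f' : 𝓢'(Space d, ℂ)) :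
    fourierAmalgamNorm p q s (f + f') ≤ fourierAmalgamNorm p q s f + fourierAmalgamNorm p q s f' := by
  rcases eq_or_ne (fourierAmalgamNorm p q s f) ⊤ with h | h
  · simp [h]
  rcases eq_or_ne (fourierAmalgamNorm p q s f') ⊤ with h' | h'
  · simp [h']
  obtain ⟨g, hg⟩ := exists_represents_of_fourierAmalgamNorm_lt_top h.lt_top
  obtain ⟨g', hg'⟩ := exists_represents_of_fourierAmalgamNorm_lt_top h'.lt_top
  have hs : Represents (g + g') (𝓕 (f + f')) := by
    rw [fourier_add]
    exact hg.add hg'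
  rw [fourierAmalgamNorm_eq hg, fourierAmalgamNorm_eq hg', fourierAmalgamNorm_eq hs]
  refine le_trans (ellNorm_mono fun n => ?_) (ellNorm_add_le hq)
  rw [← add_mul]
  exact mul_le_mul_left (eLpNorm_add_le hg.1.restrict hg'.1.restrict hp) _

theorem fourierAmalgamNorm_zero (p q : ℝ≥0∞) (s : ℝ) :
    fourierAmalgamNorm p q s (0 : 𝓢'(Space d, ℂ)) = 0 := by
  have h : Represents 0 (𝓕 (0 : 𝓢'(Space d, ℂ))) := by
    have := fourier_sub (0 : 𝓢'(Space d, ℂ)) 0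
    rw [sub_self, sub_self] at this
    rw [this]
    exact Represents.zero
  rw [fourierAmalgamNorm_eq h]
  refine (congrArg (ellNorm q) (funext fun n => ?_)).trans ellNorm_zero
  rw [eLpNorm_zero, zero_mul]

theorem eLpNorm_unitCube_le {n : Lattice d} {β : ℝ≥0∞} (h : ∀ ξ ∈ unitCube n, ‖g ξ‖ₑ ≤ β) :
    eLpNorm g p (volume.restrict (unitCube n)) ≤ β := by
  refine (eLpNorm_le_of_ae_enorm_bound (C := β)
    ((ae_restrict_iff' (measurableSet_unitCube n)).2 (Eventually.of_forall h))).trans ?_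
  simp [volume_unitCube]

theorem hasUpperBound_fourierAmalgam (hq : 1 ≤ q) (p : ℝ≥0∞) (s : ℝ) :
    HasUpperBound (AddMonoidHom.id (Space d)) FourierProfile (fourierAmalgamNorm p q s) s := by
  refine ⟨1, ENNReal.one_ne_top, fun f h hf _ β hβ => ?_⟩
  rw [one_mul, fourierAmalgamNorm_eq hf.2]
  refine (ellNorm_mono fun n => ?_).trans (ellNorm_le_tsum hq)
  exact mul_le_mul_left (eLpNorm_unitCube_le fun ξ hξ => hβ ξ n hξ) _

theorem mem_unitCube_zero_of_norm_le {ξ : Space d} (h : ‖ξ‖ ≤ 1 / 4) :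
    ξ ∈ unitCube (0 : Lattice d) := fun i => by
  have h1 : |ξ i| ≤ 1 / 4 := (PiLp.norm_apply_le ξ i).trans h
  have h2 := abs_le.1 h1
  simp only [Pi.zero_apply, Int.cast_zero, sub_zero]
  exact ⟨by linarith [h2.1], by linarith [h2.2]⟩

theorem IsLowCutoff.enorm_integral_le {κ : Space d → ℝ} {r₀ : ℝ} (hκ : IsLowCutoff κ r₀)
    (h : Space d → ℂ) :
    ‖∫ ξ, (κ ξ : ℂ) * h ξ‖ₑ ≤ eLpNorm h 1 (volume.restrict (unitCube 0)) := by
  refine (enorm_integral_le_lintegral_enorm _).trans ?_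
  rw [eLpNorm_one_eq_lintegral_enorm, ← lintegral_indicator (measurableSet_unitCube 0)]
  refine lintegral_mono fun ξ => ?_
  by_cases hξ : ‖ξ‖ ≤ 1 / 4
  · rw [indicator_of_mem (mem_unitCube_zero_of_norm_le hξ), enorm_mul]
    refine mul_le_of_le_one_left' ?_
    rw [← ofReal_norm, ← ENNReal.ofReal_one]
    refine ENNReal.ofReal_le_ofReal ?_
    rw [Complex.norm_real, Real.norm_eq_abs, abs_of_nonneg (hκ.mem_unit ξ).1]
    exact (hκ.mem_unit ξ).2
  · rw [hκ.eq_zero ξ (not_le.1 hξ)]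
    simp

theorem eLpNorm_one_unitCube_le (hp : 1 ≤ p) (n : Lattice d) (hg : AEStronglyMeasurable g volume) :
    eLpNorm g 1 (volume.restrict (unitCube n)) ≤ eLpNorm g p (volume.restrict (unitCube n)) := by
  have : IsProbabilityMeasure ((volume : Measure (Space d)).restrict (unitCube n)) :=
    ⟨by rw [Measure.restrict_apply_univ, volume_unitCube]⟩
  exact eLpNorm_le_eLpNorm_of_exponent_le hp hg.restrict

/-- The support of κ lies in the unit cube around 0. There L^p controls L¹ by Hölder's inequality on
a probability space, and the weight is 1 for every s. -/
theorem hasLowerBound_fourierAmalgam (hp : 1 ≤ p) (hq : 1 ≤ q) (s : ℝ) {κ : Space d → ℝ} {r₀ : ℝ}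
    (hκ : IsLowCutoff κ r₀) : HasLowerBound volume (AddMonoidHom.id (Space d)) FourierProfile κ
      (fourierAmalgamNorm p q s) := by
  refine ⟨1, ENNReal.one_ne_top, fun f h hf hh => ?_⟩
  rw [one_mul, fourierAmalgamNorm_eq hf.2]
  refine (hκ.enorm_integral_le h).trans ((eLpNorm_one_unitCube_le hp 0
    hh.1.aestronglyMeasurable).trans ?_)
  refine le_trans (le_of_eq ?_) (le_ellNorm (one_pos.trans_le hq).ne' 0)
  rw [weight_zero_right, mul_one]

/-- Truncation of a function to a bounded function that is supported in finitely many cubes. -/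
theorem exists_nice_truncation (hg : StronglyMeasurable g) (F : Finset (Lattice d))
    (hF : ∀ n ∈ F, eLpNorm g p (volume.restrict (unitCube n)) < ⊤) {η : ℝ} (hη : 0 < η) :
    ∃ h : Space d → ℂ, Nice (AddMonoidHom.id (Space d)) h ∧
      (∀ n ∈ F, eLpNorm (g - h) p (volume.restrict (unitCube n)) ≤ ENNReal.ofReal η) ∧
      ∀ n ∉ F, ∀ x ∈ unitCube n, h x = 0 := by
  -- A level is chosen for each of the finitely many cubes; the sum of their absolute values is a
  -- common level for the truncation.
  have hM : ∀ n : Lattice d, ∃ M : ℝ, n ∈ F → eLpNorm ({x | M ≤ ‖g x‖₊}.indicator g) p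
      (volume.restrict (unitCube n)) ≤ ENNReal.ofReal η := fun n => by
    by_cases hn : n ∈ F
    · obtain ⟨M, hM⟩ := MemLp.eLpNorm_indicator_norm_ge_le
        (⟨hg.aestronglyMeasurable, hF n hn⟩ : MemLp g p (volume.restrict (unitCube n))) hg hη
      exact ⟨M, fun _ => hM⟩
    · exact ⟨0, fun h => absurd h hn⟩
  choose M hM using hM
  obtain ⟨B, hB⟩ : ∃ B, B = ∑ n ∈ F, |M n| := ⟨_, rfl⟩
  have hB0 : 0 ≤ B := by rw [hB]; positivity
  have hMB : ∀ n ∈ F, M n ≤ B := fun n hn => (le_abs_self _).trans (by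
    rw [hB]
    exact Finset.single_le_sum (f := fun n => |M n|) (fun _ _ => abs_nonneg _) hn)
  obtain ⟨S, hS⟩ : ∃ S : Set (Space d), S = {x | ‖g x‖ < B} ∩ ⋃ n ∈ F, unitCube n := ⟨_, rfl⟩
  have hSm : MeasurableSet S := by
    rw [hS]
    exact (measurableSet_lt hg.measurable.norm measurable_const).inter
      (F.measurableSet_biUnion fun n _ => measurableSet_unitCube n)
  refine ⟨S.indicator g, ⟨hg.measurable.indicator hSm, B, hB0,
    ∑ n ∈ F, (‖latticePt n‖ + d), by positivity, fun ξ => ⟨?_, fun h => ?_⟩⟩, fun n hn => ?_,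
    fun n hn x hx => ?_⟩
  · by_cases hξ : ξ ∈ S
    · rw [indicator_of_mem hξ]
      rw [hS] at hξ
      exact hξ.1.le
    · rw [indicator_of_notMem hξ, norm_zero]
      exact hB0
  · refine indicator_of_notMem (fun hξ => h.not_ge ?_) _
    rw [hS] at hξ
    obtain ⟨n, hn, hξn⟩ := mem_iUnion₂.1 hξ.2
    have h1 := Finset.single_le_sum (f := fun n : Lattice d => ‖latticePt n‖ + d)
      (fun _ _ => by positivity) hn
    have h2 := norm_le_norm_latticePt hξn
    rw [AddMonoidHom.id_apply]
    linarith
  · refine le_trans (eLpNorm_mono_ae ?_) (hM n hn)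
    filter_upwards [ae_restrict_mem (measurableSet_unitCube n)] with x hx
    by_cases hxB : ‖g x‖ < B
    · have : x ∈ S := by
        rw [hS]
        exact ⟨hxB, mem_iUnion₂.2 ⟨n, hn, hx⟩⟩
      rw [Pi.sub_apply, indicator_of_mem this, sub_self, norm_zero]
      exact norm_nonneg _
    · have h1 : x ∉ S := fun h => by
        rw [hS] at h
        exact hxB h.1
      have h2 : x ∈ {x | M n ≤ ‖g x‖₊} := (hMB n hn).trans (not_lt.1 hxB)
      rw [Pi.sub_apply, indicator_of_notMem h1, indicator_of_mem h2, sub_zero]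
  · refine indicator_of_notMem (fun h => hn ?_) _
    rw [hS] at h
    obtain ⟨m, hm, hxm⟩ := mem_iUnion₂.1 h.2
    rwa [eq_of_mem_unitCube hx hxm]

/-- The tail outside finitely many cubes costs δ / 2. On these cubes the function is cut off at a
high level, with an error η small against the finite sum of the weights. -/
theorem niceApprox_fourierAmalgam_of_tail (hq : 1 ≤ q) (hf : fourierAmalgamNorm p q s f < ⊤)
    (hg : Represents g (𝓕 f)) (htail : ∀ δ : ℝ≥0∞, 0 < δ → ∃ F : Finset (Lattice d),
      ellNorm q (fun n => if n ∈ F then 0 else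
        eLpNorm g p (volume.restrict (unitCube n)) * weight s n) < δ) :
    NiceApprox (AddMonoidHom.id (Space d)) FourierProfile (fourierAmalgamNorm p q s) f := by
  obtain ⟨g', hg'm, hgg'⟩ := hg.1
  have hg' : Represents g' (𝓕 f) := hg.congr hgg'
  have he : ∀ n : Lattice d, eLpNorm g p (volume.restrict (unitCube n)) =
      eLpNorm g' p (volume.restrict (unitCube n)) := fun n =>
    eLpNorm_congr_ae (ae_restrict_of_ae hgg')
  simp only [he] at htail
  intro δ hδ
  have hδ2 : 0 < δ / 2 := ENNReal.half_pos hδ.ne'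
  obtain ⟨F, hF⟩ := htail _ hδ2
  have hW : ∑ n ∈ F, weight s n ≠ ⊤ := ENNReal.sum_ne_top.2 fun n _ => weight_ne_top s n
  obtain ⟨η, hη, hηW⟩ := ENNReal.exists_nnreal_pos_mul_lt hW hδ2.ne'
  rw [fourierAmalgamNorm_eq hg'] at hf
  obtain ⟨h, hh, hFh, hFh'⟩ := exists_nice_truncation (p := p) hg'm F (fun n _ => by
    have h1 := (le_ellNorm (one_pos.trans_le hq).ne' n).trans_lt hf
    exact ENNReal.lt_top_of_mul_ne_top_left h1.ne (weight_pos s n).ne')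
    (NNReal.coe_pos.2 hη)
  obtain ⟨f', hf'⟩ := isRealization_space.exists_profile (hh.decays volume)
  refine ⟨f', h, hf', hh, ?_⟩
  have hsub : Represents (g' - h) (𝓕 (f - f')) := by
    rw [fourier_sub]
    exact hg'.sub hf'.2
  rw [fourierAmalgamNorm_eq hsub]
  calc ellNorm q (fun n => eLpNorm (g' - h) p (volume.restrict (unitCube n)) * weight s n)
      ≤ ellNorm q (fun n => (if n ∈ F then 0 else
          eLpNorm g' p (volume.restrict (unitCube n)) * weight s n) +
          if n ∈ F then η * weight s n else 0) := by
        refine ellNorm_mono fun n => ?_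
        split_ifs with hn
        · rw [zero_add]
          refine mul_le_mul_left ((hFh n hn).trans (le_of_eq ?_)) _
          exact ENNReal.ofReal_coe_nnreal
        · rw [add_zero]
          refine mul_le_mul_left (le_of_eq (eLpNorm_congr_ae ?_)) _
          filter_upwards [ae_restrict_mem (measurableSet_unitCube n)] with x hx
          rw [Pi.sub_apply, hFh' n hn x hx, sub_zero]
    _ ≤ ellNorm q (fun n => (if n ∈ F then 0 else
          eLpNorm g' p (volume.restrict (unitCube n)) * weight s n)) +
          ∑' n, (if n ∈ F then η * weight s n else 0) :=
        (ellNorm_add_le hq).trans (add_le_add_right (ellNorm_le_tsum hq) _)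
    _ = ellNorm q (fun n => (if n ∈ F then 0 else
          eLpNorm g' p (volume.restrict (unitCube n)) * weight s n)) +
          η * ∑ n ∈ F, weight s n := by
        rw [tsum_eq_sum (s := F) fun n hn => if_neg hn, Finset.mul_sum]
        exact congrArg _ (Finset.sum_congr rfl fun n hn => if_pos hn)
    _ < δ / 2 + δ / 2 := ENNReal.add_lt_add hF hηW
    _ = δ := ENNReal.add_halves δ

theorem niceApprox_fourierAmalgam (hq : 1 ≤ q) (hq' : q ≠ ⊤)
    (hf : fourierAmalgamNorm p q s f < ⊤) :
    NiceApprox (AddMonoidHom.id (Space d)) FourierProfile (fourierAmalgamNorm p q s) f := by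
  obtain ⟨g, hg⟩ := exists_represents_of_fourierAmalgamNorm_lt_top hf
  refine niceApprox_fourierAmalgam_of_tail hq hf hg fun δ hδ => ?_
  rw [fourierAmalgamNorm_eq hg] at hf
  exact exists_ellNorm_tail_lt hq hq' hf hδ

theorem finite_norm_latticePt_le (R : ℝ) : {n : Lattice d | ‖latticePt n‖ ≤ R}.Finite := by
  refine (Set.finite_Icc (fun _ => -⌈R⌉ : Lattice d) (fun _ => ⌈R⌉)).subset fun n hn => ?_
  have h : ∀ i, |(n i : ℝ)| ≤ ⌈R⌉ := fun i =>
    (PiLp.norm_apply_le (latticePt n) i).trans (le_trans hn (Int.le_ceil R))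
  have h' : ∀ i, |n i| ≤ ⌈R⌉ := fun i => by exact_mod_cast h i
  exact ⟨fun i => (abs_le.1 (h' i)).1, fun i => (abs_le.1 (h' i)).2⟩

theorem niceApprox_fourierAmalgam_of_bandLimited (hq : 1 ≤ q) (hb : BandLimited f)
    (hf : fourierAmalgamNorm p q s f < ⊤) :
    NiceApprox (AddMonoidHom.id (Space d)) FourierProfile (fourierAmalgamNorm p q s) f := by
  obtain ⟨g, hg⟩ := exists_represents_of_fourierAmalgamNorm_lt_top hf
  refine niceApprox_fourierAmalgam_of_tail hq hf hg fun δ hδ => ?_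
  obtain ⟨R, hR⟩ := hb
  have hvan := hg.ae_eq_zero_of_isVanishingOn Metric.isClosed_closedBall.isOpen_compl hR
  refine ⟨(finite_norm_latticePt_le (d := d) (R + d)).toFinset, lt_of_le_of_lt (le_of_eq ?_) hδ⟩
  refine (congrArg (ellNorm q) (funext fun n => ?_)).trans ellNorm_zero
  split_ifs with hn
  · rfl
  · rw [Set.Finite.mem_toFinset, mem_ofPred_eq, not_le] at hn
    have : eLpNorm g p (volume.restrict (unitCube n)) = 0 := by
      refine (eLpNorm_congr_ae ?_).trans (eLpNorm_zero (ε := ℂ))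
      filter_upwards [ae_restrict_mem (measurableSet_unitCube n), ae_restrict_of_ae hvan]
        with x hx hx'
      refine hx' fun hmem => ?_
      rw [mem_closedBall_zero_iff] at hmem
      have := norm_latticePt_le hx
      linarith
    rw [this, zero_mul]

theorem stronglyIllPosed_fourierAmalgam (i₀ : Fin d) {σ ρ : ℕ} (hσ : 2 ≤ σ) (hρ : ρ ≤ σ) {μ : ℂ}
    (hμ : ‖μ‖ = 1) (hp : 1 ≤ p) (hq : 1 ≤ q) (hs : s < 0) :
    StronglyIllPosed (fourierAmalgamNorm (d := d) p q) (SolRd μ ρ σ) BandLimited q s :=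
  isRealization_space.stronglyIllPosed (e := EuclideanSpace.single i₀ 1)
    (hasUpperBound_fourierAmalgam le_rfl 1 0) (fun θ => hasUpperBound_fourierAmalgam hq p θ)
    (fun _ hκ θ => hasLowerBound_fourierAmalgam hp hq θ hκ)
    (fun θ => fourierAmalgamNorm_add_le hp hq θ) (fun θ => fourierAmalgamNorm_zero p q θ) rfl
    (fun hq' _ _ hf => niceApprox_fourierAmalgam hq hq' hf)
    (fun _ _ _ hb hf => niceApprox_fourierAmalgam_of_bandLimited hq hb hf) hμ hσ hρ hs

end

end

section

/-! ### Integral inequalities -/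

section

variable {d : ℕ} {q : ℝ≥0∞} {Y : Type} [MeasurableSpace Y] {ν : Measure Y}

theorem measurable_ellNorm (hq : q ≠ 0) {a : Lattice d → Y → ℝ≥0∞} (ha : ∀ n, Measurable (a n)) :
    Measurable fun y => ellNorm q fun n => a n y := by
  rcases eq_or_ne q ⊤ with rfl | hq'
  · simp only [ellNorm_top]
    exact Measurable.iSup ha
  · simp only [ellNorm_eq_tsum hq hq']
    exact (Measurable.tsum fun n => (ha n).pow_const _).pow_const _

/-- Minkowski's integral inequality for `ℓ^q`. -/
theorem ellNorm_lintegral_le (hq : 1 ≤ q) (hq' : q ≠ ⊤) {a : Lattice d → Y → ℝ≥0∞}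
    (ha : ∀ n, Measurable (a n)) :
    ellNorm q (fun n => ∫⁻ y, a n y ∂ν) ≤ ∫⁻ y, ellNorm q (fun n => a n y) ∂ν := by
  have hq0 : q ≠ 0 := (one_pos.trans_le hq).ne'
  obtain ⟨r, hr⟩ : ∃ r, r = q.toReal := ⟨_, rfl⟩
  have hr1 : 1 ≤ r := by
    rw [hr, ← ENNReal.toReal_one]
    exact ENNReal.toReal_mono hq' hq
  have hr0 : 0 < r := one_pos.trans_le hr1
  obtain ⟨I, hI⟩ : ∃ I, I = ∫⁻ y, ellNorm q (fun n => a n y) ∂ν := ⟨_, rfl⟩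
  rw [← hI]
  rcases eq_or_ne I ⊤ with hIt | hIt
  · rw [hIt]
    exact le_top
  have hA : ∀ n, ∫⁻ y, a n y ∂ν ≤ I := fun n => by
    rw [hI]
    exact lintegral_mono fun y => le_ellNorm (a := fun n => a n y) hq0 n
  generalize hAdef : (fun n => ∫⁻ y, a n y ∂ν) = A
  have hA' : ∀ n, A n = ∫⁻ y, a n y ∂ν := fun n => by rw [← hAdef]
  have hAt : ∀ n, A n ≠ ⊤ := fun n => by
    rw [hA']
    exact ne_top_of_le_ne_top hIt (hA n)
  -- Passing to finite partial sums makes P finite, so that a power of P can be cancelled at the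
  -- end.
  rw [ellNorm_eq_tsum hq0 hq', ← hr, one_div, ENNReal.rpow_inv_le_iff hr0, ENNReal.tsum_eq_iSup_sum]
  refine iSup_le fun S => ?_
  obtain ⟨P, hP⟩ : ∃ P, P = ∑ n ∈ S, A n ^ r := ⟨_, rfl⟩
  rw [← hP]
  have hPt : P ≠ ⊤ := by
    rw [hP]
    exact ENNReal.sum_ne_top.2 fun n _ => ENNReal.rpow_ne_top_of_nonneg hr0.le (hAt n)
  rcases eq_or_ne P 0 with hP0 | hP0
  · rw [hP0]
    exact bot_le
  have hsplit : ∀ n, A n ^ r = ∫⁻ y, A n ^ (r - 1) * a n y ∂ν := fun n => by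
    rw [lintegral_const_mul _ (ha n), ← hA']
    conv_rhs => rw [← ENNReal.rpow_one (A n), ← ENNReal.rpow_mul, one_mul,
      ← ENNReal.rpow_add_of_nonneg _ _ (by linarith) zero_le_one]
    ring_nf
  -- The usual duality argument: write A^r = A^(r-1) ∫ a and apply Hölder's inequality under the
  -- integral, which gives P ≤ P^((r-1)/r) I. The case r = 1 has no conjugate exponent and is
  -- separate.
  have hHolder : ∀ y, ∑ n ∈ S, A n ^ (r - 1) * a n y ≤
      P ^ ((r - 1) / r) * ellNorm q fun n => a n y := fun y => by
    have h2 : (∑ n ∈ S, a n y ^ r) ^ (1 / r) ≤ ellNorm q fun n => a n y := by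
      rw [ellNorm_eq_tsum hq0 hq', ← hr]
      exact ENNReal.rpow_le_rpow (ENNReal.sum_le_tsum S) (by positivity)
    rcases hr1.eq_or_lt with h1 | h1
    · rw [← h1] at h2 ⊢
      simpa using h2
    · have hc := (Real.HolderConjugate.conjExponent h1).symm
      refine (ENNReal.inner_le_Lp_mul_Lq S (fun n => A n ^ (r - 1)) (fun n => a n y) hc).trans ?_
      refine mul_le_mul' (le_of_eq ?_) h2
      have e : ∀ n, (A n ^ (r - 1)) ^ r.conjExponent = A n ^ r := fun n => by
        rw [← ENNReal.rpow_mul]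
        congr 1
        rw [Real.conjExponent]
        have : r - 1 ≠ 0 := by linarith
        field_simp
      simp only [e, ← hP]
      congr 1
      rw [Real.conjExponent, one_div_div]
  have key : P ≤ P ^ ((r - 1) / r) * I := by
    conv_lhs => rw [hP]
    simp only [hsplit]
    rw [← lintegral_finsetSum _ fun n _ => (ha n).const_mul _, hI,
      ← lintegral_const_mul _ (measurable_ellNorm hq0 ha)]
    exact lintegral_mono hHolder
  have hpos : P ^ ((r - 1) / r) ≠ 0 := (ENNReal.rpow_pos (pos_iff_ne_zero.2 hP0) hPt).ne'
  have hfin : P ^ ((r - 1) / r) ≠ ⊤ :=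
    ENNReal.rpow_ne_top_of_nonneg (div_nonneg (by linarith) hr0.le) hPt
  rw [← ENNReal.rpow_inv_le_iff hr0]
  have e : P = P ^ ((r - 1) / r) * P ^ r⁻¹ := by
    rw [← ENNReal.rpow_add _ _ hP0 hPt]
    conv_lhs => rw [← ENNReal.rpow_one P]
    congr 1
    field_simp
    ring
  refine (ENNReal.mul_le_mul_iff_right hpos hfin).1 ?_
  rw [← e]
  exact key

theorem eLpNorm_two_eq (A : Y → ℝ≥0∞) :
    eLpNorm A 2 ν = (∫⁻ y, A y ^ (2 : ℝ) ∂ν) ^ (1 / 2 : ℝ) := by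
  rw [eLpNorm_eq_lintegral_rpow_enorm_toReal two_ne_zero ENNReal.ofNat_ne_top]
  simp

/-- Minkowski's inequality for finite sums, and monotone convergence along the directed family of
finite subsets. -/
theorem eLpNorm_tsum_le {a : Lattice d → Y → ℝ≥0∞} (ha : ∀ n, AEMeasurable (a n) ν) :
    eLpNorm (fun y => ∑' n, a n y) 2 ν ≤ ∑' n, eLpNorm (a n) 2 ν := by
  have e : ∀ y, (∑' n, a n y) ^ (2 : ℝ) = ⨆ S : Finset (Lattice d), (∑ n ∈ S, a n y) ^ (2 : ℝ) :=
    fun y => by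
      rw [ENNReal.tsum_eq_iSup_sum]
      exact (ENNReal.orderIsoRpow 2 two_pos).map_iSup _
  rw [eLpNorm_two_eq, one_div, ENNReal.rpow_inv_le_iff two_pos]
  simp only [e]
  rw [lintegral_iSup_directed]
  · refine iSup_le fun S => ?_
    rw [← ENNReal.rpow_inv_le_iff two_pos, ← one_div, ← eLpNorm_two_eq]
    have h1 := eLpNorm_sum_le (s := S) (f := a) (μ := ν) (p := 2)
      (fun n _ => (ha n).aestronglyMeasurable) one_le_two
    have h2 : (∑ n ∈ S, a n) = fun y => ∑ n ∈ S, a n y := by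
      funext y
      simp
    rw [h2] at h1
    exact h1.trans (ENNReal.sum_le_tsum S)
  · exact fun S => (Finset.aemeasurable_fun_sum S fun n _ => ha n).pow_const _
  · intro S S'
    classical
    exact ⟨S ∪ S', fun y => ENNReal.rpow_le_rpow
        (Finset.sum_le_sum_of_subset Finset.subset_union_left) zero_le_two,
      fun y => ENNReal.rpow_le_rpow
        (Finset.sum_le_sum_of_subset Finset.subset_union_right) zero_le_two⟩

/-- Young's inequality `L¹ * L² ⊆ L²`. -/
theorem eLpNorm_lconvolution_le {k A : Space d → ℝ≥0∞} (hk : Measurable k) (hA : Measurable A) :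
    eLpNorm (fun x => ∫⁻ y, k y * A (x - y)) 2 volume ≤ (∫⁻ y, k y) * eLpNorm A 2 volume := by
  have hsq : ∀ x : ℝ≥0∞, x ^ (1 / 2 : ℝ) * x ^ (1 / 2 : ℝ) = x := fun x => by
    rw [← ENNReal.rpow_add_of_nonneg _ _ (by norm_num) (by norm_num)]
    norm_num
  -- Cauchy–Schwarz with k split into two square roots.
  have hcs : ∀ x, (∫⁻ y, k y * A (x - y)) ^ (2 : ℝ) ≤
      (∫⁻ y, k y) * ∫⁻ y, k y * A (x - y) ^ (2 : ℝ) := fun x => by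
    have hAx : Measurable fun y => A (x - y) := hA.comp (measurable_const.sub measurable_id)
    have h1 := ENNReal.lintegral_mul_le_Lp_mul_Lq volume Real.HolderConjugate.two_two
      (f := fun y => k y ^ (1 / 2 : ℝ)) (g := fun y => k y ^ (1 / 2 : ℝ) * A (x - y))
      (hk.pow_const _).aemeasurable ((hk.pow_const _).mul hAx).aemeasurable
    have e1 : ∀ y, (k y ^ (1 / 2 : ℝ)) ^ (2 : ℝ) = k y := fun y => by
      rw [← ENNReal.rpow_mul]
      norm_num
    have e2 : ∀ y, (k y ^ (1 / 2 : ℝ) * A (x - y)) ^ (2 : ℝ) = k y * A (x - y) ^ (2 : ℝ) := fun y => by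
      rw [ENNReal.mul_rpow_of_nonneg _ _ zero_le_two, e1]
    simp only [Pi.mul_apply, e1, e2, ← mul_assoc, hsq] at h1
    calc (∫⁻ y, k y * A (x - y)) ^ (2 : ℝ)
        ≤ ((∫⁻ y, k y) ^ (1 / 2 : ℝ) * (∫⁻ y, k y * A (x - y) ^ (2 : ℝ)) ^ (1 / 2 : ℝ)) ^ (2 : ℝ) :=
          ENNReal.rpow_le_rpow h1 zero_le_two
      _ = _ := by
          rw [ENNReal.mul_rpow_of_nonneg _ _ zero_le_two, ← ENNReal.rpow_mul, ← ENNReal.rpow_mul]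
          norm_num
  have hm2 : Measurable fun z : Space d × Space d => k z.2 * A (z.1 - z.2) ^ (2 : ℝ) :=
    (hk.comp measurable_snd).mul ((hA.comp (measurable_fst.sub measurable_snd)).pow_const _)
  rw [eLpNorm_two_eq, eLpNorm_two_eq, one_div, ENNReal.rpow_inv_le_iff two_pos,
    ENNReal.mul_rpow_of_nonneg _ _ zero_le_two, ← ENNReal.rpow_mul, inv_mul_cancel₀ two_ne_zero,
    ENNReal.rpow_one]
  calc ∫⁻ x, (∫⁻ y, k y * A (x - y)) ^ (2 : ℝ)
      ≤ ∫⁻ x, (∫⁻ y, k y) * ∫⁻ y, k y * A (x - y) ^ (2 : ℝ) := lintegral_mono hcs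
    _ = (∫⁻ y, k y) * ∫⁻ x, ∫⁻ y, k y * A (x - y) ^ (2 : ℝ) :=
        lintegral_const_mul _ hm2.lintegral_prod_right'
    _ = (∫⁻ y, k y) * ∫⁻ y, ∫⁻ x, k y * A (x - y) ^ (2 : ℝ) := by
        rw [lintegral_lintegral_swap hm2.aemeasurable]
    _ = (∫⁻ y, k y) * ((∫⁻ y, k y) * ∫⁻ x, A x ^ (2 : ℝ)) := by
        congr 1
        have : ∀ y, ∫⁻ x, k y * A (x - y) ^ (2 : ℝ) = k y * ∫⁻ x, A x ^ (2 : ℝ) := fun y => by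
          have hAy : Measurable fun x => A (x - y) ^ (2 : ℝ) :=
            (hA.comp (measurable_id.sub_const y)).pow_const _
          rw [lintegral_const_mul _ hAy,
            lintegral_sub_right_eq_self (fun x => A x ^ (2 : ℝ)) y]
        simp only [this]
        exact lintegral_mul_const _ hk
    _ = (∫⁻ y, k y) ^ (2 : ℝ) * ∫⁻ x, A x ^ (2 : ℝ) := by
        rw [← mul_assoc]
        congr 1
        rw [show (2 : ℝ) = ((2 : ℕ) : ℝ) by norm_num, ENNReal.rpow_natCast, sq]

/-- The `ℓ^q` tails of an element of `L²(ℓ^q)` are small. -/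
theorem exists_eLpNorm_tail_lt (hq : 1 ≤ q) (hq' : q ≠ ⊤) {a : Lattice d → Y → ℝ≥0∞}
    (ha : ∀ n, Measurable (a n)) (hfin : eLpNorm (fun y => ellNorm q fun n => a n y) 2 ν < ⊤)
    {δ : ℝ≥0∞} (hδ : 0 < δ) : ∃ F : Finset (Lattice d),
      eLpNorm (fun y => ellNorm q fun n => if n ∈ F then 0 else a n y) 2 ν < δ := by
  classical
  have hq0 : q ≠ 0 := (one_pos.trans_le hq).ne'
  -- An exhausting sequence of finite sets replaces the directed family, because dominated
  -- convergence is applied along a sequence.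
  obtain ⟨F, hmono, hF⟩ : ∃ F : ℕ → Finset (Lattice d), Monotone F ∧ ∀ n, ∃ j, n ∈ F j := by
    obtain ⟨e, he⟩ := exists_surjective_nat (Lattice d)
    refine ⟨fun j => (Finset.range (j + 1)).image e, fun i j hij => Finset.image_subset_image
      (Finset.range_subset_range.2 (by omega)), fun n => ?_⟩
    obtain ⟨j, rfl⟩ := he n
    exact ⟨j, Finset.mem_image_of_mem e (Finset.self_mem_range_succ j)⟩
  obtain ⟨A, hA⟩ : ∃ A : ℕ → Y → ℝ≥0∞, A = fun j y => ellNorm q fun n =>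
    if n ∈ F j then 0 else a n y := ⟨_, rfl⟩
  have hAm : ∀ j, Measurable (A j) := fun j => by
    rw [hA]
    refine measurable_ellNorm hq0 fun n => ?_
    split_ifs
    · exact measurable_const
    · exact ha n
  have hle : ∀ j y, A j y ≤ ellNorm q fun n => a n y := fun j y => by
    rw [hA]
    refine ellNorm_mono fun n => ?_
    split_ifs
    · exact bot_le
    · exact le_rfl
  have hfin2 : ∫⁻ y, (ellNorm q fun n => a n y) ^ (2 : ℝ) ∂ν ≠ ⊤ := fun h => by
    rw [eLpNorm_two_eq, h, ENNReal.top_rpow_of_pos (by norm_num)] at hfin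
    exact hfin.ne rfl
  have hpt : ∀ y, ellNorm q (fun n => a n y) < ⊤ → Tendsto (fun j => A j y) atTop (𝓝 0) :=
    fun y hy => by
      refine ENNReal.tendsto_nhds_zero.2 fun ε hε => ?_
      obtain ⟨S, hS⟩ := exists_ellNorm_tail_lt hq hq' hy hε
      choose j hj using hF
      filter_upwards [eventually_ge_atTop (S.sup j)] with i hi
      refine le_trans ?_ hS.le
      rw [hA]
      refine ellNorm_mono fun n => ?_
      by_cases hn : n ∈ S
      · have : n ∈ F i := hmono ((Finset.le_sup hn).trans hi) (hj n)
        simp [this]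
      · rw [if_neg hn]
        split_ifs
        · exact bot_le
        · exact le_rfl
  have hlim : Tendsto (fun j => ∫⁻ y, A j y ^ (2 : ℝ) ∂ν) atTop (𝓝 0) := by
    have := tendsto_lintegral_of_dominated_convergence
      (μ := ν) (F := fun j y => A j y ^ (2 : ℝ)) (f := fun _ => 0)
      (fun y => (ellNorm q fun n => a n y) ^ (2 : ℝ)) (fun j => (hAm j).pow_const _)
      (fun j => Eventually.of_forall fun y => ENNReal.rpow_le_rpow (hle j y) zero_le_two) hfin2 (by
        filter_upwards [ae_lt_top ((measurable_ellNorm hq0 ha).pow_const _) hfin2] with y hy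
        have hy' : ellNorm q (fun n => a n y) < ⊤ := by
          by_contra h
          rw [not_lt_top_iff.1 h, ENNReal.top_rpow_of_pos two_pos] at hy
          exact hy.ne rfl
        have h1 := ((ENNReal.continuous_rpow_const (y := 2)).tendsto 0).comp (hpt y hy')
        simpa [Function.comp_def] using h1)
    simpa using this
  have hδ' : 0 < δ ^ (2 : ℝ) := by
    rcases eq_or_ne δ ⊤ with rfl | h
    · rw [ENNReal.top_rpow_of_pos two_pos]
      exact ENNReal.zero_lt_top
    · exact ENNReal.rpow_pos hδ h
  obtain ⟨j, hj⟩ := (hlim.eventually_lt_const hδ').exists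
  refine ⟨F j, ?_⟩
  have e : (fun y => ellNorm q fun n => if n ∈ F j then 0 else a n y) = A j := by rw [hA]
  rw [e, eLpNorm_two_eq, one_div, ENNReal.rpow_inv_lt_iff two_pos]
  exact hj

end

end

section

/-! ### The uniform decomposition -/

section

variable {d : ℕ} {χ : Space d → ℝ}

/-- The lattice points `k` with `|k|_∞ ≤ 1`. -/
def neighbours (d : ℕ) : Finset (Lattice d) := Fintype.piFinset fun _ => {-1, 0, 1}

theorem mem_neighbours_of_abs_lt {m n : Lattice d} (h : ∀ i, |(m i : ℝ) - n i| < 2) :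
    m - n ∈ neighbours d := by
  refine Fintype.mem_piFinset.2 fun i => ?_
  have h1 : |m i - n i| < 2 := by exact_mod_cast h i
  have h2 := abs_lt.1 h1
  simp only [Pi.sub_apply, Finset.mem_insert, Finset.mem_singleton]
  omega

theorem abs_le_of_mem_neighbours {k : Lattice d} (h : k ∈ neighbours d) (i : Fin d) :
    |(k i : ℝ)| ≤ 1 := by
  have := Fintype.mem_piFinset.1 h i
  simp only [Finset.mem_insert, Finset.mem_singleton] at this
  rcases this with h | h | h <;> simp [h]

/-- The normalizing sum of the partition of unity. -/
def boxSum (χ : Space d → ℝ) (ξ : Space d) : ℝ := ∑' l : Lattice d, χ (ξ - latticePt l)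

theorem boxSymbol_eq (χ : Space d → ℝ) (n : Lattice d) (ξ : Space d) :
    boxSymbol χ n ξ = ((χ (ξ - latticePt n) / boxSum χ ξ : ℝ) : ℂ) := rfl

theorem sub_latticePt_apply (ξ : Space d) (n : Lattice d) (i : Fin d) :
    (ξ - latticePt n) i = ξ i - n i := rfl

namespace IsCutoff

theorem abs_sub_lt_one (hχ : IsCutoff χ) {ξ : Space d} {n : Lattice d}
    (h : χ (ξ - latticePt n) ≠ 0) (i : Fin d) : |ξ i - n i| < 1 := by
  by_contra h'
  exact h (hχ.eq_zero _ ⟨i, not_lt.1 h'⟩)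

theorem boxSum_eq_sum (hχ : IsCutoff χ) {ξ : Space d} {F : Finset (Lattice d)}
    (hF : ∀ l : Lattice d, (∀ i, |ξ i - l i| < 1) → l ∈ F) :
    boxSum χ ξ = ∑ l ∈ F, χ (ξ - latticePt l) :=
  tsum_eq_sum fun l hl => by
    by_contra h
    exact hl (hF l fun i => hχ.abs_sub_lt_one h i)

theorem norm_latticePt_le_of_abs_lt {ξ : Space d} {l : Lattice d} (h : ∀ i, |ξ i - l i| < 1) :
    ‖latticePt l‖ ≤ ‖ξ‖ + d := by
  have h1 := norm_le_of_abs_le (x := ξ - latticePt l) (c := 1) fun i => (h i).le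
  have h2 := norm_sub_norm_le (latticePt l) ξ
  rw [norm_sub_rev] at h2
  linarith

/-- Near each point only finitely many translates of χ contribute, and the finite set can be chosen
uniformly on a unit ball. -/
theorem contDiff_boxSum (hχ : IsCutoff χ) : ContDiff ℝ ∞ (boxSum χ) := by
  rw [contDiff_iff_contDiffAt]
  intro ξ₀
  have hF := finite_norm_latticePt_le (d := d) (‖ξ₀‖ + 1 + d)
  have hsum : ContDiffAt ℝ ∞ (fun ξ => ∑ l ∈ hF.toFinset, χ (ξ - latticePt l)) ξ₀ :=
    (ContDiff.sum fun l _ => hχ.smooth.comp (contDiff_id.sub contDiff_const)).contDiffAt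
  refine hsum.congr_of_eventuallyEq ?_
  filter_upwards [Metric.ball_mem_nhds ξ₀ one_pos] with ξ hξ
  refine hχ.boxSum_eq_sum fun l hl => ?_
  rw [Set.Finite.mem_toFinset, mem_ofPred_eq]
  have h1 := norm_latticePt_le_of_abs_lt hl
  have h2 := norm_sub_norm_le ξ ξ₀
  rw [mem_ball_iff_norm] at hξ
  linarith

theorem eq_one_of_mem_unitCube (hχ : IsCutoff χ) {ξ : Space d} {n : Lattice d}
    (h : ξ ∈ unitCube n) : χ (ξ - latticePt n) = 1 :=
  hχ.eq_one _ fun i => by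
    rw [sub_latticePt_apply]
    exact abs_le.2 ⟨(h i).1.le, (h i).2⟩

theorem boxSum_eq_sum_neighbours (hχ : IsCutoff χ) {ξ : Space d} {n : Lattice d}
    (h : ∀ i, |ξ i - n i| < 1) :
    boxSum χ ξ = ∑ k ∈ neighbours d, χ (ξ - latticePt (n + k)) := by
  classical
  rw [hχ.boxSum_eq_sum (F := (neighbours d).map (addLeftEmbedding n)) fun l hl => ?_]
  · rw [Finset.sum_map]
    rfl
  · rw [Finset.mem_map]
    refine ⟨l - n, mem_neighbours_of_abs_lt fun i => ?_, by simp [addLeftEmbedding]⟩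
    have h1 := abs_lt.1 (h i)
    have h2 := abs_lt.1 (hl i)
    exact abs_lt.2 ⟨by linarith, by linarith⟩

theorem abs_sub_nearestPt_lt (ξ : Space d) (i : Fin d) : |ξ i - nearestPt ξ i| < 1 := by
  have h := mem_unitCube_nearestPt ξ i
  exact abs_lt.2 ⟨by linarith [h.1], by linarith [h.2]⟩

theorem one_le_boxSum (hχ : IsCutoff χ) (ξ : Space d) : 1 ≤ boxSum χ ξ := by
  rw [hχ.boxSum_eq_sum_neighbours (abs_sub_nearestPt_lt ξ)]
  have h0 : (0 : Lattice d) ∈ neighbours d := Fintype.mem_piFinset.2 fun i => by simp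
  refine le_trans (le_of_eq ?_) (Finset.single_le_sum
    (f := fun k => χ (ξ - latticePt (nearestPt ξ + k))) (fun k _ => (hχ.mem_unit _).1) h0)
  rw [add_zero, hχ.eq_one_of_mem_unitCube (mem_unitCube_nearestPt ξ)]

theorem boxSum_le (hχ : IsCutoff χ) (ξ : Space d) : boxSum χ ξ ≤ (neighbours d).card := by
  rw [hχ.boxSum_eq_sum_neighbours (abs_sub_nearestPt_lt ξ)]
  refine (Finset.sum_le_sum fun k _ => (hχ.mem_unit _).2).trans ?_
  simp

theorem boxSymbol_eq_zero (hχ : IsCutoff χ) {ξ : Space d} {n : Lattice d}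
    (h : ¬ ∀ i, |ξ i - n i| < 1) : boxSymbol χ n ξ = 0 := by
  have : χ (ξ - latticePt n) = 0 := by
    by_contra h'
    exact h fun i => hχ.abs_sub_lt_one h' i
  rw [boxSymbol_eq, this, zero_div, Complex.ofReal_zero]

theorem norm_boxSymbol_le_one (hχ : IsCutoff χ) (n : Lattice d) (ξ : Space d) :
    ‖boxSymbol χ n ξ‖ ≤ 1 := by
  have h1 := hχ.one_le_boxSum ξ
  have h2 := hχ.mem_unit (ξ - latticePt n)
  rw [boxSymbol_eq, Complex.norm_real, Real.norm_eq_abs,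
    abs_of_nonneg (div_nonneg h2.1 (by linarith)), div_le_one (by linarith)]
  linarith [h2.2]

theorem contDiff_boxSymbol (hχ : IsCutoff χ) (n : Lattice d) : ContDiff ℝ ∞ (boxSymbol χ n) := by
  have h : ContDiff ℝ ∞ fun ξ => χ (ξ - latticePt n) / boxSum χ ξ :=
    (hχ.smooth.comp (contDiff_id.sub contDiff_const)).div hχ.contDiff_boxSum fun ξ =>
      (one_pos.trans_le (hχ.one_le_boxSum ξ)).ne'
  exact Complex.ofRealCLM.contDiff.comp h

theorem hasCompactSupport_boxSymbol (hχ : IsCutoff χ) (n : Lattice d) :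
    HasCompactSupport (boxSymbol χ n) := by
  refine HasCompactSupport.intro (isCompact_closedBall (latticePt n) d) fun ξ hξ =>
    hχ.boxSymbol_eq_zero fun h => hξ ?_
  have := norm_le_of_abs_le (x := ξ - latticePt n) (c := 1) fun i => (h i).le
  rw [mem_closedBall_iff_norm]
  simpa using this

theorem hasTemperateGrowth_boxSymbol (hχ : IsCutoff χ) (n : Lattice d) :
    (boxSymbol χ n).HasTemperateGrowth :=
  (hχ.hasCompactSupport_boxSymbol n).hasTemperateGrowth (hχ.contDiff_boxSymbol n)

theorem sum_boxSymbol_eq_one (hχ : IsCutoff χ) {ξ : Space d} {F : Finset (Lattice d)}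
    (hF : ∀ l : Lattice d, (∀ i, |ξ i - l i| < 1) → l ∈ F) : ∑ n ∈ F, boxSymbol χ n ξ = 1 := by
  simp only [boxSymbol_eq]
  rw [← Complex.ofReal_sum, ← Finset.sum_div, ← hχ.boxSum_eq_sum hF,
    div_self (one_pos.trans_le (hχ.one_le_boxSum ξ)).ne', Complex.ofReal_one]

/-- On the support of the nth symbol the neighbouring symbols already sum to 1. -/
theorem boxSymbol_mul_sum_neighbours (hχ : IsCutoff χ) (n : Lattice d) (ξ : Space d) :
    boxSymbol χ n ξ * ∑ k ∈ neighbours d, boxSymbol χ (n + k) ξ = boxSymbol χ n ξ := by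
  by_cases h : ∀ i, |ξ i - n i| < 1
  · simp only [boxSymbol_eq]
    rw [← Complex.ofReal_sum, ← Finset.sum_div, ← hχ.boxSum_eq_sum_neighbours h,
      div_self (one_pos.trans_le (hχ.one_le_boxSum ξ)).ne', Complex.ofReal_one, mul_one]
  · rw [hχ.boxSymbol_eq_zero h, zero_mul]

theorem boxSum_sub_latticePt (χ : Space d → ℝ) (n : Lattice d) (ξ : Space d) :
    boxSum χ (ξ - latticePt n) = boxSum χ ξ := by
  rw [boxSum, boxSum, ← (Equiv.addLeft n).tsum_eq fun l => χ (ξ - latticePt l)]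
  refine tsum_congr fun l => congrArg χ ?_
  have : latticePt (n + l) = latticePt n + latticePt l := (latticeHom d).map_add n l
  rw [Equiv.coe_addLeft, this, sub_sub]

theorem boxSymbol_eq_translate (χ : Space d → ℝ) (n : Lattice d) (ξ : Space d) :
    boxSymbol χ n ξ = boxSymbol χ 0 (ξ - latticePt n) := by
  have : latticePt (0 : Lattice d) = 0 := (latticeHom d).map_zero
  rw [boxSymbol_eq, boxSymbol_eq, boxSum_sub_latticePt, this, sub_zero]

end IsCutoff

variable {f f' : 𝓢'(Space d, ℂ)} {h : Space d → ℂ}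

theorem fourier_box (χ : Space d → ℝ) (n : Lattice d) (f : 𝓢'(Space d, ℂ)) :
    𝓕 (box χ n f) = TemperedDistribution.smulLeftCLM ℂ (boxSymbol χ n) (𝓕 f) := by
  rw [box, TemperedDistribution.fourierMultiplierCLM_apply, FourierTransform.fourier_fourierInv_eq]

theorem Represents.smulLeft {m : Space d → ℂ} (hm : m.HasTemperateGrowth) (hf : Represents h f) :
    Represents (fun ξ => m ξ * h ξ) (TemperedDistribution.smulLeftCLM ℂ m f) := by
  refine ⟨hm.1.continuous.aestronglyMeasurable.mul hf.1, fun φ => ?_⟩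
  have h1 := hf.2 (SchwartzMap.smulLeftCLM ℂ m φ)
  have e : (fun x => SchwartzMap.smulLeftCLM ℂ m φ x * h x) = fun x => φ x * (m x * h x) := by
    funext x
    rw [SchwartzMap.smulLeftCLM_apply_apply hm, smul_eq_mul]
    ring
  rw [e] at h1
  rw [TemperedDistribution.smulLeftCLM_apply_apply]
  exact h1

theorem Represents.fourier_box (hχ : IsCutoff χ) (n : Lattice d) (hf : Represents h (𝓕 f)) :
    Represents (fun ξ => boxSymbol χ n ξ * h ξ) (𝓕 (box χ n f)) := by
  rw [NLW.fourier_box]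
  exact hf.smulLeft (hχ.hasTemperateGrowth_boxSymbol n)

theorem box_add (χ : Space d → ℝ) (n : Lattice d) (f f' : 𝓢'(Space d, ℂ)) :
    box χ n (f + f') = box χ n f + box χ n f' := map_add _ f f'

theorem box_sub (χ : Space d → ℝ) (n : Lattice d) (f f' : 𝓢'(Space d, ℂ)) :
    box χ n (f - f') = box χ n f - box χ n f' := map_sub _ f f'

theorem eLpNorm_boxSymbol_mul_le (hχ : IsCutoff χ) (n : Lattice d)
    (hh : AEStronglyMeasurable h volume) :
    eLpNorm (fun ξ => boxSymbol χ n ξ * h ξ) 2 volume ≤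
      ∑ k ∈ neighbours d, eLpNorm h 2 (volume.restrict (unitCube (n + k))) := by
  have hpt : ∀ ξ, ‖boxSymbol χ n ξ * h ξ‖ ≤
      ‖(∑ k ∈ neighbours d, (unitCube (n + k)).indicator h) ξ‖ := fun ξ => by
    by_cases hξ : ∀ i, |ξ i - n i| < 1
    · have hm : nearestPt ξ - n ∈ neighbours d := mem_neighbours_of_abs_lt fun i => by
        have h1 := abs_lt.1 (hξ i)
        have h2 := mem_unitCube_nearestPt ξ i
        exact abs_lt.2 ⟨by linarith [h2.2], by linarith [h2.1]⟩
      rw [Finset.sum_apply, Finset.sum_eq_single_of_mem _ hm fun k _ hk => ?_]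
      · rw [add_sub_cancel, indicator_of_mem (mem_unitCube_nearestPt ξ), norm_mul]
        exact mul_le_of_le_one_left (norm_nonneg _) (hχ.norm_boxSymbol_le_one n ξ)
      · refine indicator_of_notMem (fun hk' => hk ?_) _
        rw [eq_of_mem_unitCube (mem_unitCube_nearestPt ξ) hk', add_sub_cancel_left]
    · rw [hχ.boxSymbol_eq_zero hξ, zero_mul, norm_zero]
      exact norm_nonneg _
  refine (eLpNorm_mono hpt).trans ((eLpNorm_sum_le (fun k _ =>
    hh.indicator (measurableSet_unitCube _)) one_le_two).trans (le_of_eq ?_))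
  exact Finset.sum_congr rfl fun k _ => eLpNorm_indicator_eq_eLpNorm_restrict
    (measurableSet_unitCube _)

theorem rpow_le_rpow_mul {x y A t : ℝ} (hx : 0 < x) (hy : 0 < y) (hA : 1 ≤ A) (hxy : x ≤ A * y)
    (hyx : y ≤ A * x) : x ^ t ≤ A ^ |t| * y ^ t := by
  have hA0 : 0 < A := one_pos.trans_le hA
  rcases le_total 0 t with ht | ht
  · rw [abs_of_nonneg ht, ← Real.mul_rpow hA0.le hy.le]
    exact Real.rpow_le_rpow hx.le hxy ht
  · rw [abs_of_nonpos ht, Real.rpow_neg hA0.le, ← Real.inv_rpow hA0.le,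
      ← Real.mul_rpow (inv_nonneg.2 hA0.le) hy.le]
    refine Real.rpow_le_rpow_of_nonpos (by positivity) ?_ ht
    rwa [inv_mul_le_iff₀ hA0]

/-- The weights are comparable at neighbouring lattice points. -/
theorem exists_weight_le_weight_add (d : ℕ) (s : ℝ) : ∃ C : ℝ≥0∞, C ≠ ⊤ ∧
    ∀ n : Lattice d, ∀ k ∈ neighbours d, weight s n ≤ C * weight s (n + k) := by
  refine ⟨ENNReal.ofReal ((2 + 2 * d : ℝ) ^ |s / 2|), ENNReal.ofReal_ne_top, fun n k hk => ?_⟩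
  rw [weight, weight, ← ENNReal.ofReal_mul (by positivity)]
  refine ENNReal.ofReal_le_ofReal ?_
  have hk2 : ∀ i, (k i : ℝ) ^ 2 ≤ 1 := fun i => by
    have := abs_le.1 (abs_le_of_mem_neighbours hk i)
    nlinarith [this.1, this.2]
  have hsum : ∑ i, (k i : ℝ) ^ 2 ≤ d := (Finset.sum_le_sum fun i _ => hk2 i).trans (by simp)
  have hd : (0 : ℝ) ≤ d := Nat.cast_nonneg d
  have key : ∀ a b : Lattice d, (∀ i, (a i : ℝ) ^ 2 ≤ 2 * (b i : ℝ) ^ 2 + 2 * (k i : ℝ) ^ 2) →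
      1 + ∑ i, (a i : ℝ) ^ 2 ≤ (2 + 2 * d) * (1 + ∑ i, (b i : ℝ) ^ 2) := fun a b hab => by
    have h1 : ∑ i, (a i : ℝ) ^ 2 ≤ 2 * ∑ i, (b i : ℝ) ^ 2 + 2 * ∑ i, (k i : ℝ) ^ 2 := by
      rw [Finset.mul_sum, Finset.mul_sum, ← Finset.sum_add_distrib]
      exact Finset.sum_le_sum fun i _ => hab i
    have h2 : 0 ≤ ∑ i, (b i : ℝ) ^ 2 := by positivity
    nlinarith
  refine rpow_le_rpow_mul (by positivity) (by positivity) (by linarith)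
    (key n (n + k) fun i => ?_) (key (n + k) n fun i => ?_)
  · simp only [Pi.add_apply, Int.cast_add]
    nlinarith [sq_nonneg ((n i : ℝ) + 2 * k i)]
  · simp only [Pi.add_apply, Int.cast_add]
    nlinarith [sq_nonneg ((n i : ℝ) - k i)]

end

/-! ### Wiener amalgam spaces -/

section

variable {d : ℕ} {χ : Space d → ℝ} {q : ℝ≥0∞} {s : ℝ} {f f' : 𝓢'(Space d, ℂ)}
  {v : Lattice d → Space d → ℂ} {h : Space d → ℂ}

theorem wienerAmalgamNorm_eq (p : ℝ≥0∞) (hv : ∀ n, Represents (v n) (box χ n f)) :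
    wienerAmalgamNorm χ p q s f =
      eLpNorm (fun x => ellNorm q (fun n : Lattice d => ‖v n x‖ₑ * weight s n)) p volume := by
  refine le_antisymm (iInf₂_le v hv) (le_iInf₂ fun v' hv' => le_of_eq (eLpNorm_congr_ae ?_))
  filter_upwards [ae_all_iff.2 fun n => (hv n).ae_eq (hv' n)] with x hx
  simp only [hx]

theorem exists_represents_of_wienerAmalgamNorm_lt_top {p : ℝ≥0∞}
    (hf : wienerAmalgamNorm χ p q s f < ⊤) :
    ∃ v : Lattice d → Space d → ℂ, (∀ n, Measurable (v n)) ∧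
      ∀ n, Represents (v n) (box χ n f) := by
  obtain ⟨v, hv⟩ := iInf_lt_iff.1 hf
  obtain ⟨hv, -⟩ := iInf_lt_iff.1 hv
  exact ⟨fun n => (hv n).1.mk (v n), fun n => (hv n).1.stronglyMeasurable_mk.measurable,
    fun n => (hv n).congr (hv n).1.ae_eq_mk⟩

theorem measurable_ellNorm_enorm (hq : q ≠ 0) (hv : ∀ n, Measurable (v n)) :
    Measurable fun x => ellNorm q fun n : Lattice d => ‖v n x‖ₑ * weight s n :=
  measurable_ellNorm hq fun n => (hv n).enorm.mul_const _

theorem wienerAmalgamNorm_add_le (hq : 1 ≤ q) (s : ℝ) (f f' : 𝓢'(Space d, ℂ)) :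
    wienerAmalgamNorm χ 2 q s (f + f') ≤
      wienerAmalgamNorm χ 2 q s f + wienerAmalgamNorm χ 2 q s f' := by
  have hq0 : q ≠ 0 := (one_pos.trans_le hq).ne'
  rcases eq_or_ne (wienerAmalgamNorm χ 2 q s f) ⊤ with h | h
  · simp [h]
  rcases eq_or_ne (wienerAmalgamNorm χ 2 q s f') ⊤ with h' | h'
  · simp [h']
  obtain ⟨v, hvm, hv⟩ := exists_represents_of_wienerAmalgamNorm_lt_top h.lt_top
  obtain ⟨v', hvm', hv'⟩ := exists_represents_of_wienerAmalgamNorm_lt_top h'.lt_top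
  have hs : ∀ n, Represents (v n + v' n) (box χ n (f + f')) := fun n => by
    rw [box_add]
    exact (hv n).add (hv' n)
  rw [wienerAmalgamNorm_eq 2 hv, wienerAmalgamNorm_eq 2 hv', wienerAmalgamNorm_eq 2 hs]
  refine le_trans (eLpNorm_mono_enorm fun x => ?_) (eLpNorm_add_le
    (measurable_ellNorm_enorm hq0 hvm).aestronglyMeasurable
    (measurable_ellNorm_enorm hq0 hvm').aestronglyMeasurable one_le_two)
  refine le_trans (ellNorm_mono fun n => ?_) (ellNorm_add_le hq)
  rw [← add_mul]
  exact mul_le_mul_left (enorm_add_le _ _) _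

theorem wienerAmalgamNorm_zero (χ : Space d → ℝ) (q : ℝ≥0∞) (s : ℝ) :
    wienerAmalgamNorm χ 2 q s (0 : 𝓢'(Space d, ℂ)) = 0 := by
  have hv : ∀ n, Represents ((0 : Lattice d → Space d → ℂ) n) (box χ n (0 : 𝓢'(Space d, ℂ))) :=
    fun n => by
      rw [box, map_zero]
      exact Represents.zero
  rw [wienerAmalgamNorm_eq 2 hv]
  have e : (fun x : Space d => ellNorm q fun n : Lattice d =>
      ‖(0 : Lattice d → Space d → ℂ) n x‖ₑ * weight s n) = fun _ => 0 := by
    funext x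
    refine (congrArg (ellNorm q) (funext fun n => ?_)).trans ellNorm_zero
    simp
  rw [e]
  exact eLpNorm_zero

theorem eLpNorm_enorm_mul_const (hh : AEStronglyMeasurable h volume) (c : ℝ≥0∞) :
    eLpNorm (fun x => ‖h x‖ₑ * c) 2 volume = eLpNorm h 2 volume * c := by
  rw [eLpNorm_two_eq, ← eLpNorm_enorm, eLpNorm_two_eq]
  simp only [ENNReal.mul_rpow_of_nonneg _ _ zero_le_two]
  rw [lintegral_mul_const'' _ (hh.enorm.pow_const _),
    ENNReal.mul_rpow_of_nonneg _ _ (by norm_num), ← ENNReal.rpow_mul]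
  norm_num

/-- Replace ℓ^q by ℓ¹ under the L² norm, take the sum out, and apply Plancherel's theorem to each
piece. This is where the exponent 2 in x enters. -/
theorem wienerAmalgamNorm_le_tsum (hχ : IsCutoff χ) (hq : 1 ≤ q) (hf : Represents h (𝓕 f))
    (hh : ∀ n, eLpNorm (fun ξ => boxSymbol χ n ξ * h ξ) 2 volume < ⊤) :
    wienerAmalgamNorm χ 2 q s f ≤
      ∑' n, eLpNorm (fun ξ => boxSymbol χ n ξ * h ξ) 2 volume * weight s n := by
  have hex : ∀ n, ∃ v, Represents v (box χ n f) ∧ eLpNorm v 2 volume =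
      eLpNorm (fun ξ => boxSymbol χ n ξ * h ξ) 2 volume := fun n =>
    (hf.fourier_box hχ n).exists_of_fourier ⟨(hf.fourier_box hχ n).1, hh n⟩
  choose v hv hvn using hex
  rw [wienerAmalgamNorm_eq 2 hv]
  refine (eLpNorm_mono_enorm (g := fun x => ∑' n, ‖v n x‖ₑ * weight s n) fun x =>
    ellNorm_le_tsum hq).trans ((eLpNorm_tsum_le fun n => ?_).trans (le_of_eq ?_))
  · exact (hv n).1.enorm.mul_const _
  · refine tsum_congr fun n => ?_
    rw [← hvn n, eLpNorm_enorm_mul_const (hv n).1]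

/-- The norm is controlled by the local `L²` norms of the Fourier transform. -/
theorem exists_wienerAmalgamNorm_le (hχ : IsCutoff χ) (hq : 1 ≤ q) (s : ℝ) : ∃ C : ℝ≥0∞, C ≠ ⊤ ∧
    ∀ (f : 𝓢'(Space d, ℂ)) (h : Space d → ℂ), Represents h (𝓕 f) →
      (∀ n : Lattice d, eLpNorm h 2 (volume.restrict (unitCube n)) < ⊤) →
      wienerAmalgamNorm χ 2 q s f ≤
        C * ∑' n : Lattice d, eLpNorm h 2 (volume.restrict (unitCube n)) * weight s n := by
  obtain ⟨C, hC, hw⟩ := exists_weight_le_weight_add d s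
  refine ⟨(neighbours d).card * C, ENNReal.mul_ne_top (ENNReal.natCast_ne_top _) hC,
    fun f h hrep hfin => ?_⟩
  have hle := fun n => eLpNorm_boxSymbol_mul_le hχ n hrep.1
  refine (wienerAmalgamNorm_le_tsum hχ hq hrep fun n => lt_of_le_of_lt (hle n)
    (ENNReal.sum_lt_top.2 fun k _ => hfin _)).trans ?_
  calc ∑' n, eLpNorm (fun ξ => boxSymbol χ n ξ * h ξ) 2 volume * weight s n
      ≤ ∑' n, ∑ k ∈ neighbours d, C * (eLpNorm h 2 (volume.restrict (unitCube (n + k))) *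
          weight s (n + k)) := by
        refine ENNReal.tsum_le_tsum fun n => (mul_le_mul_left (hle n) _).trans ?_
        rw [Finset.sum_mul]
        refine Finset.sum_le_sum fun k hk => ?_
        refine (mul_le_mul_right (hw n k hk) _).trans (le_of_eq ?_)
        ring
    _ = ∑ k ∈ neighbours d, ∑' n, C * (eLpNorm h 2 (volume.restrict (unitCube (n + k))) *
          weight s (n + k)) :=
        Summable.tsum_finsetSum fun k _ => ENNReal.summable
    _ = ∑ k ∈ neighbours d, C * ∑' n : Lattice d,
          eLpNorm h 2 (volume.restrict (unitCube n)) * weight s n := by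
        refine Finset.sum_congr rfl fun k _ => ?_
        rw [ENNReal.tsum_mul_left]
        exact congrArg _ ((Equiv.addRight k).tsum_eq fun n : Lattice d =>
          eLpNorm h 2 (volume.restrict (unitCube n)) * weight s n)
    _ = _ := by rw [Finset.sum_const, nsmul_eq_mul, mul_assoc]

theorem hasUpperBound_wienerAmalgam (hχ : IsCutoff χ) (hq : 1 ≤ q) (s : ℝ) :
    HasUpperBound (AddMonoidHom.id (Space d)) FourierProfile (wienerAmalgamNorm χ 2 q s) s := by
  obtain ⟨C, hC, hle⟩ := exists_wienerAmalgamNorm_le hχ hq s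
  refine ⟨C, hC, fun f h hf _ β hβ => ?_⟩
  obtain ⟨⟨-, a, ha, A, hA, hb⟩, hrep⟩ := hf
  refine (hle f h hrep fun n => ?_).trans (mul_le_mul_right (ENNReal.tsum_le_tsum fun n =>
    mul_le_mul_left (eLpNorm_unitCube_le fun ξ hξ => hβ ξ _ hξ) _) _)
  refine lt_of_le_of_lt (eLpNorm_unitCube_le (β := ENNReal.ofReal A) fun ξ _ => ?_)
    ENNReal.ofReal_lt_top
  rw [← ofReal_norm]
  refine ENNReal.ofReal_le_ofReal ((hb ξ).trans ?_)
  refine mul_le_of_le_one_right hA (Real.exp_le_one_iff.2 ?_)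
  have := norm_nonneg ((AddMonoidHom.id (Space d)) ξ)
  nlinarith

theorem eLpNorm_box_le (hq : 1 ≤ q) (hv : ∀ n, Represents (v n) (box χ n f)) (n : Lattice d) :
    eLpNorm (v n) 2 volume * weight s n ≤ wienerAmalgamNorm χ 2 q s f := by
  rw [wienerAmalgamNorm_eq 2 hv, ← eLpNorm_enorm_mul_const (hv n).1]
  exact eLpNorm_mono_enorm fun x => le_ellNorm (a := fun n => ‖v n x‖ₑ * weight s n)
    (one_pos.trans_le hq).ne' n

theorem memLp_box (hq : 1 ≤ q) (hf : wienerAmalgamNorm χ 2 q s f < ⊤)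
    (hv : ∀ n, Represents (v n) (box χ n f)) (n : Lattice d) : MemLp (v n) 2 volume :=
  ⟨(hv n).1, ENNReal.lt_top_of_mul_ne_top_left ((eLpNorm_box_le hq hv n).trans_lt hf).ne
    (weight_pos s n).ne'⟩

/-- On the cube around 0 the symbol of `box χ 0` is at least the inverse of the number of
neighbours. So the L² norm of h there is controlled by that of `box χ 0 f`, by Plancherel's theorem,
and this is one term of the norm, with weight 1. -/
theorem hasLowerBound_wienerAmalgam (hχ : IsCutoff χ) (hq : 1 ≤ q) (s : ℝ) {κ : Space d → ℝ}
    {r₀ : ℝ} (hκ : IsLowCutoff κ r₀) :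
    HasLowerBound volume (AddMonoidHom.id (Space d)) FourierProfile κ
      (wienerAmalgamNorm χ 2 q s) := by
  have hcard : ((neighbours d).card : ℝ≥0∞) ≠ 0 := by
    have h0 : (0 : Lattice d) ∈ neighbours d := Fintype.mem_piFinset.2 fun i => by simp
    exact_mod_cast (Finset.card_pos.2 ⟨0, h0⟩).ne'
  refine ⟨(neighbours d).card, ENNReal.natCast_ne_top _, fun f h hf hh => ?_⟩
  rcases eq_or_ne (wienerAmalgamNorm χ 2 q s f) ⊤ with htop | htop
  · rw [htop, ENNReal.mul_top hcard]
    exact le_top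
  obtain ⟨v, -, hv⟩ := exists_represents_of_wienerAmalgamNorm_lt_top htop.lt_top
  obtain ⟨u, hu, hun⟩ := (hv 0).exists_fourier (memLp_box hq htop.lt_top hv 0)
  have hae := hu.ae_eq (hf.2.fourier_box hχ 0)
  have hle := eLpNorm_box_le (s := s) hq hv 0
  rw [weight_zero_right, mul_one, ← hun, eLpNorm_congr_ae hae] at hle
  refine (hκ.enorm_integral_le h).trans ((eLpNorm_one_unitCube_le one_le_two 0
    hh.1.aestronglyMeasurable).trans ?_)
  calc eLpNorm h 2 (volume.restrict (unitCube 0))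
      ≤ eLpNorm (fun ξ => ((neighbours d).card : ℂ) * (boxSymbol χ 0 ξ * h ξ)) 2
          (volume.restrict (unitCube 0)) := by
        refine eLpNorm_mono_ae ?_
        filter_upwards [ae_restrict_mem (measurableSet_unitCube 0)] with ξ hξ
        have h1 := hχ.one_le_boxSum ξ
        rw [boxSymbol_eq, hχ.eq_one_of_mem_unitCube hξ, ← mul_assoc, norm_mul]
        refine le_mul_of_one_le_left (norm_nonneg _) ?_
        rw [norm_mul, Complex.norm_real, Complex.norm_natCast, Real.norm_eq_abs,
          abs_of_nonneg (by positivity), mul_one_div, one_le_div (by linarith)]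
        exact hχ.boxSum_le ξ
    _ ≤ eLpNorm (fun ξ => ((neighbours d).card : ℂ) * (boxSymbol χ 0 ξ * h ξ)) 2 volume :=
        eLpNorm_mono_measure _ Measure.restrict_le_self
    _ = (neighbours d).card * eLpNorm (fun ξ => boxSymbol χ 0 ξ * h ξ) 2 volume := by
        refine (eLpNorm_const_smul ((neighbours d).card : ℂ)
          (fun ξ => boxSymbol χ 0 ξ * h ξ) 2 volume).trans ?_
        rw [← ofReal_norm, Complex.norm_natCast, ENNReal.ofReal_natCast]
    _ ≤ _ := mul_le_mul_right hle _

end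

end

section

/-! ### Approximation in Wiener amalgam spaces -/

section

variable {d : ℕ} {χ : Space d → ℝ} {q : ℝ≥0∞} {s : ℝ} {f : 𝓢'(Space d, ℂ)}

/-- Only finitely many cubes meet the support, so the norm is controlled by finitely many local L²
norms, and truncation at a high level suffices for every q. -/
theorem niceApprox_wienerAmalgam_of_memLp (hχ : IsCutoff χ) (hq : 1 ≤ q) (s : ℝ)
    (hb : BandLimited f) {H : Space d → ℂ} (hH : Represents H (𝓕 f)) (hH2 : MemLp H 2 volume) :
    NiceApprox (AddMonoidHom.id (Space d)) FourierProfile (wienerAmalgamNorm χ 2 q s) f := by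
  obtain ⟨C, hC, hle⟩ := exists_wienerAmalgamNorm_le hχ hq s
  obtain ⟨R, hR⟩ := hb
  have hvan := hH.ae_eq_zero_of_isVanishingOn Metric.isClosed_closedBall.isOpen_compl hR
  obtain ⟨g, hgm, hHg⟩ := hH.1
  have hg : Represents g (𝓕 f) := hH.congr hHg
  obtain ⟨F, hF⟩ : ∃ F : Finset (Lattice d), ∀ n ∉ F, R + d < ‖latticePt n‖ :=
    ⟨(finite_norm_latticePt_le (d := d) (R + d)).toFinset, fun n hn => by
      rwa [Set.Finite.mem_toFinset, mem_ofPred_eq, not_le] at hn⟩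
  have hfin : ∀ n : Lattice d, eLpNorm g 2 (volume.restrict (unitCube n)) < ⊤ := fun n =>
    lt_of_le_of_lt ((eLpNorm_mono_measure g Measure.restrict_le_self).trans
      (eLpNorm_congr_ae hHg).ge) hH2.2
  intro δ hδ
  have hW : C * ∑ n ∈ F, weight s n ≠ ⊤ :=
    ENNReal.mul_ne_top hC (ENNReal.sum_ne_top.2 fun n _ => weight_ne_top s n)
  obtain ⟨η, hη, hηW⟩ := ENNReal.exists_nnreal_pos_mul_lt hW hδ.ne'
  obtain ⟨h, hh, hFh, hFh'⟩ := exists_nice_truncation (p := 2) hgm F (fun n _ => hfin n)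
    (NNReal.coe_pos.2 hη)
  obtain ⟨f', hf'⟩ := isRealization_space.exists_profile (hh.decays volume)
  refine ⟨f', h, hf', hh, ?_⟩
  have hsub : Represents (g - h) (𝓕 (f - f')) := by
    rw [fourier_sub]
    exact hg.sub hf'.2
  have hloc : ∀ n : Lattice d, eLpNorm (g - h) 2 (volume.restrict (unitCube n)) ≤
      if n ∈ F then (η : ℝ≥0∞) else 0 := fun n => by
    split_ifs with hn
    · exact (hFh n hn).trans (le_of_eq ENNReal.ofReal_coe_nnreal)
    · refine le_of_eq ((eLpNorm_congr_ae ?_).trans (eLpNorm_zero (ε := ℂ)))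
      filter_upwards [ae_restrict_mem (measurableSet_unitCube n), ae_restrict_of_ae hvan,
        ae_restrict_of_ae hHg] with x hx hx' hx''
      rw [Pi.sub_apply, hFh' n hn x hx, sub_zero, ← hx'']
      refine hx' fun hmem => ?_
      rw [mem_closedBall_zero_iff] at hmem
      linarith [norm_latticePt_le hx, hF n hn]
  calc wienerAmalgamNorm χ 2 q s (f - f')
      ≤ C * ∑' n : Lattice d, eLpNorm (g - h) 2 (volume.restrict (unitCube n)) * weight s n :=
        hle _ _ hsub fun n => (hloc n).trans_lt (by split_ifs <;> simp)
    _ ≤ C * ∑' n : Lattice d, if n ∈ F then η * weight s n else 0 := by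
        refine mul_le_mul_right (ENNReal.tsum_le_tsum fun n => ?_) _
        refine (mul_le_mul_left (hloc n) _).trans (le_of_eq ?_)
        split_ifs <;> simp
    _ = η * (C * ∑ n ∈ F, weight s n) := by
        rw [tsum_eq_sum (s := F) fun n hn => if_neg hn, mul_left_comm, Finset.mul_sum _ _ (η : ℝ≥0∞)]
        exact congrArg _ (Finset.sum_congr rfl fun n hn => if_pos hn)
    _ < δ := hηW

theorem fourier_sum_box (F : Finset (Lattice d)) (φ : 𝓢(Space d, ℂ)) :
    (𝓕 (∑ n ∈ F, box χ n f) : 𝓢'(Space d, ℂ)) φ =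
      ∑ n ∈ F, (𝓕 f : 𝓢'(Space d, ℂ)) (SchwartzMap.smulLeftCLM ℂ (boxSymbol χ n) φ) := by
  have h1 : (𝓕 (∑ n ∈ F, box χ n f) : 𝓢'(Space d, ℂ)) = ∑ n ∈ F, 𝓕 (box χ n f) :=
    map_sum (FourierTransform.fourierCLM ℂ 𝓢'(Space d, ℂ)) _ F
  rw [h1]
  simp only [fourier_box]
  rw [sum_apply]
  rfl

theorem box_box_apply_fourier (m n : Lattice d) (φ : 𝓢(Space d, ℂ)) :
    (𝓕 (box χ m (box χ n f)) : 𝓢'(Space d, ℂ)) φ =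
      (𝓕 f : 𝓢'(Space d, ℂ)) (SchwartzMap.smulLeftCLM ℂ (boxSymbol χ n)
        (SchwartzMap.smulLeftCLM ℂ (boxSymbol χ m) φ)) := by
  rw [fourier_box, fourier_box]
  rfl

theorem eq_of_fourier_apply_eq {f f' : 𝓢'(Space d, ℂ)}
    (h : ∀ φ : 𝓢(Space d, ℂ), (𝓕 f : 𝓢'(Space d, ℂ)) φ = (𝓕 f' : 𝓢'(Space d, ℂ)) φ) : f = f' := by
  have h1 : (𝓕 f : 𝓢'(Space d, ℂ)) = 𝓕 f' := by
    ext φ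
    exact h φ
  calc f = 𝓕⁻ (𝓕 f : 𝓢'(Space d, ℂ)) := (FourierTransform.fourierInv_fourier_eq f).symm
    _ = 𝓕⁻ (𝓕 f' : 𝓢'(Space d, ℂ)) := by rw [h1]
    _ = f' := FourierTransform.fourierInv_fourier_eq f'

theorem bandLimited_sum_box (hχ : IsCutoff χ) (F : Finset (Lattice d)) :
    BandLimited (∑ n ∈ F, box χ n f) := by
  refine ⟨∑ n ∈ F, (‖latticePt n‖ + d), fun φ hφ => ?_⟩
  rw [fourier_sum_box]
  refine Finset.sum_eq_zero fun n hn => ?_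
  have : SchwartzMap.smulLeftCLM ℂ (boxSymbol χ n) φ = 0 := by
    ext ξ
    rw [SchwartzMap.smulLeftCLM_apply_apply (hχ.hasTemperateGrowth_boxSymbol n), smul_eq_mul]
    by_cases hξ : ∀ i, |ξ i - n i| < 1
    · have h1 : ξ ∉ tsupport φ := fun hmem => hφ hmem (by
        rw [mem_closedBall_zero_iff]
        refine le_trans ?_ (Finset.single_le_sum (f := fun n : Lattice d => ‖latticePt n‖ + d)
          (fun _ _ => by positivity) hn)
        have h2 := norm_le_of_abs_le (x := ξ - latticePt n) (c := 1) fun i => (hξ i).le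
        have h3 := norm_sub_norm_le ξ (latticePt n)
        linarith)
      rw [image_eq_zero_of_notMem_tsupport h1, mul_zero]
      rfl
    · rw [hχ.boxSymbol_eq_zero hξ, zero_mul]
      rfl
  rw [this, map_zero]

theorem exists_eq_sum_box (hχ : IsCutoff χ) (hb : BandLimited f) :
    ∃ F : Finset (Lattice d), f = ∑ n ∈ F, box χ n f := by
  obtain ⟨R, hR⟩ := hb
  -- The symbols of F sum to 1 on the ball of radius R + 1, larger than R, because the closed
  -- support of the difference must avoid the closed ball of radius R.
  obtain ⟨F, hF⟩ : ∃ F : Finset (Lattice d), ∀ n, ‖latticePt n‖ ≤ R + 1 + d → n ∈ F :=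
    ⟨(finite_norm_latticePt_le (d := d) (R + 1 + d)).toFinset, fun n hn => by
      rwa [Set.Finite.mem_toFinset, mem_ofPred_eq]⟩
  refine ⟨F, eq_of_fourier_apply_eq fun φ => ?_⟩
  rw [fourier_sum_box, ← map_sum, ← sub_eq_zero, ← map_sub]
  refine hR _ ?_
  have hzero : ∀ ξ ∈ Metric.ball (0 : Space d) (R + 1),
      (φ - ∑ n ∈ F, SchwartzMap.smulLeftCLM ℂ (boxSymbol χ n) φ) ξ = 0 := fun ξ hξ => by
    rw [mem_ball_zero_iff] at hξ
    have h1 : (∑ n ∈ F, SchwartzMap.smulLeftCLM ℂ (boxSymbol χ n) φ) ξ =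
        (∑ n ∈ F, boxSymbol χ n ξ) * φ ξ := by
      rw [sum_apply, Finset.sum_mul]
      refine Finset.sum_congr rfl fun n _ => ?_
      rw [SchwartzMap.smulLeftCLM_apply_apply (hχ.hasTemperateGrowth_boxSymbol n), smul_eq_mul]
    rw [sub_apply, h1, hχ.sum_boxSymbol_eq_one fun l hl => hF l ?_, one_mul, sub_self]
    linarith [IsCutoff.norm_latticePt_le_of_abs_lt hl]
  have hsub : tsupport (φ - ∑ n ∈ F, SchwartzMap.smulLeftCLM ℂ (boxSymbol χ n) φ) ⊆
      (Metric.ball (0 : Space d) (R + 1))ᶜ :=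
    closure_minimal (fun ξ hξ hmem => hξ (hzero ξ hmem)) Metric.isOpen_ball.isClosed_compl
  refine hsub.trans (compl_subset_compl.2 fun ξ hξ => ?_)
  rw [mem_closedBall_zero_iff] at hξ
  rw [mem_ball_zero_iff]
  linarith

theorem niceApprox_sum_box (hχ : IsCutoff χ) (hq : 1 ≤ q) (hf : wienerAmalgamNorm χ 2 q s f < ⊤)
    (F : Finset (Lattice d)) : NiceApprox (AddMonoidHom.id (Space d)) FourierProfile
      (wienerAmalgamNorm χ 2 q s) (∑ n ∈ F, box χ n f) := by
  obtain ⟨v, -, hv⟩ := exists_represents_of_wienerAmalgamNorm_lt_top hf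
  have h2 : MemLp (∑ n ∈ F, v n) 2 volume := memLp_finsetSum' F fun n _ => memLp_box hq hf hv n
  obtain ⟨H, hH, hn⟩ := (Represents.sum F fun n _ => hv n).exists_fourier h2
  exact niceApprox_wienerAmalgam_of_memLp hχ hq s (bandLimited_sum_box hχ F) hH
    ⟨hH.1, by rw [hn]; exact h2.2⟩

theorem niceApprox_wienerAmalgam_of_bandLimited (hχ : IsCutoff χ) (hq : 1 ≤ q) (hb : BandLimited f)
    (hf : wienerAmalgamNorm χ 2 q s f < ⊤) :
    NiceApprox (AddMonoidHom.id (Space d)) FourierProfile (wienerAmalgamNorm χ 2 q s) f := by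
  obtain ⟨F, hF⟩ := exists_eq_sum_box hχ hb
  have := niceApprox_sum_box hχ hq hf F
  rwa [← hF] at this

theorem box_box_eq_zero (hχ : IsCutoff χ) {m n : Lattice d} (h : n - m ∉ neighbours d) :
    box χ m (box χ n f) = 0 := by
  have h0 : (𝓕 (0 : 𝓢'(Space d, ℂ)) : 𝓢'(Space d, ℂ)) = 0 := by
    have := fourier_sub (0 : 𝓢'(Space d, ℂ)) 0
    rwa [sub_self, sub_self] at this
  refine eq_of_fourier_apply_eq fun φ => ?_
  rw [box_box_apply_fourier, h0, SchwartzMap.smulLeftCLM_smulLeftCLM_apply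
    (hχ.hasTemperateGrowth_boxSymbol n) (hχ.hasTemperateGrowth_boxSymbol m)]
  have : boxSymbol χ n * boxSymbol χ m = fun _ => 0 := by
    funext ξ
    rw [Pi.mul_apply]
    by_cases hn : ∀ i, |ξ i - n i| < 1
    · rw [hχ.boxSymbol_eq_zero (n := m) fun hm => h (mem_neighbours_of_abs_lt fun i => ?_), mul_zero]
      have h1 := abs_lt.1 (hn i)
      have h2 := abs_lt.1 (hm i)
      exact abs_lt.2 ⟨by linarith, by linarith⟩
    · rw [hχ.boxSymbol_eq_zero hn, zero_mul]
  rw [this, SchwartzMap.smulLeftCLM_const]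
  simp

/-- Together with `box_box_eq_zero` this says that `box χ m` sees only the neighbouring pieces of f;
hence a frequency truncation leaves a remainder that is local in frequency. -/
theorem box_eq_sum_neighbours (hχ : IsCutoff χ) (m : Lattice d) :
    box χ m f = ∑ k ∈ neighbours d, box χ m (box χ (m + k) f) := by
  refine eq_of_fourier_apply_eq fun φ => ?_
  have h1 : (𝓕 (∑ k ∈ neighbours d, box χ m (box χ (m + k) f)) : 𝓢'(Space d, ℂ)) =
      ∑ k ∈ neighbours d, 𝓕 (box χ m (box χ (m + k) f)) :=
    map_sum (FourierTransform.fourierCLM ℂ 𝓢'(Space d, ℂ)) _ _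
  rw [h1, sum_apply]
  simp only [box_box_apply_fourier]
  rw [← map_sum, fourier_box, TemperedDistribution.smulLeftCLM_apply_apply]
  congr 1
  ext ξ
  rw [sum_apply, SchwartzMap.smulLeftCLM_apply_apply (hχ.hasTemperateGrowth_boxSymbol m)]
  have h2 : ∀ k, SchwartzMap.smulLeftCLM ℂ (boxSymbol χ (m + k))
      (SchwartzMap.smulLeftCLM ℂ (boxSymbol χ m) φ) ξ =
      boxSymbol χ m ξ * boxSymbol χ (m + k) ξ * φ ξ := fun k => by
    rw [SchwartzMap.smulLeftCLM_apply_apply (hχ.hasTemperateGrowth_boxSymbol _),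
      SchwartzMap.smulLeftCLM_apply_apply (hχ.hasTemperateGrowth_boxSymbol _), smul_eq_mul,
      smul_eq_mul]
    ring
  simp only [h2]
  rw [← Finset.sum_mul, ← Finset.mul_sum, hχ.boxSymbol_mul_sum_neighbours, smul_eq_mul]

/-- Localization of the remainder after truncation in frequency. -/
theorem box_sub_sum_box (hχ : IsCutoff χ) (m : Lattice d) (F : Finset (Lattice d)) :
    box χ m (f - ∑ n ∈ F, box χ n f) =
      box χ m (∑ k ∈ neighbours d with m + k ∉ F, box χ (m + k) f) := by
  classical
  have hlin : ∀ (S : Finset (Lattice d)) (g : Lattice d → 𝓢'(Space d, ℂ)),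
      box χ m (∑ n ∈ S, g n) = ∑ n ∈ S, box χ m (g n) := fun S g =>
    map_sum (TemperedDistribution.fourierMultiplierCLM ℂ (boxSymbol χ m)) _ _
  have h1 : ∑ n ∈ F, box χ m (box χ n f) =
      ∑ k ∈ neighbours d with m + k ∈ F, box χ m (box χ (m + k) f) := by
    symm
    refine Finset.sum_of_injOn (fun k => m + k) (fun a _ b _ h => add_left_cancel h)
      (fun k hk => (Finset.mem_filter.1 hk).2) (fun n hn hn' => ?_) fun k _ => rfl
    refine box_box_eq_zero hχ fun hmem => hn' ⟨n - m, ?_, add_sub_cancel m n⟩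
    exact Finset.mem_coe.2 (Finset.mem_filter.2 ⟨hmem, by rwa [add_sub_cancel]⟩)
  rw [box_sub, hlin, hlin, h1, box_eq_sum_neighbours hχ,
    ← Finset.sum_filter_add_sum_filter_not (neighbours d) (fun k => m + k ∈ F)]
  exact add_sub_cancel_left _ _

end

end

section

/-! ### The kernels of the uniform decomposition -/

section

variable {d : ℕ} {χ : Space d → ℝ} {q : ℝ≥0∞} {s : ℝ} {f : 𝓢'(Space d, ℂ)}

/-- The kernel of `box χ n`. -/
def boxKernel (χ : Space d → ℝ) (n : Lattice d) : Space d → ℂ := 𝓕⁻ (boxSymbol χ n)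

theorem IsCutoff.exists_schwartz_boxKernel (hχ : IsCutoff χ) (n : Lattice d) :
    ∃ k : 𝓢(Space d, ℂ), ⇑k = boxKernel χ n := by
  obtain ⟨S, hS⟩ : ∃ S : 𝓢(Space d, ℂ), ⇑S = boxSymbol χ n :=
    ⟨(hχ.hasCompactSupport_boxSymbol n).toSchwartzMap (hχ.contDiff_boxSymbol n), rfl⟩
  refine ⟨𝓕⁻ S, ?_⟩
  rw [SchwartzMap.fourierInv_coe, hS]
  rfl

/-- The symbols are translates of one another, so the kernels differ by modulations. One integrable
majorant thus serves all n simultaneously. -/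
theorem norm_boxKernel (χ : Space d → ℝ) (n : Lattice d) (y : Space d) :
    ‖boxKernel χ n y‖ = ‖boxKernel χ 0 y‖ := by
  have e : boxSymbol χ n = boxSymbol χ 0 ∘ fun ξ => ξ + -latticePt n := by
    funext ξ
    rw [IsCutoff.boxSymbol_eq_translate, Function.comp_apply, ← sub_eq_add_neg]
  have h := congrFun (VectorFourier.fourierIntegral_comp_add_right Real.fourierChar
    (volume : Measure (Space d)) (-innerₗ (Space d)) (boxSymbol χ 0) (-latticePt n)) y
  rw [← e] at h
  have h' : boxKernel χ n y = Real.fourierChar ((-innerₗ (Space d)) (-latticePt n) y) •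
      boxKernel χ 0 y := h
  rw [h', Circle.norm_smul]

theorem fourier_boxSymbol_mul_fourierInv (hχ : IsCutoff χ) (n : Lattice d) (φ : 𝓢(Space d, ℂ))
    (z : Space d) : (𝓕 (SchwartzMap.smulLeftCLM ℂ (boxSymbol χ n) (𝓕⁻ φ)) : 𝓢(Space d, ℂ)) z =
      ∫ x, φ x * boxKernel χ n (x - z) := by
  have hintg : Integrable (fun ξ => Real.fourierChar (-inner ℝ ξ z) • boxSymbol χ n ξ) volume := by
    have h1 : Integrable (boxSymbol χ n) volume :=
      (hχ.contDiff_boxSymbol n).continuous.integrable_of_hasCompactSupport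
        (hχ.hasCompactSupport_boxSymbol n)
    refine h1.mono (Continuous.aestronglyMeasurable ?_) (Eventually.of_forall fun ξ => ?_)
    · exact (Real.continuous_fourierChar.comp
        (continuous_id.inner continuous_const).neg).smul (hχ.contDiff_boxSymbol n).continuous
    · rw [Circle.norm_smul]
  have h1 := integral_fourierInv_mul_eq_flip φ hintg
  rw [SchwartzMap.fourier_coe, Real.fourier_eq]
  refine Eq.trans (integral_congr_ae (Eventually.of_forall fun ξ => ?_)) (h1.trans
    (integral_congr_ae (Eventually.of_forall fun x => ?_)))
  · dsimp only
    rw [SchwartzMap.smulLeftCLM_apply_apply (hχ.hasTemperateGrowth_boxSymbol n)]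
    simp only [Circle.smul_def, smul_eq_mul]
    ring
  · dsimp only
    rw [boxKernel, Real.fourierInv_eq, Real.fourierInv_eq]
    congr 1
    refine integral_congr_ae (Eventually.of_forall fun ξ => ?_)
    dsimp only
    rw [smul_smul, ← AddChar.map_add_eq_mul, inner_sub_right, sub_eq_add_neg]

/-- Cauchy–Schwarz in the second variable, then integrability of φ in the first. It justifies
Fubini's theorem in `Represents.box_conv`. -/
theorem integrable_conv_kernel (φ k : 𝓢(Space d, ℂ)) {v : Space d → ℂ} (hv : Measurable v)
    (hv2 : MemLp v 2 volume) : Integrable (fun z : Space d × Space d =>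
      φ z.1 * k (z.1 - z.2) * v z.2) (volume.prod volume) := by
  have hkm : Measurable k := k.continuous.measurable
  have hm : Measurable fun z : Space d × Space d => φ z.1 * k (z.1 - z.2) * v z.2 :=
    ((φ.continuous.measurable.comp measurable_fst).mul
      (hkm.comp (measurable_fst.sub measurable_snd))).mul (hv.comp measurable_snd)
  refine ⟨hm.aestronglyMeasurable, ?_⟩
  rw [hasFiniteIntegral_iff_enorm, lintegral_prod _ hm.enorm.aemeasurable]
  have hin : ∀ x, ∫⁻ z, ‖φ x * k (x - z) * v z‖ₑ ≤
      ‖φ x‖ₑ * (eLpNorm k 2 volume * eLpNorm v 2 volume) := fun x => by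
    have hkx : Measurable fun z => ‖k (x - z)‖ₑ :=
      (hkm.comp (measurable_const.sub measurable_id)).enorm
    have h1 := ENNReal.lintegral_mul_le_Lp_mul_Lq volume Real.HolderConjugate.two_two
      hkx.aemeasurable hv.enorm.aemeasurable
    rw [lintegral_sub_left_eq_self (fun y => ‖k y‖ₑ ^ (2 : ℝ)) x, ← eLpNorm_two_eq,
      ← eLpNorm_two_eq, eLpNorm_enorm, eLpNorm_enorm] at h1
    simp only [enorm_mul, mul_assoc]
    have hkv : Measurable fun z => ‖k (x - z)‖ₑ * ‖v z‖ₑ := hkx.mul hv.enorm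
    rw [lintegral_const_mul _ hkv]
    exact mul_le_mul_right h1 _
  refine lt_of_le_of_lt (lintegral_mono hin) ?_
  rw [lintegral_mul_const _ φ.continuous.measurable.enorm]
  exact ENNReal.mul_lt_top φ.integrable.2 (ENNReal.mul_lt_top (k.memLp 2 volume).2 hv2.2)

/-- On `L²` the operator `box χ n` is the convolution with its kernel. -/
theorem Represents.box_conv (hχ : IsCutoff χ) (n : Lattice d) {v : Space d → ℂ}
    (hv : Represents v f) (hvm : Measurable v) (hv2 : MemLp v 2 volume) :
    Represents (fun x => ∫ y, boxKernel χ n y * v (x - y)) (box χ n f) := by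
  obtain ⟨k, hk⟩ := hχ.exists_schwartz_boxKernel n
  have hflip : ∀ x, ∫ y, boxKernel χ n y * v (x - y) = ∫ z, k (x - z) * v z := fun x => by
    rw [← integral_sub_left_eq_self (fun y => boxKernel χ n y * v (x - y)) volume x, hk]
    simp only [sub_sub_cancel]
  simp only [hflip]
  have hm : Measurable fun z : Space d × Space d => k (z.1 - z.2) * v z.2 :=
    (k.continuous.measurable.comp (measurable_fst.sub measurable_snd)).mul
      (hvm.comp measurable_snd)
  refine ⟨hm.stronglyMeasurable.integral_prod_right.aestronglyMeasurable, fun φ => ?_⟩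
  have hintg := integrable_conv_kernel φ k hvm hv2
  have e1 : ∀ x, φ x * ∫ z, k (x - z) * v z = ∫ z, φ x * k (x - z) * v z := fun x => by
    rw [← integral_const_mul]
    simp only [mul_assoc]
  simp only [e1]
  refine ⟨hintg.integral_prod_left, ?_⟩
  rw [box, TemperedDistribution.fourierMultiplierCLM_apply_apply, (hv.2 _).2,
    integral_integral_swap hintg]
  refine integral_congr_ae (Eventually.of_forall fun z => ?_)
  dsimp only
  rw [fourier_boxSymbol_mul_fourierInv hχ, ← hk, integral_mul_const]

theorem ellNorm_comp_add (q : ℝ≥0∞) (a : Lattice d → ℝ≥0∞) (k : Lattice d) :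
    ellNorm q (fun n => a (n + k)) = ellNorm q a := by
  have h : MeasurePreserving (fun n : Lattice d => n + k) Measure.count Measure.count :=
    ⟨measurable_of_countable _, map_count_equiv (Equiv.addRight k)⟩
  exact eLpNorm_comp_measurePreserving (measurable_of_countable a).aestronglyMeasurable h

theorem ellNorm_sum_neighbours_le (hq : 1 ≤ q) (a : Lattice d → ℝ≥0∞) :
    ellNorm q (fun n => ∑ k ∈ neighbours d, a (n + k)) ≤ (neighbours d).card * ellNorm q a := by
  have h1 := eLpNorm_sum_le (s := neighbours d) (f := fun k (n : Lattice d) => a (n + k))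
    (μ := Measure.count) (p := q) (fun k _ => (measurable_of_countable _).aestronglyMeasurable) hq
  have e : (∑ k ∈ neighbours d, fun n : Lattice d => a (n + k)) =
      fun n => ∑ k ∈ neighbours d, a (n + k) := by
    funext n
    simp
  rw [e] at h1
  refine h1.trans (le_of_eq ?_)
  refine (Finset.sum_congr rfl fun k _ => ellNorm_comp_add q a k).trans ?_
  rw [Finset.sum_const, nsmul_eq_mul]

theorem ellNorm_const_mul (hq : q ≠ 0) (hq' : q ≠ ⊤) (c : ℝ≥0∞) (a : Lattice d → ℝ≥0∞) :
    ellNorm q (fun n => c * a n) = c * ellNorm q a := by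
  have hpos := ENNReal.toReal_pos hq hq'
  simp only [ellNorm_eq_tsum hq hq', ENNReal.mul_rpow_of_nonneg _ _ hpos.le]
  rw [ENNReal.tsum_mul_left, ENNReal.mul_rpow_of_nonneg _ _ (by positivity), ← ENNReal.rpow_mul,
    mul_one_div_cancel hpos.ne', ENNReal.rpow_one]

/-- The remainder after truncation in frequency is controlled by the tail of the norm. -/
theorem exists_wienerAmalgamNorm_sub_le (hχ : IsCutoff χ) (hq : 1 ≤ q) (hq' : q ≠ ⊤) (s : ℝ) :
    ∃ C : ℝ≥0∞, C ≠ ⊤ ∧ ∀ (f : 𝓢'(Space d, ℂ)) (v : Lattice d → Space d → ℂ),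
      wienerAmalgamNorm χ 2 q s f < ⊤ → (∀ n, Measurable (v n)) →
      (∀ n, Represents (v n) (box χ n f)) → ∀ F : Finset (Lattice d),
      wienerAmalgamNorm χ 2 q s (f - ∑ n ∈ F, box χ n f) ≤
        C * eLpNorm (fun x => ellNorm q fun n => if n ∈ F then 0 else ‖v n x‖ₑ * weight s n) 2
          volume := by
  obtain ⟨Cw, hCw, hw⟩ := exists_weight_le_weight_add d s
  obtain ⟨k₀, hk₀⟩ := hχ.exists_schwartz_boxKernel 0
  have hq0 : q ≠ 0 := (one_pos.trans_le hq).ne'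
  obtain ⟨K, hK⟩ : ∃ K : Space d → ℝ≥0∞, K = fun y => ‖k₀ y‖ₑ := ⟨_, rfl⟩
  have hKm : Measurable K := by
    rw [hK]
    exact k₀.continuous.measurable.enorm
  have hKint : ∫⁻ y, K y ≠ ⊤ := by
    rw [hK]
    exact k₀.integrable.2.ne
  refine ⟨Cw * (neighbours d).card * ∫⁻ y, K y, ENNReal.mul_ne_top
    (ENNReal.mul_ne_top hCw (ENNReal.natCast_ne_top _)) hKint, fun f v hf hvm hv F => ?_⟩
  obtain ⟨b, hb⟩ : ∃ b : Lattice d → Space d → ℝ≥0∞,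
    b = fun n x => if n ∈ F then 0 else ‖v n x‖ₑ * weight s n := ⟨_, rfl⟩
  have hbm : ∀ n, Measurable (b n) := fun n => by
    rw [hb]
    by_cases hn : n ∈ F
    · simp [hn]
    · simpa [hn] using (hvm n).enorm.mul_const _
  have e : (fun x => ellNorm q fun n => if n ∈ F then 0 else ‖v n x‖ₑ * weight s n) =
      fun x => ellNorm q fun n => b n x := by rw [hb]
  rw [e]
  have hAm : Measurable fun x => ellNorm q fun n => b n x := measurable_ellNorm hq0 hbm
  -- The neighbouring pieces that the truncation leaves out. By `box_sub_sum_box`, applying `box χ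
  -- m` to the remainder is convolving V m with the mth kernel.
  obtain ⟨V, hV⟩ : ∃ V : Lattice d → Space d → ℂ,
    V = fun m => ∑ k ∈ neighbours d with m + k ∉ F, v (m + k) := ⟨_, rfl⟩
  have hVm : ∀ m, Measurable (V m) := fun m => by
    rw [hV]
    dsimp only
    rw [show (∑ k ∈ neighbours d with m + k ∉ F, v (m + k)) =
        fun a => ∑ k ∈ neighbours d with m + k ∉ F, v (m + k) a from
      funext fun a => Finset.sum_apply a _ _]
    exact Finset.measurable_sum _ fun k _ => hvm _
  have hu : ∀ m, Represents (fun x => ∫ y, boxKernel χ m y * V m (x - y))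
      (box χ m (f - ∑ n ∈ F, box χ n f)) := fun m => by
    rw [box_sub_sum_box hχ]
    have hr : Represents (V m) (∑ k ∈ neighbours d with m + k ∉ F, box χ (m + k) f) := by
      rw [hV]
      exact Represents.sum _ fun k _ => hv _
    have hV2 : MemLp (V m) 2 volume := by
      rw [hV]
      exact memLp_finsetSum' _ fun k _ => memLp_box hq hf hv _
    exact hr.box_conv hχ m (hVm m) hV2
  have hVb : ∀ m z, ‖V m z‖ₑ * weight s m ≤ Cw * ∑ k ∈ neighbours d, b (m + k) z := fun m z => by
    rw [hV]
    dsimp only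
    rw [Finset.sum_apply]
    refine (mul_le_mul_left (enorm_sum_le _ _) _).trans ?_
    rw [Finset.sum_filter, Finset.sum_mul, Finset.mul_sum]
    refine Finset.sum_le_sum fun k hk => ?_
    rw [hb]
    dsimp only
    by_cases hmk : m + k ∈ F
    · simp [hmk]
    · rw [if_pos hmk, if_neg hmk]
      refine (mul_le_mul_right (hw m k hk) _).trans (le_of_eq ?_)
      ring
  -- Minkowski's inequality moves the ℓ^q norm inside the convolution, at the same x, with the
  -- common majorant K. Young's inequality in x then finishes the estimate.
  have hpt : ∀ x, ellNorm q (fun m => ‖∫ y, boxKernel χ m y * V m (x - y)‖ₑ * weight s m) ≤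
      Cw * (neighbours d).card * ∫⁻ y, K y * ellNorm q fun n => b n (x - y) := fun x => by
    have hsubm : Measurable fun y : Space d => x - y := measurable_const.sub measurable_id
    have hbs : ∀ m, Measurable fun y => ∑ k ∈ neighbours d, b (m + k) (x - y) := fun m =>
      Finset.measurable_fun_sum _ fun k _ => (hbm _).comp hsubm
    calc ellNorm q (fun m => ‖∫ y, boxKernel χ m y * V m (x - y)‖ₑ * weight s m)
        ≤ ellNorm q (fun m => ∫⁻ y, K y * (Cw * ∑ k ∈ neighbours d, b (m + k) (x - y))) := by
          refine ellNorm_mono fun m => ?_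
          refine (mul_le_mul_left (enorm_integral_le_lintegral_enorm _) _).trans ?_
          rw [← lintegral_mul_const' _ _ (weight_ne_top s m)]
          refine lintegral_mono fun y => ?_
          dsimp only
          have : ‖boxKernel χ m y‖ₑ = K y := by
            rw [hK, ← ofReal_norm, norm_boxKernel, ← hk₀, ofReal_norm]
          rw [enorm_mul, this, mul_assoc]
          exact mul_le_mul_right (hVb m (x - y)) _
      _ ≤ ∫⁻ y, ellNorm q fun m => K y * (Cw * ∑ k ∈ neighbours d, b (m + k) (x - y)) :=
          ellNorm_lintegral_le hq hq' fun m => hKm.mul ((hbs m).const_mul _)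
      _ ≤ ∫⁻ y, Cw * (neighbours d).card * (K y * ellNorm q fun n => b n (x - y)) := by
          refine lintegral_mono fun y => ?_
          simp only [← mul_assoc]
          rw [ellNorm_const_mul hq0 hq']
          refine (mul_le_mul_right (ellNorm_sum_neighbours_le hq fun n => b n (x - y)) _).trans
            (le_of_eq ?_)
          ring
      _ = _ := lintegral_const_mul _ (hKm.mul (hAm.comp hsubm))
  rw [wienerAmalgamNorm_eq 2 hu]
  refine (eLpNorm_mono_enorm (g := fun x => Cw * (neighbours d).card *
    ∫⁻ y, K y * ellNorm q fun n => b n (x - y)) hpt).trans ?_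
  have hconst : ∀ A : Space d → ℝ≥0∞, Measurable A →
      eLpNorm (fun x => Cw * (neighbours d).card * A x) 2 volume =
        Cw * (neighbours d).card * eLpNorm A 2 volume := fun A hA => by
    simp only [eLpNorm_two_eq, ENNReal.mul_rpow_of_nonneg _ _ zero_le_two]
    rw [lintegral_const_mul _ (hA.pow_const _), ENNReal.mul_rpow_of_nonneg _ _ (by norm_num),
      ← ENNReal.mul_rpow_of_nonneg _ _ zero_le_two, ← ENNReal.rpow_mul]
    norm_num
  have hcm : Measurable fun x => ∫⁻ y, K y * ellNorm q fun n => b n (x - y) := by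
    have : Measurable fun z : Space d × Space d => K z.2 * ellNorm q fun n => b n (z.1 - z.2) :=
      (hKm.comp measurable_snd).mul (hAm.comp (measurable_fst.sub measurable_snd))
    exact this.lintegral_prod_right'
  rw [hconst _ hcm, mul_assoc _ (∫⁻ y, K y)]
  exact mul_le_mul_right (eLpNorm_lconvolution_le hKm hAm) _

/-- First truncate in frequency, which costs a tail of the L²(ℓ^q) norm, then approximate the
resulting finite sum of pieces, whose Fourier transform is in L² with bounded support. -/
theorem niceApprox_wienerAmalgam (hχ : IsCutoff χ) (hq : 1 ≤ q) (hq' : q ≠ ⊤)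
    (hf : wienerAmalgamNorm χ 2 q s f < ⊤) :
    NiceApprox (AddMonoidHom.id (Space d)) FourierProfile (wienerAmalgamNorm χ 2 q s) f := by
  intro δ hδ
  have hδ2 : 0 < δ / 2 := ENNReal.half_pos hδ.ne'
  obtain ⟨C, hC, hle⟩ := exists_wienerAmalgamNorm_sub_le (d := d) hχ hq hq' s
  obtain ⟨v, hvm, hv⟩ := exists_represents_of_wienerAmalgamNorm_lt_top hf
  obtain ⟨η, hη, hηC⟩ := ENNReal.exists_nnreal_pos_mul_lt hC hδ2.ne'
  have hfin := hf
  rw [wienerAmalgamNorm_eq 2 hv] at hfin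
  obtain ⟨F, hF⟩ := exists_eLpNorm_tail_lt hq hq' (fun n => (hvm n).enorm.mul_const (weight s n))
    hfin (ENNReal.coe_pos.2 hη)
  obtain ⟨g, h, hg, hh, hgh⟩ := niceApprox_sum_box hχ hq hf F (δ / 2) hδ2
  refine ⟨g, h, hg, hh, ?_⟩
  calc wienerAmalgamNorm χ 2 q s (f - g)
      = wienerAmalgamNorm χ 2 q s ((f - ∑ n ∈ F, box χ n f) + (∑ n ∈ F, box χ n f - g)) := by
        rw [sub_add_sub_cancel]
    _ ≤ wienerAmalgamNorm χ 2 q s (f - ∑ n ∈ F, box χ n f) +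
          wienerAmalgamNorm χ 2 q s (∑ n ∈ F, box χ n f - g) := wienerAmalgamNorm_add_le hq s _ _
    _ < δ / 2 + δ / 2 := by
        refine ENNReal.add_lt_add (lt_of_le_of_lt (hle f v hf hvm hv F) ?_) hgh
        refine lt_of_le_of_lt (mul_le_mul_right hF.le _) ?_
        rwa [mul_comm]
    _ = δ := ENNReal.add_halves δ

theorem stronglyIllPosed_wienerAmalgam (hχ : IsCutoff χ) (i₀ : Fin d) {σ ρ : ℕ} (hσ : 2 ≤ σ)
    (hρ : ρ ≤ σ) {μ : ℂ} (hμ : ‖μ‖ = 1) (hq : 1 ≤ q) (hs : s < 0) :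
    StronglyIllPosed (wienerAmalgamNorm χ 2 q) (SolRd μ ρ σ) BandLimited q s :=
  isRealization_space.stronglyIllPosed (e := EuclideanSpace.single i₀ 1)
    (hasUpperBound_fourierAmalgam le_rfl 1 0) (fun θ => hasUpperBound_wienerAmalgam hχ hq θ)
    (fun _ hκ θ => hasLowerBound_wienerAmalgam hχ hq θ hκ)
    (fun θ => wienerAmalgamNorm_add_le hq θ) (fun θ => wienerAmalgamNorm_zero χ q θ) rfl
    (fun hq' _ _ hf => niceApprox_wienerAmalgam hχ hq hq' hf)
    (fun _ _ _ hb hf => niceApprox_wienerAmalgam_of_bandLimited hχ hq hb hf) hμ hσ hρ hs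

end

end

end NLW

end

/-! ### The main theorem -/

theorem theorem1 (d : ℕ) (hd : 1 ≤ d) (σ ρ : ℕ) (hσ : 2 ≤ σ) (hρ : ρ ≤ σ)
    (μ : ℂ) (hμ : μ = 1 ∨ μ = -1) (p q : ℝ≥0∞) (hp : 1 ≤ p) (hq : 1 ≤ q) (s : ℝ) (hs : s < 0) :
    NLW.StronglyIllPosed (NLW.fourierAmalgamNorm (d := d) p q) (NLW.SolRd μ ρ σ)
        NLW.BandLimited q s ∧
      (∀ χ : NLW.Space d → ℝ, NLW.IsCutoff χ →
        NLW.StronglyIllPosed (NLW.wienerAmalgamNorm χ 2 q) (NLW.SolRd μ ρ σ)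
          NLW.BandLimited q s) ∧
      NLW.StronglyIllPosed (NLW.torusFourierLebesgueNorm (d := d) q) (NLW.SolTorus μ ρ σ)
        NLW.TorusBandLimited q s := by
  have hμ' : ‖μ‖ = 1 := by rcases hμ with rfl | rfl <;> simp
  -- Since d ≥ 1 there is a coordinate direction along which the packets can be placed.
  exact ⟨NLW.stronglyIllPosed_fourierAmalgam ⟨0, hd⟩ hσ hρ hμ' hp hq hs,
    fun _ hχ => NLW.stronglyIllPosed_wienerAmalgam hχ ⟨0, hd⟩ hσ hρ hμ' hq hs,
    NLW.stronglyIllPosed_torus ⟨0, hd⟩ hσ hρ hμ' hq hs⟩
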